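/- **Notation.** For $|p|<1$ let $(a;p)_\infty=\prod_{n\ge0}(1-ap^n)$ and $\theta(x;p)=(x;p)_\infty(px^{-1};p)_\infty$; for $|p|,|q|<1$ let $\Gamma(z;p,q)=\prod_{j,k\ge0}\frac{1-z^{-1}p^{j+1}q^{k+1}}{1-zp^jq^k}$. Commas denote products: $\theta(x,y;p)=\theta(x;p)\theta(y;p)$, $\Gamma(x,y)=\Gamma(x;p,q)\Gamma(y;p,q)$, $\Gamma(tz^{\pm})=\Gamma(tz,tz^{-1})$, and $f(a\pm b)=f(a+b)f(a-b)$. Let $0<|p|,|q|<1$, let $\underline t=(t_1,\dots,t_8)$ satisfy $\prod_{j=1}^8t_j=p^2q^2$, and put $$\Delta(z,\underline t)=\frac{\prod_{j=1}^8\Gamma(t_jz^{\pm})}{\Gamma(z^{\pm2})},\qquad V(\underline t)=V(\underline t;p,q)=\frac{(p;p)_\infty(q;q)_\infty}{4\pi i}\int_C\Delta(z,\underline t)\frac{dz}{z},\qquad U(\underline t)=\frac{V(\underline t)}{\prod_{k=1}^7\Gamma(t_kt_8,t_k/t_8)},$$ where $C$ is any contour that winds once around $0$ and around the points $t_jp^aq^b$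 ($a,b\ge0$) and not around their reciprocals. If $t_jt_kp^aq^b\ne1$ for all $j,k$ and all $a,b\ge 0$, such $C$ exist and $V(\underline t)$ does not depend on the choice. In the relations below all values of $V$ that occur are assumed to be of this kind, the gamma factors in all values of $U$ that occur are assumed to be finite and nonzero, and denominators are assumed to be nonzero. $V(qt_6,q^{-1}t_8)$ means $V(\underline t)$ with $t_6,t_8$ replaced by $qt_6,q^{-1}t_8$, etc., and $(t_6\leftrightarrow t_7)$ is the preceding expression with $t_6,t_7$ interchanged. **(a)** For $w,x,y,z\in\mathbb C^*$, $$\theta(xw,\tfrac xw,yz,\tfrac yz;p)-\theta(xz,\tfrac xz,yw,\tfrac yw;p)=\tfrac yw\,\theta(xy,\tfrac xy,wz,\tfrac wz;p).$$ Consequently, for nonzero $t_j$ (with no balancing condition) and $z\neq0$ away from the poles of the gamma factors, $$\Delta(z,qt_6,q^{-1}t_8)-\frac{\theta(t_6t_7^{\pm};p)}{\theta(q^{-1}t_8t_7^{\pm};p)}\Delta(z,\underline t)=\frac{t_6}{t_7}\frac{\theta(q^{-1}t_8t_6^{\pm};p)}{\theta(q^{-1}t_8t_7^{\pm};p)}\Delta(z,qt_7,q^{-1}t_8).$$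 **(b)** First contiguous relation: $$t_7\,\theta(t_8t_7/q,\,t_8/qt_7;p)\,V(qt_6,q^{-1}t_8)-(t_6\leftrightarrow t_7)=t_7\,\theta(t_6t_7,\,t_6/t_7;p)\,V(\underline t).$$ **(c)** Second contiguous relation: $$t_6\,\theta(t_7/qt_8;p)\prod_{k=1}^5\theta(t_6t_k/q;p)\,V(q^{-1}t_6,qt_8)-(t_6\leftrightarrow t_7)=t_6\,\theta(t_7/t_6;p)\prod_{k=1}^5\theta(t_8t_k;p)\,V(\underline t).$$ **(d)** $b(\underline t)\big(U(qt_6,q^{-1}t_7)-U(\underline t)\big)+(t_6\leftrightarrow t_7)+U(\underline t)=0$, where, with $t_8=p^2t_0$, $$b(\underline t)=\frac{\theta(t_6/qt_8,t_6t_8,t_8/t_6;p)}{\theta(t_6/t_7,t_7/qt_6,t_6t_7/q;p)}\prod_{k=1}^5\frac{\theta(t_7t_k/q;p)}{\theta(t_8t_k;p)}=\frac{\theta(qt_0/t_6,t_0t_6,t_0/t_6;p)}{\theta(t_6/t_7,qt_6/t_7,q/t_6t_7;p)}\prod_{k=1}^5\frac{\theta(q/t_7t_k;p)}{\theta(t_0t_k;p)}.$$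 With $t_j=e^{2\pi ig_j/\omega_2}$, $q=e^{2\pi i\omega_1/\omega_2}$, $p=e^{2\pi i\omega_3/\omega_2}$, $\operatorname{Im}(\omega_3/\omega_2)>0$ (no condition on $\omega_1$), $g_8=2\sum_k\omega_k-\sum_{j\le7}g_j$, the function $b$ is meromorphic in each of $g_1,\dots,g_7$, has periods $\omega_2,\omega_3$ in each of them, and is invariant under $(\omega_2,\omega_3)\to(\omega_2,\omega_3+\omega_2)$ and $(\omega_2,\omega_3)\to(-\omega_3,\omega_2)$ with $\omega_1,g_1,\dots,g_7$ fixed. **(e)** Elliptic hypergeometric equation: for $t_6=az$, $t_7=a/z$, $t_8=p^2q^2/(a^2\prod_{k=1}^5t_k)$ the function $f(z)=U(t_1,\dots,t_5,az,a/z,t_8)$ satisfies $$\begin{aligned}&\frac{\theta(az/qt_8,at_8z,t_8/az;p)}{\theta(z^2,1/qz^2;p)}\prod_{k=1}^5\theta(at_k/qz;p)\,\big(f(qz)-f(z)\big)\\&+\frac{\theta(a/qt_8z,at_8/z,t_8z/a;p)}{\theta(1/z^2,z^2/q;p)}\prod_{k=1}^5\theta(at_kz/q;p)\,\big(f(q^{-1}z)-f(z)\big)+\theta(a^2/q;p)\prod_{k=1}^5\theta(t_kt_8;p)\,f(z)=0.\end{aligned}$$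 **(f)** Let $\operatorname{Im}(\omega_1/\omega_2)\ge0$, $\operatorname{Im}(\omega_3/\omega_1)>0$, $\operatorname{Im}(\omega_3/\omega_2)>0$, and $q=e^{2\pi i\omega_1/\omega_2}$, $p=e^{2\pi i\omega_3/\omega_2}$, $r=e^{2\pi i\omega_3/\omega_1}$, $\tilde q=e^{-2\pi i\omega_2/\omega_1}$, $\tilde p=e^{-2\pi i\omega_2/\omega_3}$, $\tilde r=e^{-2\pi i\omega_1/\omega_3}$. Let $P$ be the cubic polynomial with $P(u+\frac12\sum_k\omega_k)=\dfrac{u(u^2-\frac14\sum_k\omega_k^2)}{3\omega_1\omega_2\omega_3}$. Let $$G(u;\omega)=\Gamma(e^{2\pi iu/\omega_2};p,q)\,\Gamma(re^{-2\pi iu/\omega_1};r,\tilde q)\quad(|q|<1),$$ and for $|q|=1$ let $G$ be its continuous extension $e^{-\pi iP(u)}\Gamma(e^{-2\pi iu/\omega_3};\tilde r,\tilde p)$. For $\sum_{j=1}^8g_j=2\sum_{k=1}^3\omega_k$ and $\operatorname{Im}(g_j/\omega_3)<0$ put $$v^{mod}(\underline g;\omega)=\int_{-\omega_3/2}^{\omega_3/2}\frac{\prod_{j=1}^8G(g_j\pm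 x;\omega)}{G(\pm2x;\omega)}\frac{dx}{\omega_2},\qquad U^{mod}(\underline g)=\frac{v^{mod}(\underline g;\omega)}{\prod_{k=1}^7G(g_k\pm g_8;\omega)} .$$ Then $f(y)=U^{mod}(g_1,\dots,g_5,\alpha+y,\alpha-y,g_8)$ solves the equation of (e) with $t_k=e^{2\pi ig_k/\omega_2}$, $a=e^{2\pi i\alpha/\omega_2}$, $z=e^{2\pi iy/\omega_2}$ and $f(q^{\pm1}z)$ replaced by $f(y\pm\omega_1)$, whenever the values at $y,y\pm\omega_1$ are defined (the conditions $\operatorname{Im}(g_j/\omega_3)<0$ hold for the corresponding parameters, and the gamma factors in the normalizing products, for $|q|<1$ both $\Gamma$-factors of each $G(g_k\pm g_8)$, are at neither zeros nor poles) and the theta functions in the denominators do not vanish. **(g)** With $v(\underline g;\omega_1,\omega_2,\omega_3)=V(e^{2\pi ig_1/\omega_2},\dots,e^{2\pi ig_8/\omega_2};e^{2\pi i\omega_1/\omega_2},e^{2\pi i\omega_3/\omega_2})$, for $\sum_jg_j=2\sum_k\omega_k$ and $\operatorname{Im}(g_j/\omega_3)<0$, $$v^{mod}(\underline g;\omega)=\frac{2\omega_3\,e^{2\pi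 i(P(0)-\sum_{j=1}^8P(g_j))}}{\omega_2(\tilde p;\tilde p)_\infty(\tilde r;\tilde r)_\infty}\,v(\underline g;\omega_1,-\omega_3,\omega_2).$$ **(h)** If moreover $\operatorname{Im}(\omega_1/\omega_2)>0$ and $\omega_1,\omega_2,\omega_3$ are linearly independent over $\mathbb Z$, then the solutions $U$ and $U^{mod}$ are linearly independent for generic parameters: write $\underline g^+=(g_1,\dots,g_5,g_6+\omega_1,g_7-\omega_1,g_8)$ and $U(\underline g)=U(e^{2\pi ig_1/\omega_2},\dots,e^{2\pi ig_8/\omega_2})$; in the set of all $\underline g$ with $\sum_jg_j=2\sum_k\omega_k$ for which both $\underline g$ and $\underline g^+$ satisfy $\operatorname{Im}(g_j/\omega_3)<0$ for all $j$, the points at which $U,U^{mod}$ are defined at $\underline g$ and $\underline g^+$ and the Casorati determinant $U(\underline g)U^{mod}(\underline g^+)-U(\underline g^+)U^{mod}(\underline g)$ is nonzero form a relatively open dense subset. -/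

import Mathlib

open Complex

noncomputable section

namespace EllHyp

/-! ### Theta function and elliptic gamma function -/

/-- `(a;p)_∞ = ∏_{n ≥ 0} (1 - a p^n)`, for `|p| < 1`. -/
def qPoch (a p : ℂ) : ℂ := ∏' n : ℕ, (1 - a * p ^ n)

/-- `θ(x;p) = (x;p)_∞ (p/x;p)_∞`. -/
def theta (p x : ℂ) : ℂ := qPoch x p * qPoch (p / x) p

/-- The standard elliptic gamma function
`Γ(z;p,q) = ∏_{j,k ≥ 0} (1 - z⁻¹ p^{j+1} q^{k+1}) / (1 - z p^j q^k)`.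
As a total function it takes the value `0` at its poles `z = p^{-j} q^{-k}`, so for `z ≠ 0` the
condition `ellGamma p q z ≠ 0` says that `z` is neither a zero nor a pole. -/
def ellGamma (p q z : ℂ) : ℂ :=
  (∏' n : ℕ × ℕ, (1 - z⁻¹ * p ^ (n.1 + 1) * q ^ (n.2 + 1))) /
    (∏' n : ℕ × ℕ, (1 - z * p ^ n.1 * q ^ n.2))

/-! ### Contours -/

/-- A continuously differentiable closed curve in `ℂ`, parametrized with period `1`. -/
structure ClosedCurve where
  toFun : ℝ → ℂ
  contDiff : ContDiff ℝ 1 toFun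
  periodic : Function.Periodic toFun 1

/-- `∮_γ f(z) dz`. -/
def ClosedCurve.integral (γ : ClosedCurve) (f : ℂ → ℂ) : ℂ :=
  ∫ s in (0 : ℝ)..1, f (γ.toFun s) * deriv γ.toFun s

/-- A contour is a finite sum (cycle) of closed curves; a single closed curve is a special case. -/
abbrev Contour := List ClosedCurve

/-- `∫_C f(z) dz`. -/
def contourIntegral (C : Contour) (f : ℂ → ℂ) : ℂ := (C.map fun γ => γ.integral f).sum

/-- Winding number of the contour around `w`. -/
def contourIndex (C : Contour) (w : ℂ) : ℂ :=
  (2 * Real.pi * I)⁻¹ * contourIntegral C fun z => (z - w)⁻¹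

/-- `C` separates the sequences of points `t_j p^a q^b`, which converge to zero, from the sequences
of their reciprocals, which diverge: it passes through none of these points nor through `0`, winds
once (in the positive direction) around `0` and around every point of the first kind, and does not
wind around the points of the second kind. -/
structure IsSeparating (p q : ℂ) (t : Fin 8 → ℂ) (C : Contour) : Prop where
  avoids_zero : ∀ γ ∈ C, ∀ s : ℝ, γ.toFun s ≠ 0
  avoids_inner : ∀ γ ∈ C, ∀ (s : ℝ) (j : Fin 8) (a b : ℕ), γ.toFun s ≠ t j * p ^ a * q ^ b
  avoids_outer : ∀ γ ∈ C, ∀ (s : ℝ) (j : Fin 8) (a b : ℕ),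
    γ.toFun s ≠ (t j * p ^ a * q ^ b)⁻¹
  index_zero : contourIndex C 0 = 1
  index_inner : ∀ (j : Fin 8) (a b : ℕ), contourIndex C (t j * p ^ a * q ^ b) = 1
  index_outer : ∀ (j : Fin 8) (a b : ℕ), contourIndex C (t j * p ^ a * q ^ b)⁻¹ = 0

/-! ### The elliptic hypergeometric function `V` -/

/-- `Δ(z,t) = ∏_j Γ(t_j z) Γ(t_j / z) / (Γ(z²) Γ(z⁻²))`. -/
def kernel (p q : ℂ) (t : Fin 8 → ℂ) (z : ℂ) : ℂ :=
  (∏ j : Fin 8, ellGamma p q (t j * z) * ellGamma p q (t j * z⁻¹)) /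
    (ellGamma p q (z ^ 2) * ellGamma p q (z⁻¹ ^ 2))

/-- `κ = (q;q)_∞ (p;p)_∞ / (4 π i)`. -/
def kappa (p q : ℂ) : ℂ := qPoch q q * qPoch p p / (4 * Real.pi * I)

/-- The balancing condition `∏_j t_j = p² q²`. -/
def Balanced (p q : ℂ) (t : Fin 8 → ℂ) : Prop := ∏ j : Fin 8, t j = p ^ 2 * q ^ 2

/-- The two families of points to be separated by the contour are disjoint. -/
def Admissible (p q : ℂ) (t : Fin 8 → ℂ) : Prop :=
  ∀ (j k : Fin 8) (a b : ℕ), t j * t k * p ^ a * q ^ b ≠ 1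

open Classical in
/-- `V(t;p,q) = κ ∫_C Δ(z,t) dz/z`, where `C` is any separating contour. -/
def V (p q : ℂ) (t : Fin 8 → ℂ) : ℂ :=
  if h : ∃ C : Contour, IsSeparating p q t C then
    kappa p q * contourIntegral h.choose fun z => kernel p q t z / z
  else 0

/-- `U(t) = V(t) / ∏_{k=1}^7 Γ(t_k t_8) Γ(t_k / t_8)`. -/
def U (p q : ℂ) (t : Fin 8 → ℂ) : ℂ :=
  V p q t / ∏ k ∈ Finset.Iio (7 : Fin 8), ellGamma p q (t k * t 7) * ellGamma p q (t k / t 7)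

/-- The parameters are such that `U(t)` is defined: a separating contour exists, and the
normalizing gamma functions have neither zeros nor poles. -/
def UDefined (p q : ℂ) (t : Fin 8 → ℂ) : Prop :=
  Admissible p q t ∧ ∀ k ∈ Finset.Iio (7 : Fin 8),
    ellGamma p q (t k * t 7) ≠ 0 ∧ ellGamma p q (t k / t 7) ≠ 0

/-- `t_i` is replaced by `q t_i` and `t_j` by `q⁻¹ t_j`. -/
def qShift (q : ℂ) (t : Fin 8 → ℂ) (i j : Fin 8) : Fin 8 → ℂ :=
  Function.update (Function.update t i (q * t i)) j (q⁻¹ * t j)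

/-- The permutation `t_6 ↔ t_7`. -/
def swap67 (t : Fin 8 → ℂ) : Fin 8 → ℂ := fun j => t (Equiv.swap 5 6 j)

/-! ### The elliptic hypergeometric equation -/

/-- The denominator of the potential does not vanish. -/
def PotentialDefined (p q : ℂ) (t : Fin 8 → ℂ) : Prop :=
  theta p (t 5 / t 6) ≠ 0 ∧ theta p (t 6 / (q * t 5)) ≠ 0 ∧ theta p (t 5 * t 6 / q) ≠ 0 ∧
    ∀ k ∈ Finset.Iio (5 : Fin 8), theta p (t 7 * t k) ≠ 0

/-- The potential `b(t)`. -/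
def potential (p q : ℂ) (t : Fin 8 → ℂ) : ℂ :=
  theta p (t 5 / (q * t 7)) * theta p (t 5 * t 7) * theta p (t 7 / t 5) /
      (theta p (t 5 / t 6) * theta p (t 6 / (q * t 5)) * theta p (t 5 * t 6 / q)) *
    ∏ k ∈ Finset.Iio (5 : Fin 8), theta p (t 6 * t k / q) / theta p (t 7 * t k)

/-- The second expression for the potential, in which `t_8 = p² t_0`. -/
def potential' (p q : ℂ) (t : Fin 8 → ℂ) (t₀ : ℂ) : ℂ :=
  theta p (q * t₀ / t 5) * theta p (t₀ * t 5) * theta p (t₀ / t 5) /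
      (theta p (t 5 / t 6) * theta p (q * t 5 / t 6) * theta p (q / (t 5 * t 6))) *
    ∏ k ∈ Finset.Iio (5 : Fin 8), theta p (q / (t 6 * t k)) / theta p (t₀ * t k)

/-- The parameters `(t_1,…,t_5, a z, a/z, t_8)`. -/
def eheParams (a : ℂ) (τ : Fin 5 → ℂ) (t₈ z : ℂ) : Fin 8 → ℂ :=
  ![τ 0, τ 1, τ 2, τ 3, τ 4, a * z, a / z, t₈]

/-- The coefficient of `f(qz) - f(z)` in the elliptic hypergeometric equation; the coefficient of
`f(z/q) - f(z)` is obtained from it by `z → 1/z`. -/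
def eheCoeff (p q a : ℂ) (τ : Fin 5 → ℂ) (t₈ z : ℂ) : ℂ :=
  theta p (a * z / (q * t₈)) * theta p (a * t₈ * z) * theta p (t₈ / (a * z)) /
      (theta p (z ^ 2) * theta p (1 / (q * z ^ 2))) *
    ∏ k : Fin 5, theta p (a * τ k / (q * z))

/-- The denominators in the elliptic hypergeometric equation do not vanish. -/
def EheDefined (p q z : ℂ) : Prop :=
  theta p (z ^ 2) ≠ 0 ∧ theta p (1 / (q * z ^ 2)) ≠ 0 ∧
    theta p (1 / z ^ 2) ≠ 0 ∧ theta p (z ^ 2 / q) ≠ 0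

/-- The elliptic hypergeometric equation at the point `z`, where `fp`, `f0`, `fm` are the values
of the unknown function at `q z`, `z`, `z / q`. -/
def EllHypEquation (p q a : ℂ) (τ : Fin 5 → ℂ) (t₈ z fp f0 fm : ℂ) : Prop :=
  eheCoeff p q a τ t₈ z * (fp - f0) + eheCoeff p q a τ t₈ z⁻¹ * (fm - f0) +
    theta p (a ^ 2 / q) * (∏ k : Fin 5, theta p (τ k * t₈)) * f0 = 0

/-! ### Additive notation and the modified functions -/

/-- `e(x) = exp(2 π i x)`. -/
def e (x : ℂ) : ℂ := exp (2 * Real.pi * I * x)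

/-- The additive balancing condition `∑_j g_j = 2 ∑_k ω_k`. -/
def AddBalanced (ω₁ ω₂ ω₃ : ℂ) (g : Fin 8 → ℂ) : Prop :=
  ∑ j : Fin 8, g j = 2 * (ω₁ + ω₂ + ω₃)

/-- `t_j = e^{2 π i g_j / ω₂}`. -/
def expParams (ω₂ : ℂ) (g : Fin 8 → ℂ) : Fin 8 → ℂ := fun j => e (g j / ω₂)

/-- `v(g;ω₁,ω₂,ω₃)`. -/
def v (g : Fin 8 → ℂ) (ω₁ ω₂ ω₃ : ℂ) : ℂ := V (e (ω₁ / ω₂)) (e (ω₃ / ω₂)) (expParams ω₂ g)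

/-- The cubic polynomial with `P(u + ∑ ω_n/2) = u (u² - ∑ ω_k²/4) / (3 ω₁ ω₂ ω₃)`. -/
def cubicP (ω₁ ω₂ ω₃ u : ℂ) : ℂ :=
  (u - (ω₁ + ω₂ + ω₃) / 2) *
      ((u - (ω₁ + ω₂ + ω₃) / 2) ^ 2 - (ω₁ ^ 2 + ω₂ ^ 2 + ω₃ ^ 2) / 4) /
    (3 * ω₁ * ω₂ * ω₃)

/-- The modified elliptic gamma function
`G(u;ω) = Γ(e^{2πiu/ω₂};p,q) Γ(r e^{-2πiu/ω₁};r,q̃)` for `|q| < 1`, where `p = e(ω₃/ω₂)`,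
`q = e(ω₁/ω₂)`, `r = e(ω₃/ω₁)`, `q̃ = e(-ω₂/ω₁)`. For `|q| = 1`, where this product makes no sense,
it is `e^{-πiP(u)} Γ(e^{-2πiu/ω₃}; r̃, p̃)` with `r̃ = e(-ω₁/ω₃)`, `p̃ = e(-ω₂/ω₃)`, the continuous
extension. As for `ellGamma`, nonvanishing of the value excludes both zeros and poles. -/
def modGamma (ω₁ ω₂ ω₃ u : ℂ) : ℂ :=
  if 0 < (ω₁ / ω₂).im then
    ellGamma (e (ω₃ / ω₂)) (e (ω₁ / ω₂)) (e (u / ω₂)) *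
      ellGamma (e (ω₃ / ω₁)) (e (-ω₂ / ω₁)) (e (ω₃ / ω₁) * e (-u / ω₁))
  else
    exp (-Real.pi * I * cubicP ω₁ ω₂ ω₃ u) *
      ellGamma (e (-ω₁ / ω₃)) (e (-ω₂ / ω₃)) (e (-u / ω₃))

/-- `v^{mod}(g;ω) = ∫_{-ω₃/2}^{ω₃/2} ∏_j G(g_j ± x;ω) / G(±2x;ω) dx/ω₂`, over the segment
`x = s ω₃`, `-1/2 ≤ s ≤ 1/2`. -/
def vMod (g : Fin 8 → ℂ) (ω₁ ω₂ ω₃ : ℂ) : ℂ :=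
  ∫ s in (-1 / 2 : ℝ)..(1 / 2),
    (∏ j : Fin 8, modGamma ω₁ ω₂ ω₃ (g j + s * ω₃) * modGamma ω₁ ω₂ ω₃ (g j - s * ω₃)) /
      (modGamma ω₁ ω₂ ω₃ (2 * (s * ω₃)) * modGamma ω₁ ω₂ ω₃ (-(2 * (s * ω₃)))) * (ω₃ / ω₂)

/-- The poles of the integrand of `v^{mod}` are lined up on the two sides of the line through
`-ω₃/2` and `ω₃/2`. -/
def LinedUp (ω₃ : ℂ) (g : Fin 8 → ℂ) : Prop := ∀ j : Fin 8, (g j / ω₃).im < 0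

/-- The analogue of `U` built from the modified gamma function. -/
def UMod (ω₁ ω₂ ω₃ : ℂ) (g : Fin 8 → ℂ) : ℂ :=
  vMod g ω₁ ω₂ ω₃ / ∏ k ∈ Finset.Iio (7 : Fin 8),
    modGamma ω₁ ω₂ ω₃ (g k + g 7) * modGamma ω₁ ω₂ ω₃ (g k - g 7)

/-- The parameters are such that `UMod` is defined. -/
def UModDefined (ω₁ ω₂ ω₃ : ℂ) (g : Fin 8 → ℂ) : Prop :=
  LinedUp ω₃ g ∧ ∀ k ∈ Finset.Iio (7 : Fin 8),
    modGamma ω₁ ω₂ ω₃ (g k + g 7) ≠ 0 ∧ modGamma ω₁ ω₂ ω₃ (g k - g 7) ≠ 0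

/-- The additive parameters `(g_1,…,g_5, α + y, α - y, g_8)`. -/
def addParams (α : ℂ) (c : Fin 5 → ℂ) (g₈ y : ℂ) : Fin 8 → ℂ :=
  ![c 0, c 1, c 2, c 3, c 4, α + y, α - y, g₈]

/-- The shift `g_6 → g_6 + ω₁`, `g_7 → g_7 - ω₁`, i.e. `y → y + ω₁` (`z → q z`). -/
def addShift (ω₁ : ℂ) (g : Fin 8 → ℂ) : Fin 8 → ℂ :=
  Function.update (Function.update g 5 (g 5 + ω₁)) 6 (g 6 - ω₁)

/-- `U(t)` as a function of the additive parameters. -/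
def UAdd (ω₁ ω₂ ω₃ : ℂ) (g : Fin 8 → ℂ) : ℂ :=
  U (e (ω₃ / ω₂)) (e (ω₁ / ω₂)) (expParams ω₂ g)

/-- `UDefined` in terms of the additive parameters. -/
def UAddDefined (ω₁ ω₂ ω₃ : ℂ) (g : Fin 8 → ℂ) : Prop :=
  UDefined (e (ω₃ / ω₂)) (e (ω₁ / ω₂)) (expParams ω₂ g)

/-- The Casorati determinant of the solutions `U` and `U^{mod}` of the elliptic hypergeometric
equation. Two solutions are linearly independent over the functions with period `ω₁` in `y`
exactly when it does not vanish identically. -/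
def casorati (ω₁ ω₂ ω₃ : ℂ) (g : Fin 8 → ℂ) : ℂ :=
  UAdd ω₁ ω₂ ω₃ g * UMod ω₁ ω₂ ω₃ (addShift ω₁ g) -
    UAdd ω₁ ω₂ ω₃ (addShift ω₁ g) * UMod ω₁ ω₂ ω₃ g

/-- The common domain of parameters: balanced, with the poles lined up both for `g` and for the
shifted parameters. -/
def solutionDomain (ω₁ ω₂ ω₃ : ℂ) : Set (Fin 8 → ℂ) :=
  {g | AddBalanced ω₁ ω₂ ω₃ g ∧ LinedUp ω₃ g ∧ LinedUp ω₃ (addShift ω₁ g)}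

/-- The parameters at which both solutions are defined (also after the shift) and the Casorati
determinant does not vanish. -/
def independenceSet (ω₁ ω₂ ω₃ : ℂ) : Set (Fin 8 → ℂ) :=
  {g ∈ solutionDomain ω₁ ω₂ ω₃ |
    UAddDefined ω₁ ω₂ ω₃ g ∧ UAddDefined ω₁ ω₂ ω₃ (addShift ω₁ g) ∧
    UModDefined ω₁ ω₂ ω₃ g ∧ UModDefined ω₁ ω₂ ω₃ (addShift ω₁ g) ∧
    casorati ω₁ ω₂ ω₃ g ≠ 0}

/-- The potential as a function of `g_1,…,g_7`, with `g_8 = 2 ∑ ω_k - ∑_{j ≤ 7} g_j`. -/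
def potentialAdd (ω₁ ω₂ ω₃ : ℂ) (g : Fin 7 → ℂ) : ℂ :=
  potential (e (ω₃ / ω₂)) (e (ω₁ / ω₂))
    (expParams ω₂ (Fin.snoc (α := fun _ => ℂ) g (2 * (ω₁ + ω₂ + ω₃) - ∑ j, g j)))

end EllHyp

end

namespace EllHyp

/-! ### Infinite products `∏ (1 - z a_i)` -/

/-- The entire function `z ↦ ∏_i (1 - z a_i)` attached to an absolutely summable family. -/
noncomputable def prodOne {ι : Type*} (a : ι → ℂ) (z : ℂ) : ℂ := ∏' i, (1 - z * a i)

section prodOne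

variable {ι : Type*} {a : ι → ℂ}

lemma multipliable_prodOne (ha : Summable fun i => ‖a i‖) (z : ℂ) :
    Multipliable fun i => 1 - z * a i := by
  have : Summable fun i => ‖-(z * a i)‖ := by
    simpa [norm_mul] using ha.mul_left ‖z‖
  simpa [sub_eq_add_neg] using multipliable_one_add_of_summable this

lemma differentiable_prodOne (ha : Summable fun i => ‖a i‖) : Differentiable ℂ (prodOne a) := by
  intro z₀
  have hu : Summable fun i => (‖z₀‖ + 1) * ‖a i‖ := ha.mul_left _
  have h := Summable.hasProdLocallyUniformlyOn_one_add (f := fun i (z : ℂ) => -(z * a i))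
    (K := Metric.ball z₀ 1) Metric.isOpen_ball hu
    (Filter.Eventually.of_forall fun i z hz => by
      rw [norm_neg, norm_mul]
      gcongr
      have := norm_sub_norm_le z z₀
      rw [Metric.mem_ball, dist_eq_norm] at hz
      linarith)
    (fun i => by fun_prop)
  rw [hasProdLocallyUniformlyOn_iff_tendstoLocallyUniformlyOn] at h
  have hd := h.differentiableOn (Filter.Eventually.of_forall fun s => by
    fun_prop) Metric.isOpen_ball
  have := (hd z₀ (Metric.mem_ball_self one_pos)).differentiableAt
    (Metric.isOpen_ball.mem_nhds (Metric.mem_ball_self one_pos))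
  simpa only [sub_eq_add_neg, prodOne] using! this

lemma prodOne_eq_zero_iff (ha : Summable fun i => ‖a i‖) {z : ℂ} :
    prodOne a z = 0 ↔ ∃ i, z * a i = 1 := by
  constructor
  · intro h
    by_contra! hne
    have : Summable fun i => ‖-(z * a i)‖ := by
      simpa [norm_mul] using ha.mul_left ‖z‖
    refine tprod_one_add_ne_zero_of_summable (fun i => ?_) this (by
      simpa [prodOne, sub_eq_add_neg] using h)
    intro h0
    exact hne i (by linear_combination -h0)
  · rintro ⟨i, hi⟩
    exact tprod_of_exists_eq_zero ⟨i, by simp [hi]⟩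

lemma prodOne_equiv {κ : Type*} (e : κ ≃ ι) (z : ℂ) : prodOne (a ∘ e) z = prodOne a z :=
  e.tprod_eq fun i => 1 - z * a i

lemma prodOne_sum {κ : Type*} {f : ι ⊕ κ → ℂ} (hf : Summable fun i => ‖f i‖) (z : ℂ) :
    prodOne f z = prodOne (f ∘ Sum.inl) z * prodOne (f ∘ Sum.inr) z := by
  have h1 : Summable fun i => ‖f (Sum.inl i)‖ := hf.comp_injective Sum.inl_injective
  have h2 : Summable fun i => ‖f (Sum.inr i)‖ := hf.comp_injective Sum.inr_injective
  exact ((multipliable_prodOne h1 z).hasProd.sum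
    (f := fun i => 1 - z * f i) (multipliable_prodOne h2 z).hasProd).tprod_eq

end prodOne

/-! ### The products `(a;p)_∞` and `(a;p,q)_∞` -/

lemma summable_norm_pow {p : ℂ} (hp : ‖p‖ < 1) : Summable fun n : ℕ => ‖p ^ n‖ := by
  simpa using summable_geometric_of_lt_one (norm_nonneg p) hp

lemma summable_norm_pow_mul_pow {p q : ℂ} (hp : ‖p‖ < 1) (hq : ‖q‖ < 1) :
    Summable fun n : ℕ × ℕ => ‖p ^ n.1 * q ^ n.2‖ := by
  have := Summable.mul_of_nonneg (summable_norm_pow hp) (summable_norm_pow hq)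
    (fun _ => norm_nonneg _) (fun _ => norm_nonneg _)
  simpa using this

/-- `(z;p,q)_∞ = ∏_{j,k ≥ 0} (1 - z p^j q^k)`. -/
noncomputable def dblPoch (p q z : ℂ) : ℂ := prodOne (fun n : ℕ × ℕ => p ^ n.1 * q ^ n.2) z

lemma ellGamma_eq (p q z : ℂ) :
    ellGamma p q z = dblPoch p q (z⁻¹ * p * q) / dblPoch p q z := by
  simp only [ellGamma, dblPoch, prodOne]
  congr 1
  · congr 1; ext n; ring
  · congr 1; ext n; ring

lemma dblPoch_comm (p q z : ℂ) : dblPoch p q z = dblPoch q p z := by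
  rw [dblPoch, dblPoch, ← prodOne_equiv (Equiv.prodComm ℕ ℕ)]
  congr 1; ext n; simp [mul_comm]

lemma ellGamma_comm (p q z : ℂ) : ellGamma p q z = ellGamma q p z := by
  rw [ellGamma_eq, ellGamma_eq, dblPoch_comm, dblPoch_comm p q z, mul_right_comm]

section products

variable {p q : ℂ}

lemma differentiable_qPoch (hp : ‖p‖ < 1) : Differentiable ℂ fun z => qPoch z p :=
  differentiable_prodOne (summable_norm_pow hp)

lemma continuous_qPoch (hp : ‖p‖ < 1) : Continuous fun z => qPoch z p :=
  (differentiable_qPoch hp).continuous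

lemma differentiable_dblPoch (hp : ‖p‖ < 1) (hq : ‖q‖ < 1) : Differentiable ℂ (dblPoch p q) :=
  differentiable_prodOne (summable_norm_pow_mul_pow hp hq)

lemma continuous_dblPoch (hp : ‖p‖ < 1) (hq : ‖q‖ < 1) : Continuous (dblPoch p q) :=
  (differentiable_dblPoch hp hq).continuous

lemma qPoch_eq_zero_iff (hp : ‖p‖ < 1) {z : ℂ} : qPoch z p = 0 ↔ ∃ n : ℕ, z * p ^ n = 1 :=
  prodOne_eq_zero_iff (summable_norm_pow hp)

lemma dblPoch_eq_zero_iff (hp : ‖p‖ < 1) (hq : ‖q‖ < 1) {z : ℂ} :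
    dblPoch p q z = 0 ↔ ∃ a b : ℕ, z * p ^ a * q ^ b = 1 := by
  rw [dblPoch, prodOne_eq_zero_iff (summable_norm_pow_mul_pow hp hq)]
  simp [mul_assoc]

lemma qPoch_eq (hp : ‖p‖ < 1) (z : ℂ) : qPoch z p = (1 - z) * qPoch (p * z) p := by
  have := (multipliable_prodOne (summable_norm_pow hp) (p * z))
  rw [qPoch, tprod_eq_zero_mul', qPoch]
  · simp only [pow_zero, mul_one, pow_succ]
    congr 2; ext n; ring
  · convert this using 2 with n
    ring

/-- The decomposition of `ℕ × ℕ` into the pairs with vanishing and with positive second entry. -/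
def sumProdEquiv : ℕ ⊕ (ℕ × ℕ) ≃ ℕ × ℕ where
  toFun := Sum.elim (fun j => (j, 0)) fun n => (n.1, n.2 + 1)
  invFun n := match n with
    | (j, 0) => Sum.inl j
    | (j, k + 1) => Sum.inr (j, k)
  left_inv := by rintro (j | ⟨j, k⟩) <;> rfl
  right_inv := by rintro ⟨j, _ | k⟩ <;> rfl

lemma dblPoch_eq_right (hp : ‖p‖ < 1) (hq : ‖q‖ < 1) (z : ℂ) :
    dblPoch p q z = qPoch z p * dblPoch p q (q * z) := by
  have hs := summable_norm_pow_mul_pow hp hq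
  rw [dblPoch, ← prodOne_equiv sumProdEquiv, prodOne_sum]
  · congr 1
    · simp [prodOne, qPoch, sumProdEquiv]
    · simp only [prodOne, dblPoch, sumProdEquiv, Function.comp]
      congr 1; ext n; simp [pow_succ]; ring
  · exact (sumProdEquiv.summable_iff (f := fun n : ℕ × ℕ => ‖p ^ n.1 * q ^ n.2‖)).2 hs

lemma dblPoch_eq_left (hp : ‖p‖ < 1) (hq : ‖q‖ < 1) (z : ℂ) :
    dblPoch p q z = qPoch z q * dblPoch p q (p * z) := by
  rw [dblPoch_comm, dblPoch_eq_right hq hp, dblPoch_comm q p]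

/-! ### Theta functions -/

lemma theta_p_mul (hp : ‖p‖ < 1) (hp0 : p ≠ 0) {x : ℂ} (hx : x ≠ 0) :
    theta p (p * x) = -x⁻¹ * theta p x := by
  have h1 := qPoch_eq hp x
  have h2 := qPoch_eq hp (p / (p * x))
  have e : p * (p / (p * x)) = p / x := by field_simp
  rw [e] at h2
  rw [theta, theta, h1, h2]
  field_simp
  ring

lemma theta_inv (hp : ‖p‖ < 1) {x : ℂ} (hx : x ≠ 0) :
    theta p x⁻¹ = -x⁻¹ * theta p x := by
  have h1 := qPoch_eq hp x
  have h2 := qPoch_eq hp x⁻¹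
  rw [theta, theta, h1, h2, div_inv_eq_mul, div_eq_mul_inv]
  field_simp
  ring

lemma theta_div_swap (hp : ‖p‖ < 1) {x y : ℂ} (hx : x ≠ 0) (hy : y ≠ 0) :
    theta p (y / x) = -(y / x) * theta p (x / y) := by
  rw [← inv_div x y, theta_inv hp (div_ne_zero hx hy)]

lemma theta_p_div (hp : ‖p‖ < 1) (hp0 : p ≠ 0) {x : ℂ} (hx : x ≠ 0) :
    theta p (p / x) = theta p x := by
  rw [div_eq_mul_inv, theta_p_mul hp hp0 (inv_ne_zero hx), theta_inv hp hx]
  field_simp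

lemma theta_zpow_mul (hp : ‖p‖ < 1) (hp0 : p ≠ 0) (n : ℤ) :
    ∀ x : ℂ, x ≠ 0 → ∃ c : ℂ, c ≠ 0 ∧ theta p (p ^ n * x) = c * theta p x := by
  induction n using Int.induction_on with
  | zero => exact fun x hx => ⟨1, one_ne_zero, by simp⟩
  | succ n ih =>
    intro x hx
    obtain ⟨c, hc, h⟩ := ih x hx
    refine ⟨-(p ^ (n : ℤ) * x)⁻¹ * c, by simp [hc, hx, hp0], ?_⟩
    rw [zpow_add₀ hp0, zpow_one, mul_comm (p ^ (n : ℤ)), mul_assoc,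
      theta_p_mul hp hp0 (mul_ne_zero (zpow_ne_zero _ hp0) hx), h]
    ring
  | pred n ih =>
    intro x hx
    obtain ⟨c, hc, h⟩ := ih x hx
    have hy : p ^ (-(n : ℤ) - 1) * x ≠ 0 := mul_ne_zero (zpow_ne_zero _ hp0) hx
    refine ⟨-(p ^ (-(n : ℤ) - 1) * x) * c, by simp [hc, hx, hp0, zpow_ne_zero], ?_⟩
    have h3 := theta_p_mul hp hp0 hy
    rw [← mul_assoc, ← zpow_one_add₀ hp0, show 1 + (-(n : ℤ) - 1) = -n by ring, h] at h3
    rw [mul_assoc, h3]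
    field_simp

lemma theta_one (hp : ‖p‖ < 1) : theta p 1 = 0 := by
  rw [theta, qPoch_eq hp]; simp

lemma theta_eq_zero_iff (hp : ‖p‖ < 1) (hp0 : p ≠ 0) {x : ℂ} (hx : x ≠ 0) :
    theta p x = 0 ↔ ∃ n : ℤ, x = p ^ n := by
  constructor
  · rw [theta, mul_eq_zero, qPoch_eq_zero_iff hp, qPoch_eq_zero_iff hp]
    rintro (⟨n, hn⟩ | ⟨n, hn⟩)
    · exact ⟨-n, by rw [zpow_neg, zpow_natCast]; exact eq_inv_of_mul_eq_one_left hn⟩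
    · refine ⟨n + 1, ?_⟩
      rw [zpow_add₀ hp0, zpow_natCast, zpow_one]
      field_simp at hn
      rw [← hn]; ring
  · rintro ⟨n, rfl⟩
    obtain ⟨c, -, h⟩ := theta_zpow_mul hp hp0 n 1 one_ne_zero
    rw [mul_one] at h
    rw [h, theta_one hp, mul_zero]

lemma differentiableAt_theta (hp : ‖p‖ < 1) {x : ℂ} (hx : x ≠ 0) :
    DifferentiableAt ℂ (theta p) x := by
  have h : DifferentiableAt ℂ (fun x : ℂ => p / x) x := by fun_prop (disch := assumption)
  exact (differentiable_qPoch hp x).mul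
    ((differentiable_qPoch hp (p / x)).comp x h)

lemma continuousAt_theta (hp : ‖p‖ < 1) {x : ℂ} (hx : x ≠ 0) : ContinuousAt (theta p) x :=
  (differentiableAt_theta hp hx).continuousAt

/-! ### The elliptic gamma function -/

lemma ellGamma_q_mul (hp : ‖p‖ < 1) (hq : ‖q‖ < 1) (hq0 : q ≠ 0) {z : ℂ}
    (hz : dblPoch p q z ≠ 0) : ellGamma p q (q * z) = theta p z * ellGamma p q z := by
  have h1 := dblPoch_eq_right hp hq z
  have h2 := dblPoch_eq_right hp hq (p * z⁻¹)
  have e1 : (q * z)⁻¹ * p * q = p * z⁻¹ := by rw [mul_inv]; field_simp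
  have e2 : z⁻¹ * p * q = q * (p * z⁻¹) := by ring
  have h3 : qPoch z p ≠ 0 := by rw [h1] at hz; exact left_ne_zero_of_mul hz
  have h4 : dblPoch p q (q * z) ≠ 0 := by rw [h1] at hz; exact right_ne_zero_of_mul hz
  rw [ellGamma_eq, ellGamma_eq, e1, e2, h1, h2, theta, div_eq_mul_inv p z]
  field_simp

lemma ellGamma_ne_zero_iff {z : ℂ} :
    ellGamma p q z ≠ 0 ↔ dblPoch p q (z⁻¹ * p * q) ≠ 0 ∧ dblPoch p q z ≠ 0 := by
  rw [ellGamma_eq, div_ne_zero_iff]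

lemma ellGamma_q_mul' (hp : ‖p‖ < 1) (hq : ‖q‖ < 1) (hq0 : q ≠ 0) {z : ℂ}
    (hz : ellGamma p q z ≠ 0) : ellGamma p q (q * z) = theta p z * ellGamma p q z :=
  ellGamma_q_mul hp hq hq0 (ellGamma_ne_zero_iff.1 hz).2

end products

open Filter Topology

/-! ### Liouville-type theorems for quotients -/

lemma dense_ne_zero_of_entire {D : ℂ → ℂ} (hD : Differentiable ℂ D) (hD0 : ∃ z, D z ≠ 0) :
    ∀ z, ∀ᶠ w in 𝓝[≠] z, D w ≠ 0 := by
  intro z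
  have hA : AnalyticOnNhd ℂ D Set.univ := fun z _ => hD.analyticAt z
  rcases (hA z trivial).eventually_eq_zero_or_eventually_ne_zero with h | h
  · obtain ⟨w, hw⟩ := hD0
    exact absurd (hA.eqOn_zero_of_preconnected_of_eventuallyEq_zero isPreconnected_univ
      (Set.mem_univ z) h (Set.mem_univ w)) hw
  · exact h

/-- If `|F| ≤ M |D|` for entire functions `F` and `D ≢ 0`, then `F` is a multiple of `D`. -/
lemma entire_eq_const_mul {F D : ℂ → ℂ} (hF : Differentiable ℂ F) (hD : Differentiable ℂ D)
    (hD0 : ∃ z, D z ≠ 0) {M : ℝ} (h : ∀ z, ‖F z‖ ≤ M * ‖D z‖) : ∃ c, ∀ z, F z = c * D z := by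
  have hne := dense_ne_zero_of_entire hD hD0
  have hM : 0 ≤ M := by
    obtain ⟨z, hz⟩ := hD0
    have := (norm_nonneg _).trans (h z)
    exact nonneg_of_mul_nonneg_left this (norm_pos_iff.2 hz)
  have hbd : ∀ z, ‖F z / D z‖ ≤ M := by
    intro z
    rw [norm_div]
    by_cases hz : D z = 0
    · simpa [hz] using hM
    · rw [div_le_iff₀ (norm_pos_iff.2 hz)]; exact h z
  set H : ℂ → ℂ := fun z => limUnder (𝓝[≠] z) fun w => F w / D w with hH
  have hHD : ∀ z, D z ≠ 0 → H z = F z / D z := by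
    intro z hz
    have : ContinuousAt (fun w => F w / D w) z :=
      (hF z).continuousAt.div (hD z).continuousAt hz
    exact (this.tendsto.mono_left nhdsWithin_le_nhds).limUnder_eq
  have hdiff : Differentiable ℂ H := by
    intro z
    obtain ⟨r, hr, hb⟩ := Metric.mem_nhdsWithin_iff.1 (hne z)
    have hball : ∀ w ∈ Metric.ball z r \ {z}, D w ≠ 0 := fun w hw => hb ⟨hw.1, hw.2⟩
    have h1 := Complex.differentiableOn_update_limUnder_of_bddAbove
      (f := fun w => F w / D w) (Metric.ball_mem_nhds z hr)
      (fun w hw => ((hF w).div (hD w) (hball w hw)).differentiableWithinAt)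
      ⟨M, by rintro _ ⟨w, -, rfl⟩; exact hbd w⟩
    have h2 := (h1 z (Metric.mem_ball_self hr)).differentiableAt (Metric.ball_mem_nhds z hr)
    refine h2.congr_of_eventuallyEq ?_
    filter_upwards [Metric.ball_mem_nhds z hr] with w hw
    by_cases hwz : w = z
    · subst hwz; simp [hH]
    · rw [Function.update_of_ne hwz]
      exact hHD w (hball w ⟨hw, hwz⟩)
  have hHbd : ∀ z, ‖H z‖ ≤ M := by
    intro z
    have h1 : Tendsto (fun w => ‖H w‖) (𝓝[≠] z) (𝓝 ‖H z‖) :=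
      ((hdiff z).continuousAt.norm.tendsto).mono_left nhdsWithin_le_nhds
    refine le_of_tendsto h1 ?_
    filter_upwards [hne z] with w hw
    rw [hHD w hw]; exact hbd w
  have hb : Bornology.IsBounded (Set.range H) := by
    rw [isBounded_iff_forall_norm_le]
    exact ⟨M, by rintro _ ⟨w, rfl⟩; exact hHbd w⟩
  refine ⟨H 0, fun z => ?_⟩
  by_cases hz : D z = 0
  · have := h z
    rw [hz, norm_zero, mul_zero, norm_le_zero_iff] at this
    rw [this, hz, mul_zero]
  · rw [← hdiff.apply_eq_apply_of_bounded hb z 0, hHD z hz, div_mul_cancel₀ _ hz]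

/-- If the quotient `F / D` of entire functions is doubly periodic and locally bounded, then it is
constant. -/
lemma eq_const_mul_of_periodic {F D : ℂ → ℂ} (hF : Differentiable ℂ F) (hD : Differentiable ℂ D)
    (hD0 : ∃ z, D z ≠ 0) {ω₁ ω₂ : ℂ} (h₁ : ∀ u, F (u + ω₁) * D u = F u * D (u + ω₁))
    (h₂ : ∀ u, F (u + ω₂) * D u = F u * D (u + ω₂)) {K : Set ℂ} (hK : IsCompact K)
    (hcov : ∀ u, ∃ m n : ℤ, u - (m • ω₁ + n • ω₂) ∈ K)
    (hloc : ∀ x ∈ K, ∃ M : ℝ, ∀ᶠ u in 𝓝 x, ‖F u‖ ≤ M * ‖D u‖) : ∃ c, ∀ z, F z = c * D z := by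
  have hne := dense_ne_zero_of_entire hD hD0
  have key : ∀ {G : ℂ → ℂ} {l : ℂ}, Continuous G → (∀ u, D (u + l) * G u = 0) → ∀ u, G u = 0 := by
    intro G l hG h u
    have h1 : Tendsto G (𝓝[≠] u) (𝓝 (G u)) := hG.continuousAt.tendsto.mono_left nhdsWithin_le_nhds
    have h2 : ∀ᶠ w in 𝓝[≠] u, D (w + l) ≠ 0 := by
      have : Tendsto (fun w => w + l) (𝓝[≠] u) (𝓝[≠] (u + l)) := by
        refine tendsto_nhdsWithin_of_tendsto_nhds_of_eventually_within _ ?_ ?_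
        · exact ((continuous_id.add continuous_const).tendsto u).mono_left nhdsWithin_le_nhds
        · filter_upwards [self_mem_nhdsWithin] with w hw
          simpa using hw
      exact this.eventually (hne (u + l))
    refine tendsto_nhds_unique (h1.congr' ?_) tendsto_const_nhds
    filter_upwards [h2] with w hw
    exact (mul_eq_zero.1 (h w)).resolve_left hw
  have hFc := hF.continuous
  have hDc := hD.continuous
  let S : AddSubgroup ℂ :=
    { carrier := {l | ∀ u, F (u + l) * D u = F u * D (u + l)}
      zero_mem' := by intro u; simp
      add_mem' := by
        intro a b ha hb u
        have := key (G := fun u => F (u + (a + b)) * D u - F u * D (u + (a + b))) (l := a)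
          (by fun_prop) (fun u => by
            have h1 := ha u
            have h2 := hb (u + a)
            rw [add_assoc] at h2
            linear_combination D u * h2 + D (u + (a + b)) * h1) u
        exact sub_eq_zero.1 this
      neg_mem' := by
        intro a ha u
        have := ha (u + -a)
        rw [neg_add_cancel_right] at this
        exact this.symm }
  have hlat : ∀ m n : ℤ, ∀ u, F (u + (m • ω₁ + n • ω₂)) * D u = F u * D (u + (m • ω₁ + n • ω₂)) :=
    fun m n => S.add_mem (S.zsmul_mem h₁ m) (S.zsmul_mem h₂ n)
  obtain ⟨M, hM⟩ : ∃ M : ℝ, ∀ x ∈ K, ∀ᶠ u in 𝓝 x, ‖F u‖ ≤ M * ‖D u‖ := by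
    refine hK.induction_on (p := fun s => ∃ M : ℝ, ∀ x ∈ s, ∀ᶠ u in 𝓝 x, ‖F u‖ ≤ M * ‖D u‖)
      ⟨0, by simp⟩ ?_ ?_ ?_
    · rintro s t hst ⟨M, hM⟩
      exact ⟨M, fun x hx => hM x (hst hx)⟩
    · rintro s t ⟨M, hM⟩ ⟨M', hM'⟩
      refine ⟨max M M', fun x hx => ?_⟩
      rcases hx with hx | hx
      · filter_upwards [hM x hx] with u hu
        exact hu.trans (by gcongr; exact le_max_left _ _)
      · filter_upwards [hM' x hx] with u hu
        exact hu.trans (by gcongr; exact le_max_right _ _)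
    · intro x hx
      obtain ⟨M, hM⟩ := hloc x hx
      exact ⟨{y | ∀ᶠ u in 𝓝 y, ‖F u‖ ≤ M * ‖D u‖},
        mem_nhdsWithin_of_mem_nhds (eventually_eventually_nhds.2 hM), M, fun y hy => hy⟩
  refine entire_eq_const_mul hF hD hD0 (M := M) fun u => ?_
  obtain ⟨m, n, hmn⟩ := hcov u
  set l := m • ω₁ + n • ω₂
  have hshift : Tendsto (fun w => w - l) (𝓝[≠] u) (𝓝[≠] (u - l)) := by
    refine tendsto_nhdsWithin_of_tendsto_nhds_of_eventually_within _ ?_ ?_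
    · exact ((continuous_id.sub continuous_const).tendsto u).mono_left nhdsWithin_le_nhds
    · filter_upwards [self_mem_nhdsWithin] with w hw
      simpa using hw
  have h1 := hshift.eventually ((hM _ hmn).filter_mono nhdsWithin_le_nhds)
  have h2 := hshift.eventually (hne (u - l))
  have t1 : Tendsto (fun w => ‖F w‖) (𝓝[≠] u) (𝓝 ‖F u‖) :=
    hFc.norm.continuousAt.tendsto.mono_left nhdsWithin_le_nhds
  have t2 : Tendsto (fun w => M * ‖D w‖) (𝓝[≠] u) (𝓝 (M * ‖D u‖)) :=
    (hDc.norm.const_mul M).continuousAt.tendsto.mono_left nhdsWithin_le_nhds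
  refine le_of_tendsto_of_tendsto t1 t2 ?_
  filter_upwards [h1, h2] with w hw1 hw2
  have h3 := hlat m n (w - l)
  rw [show w - l + (m • ω₁ + n • ω₂) = w by simp [l]] at h3
  have h4 : ‖F w‖ * ‖D (w - l)‖ ≤ M * ‖D w‖ * ‖D (w - l)‖ := by
    rw [← norm_mul, h3, norm_mul]
    calc _ ≤ M * ‖D (w - l)‖ * ‖D w‖ := by gcongr
      _ = _ := by ring
  exact le_of_mul_le_mul_right h4 (norm_pos_iff.2 hw2)

/-- At a simple zero of `D` which is also a zero of `F`, the quotient `F / D` is bounded. -/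
lemma eventually_norm_le_of_deriv_ne_zero {F D : ℂ → ℂ} {x D' : ℂ} (hF : DifferentiableAt ℂ F x)
    (hD : HasDerivAt D D' x) (hD' : D' ≠ 0) (hFx : F x = 0) :
    ∃ M : ℝ, ∀ᶠ u in 𝓝 x, ‖F u‖ ≤ M * ‖D u‖ := by
  by_cases hDx : D x = 0
  · have h1 : F =O[𝓝 x] fun u => u - x := by simpa [hFx] using hF.isBigO_sub
    have h2 : (fun u => u - x) =O[𝓝 x] D := by
      have := (hD.isTheta_sub hD').2
      simpa [Function.comp_def, hDx] using this
    obtain ⟨M, hM⟩ := (h1.trans h2).bound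
    exact ⟨M, hM⟩
  · refine ⟨1, ?_⟩
    have := (hF.continuousAt.norm).eventually_lt (hD.continuousAt.norm)
      (by simpa [hFx] using hDx)
    filter_upwards [this] with u hu
    linarith

lemma eventually_norm_le_of_ne_zero {F D : ℂ → ℂ} {x : ℂ} (hF : ContinuousAt F x)
    (hD : ContinuousAt D x) (hDx : D x ≠ 0) :
    ∃ M : ℝ, ∀ᶠ u in 𝓝 x, ‖F u‖ ≤ M * ‖D u‖ := by
  refine ⟨‖F x‖ / ‖D x‖ + 1, ?_⟩
  have hpos := norm_pos_iff.2 hDx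
  have := (hF.norm).eventually_lt (hD.norm.const_mul (‖F x‖ / ‖D x‖ + 1)) (by
    rw [add_mul, div_mul_cancel₀ _ hpos.ne']; linarith)
  filter_upwards [this] with u hu using hu.le

/-- The closed parallelogram `{α ω₁ + β ω₂ | a ≤ α, β ≤ a + 1}`. -/
def parallelogram (ω₁ ω₂ : ℂ) (a : ℝ) : Set ℂ :=
  (fun x : ℝ × ℝ => x.1 * ω₁ + x.2 * ω₂) '' (Set.Icc a (a + 1) ×ˢ Set.Icc a (a + 1))

lemma isCompact_parallelogram (ω₁ ω₂ : ℂ) (a : ℝ) : IsCompact (parallelogram ω₁ ω₂ a) :=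
  (isCompact_Icc.prod isCompact_Icc).image (by fun_prop)

lemma exists_real_coords {ω₁ ω₂ : ℂ} (h : (ω₁ / ω₂).im ≠ 0) (u : ℂ) :
    ∃ α β : ℝ, u = α * ω₁ + β * ω₂ := by
  have hω : ω₂ ≠ 0 := by rintro rfl; simp at h
  refine ⟨(u / ω₂).im / (ω₁ / ω₂).im,
    (u / ω₂).re - (u / ω₂).im / (ω₁ / ω₂).im * (ω₁ / ω₂).re, ?_⟩
  have : u / ω₂ = ((u / ω₂).im / (ω₁ / ω₂).im : ℝ) * (ω₁ / ω₂) +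
      ((u / ω₂).re - (u / ω₂).im / (ω₁ / ω₂).im * (ω₁ / ω₂).re : ℝ) := by
    apply Complex.ext
    · simp only [add_re, re_ofReal_mul, ofReal_re]; ring
    · simp only [add_im, im_ofReal_mul, ofReal_im]; field_simp; ring
  have h1 : u = u / ω₂ * ω₂ := by field_simp
  have h2 : ω₁ = ω₁ / ω₂ * ω₂ := by field_simp
  linear_combination ω₂ * this + h1 - ((u / ω₂).im / (ω₁ / ω₂).im : ℝ) * h2

lemma parallelogram_covers {ω₁ ω₂ : ℂ} (h : (ω₁ / ω₂).im ≠ 0) (a : ℝ) (u : ℂ) :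
    ∃ m n : ℤ, u - (m • ω₁ + n • ω₂) ∈ parallelogram ω₁ ω₂ a := by
  obtain ⟨α, β, rfl⟩ := exists_real_coords h u
  refine ⟨⌊α - a⌋, ⌊β - a⌋, ⟨(α - ⌊α - a⌋, β - ⌊β - a⌋), ?_, ?_⟩⟩
  · have h1 := Int.floor_le (α - a)
    have h2 := Int.lt_floor_add_one (α - a)
    have h3 := Int.floor_le (β - a)
    have h4 := Int.lt_floor_add_one (β - a)
    simp only [Set.mem_prod, Set.mem_Icc]
    refine ⟨⟨?_, ?_⟩, ⟨?_, ?_⟩⟩ <;> linarith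
  · simp only [zsmul_eq_mul, ofReal_sub, ofReal_intCast]; ring

/-! ### The exponential `e` -/

lemma e_add (x y : ℂ) : e (x + y) = e x * e y := by
  rw [e, e, e, ← Complex.exp_add]; ring_nf

lemma e_neg (x : ℂ) : e (-x) = (e x)⁻¹ := by rw [e, e, ← Complex.exp_neg]; ring_nf

lemma e_sub (x y : ℂ) : e (x - y) = e x / e y := by
  rw [sub_eq_add_neg, e_add, e_neg, div_eq_mul_inv]

lemma e_zero : e 0 = 1 := by simp [e]

lemma e_ne_zero (x : ℂ) : e x ≠ 0 := Complex.exp_ne_zero _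

lemma e_eq_one_iff {x : ℂ} : e x = 1 ↔ ∃ n : ℤ, x = n := by
  rw [e, Complex.exp_eq_one_iff]
  constructor <;> rintro ⟨n, hn⟩ <;> refine ⟨n, ?_⟩
  · have := Complex.two_pi_I_ne_zero
    apply mul_left_cancel₀ this
    linear_combination hn
  · rw [hn]; ring

lemma e_int (n : ℤ) : e n = 1 := e_eq_one_iff.2 ⟨n, rfl⟩

lemma e_one : e 1 = 1 := by simpa using e_int 1

lemma e_add_one (x : ℂ) : e (x + 1) = e x := by rw [e_add, e_one, mul_one]

lemma e_int_mul (n : ℤ) (x : ℂ) : e (n * x) = e x ^ n := by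
  rw [e, e, ← Complex.exp_int_mul]; ring_nf

lemma e_nat_mul (n : ℕ) (x : ℂ) : e (n * x) = e x ^ n := by
  rw [e, e, ← Complex.exp_nat_mul]; ring_nf

lemma e_two_mul (x : ℂ) : e (2 * x) = e x ^ 2 := by simpa using e_nat_mul 2 x

lemma norm_e (x : ℂ) : ‖e x‖ = Real.exp (-(2 * Real.pi * x.im)) := by
  rw [e, Complex.norm_exp]; simp

lemma norm_e_lt_one {x : ℂ} : ‖e x‖ < 1 ↔ 0 < x.im := by
  rw [norm_e, Real.exp_lt_one_iff]
  have := Real.pi_pos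
  constructor <;> intro h
  · by_contra! h'
    nlinarith
  · have : 0 < 2 * Real.pi * x.im := by positivity
    linarith

lemma differentiable_e : Differentiable ℂ e := by unfold e; fun_prop

lemma continuous_e : Continuous e := differentiable_e.continuous

lemma hasDerivAt_e (x : ℂ) : HasDerivAt e (2 * Real.pi * I * e x) x := by
  have h : HasDerivAt (fun x : ℂ => 2 * Real.pi * I * x) (2 * Real.pi * I) x := by
    simpa using (hasDerivAt_id x).const_mul (2 * Real.pi * I : ℂ)
  convert! h.cexp using 1
  rw [e, mul_comm]

lemma exists_e_eq {z : ℂ} (hz : z ≠ 0) : ∃ x, e x = z := by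
  refine ⟨log z / (2 * Real.pi * I), ?_⟩
  rw [e, mul_div_cancel₀ _ Complex.two_pi_I_ne_zero, exp_log hz]

/-! ### Simple zeros and the addition formula -/

section theta

variable {p : ℂ}

lemma hasDerivAt_theta_one (hp : ‖p‖ < 1) : HasDerivAt (theta p) (-(qPoch p p) ^ 2) 1 := by
  have e1 : theta p = fun x => (1 - x) * (qPoch (p * x) p * qPoch (p / x) p) := by
    ext x; rw [theta, qPoch_eq hp]; ring
  have h1 : DifferentiableAt ℂ (fun x => qPoch (p * x) p * qPoch (p / x) p) 1 := by
    have a1 : DifferentiableAt ℂ (fun x => p * x) 1 := by fun_prop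
    have a2 : DifferentiableAt ℂ (fun x => p / x) 1 := by fun_prop (disch := norm_num)
    exact (((differentiable_qPoch hp) _).comp 1 a1).mul (((differentiable_qPoch hp) _).comp 1 a2)
  have h2 : HasDerivAt (fun x : ℂ => 1 - x) (-1) 1 := by
    simpa using (hasDerivAt_id (1 : ℂ)).const_sub 1
  have := h2.mul h1.hasDerivAt
  rw [e1]
  convert! this using 1
  simp; ring

lemma qPoch_self_ne_zero (hp : ‖p‖ < 1) : qPoch p p ≠ 0 := by
  rw [Ne, qPoch_eq_zero_iff hp]
  rintro ⟨n, hn⟩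
  have : ‖p * p ^ n‖ < 1 := by
    rw [← pow_succ', norm_pow]; exact pow_lt_one₀ (norm_nonneg _) hp (by simp)
  rw [hn] at this; simp at this

lemma deriv_theta_zpow_ne_zero (hp : ‖p‖ < 1) (hp0 : p ≠ 0) (n : ℤ) :
    deriv (theta p) (p ^ n) ≠ 0 := by
  have step : ∀ n : ℤ, p * deriv (theta p) (p ^ (n + 1)) =
      -(p ^ n)⁻¹ * deriv (theta p) (p ^ n) := by
    intro n
    have hx : p ^ n ≠ 0 := zpow_ne_zero _ hp0
    have hpx : p ^ (n + 1) = p * p ^ n := by rw [zpow_add₀ hp0, zpow_one, mul_comm]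
    have hz : theta p (p ^ n) = 0 := (theta_eq_zero_iff hp hp0 hx).2 ⟨n, rfl⟩
    have h1 : HasDerivAt (fun x => theta p (p * x)) (deriv (theta p) (p * p ^ n) * p) (p ^ n) := by
      have a : HasDerivAt (fun x : ℂ => p * x) p (p ^ n) := by
        simpa using (hasDerivAt_id (p ^ n)).const_mul p
      exact (differentiableAt_theta hp (mul_ne_zero hp0 hx)).hasDerivAt.comp (p ^ n) a
    have h2 : HasDerivAt (fun x => -x⁻¹ * theta p x)
        (-(-((p ^ n) ^ 2)⁻¹) * theta p (p ^ n) + -(p ^ n)⁻¹ * deriv (theta p) (p ^ n)) (p ^ n) :=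
      ((hasDerivAt_inv hx).neg).mul (differentiableAt_theta hp hx).hasDerivAt
    have h3 : (fun x => theta p (p * x)) =ᶠ[𝓝 (p ^ n)] fun x => -x⁻¹ * theta p x := by
      filter_upwards [isOpen_ne.mem_nhds hx] with x hx
      exact theta_p_mul hp hp0 hx
    have h4 := h1.unique (h2.congr_of_eventuallyEq h3)
    rw [hz, mul_zero, zero_add] at h4
    rw [hpx, mul_comm p, h4]
  have h0 : deriv (theta p) (p ^ (0 : ℤ)) ≠ 0 := by
    rw [zpow_zero, (hasDerivAt_theta_one hp).deriv]
    simpa using qPoch_self_ne_zero hp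
  induction n using Int.induction_on with
  | zero => exact h0
  | succ n ih =>
    intro h
    have := step n
    rw [h, mul_zero, eq_comm, mul_eq_zero] at this
    rcases this with h' | h'
    · simp [hp0] at h'
    · exact ih h'
  | pred n ih =>
    intro h
    have := step (-(n : ℤ) - 1)
    rw [h, mul_zero, mul_eq_zero, sub_add_cancel] at this
    exact this.elim hp0 ih

lemma countable_range_mul_zpow (p c : ℂ) : {z : ℂ | ∃ n : ℤ, z = c * p ^ n}.Countable := by
  have : {z : ℂ | ∃ n : ℤ, z = c * p ^ n} = Set.range fun n : ℤ => c * p ^ n := by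
    ext z; simp [eq_comm]
  rw [this]; exact Set.countable_range _

/-- A continuous function that vanishes off a countable set near a point vanishes there. -/
lemma eq_zero_of_countable {f : ℂ → ℂ} {x : ℂ} (hf : ContinuousAt f x) {B : Set ℂ}
    (hB : B.Countable) (h : ∀ᶠ z in 𝓝 x, z ∉ B → f z = 0) : f x = 0 := by
  have hd : Dense Bᶜ := hB.dense_compl ℝ
  by_contra hne
  have h1 := hf.eventually_ne hne
  obtain ⟨z, hz, hzB⟩ := (mem_closure_iff_nhds.1 (hd x)) _ (h.and h1)
  exact hz.2 (hz.1 hzB)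

lemma theta_addition_generic (hp : ‖p‖ < 1) (hp0 : p ≠ 0) {w x y z : ℂ} (hw : w ≠ 0) (hx : x ≠ 0)
    (hy : y ≠ 0) (hz : z ≠ 0) (h1 : ∀ n : ℤ, z ^ 2 ≠ p ^ n) (h2 : ∀ n : ℤ, w * z ≠ p ^ n)
    (h3 : ∀ n : ℤ, w / z ≠ p ^ n) :
    theta p (x * w) * theta p (x / w) * theta p (y * z) * theta p (y / z) -
        theta p (x * z) * theta p (x / z) * theta p (y * w) * theta p (y / w) -
      y / w * (theta p (x * y) * theta p (x / y) * theta p (w * z) * theta p (w / z)) = 0 := by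
  set f : ℂ → ℂ := fun x =>
    theta p (x * w) * theta p (x / w) * theta p (y * z) * theta p (y / z) -
        theta p (x * z) * theta p (x / z) * theta p (y * w) * theta p (y / w) -
      y / w * (theta p (x * y) * theta p (x / y) * theta p (w * z) * theta p (w / z)) with hf
  have pair : ∀ {x c : ℂ}, x ≠ 0 → c ≠ 0 → theta p (p * x * c) * theta p (p * x / c) =
      (x ^ 2)⁻¹ * (theta p (x * c) * theta p (x / c)) := by
    intro x c hx hc
    rw [mul_assoc, mul_div_assoc, theta_p_mul hp hp0 (mul_ne_zero hx hc),
      theta_p_mul hp hp0 (div_ne_zero hx hc)]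
    field_simp
  have hfp : ∀ {x : ℂ}, x ≠ 0 → f (p * x) = (x ^ 2)⁻¹ * f x := by
    intro x hx
    have a1 := pair hx hw
    have a2 := pair hx hz
    have a3 := pair hx hy
    simp only [hf]
    linear_combination theta p (y * z) * theta p (y / z) * a1 -
      theta p (y * w) * theta p (y / w) * a2 - y / w * theta p (w * z) * theta p (w / z) * a3
  have hfpn : ∀ n : ℤ, ∀ x : ℂ, x ≠ 0 → f x = 0 → f (p ^ n * x) = 0 := by
    intro n x hx h
    induction n using Int.induction_on with
    | zero => simpa using h
    | succ n ih =>
      rw [zpow_add₀ hp0, zpow_one, mul_comm (p ^ (n : ℤ)), mul_assoc,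
        hfp (mul_ne_zero (zpow_ne_zero _ hp0) hx), ih, mul_zero]
    | pred n ih =>
      have hne : p ^ (-(n : ℤ) - 1) * x ≠ 0 := mul_ne_zero (zpow_ne_zero _ hp0) hx
      have := hfp hne
      rw [← mul_assoc, ← zpow_one_add₀ hp0, show 1 + (-(n : ℤ) - 1) = -n by ring, ih, eq_comm,
        mul_eq_zero] at this
      exact this.resolve_left (by simpa using hne)
  have hs1 := theta_div_swap hp hz hw
  have hs2 := theta_div_swap hp hz hy
  have hs3 := theta_div_swap hp hw hy
  have fz : f z = 0 := by
    simp only [hf, div_self hz, theta_one hp]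
    rw [hs1, hs2, mul_comm z w, mul_comm z y]
    field_simp
    ring
  have fw : f w = 0 := by
    simp only [hf, div_self hw, theta_one hp]
    rw [hs3, mul_comm w y]
    field_simp
    ring
  have finv : f z⁻¹ = 0 := by
    have b1 : ∀ {c : ℂ}, c ≠ 0 → theta p (z⁻¹ * c) * theta p (z⁻¹ / c) =
        (z ^ 2)⁻¹ * (theta p (z * c) * theta p (z / c)) := by
      intro c hc
      have c1 := theta_div_swap hp hc hz
      have c2 := theta_inv hp (mul_ne_zero hz hc)
      rw [show z⁻¹ * c = c / z by ring, show z⁻¹ / c = (z * c)⁻¹ by rw [mul_inv, div_eq_mul_inv],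
        theta_div_swap hp hz hc, c2]
      field_simp
    have a1 := b1 hw
    have a2 := b1 hz
    have a3 := b1 hy
    have : f z⁻¹ = (z ^ 2)⁻¹ * f z := by
      simp only [hf]
      linear_combination theta p (y * z) * theta p (y / z) * a1 -
        theta p (y * w) * theta p (y / w) * a2 - y / w * theta p (w * z) * theta p (w / z) * a3
    rw [this, fz, mul_zero]
  obtain ⟨τ, hτ⟩ := exists_e_eq hp0
  have hτ0 : 0 < τ.im := by rw [← norm_e_lt_one, hτ]; exact hp
  have dθ : ∀ {c : ℂ}, c ≠ 0 → Differentiable ℂ fun u => theta p (e u * c) := by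
    intro c hc u
    exact (differentiableAt_theta hp (mul_ne_zero (e_ne_zero u) hc)).comp u
      ((differentiable_e u).mul_const c)
  have dθ' : ∀ {c : ℂ}, c ≠ 0 → Differentiable ℂ fun u => theta p (e u / c) := by
    intro c hc
    simpa [div_eq_mul_inv] using dθ (inv_ne_zero hc)
  have hF : Differentiable ℂ fun u => f (e u) := by
    simp only [hf]
    have := dθ hw; have := dθ hz; have := dθ hy
    have := dθ' hw; have := dθ' hz; have := dθ' hy
    fun_prop
  have hD : Differentiable ℂ fun u => theta p (e u * z) * theta p (e u / z) := (dθ hz).mul (dθ' hz)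
  have hDw : theta p (w * z) * theta p (w / z) ≠ 0 := by
    rw [mul_ne_zero_iff, Ne, Ne, theta_eq_zero_iff hp hp0 (mul_ne_zero hw hz),
      theta_eq_zero_iff hp hp0 (div_ne_zero hw hz)]
    exact ⟨fun ⟨n, hn⟩ => h2 n hn, fun ⟨n, hn⟩ => h3 n hn⟩
  obtain ⟨u₀, hu₀⟩ := exists_e_eq hw
  obtain ⟨c, hc⟩ := eq_const_mul_of_periodic (F := fun u => f (e u))
    (D := fun u => theta p (e u * z) * theta p (e u / z)) hF hD ⟨u₀, by simpa [hu₀] using hDw⟩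
    (ω₁ := τ) (ω₂ := 1)
    (fun u => by
      simp only [e_add, hτ, mul_comm (e u) p]
      rw [hfp (e_ne_zero u), pair (e_ne_zero u) hz]; ring)
    (fun u => by simp only [e_add_one])
    (isCompact_parallelogram τ 1 0) (parallelogram_covers (by simpa using hτ0.ne') 0)
    (fun u _ => by
      have hder : ∀ {c : ℂ}, HasDerivAt (fun u => e u * c) (2 * Real.pi * I * e u * c) u :=
        fun {c} => (hasDerivAt_e u).mul_const c
      have hu := e_ne_zero u
      have hpi := Complex.two_pi_I_ne_zero
      by_cases hD1 : theta p (e u * z) = 0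
      · obtain ⟨n, hn⟩ := (theta_eq_zero_iff hp hp0 (mul_ne_zero hu hz)).1 hD1
        have eu : e u = p ^ n * z⁻¹ := by rw [← hn]; field_simp
        have hd1 : HasDerivAt (fun u => theta p (e u * z))
            (deriv (theta p) (e u * z) * (2 * Real.pi * I * e u * z)) u :=
          HasDerivAt.comp (h₂ := theta p) (h := fun u => e u * z) u
            (differentiableAt_theta hp (mul_ne_zero hu hz)).hasDerivAt hder
        refine eventually_norm_le_of_deriv_ne_zero (hF u) (hd1.mul (dθ' hz u).hasDerivAt) ?_ ?_
        · simp only [hD1, zero_mul, add_zero]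
          refine mul_ne_zero (mul_ne_zero ?_ (mul_ne_zero (mul_ne_zero hpi hu) hz)) ?_
          · rw [hn]; exact deriv_theta_zpow_ne_zero hp hp0 n
          · rw [Ne, theta_eq_zero_iff hp hp0 (div_ne_zero hu hz)]
            rintro ⟨m, hm⟩
            refine h1 (n - m) ?_
            rw [zpow_sub₀ hp0, ← hn, ← hm]; field_simp
        · simp only [eu]
          exact hfpn n _ (inv_ne_zero hz) finv
      · by_cases hD2 : theta p (e u / z) = 0
        · obtain ⟨n, hn⟩ := (theta_eq_zero_iff hp hp0 (div_ne_zero hu hz)).1 hD2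
          have eu : e u = p ^ n * z := by rw [← hn]; field_simp
          have hd2 : HasDerivAt (fun u => theta p (e u / z))
              (deriv (theta p) (e u * z⁻¹) * (2 * Real.pi * I * e u * z⁻¹)) u := by
            simp only [div_eq_mul_inv]
            exact (differentiableAt_theta hp (mul_ne_zero hu (inv_ne_zero hz))).hasDerivAt.comp u
              hder
          refine eventually_norm_le_of_deriv_ne_zero (hF u) ((dθ hz u).hasDerivAt.mul hd2) ?_ ?_
          · simp only [hD2, mul_zero, zero_add]
            refine mul_ne_zero hD1 (mul_ne_zero ?_
              (mul_ne_zero (mul_ne_zero hpi hu) (inv_ne_zero hz)))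
            rw [← div_eq_mul_inv, hn]; exact deriv_theta_zpow_ne_zero hp hp0 n
          · simp only [eu]
            exact hfpn n _ hz fz
        · exact eventually_norm_le_of_ne_zero (hF u).continuousAt (hD u).continuousAt
            (mul_ne_zero hD1 hD2))
  have hc0 : c = 0 := by
    have := hc u₀
    simp only [hu₀, fw] at this
    exact (mul_eq_zero.1 this.symm).resolve_right hDw
  obtain ⟨u, hu⟩ := exists_e_eq hx
  have := hc u
  simp only [hu, hc0, zero_mul] at this
  exact this

lemma Set.Countable.preimage_of_countable_fiber {α β : Type*} {B : Set β} (hB : B.Countable)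
    {f : α → β} (hf : ∀ b, (f ⁻¹' {b}).Countable) : (f ⁻¹' B).Countable := by
  have : f ⁻¹' B = ⋃ b ∈ B, f ⁻¹' {b} := by ext; simp
  rw [this]
  exact hB.biUnion fun b _ => hf b

lemma countable_pow_preimage {B : Set ℂ} (hB : B.Countable) {n : ℕ} (hn : n ≠ 0) :
    {z : ℂ | z ^ n ∈ B}.Countable := by
  refine Set.Countable.preimage_of_countable_fiber hB (f := fun z : ℂ => z ^ n) fun b => ?_
  have : (fun z : ℂ => z ^ n) ⁻¹' {b} ⊆ (Polynomial.nthRoots n b).toFinset := by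
    intro z hz
    simpa [Polynomial.mem_nthRoots (Nat.pos_of_ne_zero hn)] using hz
  exact (Finset.countable_toSet _).mono this

lemma countable_zpow (p : ℂ) : {z : ℂ | ∃ n : ℤ, z = p ^ n}.Countable := by
  simpa using countable_range_mul_zpow p 1

lemma countable_mul_preimage {B : Set ℂ} (hB : B.Countable) {c : ℂ} (hc : c ≠ 0) :
    {z : ℂ | c * z ∈ B}.Countable :=
  hB.preimage (mul_right_injective₀ hc)

lemma countable_div_preimage {B : Set ℂ} (hB : B.Countable) {c : ℂ} (hc : c ≠ 0) :
    {z : ℂ | c / z ∈ B}.Countable :=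
  hB.preimage (f := fun z => c / z) fun x y h => by simpa [div_eq_mul_inv, hc] using h

/-- The addition formula for theta functions. -/
lemma theta_addition (hp : ‖p‖ < 1) (hp0 : p ≠ 0) {w x y z : ℂ} (hw : w ≠ 0) (hx : x ≠ 0)
    (hy : y ≠ 0) (hz : z ≠ 0) :
    theta p (x * w) * theta p (x / w) * theta p (y * z) * theta p (y / z) -
        theta p (x * z) * theta p (x / z) * theta p (y * w) * theta p (y / w) =
      y / w * (theta p (x * y) * theta p (x / y) * theta p (w * z) * theta p (w / z)) := by
  have hθ : ∀ {c : ℂ}, c ≠ 0 → ContinuousAt (fun z => theta p (c * z)) z := fun {c} hc =>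
    ContinuousAt.comp (g := theta p) (continuousAt_theta hp (mul_ne_zero hc hz)) (by fun_prop)
  have hθ' : ∀ {c : ℂ}, c ≠ 0 → ContinuousAt (fun z => theta p (c / z)) z := fun {c} hc =>
    ContinuousAt.comp (g := theta p) (continuousAt_theta hp (div_ne_zero hc hz))
      (by fun_prop (disch := assumption))
  have hB := countable_zpow p
  refine sub_eq_zero.1 (eq_zero_of_countable (f := fun z =>
    theta p (x * w) * theta p (x / w) * theta p (y * z) * theta p (y / z) -
        theta p (x * z) * theta p (x / z) * theta p (y * w) * theta p (y / w) -
      y / w * (theta p (x * y) * theta p (x / y) * theta p (w * z) * theta p (w / z))) ?_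
    (((countable_pow_preimage hB two_ne_zero).union (countable_mul_preimage hB hw)).union
      (countable_div_preimage hB hw)) ?_)
  · exact (((continuousAt_const.mul (hθ hy)).mul (hθ' hy)).sub
      ((((hθ hx).mul (hθ' hx)).mul continuousAt_const).mul continuousAt_const)).sub
      (continuousAt_const.mul ((continuousAt_const.mul (hθ hw)).mul (hθ' hw)))
  · filter_upwards [isOpen_ne.mem_nhds hz] with z hz hzB
    simp only [Set.mem_union, Set.mem_ofPred_eq, not_or, not_exists] at hzB
    exact theta_addition_generic hp hp0 hw hx hy hz hzB.1.1 hzB.1.2 hzB.2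

/-! ### The modular transformation of the theta function -/

lemma qPoch_e_sq_modular {τ : ℂ} (hτ : 0 < τ.im) :
    qPoch (e (-1 / τ)) (e (-1 / τ)) ^ 2 * e (-1 / τ / 12) =
      -I * τ * (qPoch (e τ) (e τ) ^ 2 * e (τ / 12)) := by
  have heta : ∀ z : ℂ, ModularForm.eta z = e (z / 24) * qPoch (e z) (e z) := by
    intro z
    rw [ModularForm.eta, qPoch]
    congr 1
    · rw [Function.Periodic.qParam, e]; congr 1; push_cast; ring
    · congr 1; ext n
      rw [ModularForm.eta_q_eq_pow, ← pow_succ', e]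
  have h := ModularForm.eta_comp_eq_csqrt_I_inv (show τ ∈ UpperHalfPlane.upperHalfPlaneSet from hτ)
  simp only [Function.comp_apply, Pi.smul_apply, Pi.mul_apply, smul_eq_mul, heta] at h
  have hsq : ∀ z : ℂ, Complex.sqrt z ^ 2 = z := fun z => by
    simp [Complex.sqrt]
  have h2 := congrArg (· ^ 2) h
  simp only [mul_pow, inv_pow, hsq] at h2
  have e12 : ∀ z : ℂ, e (z / 24) ^ 2 = e (z / 12) := fun z => by rw [← e_two_mul]; congr 1; ring
  rw [e12, e12] at h2
  rw [Complex.inv_I] at h2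
  linear_combination h2

/-- The multiplier exponent of the modular transformation of theta functions. -/
noncomputable def thetaExponent (τ u : ℂ) : ℂ :=
  u ^ 2 / τ - u * (1 + 1 / τ) + (τ + 1 / τ) / 6 + 1 / 2

lemma theta_modular_aux {τ : ℂ} (hτ : 0 < τ.im) (u : ℂ) :
    theta (e (-1 / τ)) (e (-u / τ)) =
      exp (Real.pi * I * thetaExponent τ u) * theta (e τ) (e u) := by
  have hτ0 : τ ≠ 0 := by rintro rfl; simp at hτ
  have hτ' : 0 < (-1 / τ).im := by
    rw [neg_div, one_div, neg_im, inv_im, neg_div, neg_neg]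
    exact div_pos hτ (normSq_pos.2 hτ0)
  have hp : ‖e τ‖ < 1 := norm_e_lt_one.2 hτ
  have hp' : ‖e (-1 / τ)‖ < 1 := norm_e_lt_one.2 hτ'
  have hp0 := e_ne_zero τ
  have hp0' := e_ne_zero (-1 / τ)
  have hexp : ∀ x y : ℂ, exp (Real.pi * I * (x + 2 * y)) = exp (Real.pi * I * x) * e y := by
    intro x y; rw [e, ← Complex.exp_add]; ring_nf
  have hexp1 : ∀ x : ℂ, exp (Real.pi * I * (x + 1)) = -exp (Real.pi * I * x) := by
    intro x; rw [mul_add, mul_one, Complex.exp_add, Complex.exp_pi_mul_I]; ring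
  have hF : Differentiable ℂ fun u => theta (e (-1 / τ)) (e (-u / τ)) := fun u =>
    DifferentiableAt.comp (g := theta (e (-1 / τ))) u (differentiableAt_theta hp' (e_ne_zero _))
      ((differentiable_e _).comp u (by fun_prop))
  have hθ : Differentiable ℂ fun u => theta (e τ) (e u) := fun u =>
    (differentiableAt_theta hp (e_ne_zero _)).comp u (differentiable_e u)
  have hE : Differentiable ℂ fun u => exp (Real.pi * I * thetaExponent τ u) := by
    unfold thetaExponent; fun_prop
  set x₀ := (qPoch (e τ) (e τ)) ^ 2 with hx₀
  have hx₀0 : x₀ ≠ 0 := pow_ne_zero _ (qPoch_self_ne_zero hp)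
  have dF : HasDerivAt (fun u => theta (e (-1 / τ)) (e (-u / τ)))
      (2 * Real.pi * I / τ * qPoch (e (-1 / τ)) (e (-1 / τ)) ^ 2) 0 := by
    have h1 : HasDerivAt (fun u : ℂ => -u / τ) (-1 / τ) 0 := (hasDerivAt_id 0).neg.div_const τ
    have h2 := (hasDerivAt_e (-0 / τ)).comp (0 : ℂ) h1
    have h0 : e (-0 / τ) = 1 := by simp [e_zero]
    have h3 := HasDerivAt.comp (h₂ := theta (e (-1 / τ))) (h := fun u => e (-u / τ)) (0 : ℂ)
      (by simp only [h0]; exact hasDerivAt_theta_one hp') h2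
    convert! h3 using 1
    rw [h0]; ring
  have dD : HasDerivAt (fun u => exp (Real.pi * I * thetaExponent τ u) * theta (e τ) (e u))
      (exp (Real.pi * I * thetaExponent τ 0) * (-(2 * Real.pi * I) * x₀)) 0 := by
    have h3 := HasDerivAt.comp (h₂ := theta (e τ)) (h := e) (0 : ℂ)
      (by rw [e_zero]; exact hasDerivAt_theta_one hp) (hasDerivAt_e 0)
    have h4 := (hE 0).hasDerivAt.mul h3
    convert! h4 using 1
    simp only [Function.comp_apply, e_zero, theta_one hp]
    ring
  have hpi := Complex.two_pi_I_ne_zero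
  have dD0 : exp (Real.pi * I * thetaExponent τ 0) * (-(2 * Real.pi * I) * x₀) ≠ 0 :=
    mul_ne_zero (Complex.exp_ne_zero _) (mul_ne_zero (neg_ne_zero.2 hpi) hx₀0)
  have hzero : ∀ u ∈ parallelogram τ 1 (-1 / 2), theta (e τ) (e u) = 0 → u = 0 := by
    rintro _ ⟨⟨α, β⟩, ⟨⟨h1, h2⟩, h3, h4⟩, rfl⟩ h0
    obtain ⟨n, hn⟩ := (theta_eq_zero_iff hp hp0 (e_ne_zero _)).1 h0
    rw [← e_int_mul, ← div_eq_one_iff_eq (e_ne_zero _), ← e_sub, e_eq_one_iff] at hn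
    obtain ⟨m, hm⟩ := hn
    have him := congrArg Complex.im hm
    have hre := congrArg Complex.re hm
    simp at him hre
    have hαn : α = n := by
      have : (α - n) * τ.im = 0 := by linarith
      have := (mul_eq_zero.1 this).resolve_right hτ.ne'
      linarith
    have hβm : β = m := by rw [hαn] at hre; linarith
    have bound : ∀ (x : ℝ) (k : ℤ), x = k → -1 / 2 ≤ x → x ≤ -1 / 2 + 1 → x = 0 := by
      intro x k hk a b
      have a1 : (-1 : ℝ) < k := by rw [← hk]; linarith
      have a2 : (k : ℝ) < 1 := by rw [← hk]; linarith
      have : k = 0 := by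
        have a1' : (-1 : ℤ) < k := by exact_mod_cast a1
        have a2' : k < (1 : ℤ) := by exact_mod_cast a2
        omega
      rw [hk, this]; simp
    simp [bound α n hαn h1 h2, bound β m hβm h3 h4]
  have hD0 : ∃ z, exp (Real.pi * I * thetaExponent τ z) * theta (e τ) (e z) ≠ 0 := by
    refine ⟨1 / 2, mul_ne_zero (Complex.exp_ne_zero _) fun h => ?_⟩
    have := hzero (1 / 2) ⟨(0, 1 / 2), by norm_num, by simp⟩ h
    norm_num at this
  obtain ⟨c, hc⟩ := eq_const_mul_of_periodic
    (D := fun u => exp (Real.pi * I * thetaExponent τ u) * theta (e τ) (e u)) hF (hE.mul hθ) hD0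
    (ω₁ := τ) (ω₂ := 1)
    (fun u => by
      have a1 : thetaExponent τ (u + τ) = thetaExponent τ u + 2 * (u - 1) + 1 := by
        rw [thetaExponent, thetaExponent]; field_simp; ring
      have a2 : e (-(u + τ) / τ) = e (-u / τ) := by
        rw [show -(u + τ) / τ = -u / τ - 1 by field_simp; ring, e_sub, e_one, div_one]
      simp only [a1, a2]
      rw [hexp1, hexp, e_add, mul_comm (e u), theta_p_mul hp hp0 (e_ne_zero u), e_sub, e_one]
      have := e_ne_zero u
      field_simp)
    (fun u => by
      have a1 : thetaExponent τ (u + 1) = thetaExponent τ u + 2 * (u / τ - 1) + 1 := by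
        rw [thetaExponent, thetaExponent]; field_simp; ring
      have a2 : e (-(u + 1) / τ) = e (-1 / τ) * e (-u / τ) := by
        rw [← e_add]; congr 1; ring
      simp only [a1, a2]
      rw [hexp1, hexp, e_add_one, theta_p_mul hp' hp0' (e_ne_zero _), e_sub, e_one, neg_div, e_neg]
      have := e_ne_zero (u / τ)
      field_simp)
    (isCompact_parallelogram τ 1 (-1 / 2))
    (parallelogram_covers (by simpa using hτ.ne') _)
    (fun u hu => by
      by_cases h : theta (e τ) (e u) = 0
      · obtain rfl := hzero u hu h
        exact eventually_norm_le_of_deriv_ne_zero (hF 0) dD dD0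
          (by simp only [neg_zero, zero_div, e_zero, theta_one hp'])
      · exact eventually_norm_le_of_ne_zero (hF u).continuousAt ((hE u).mul (hθ u)).continuousAt
          (mul_ne_zero (Complex.exp_ne_zero _) h))
  have hd := dF.unique ((dD.const_mul c).congr_of_eventuallyEq (Filter.Eventually.of_forall hc))
  have hη := qPoch_e_sq_modular hτ
  have hE0 : exp (Real.pi * I * thetaExponent τ 0) * e (-1 / τ / 12) = e (τ / 12) * I := by
    have hI : e (1 / 4) = I := by
      rw [e]
      convert! Complex.exp_pi_div_two_mul_I using 2
      ring
    have : exp (Real.pi * I * thetaExponent τ 0) * e (-1 / τ / 12) = e (τ / 12) * e (1 / 4) := by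
      rw [e, e, e, ← Complex.exp_add, ← Complex.exp_add]
      congr 1
      rw [thetaExponent]; field_simp; ring
    rw [this, hI]
  have hc1 : c = 1 := by
    have h5 : qPoch (e (-1 / τ)) (e (-1 / τ)) ^ 2 =
        -(c * τ * exp (Real.pi * I * thetaExponent τ 0) * x₀) := by
      apply mul_left_cancel₀ (div_ne_zero hpi hτ0)
      rw [hd]
      field_simp
    rw [h5] at hη
    have h6 : τ * I * x₀ * e (τ / 12) * (c - 1) = 0 := by
      linear_combination -hη - c * τ * x₀ * hE0
    have := (mul_eq_zero.1 h6).resolve_left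
      (mul_ne_zero (mul_ne_zero (mul_ne_zero hτ0 I_ne_zero) hx₀0) (e_ne_zero _))
    exact sub_eq_zero.1 this
  rw [hc u, hc1, one_mul]

/-- The modular transformation of the theta function in homogeneous form. -/
lemma theta_modular {ω₂ ω₃ : ℂ} (h : 0 < (ω₃ / ω₂).im) (u : ℂ) :
    theta (e (-ω₂ / ω₃)) (e (-u / ω₃)) =
      exp (Real.pi * I * thetaExponent (ω₃ / ω₂) (u / ω₂)) * theta (e (ω₃ / ω₂)) (e (u / ω₂)) := by
  have h2 : ω₂ ≠ 0 := by rintro rfl; simp at h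
  have h3 : ω₃ ≠ 0 := by rintro rfl; simp at h
  rw [← theta_modular_aux h]
  congr 2
  · field_simp
  · field_simp

end theta

/-! ### Closed curves and contours -/

section contours

lemma ClosedCurve.continuous (γ : ClosedCurve) : Continuous γ.toFun := γ.contDiff.continuous

lemma ClosedCurve.continuous_deriv (γ : ClosedCurve) : Continuous (deriv γ.toFun) :=
  γ.contDiff.continuous_deriv le_rfl

lemma ClosedCurve.hasDerivAt (γ : ClosedCurve) (s : ℝ) :
    HasDerivAt γ.toFun (deriv γ.toFun s) s :=
  (γ.contDiff.differentiable one_ne_zero s).hasDerivAt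

/-- The set of points through which a contour passes. -/
def trace (C : Contour) : Set ℂ := {z | ∃ γ ∈ C, ∃ s : ℝ, γ.toFun s = z}

lemma ClosedCurve.isCompact_range (γ : ClosedCurve) : IsCompact (Set.range γ.toFun) := by
  have := γ.periodic.image_Icc one_pos 0
  rw [← this]
  exact isCompact_Icc.image γ.continuous

lemma trace_nil : trace [] = ∅ := by ext; simp [trace]

lemma trace_cons (γ : ClosedCurve) (C : Contour) : trace (γ :: C) = Set.range γ.toFun ∪ trace C := by
  ext z; simp [trace]

lemma trace_append (C C' : Contour) : trace (C ++ C') = trace C ∪ trace C' := by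
  ext z; simp [trace, or_and_right, exists_or]

lemma isCompact_trace (C : Contour) : IsCompact (trace C) := by
  induction C with
  | nil => rw [trace_nil]; exact isCompact_empty
  | cons γ C ih => rw [trace_cons]; exact γ.isCompact_range.union ih

lemma ClosedCurve.integrable (γ : ClosedCurve) {f : ℂ → ℂ}
    (hf : ContinuousOn f (Set.range γ.toFun)) :
    IntervalIntegrable (fun s => f (γ.toFun s) * deriv γ.toFun s) MeasureTheory.volume 0 1 :=
  ((hf.comp_continuous γ.continuous fun s => ⟨s, rfl⟩).mul γ.continuous_deriv).intervalIntegrable _ _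

lemma contourIntegral_nil (f : ℂ → ℂ) : contourIntegral [] f = 0 := rfl

lemma contourIntegral_cons (γ : ClosedCurve) (C : Contour) (f : ℂ → ℂ) :
    contourIntegral (γ :: C) f = γ.integral f + contourIntegral C f := rfl

lemma contourIntegral_append (C C' : Contour) (f : ℂ → ℂ) :
    contourIntegral (C ++ C') f = contourIntegral C f + contourIntegral C' f := by
  simp [contourIntegral]

lemma contourIntegral_add {C : Contour} {f g : ℂ → ℂ} (hf : ContinuousOn f (trace C))
    (hg : ContinuousOn g (trace C)) :
    contourIntegral C (fun z => f z + g z) = contourIntegral C f + contourIntegral C g := by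
  induction C with
  | nil => simp [contourIntegral_nil]
  | cons γ C ih =>
    rw [trace_cons] at hf hg
    rw [contourIntegral_cons, contourIntegral_cons, contourIntegral_cons,
      ih (hf.mono Set.subset_union_right) (hg.mono Set.subset_union_right)]
    have : γ.integral (fun z => f z + g z) = γ.integral f + γ.integral g := by
      rw [ClosedCurve.integral, ClosedCurve.integral, ClosedCurve.integral,
        ← intervalIntegral.integral_add (γ.integrable (hf.mono Set.subset_union_left))
          (γ.integrable (hg.mono Set.subset_union_left))]
      simp only [add_mul]
    rw [this]; ring

lemma contourIntegral_const_mul (C : Contour) (c : ℂ) (f : ℂ → ℂ) :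
    contourIntegral C (fun z => c * f z) = c * contourIntegral C f := by
  induction C with
  | nil => simp [contourIntegral_nil]
  | cons γ C ih =>
    rw [contourIntegral_cons, contourIntegral_cons, ih, mul_add, ClosedCurve.integral,
      ClosedCurve.integral, ← intervalIntegral.integral_const_mul]
    simp only [mul_assoc]

lemma contourIntegral_sub {C : Contour} {f g : ℂ → ℂ} (hf : ContinuousOn f (trace C))
    (hg : ContinuousOn g (trace C)) :
    contourIntegral C (fun z => f z - g z) = contourIntegral C f - contourIntegral C g := by
  have := contourIntegral_add hf (g := fun z => -1 * g z) (by fun_prop)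
  rw [contourIntegral_const_mul] at this
  simpa [sub_eq_add_neg] using this

/-- The integral does not depend on the values of the integrand on a countable set. -/
lemma contourIntegral_congr_countable {C : Contour} {f g : ℂ → ℂ} {B : Set ℂ} (hB : B.Countable)
    (h : ∀ z ∈ trace C, z ∉ B → f z = g z) : contourIntegral C f = contourIntegral C g := by
  induction C with
  | nil => rfl
  | cons γ C ih =>
    rw [trace_cons] at h
    rw [contourIntegral_cons, contourIntegral_cons, ih fun z hz => h z (Or.inr hz)]
    congr 1
    have hc : {s : ℝ | γ.toFun s ∈ B ∧ deriv γ.toFun s ≠ 0}.Countable := by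
      have : {s : ℝ | γ.toFun s ∈ B ∧ deriv γ.toFun s ≠ 0} =
          ⋃ w ∈ B, {s : ℝ | γ.toFun s = w ∧ deriv γ.toFun s ≠ 0} := by
        ext s; simp
      rw [this]
      refine hB.biUnion fun w _ => ?_
      refine (countable_setOfPred_isolated_right_within (s := {s : ℝ | γ.toFun s = w})).mono ?_
      rintro s ⟨hs, hd⟩
      refine ⟨hs, ?_⟩
      have h1 := (γ.hasDerivAt s).eventually_ne (c := w) hd
      rw [eventually_nhdsWithin_iff] at h1
      rw [← Filter.empty_mem_iff_bot, mem_nhdsWithin_iff_exists_mem_nhds_inter]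
      exact ⟨_, h1, fun t ht => ht.1 (ne_of_gt ht.2.2) ht.2.1⟩
    refine intervalIntegral.integral_congr_ae ?_
    filter_upwards [hc.ae_notMem MeasureTheory.volume] with s hs _
    by_cases hsB : γ.toFun s ∈ B
    · have : deriv γ.toFun s = 0 := by
        by_contra hne; exact hs ⟨hsB, hne⟩
      rw [this, mul_zero, mul_zero]
    · rw [h _ (Or.inl ⟨s, rfl⟩) hsB]

lemma contourIntegral_congr {C : Contour} {f g : ℂ → ℂ} (h : ∀ z ∈ trace C, f z = g z) :
    contourIntegral C f = contourIntegral C g :=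
  contourIntegral_congr_countable Set.countable_empty fun z hz _ => h z hz

lemma contourIntegral_eq_zero_of_hasDerivAt {C : Contour} {f G : ℂ → ℂ}
    (hf : ContinuousOn f (trace C)) (h : ∀ z ∈ trace C, HasDerivAt G (f z) z) :
    contourIntegral C f = 0 := by
  induction C with
  | nil => rfl
  | cons γ C ih =>
    rw [trace_cons] at hf h
    rw [contourIntegral_cons, ih (hf.mono Set.subset_union_right) fun z hz => h z (Or.inr hz),
      add_zero, ClosedCurve.integral]
    have := intervalIntegral.integral_eq_sub_of_hasDerivAt (a := 0) (b := 1)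
      (f := fun s => G (γ.toFun s)) (f' := fun s => f (γ.toFun s) * deriv γ.toFun s)
      (fun s _ => by
        simpa [mul_comm] using! (h _ (Or.inl ⟨s, rfl⟩)).scomp s (γ.hasDerivAt s))
      (γ.integrable (hf.mono Set.subset_union_left))
    rw [this]
    have hper := γ.periodic 0
    rw [zero_add] at hper
    rw [hper, sub_self]

/-- A closed curve run through backwards. -/
def ClosedCurve.reverse (γ : ClosedCurve) : ClosedCurve where
  toFun s := γ.toFun (-s)
  contDiff := γ.contDiff.comp contDiff_neg
  periodic s := by
    have := γ.periodic (-(s + 1))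
    change γ.toFun (-(s + 1)) = γ.toFun (-s)
    rw [← this]; congr 1; ring

lemma ClosedCurve.range_reverse (γ : ClosedCurve) :
    Set.range γ.reverse.toFun = Set.range γ.toFun := by
  ext z
  constructor
  · rintro ⟨s, rfl⟩; exact ⟨-s, rfl⟩
  · rintro ⟨s, rfl⟩; exact ⟨-s, by simp [ClosedCurve.reverse]⟩

lemma ClosedCurve.integral_reverse (γ : ClosedCurve) (f : ℂ → ℂ) :
    γ.reverse.integral f = -γ.integral f := by
  have hd : ∀ s, deriv γ.reverse.toFun s = -deriv γ.toFun (-s) := fun s => by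
    have := (γ.hasDerivAt (-s)).scomp s (hasDerivAt_neg s)
    simpa using! this.deriv
  rw [ClosedCurve.integral, ClosedCurve.integral]
  simp only [hd]
  have h1 := intervalIntegral.integral_comp_neg (a := 0) (b := 1)
    (fun s => f (γ.toFun s) * -deriv γ.toFun s)
  have h2 : (∫ s in (0:ℝ)..1, f (γ.reverse.toFun s) * -deriv γ.toFun (-s)) =
    ∫ s in (0:ℝ)..1, f (γ.toFun (-s)) * -deriv γ.toFun (-s) := rfl
  rw [h2, h1, neg_zero]
  simp only [mul_neg, intervalIntegral.integral_neg]
  congr 1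
  have hper : Function.Periodic (fun s => f (γ.toFun s) * deriv γ.toFun s) 1 := by
    intro s
    have : deriv γ.toFun (s + 1) = deriv γ.toFun s := by
      rw [← deriv_comp_add_const]; congr 1; ext s; exact γ.periodic s
    simp only [this, γ.periodic s]
  have := hper.intervalIntegral_add_eq (-1) 0
  simpa using this

/-- The contour with all curves run through backwards. -/
def reverseContour (C : Contour) : Contour := C.map ClosedCurve.reverse

lemma trace_reverse (C : Contour) : trace (reverseContour C) = trace C := by
  induction C with
  | nil => rfl
  | cons γ C ih =>
    rw [trace_cons, ← ih, ← γ.range_reverse]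
    exact trace_cons _ _

lemma contourIntegral_reverse (C : Contour) (f : ℂ → ℂ) :
    contourIntegral (reverseContour C) f = -contourIntegral C f := by
  induction C with
  | nil => simp [reverseContour, contourIntegral_nil]
  | cons γ C ih =>
    have : reverseContour (γ :: C) = γ.reverse :: reverseContour C := rfl
    rw [this, contourIntegral_cons, contourIntegral_cons, ih, γ.integral_reverse]; ring

lemma contourIndex_append (C C' : Contour) (w : ℂ) :
    contourIndex (C ++ C') w = contourIndex C w + contourIndex C' w := by
  rw [contourIndex, contourIntegral_append, mul_add, contourIndex, contourIndex]

lemma contourIndex_reverse (C : Contour) (w : ℂ) :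
    contourIndex (reverseContour C) w = -contourIndex C w := by
  rw [contourIndex, contourIntegral_reverse, mul_neg, contourIndex]

lemma contourIntegral_inv_eq (C : Contour) (w : ℂ) :
    contourIntegral C (fun z => (z - w)⁻¹) = 2 * Real.pi * I * contourIndex C w := by
  rw [contourIndex, mul_inv_cancel_left₀ Complex.two_pi_I_ne_zero]

/-- The index is constant on balls that the contour does not meet. -/
lemma contourIndex_eq_of_ball {C : Contour} {w₀ : ℂ} {r : ℝ}
    (h : Disjoint (trace C) (Metric.ball w₀ r)) {w : ℂ} (hw : w ∈ Metric.ball w₀ r) :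
    contourIndex C w = contourIndex C w₀ := by
  have hr : 0 < r := dist_nonneg.trans_lt hw
  have hne : ∀ {v}, v ∈ Metric.ball w₀ r → ∀ z ∈ trace C, z - v ≠ 0 := by
    intro v hv z hz h0
    rw [sub_eq_zero] at h0
    exact Set.disjoint_left.1 h hz (h0 ▸ hv)
  have hne0 := hne (Metric.mem_ball_self hr)
  have hc : ∀ {v}, v ∈ Metric.ball w₀ r → ContinuousOn (fun z => (z - v)⁻¹) (trace C) :=
    fun {v} hv => ContinuousOn.inv₀ (by fun_prop) (hne hv)
  rw [contourIndex, contourIndex, ← sub_eq_zero, ← mul_sub,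
    ← contourIntegral_sub (hc hw) (hc (Metric.mem_ball_self hr)),
    contourIntegral_eq_zero_of_hasDerivAt (G := fun z => log ((z - w) / (z - w₀))), mul_zero]
  · exact (hc hw).sub (hc (Metric.mem_ball_self hr))
  · intro z hz
    have h1 := hne hw z hz
    have h2 := hne0 z hz
    have hlt : ‖(w - w₀) / (z - w₀)‖ < 1 := by
      rw [norm_div, div_lt_one (norm_pos_iff.2 h2)]
      have a : ‖w - w₀‖ < r := by simpa [dist_eq_norm] using hw
      have b : r ≤ ‖z - w₀‖ := by
        by_contra! hlt
        exact Set.disjoint_left.1 h hz (by simpa [dist_eq_norm] using hlt)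
      linarith
    have hslit : (z - w) / (z - w₀) ∈ slitPlane := by
      left
      have e1 : (z - w) / (z - w₀) = 1 - (w - w₀) / (z - w₀) := by field_simp; ring
      rw [e1, sub_re, one_re]
      have := (abs_re_le_norm ((w - w₀) / (z - w₀))).trans_lt hlt
      linarith [(abs_lt.1 this).2]
    have hd : HasDerivAt (fun z => (z - w) / (z - w₀))
        ((1 * (z - w₀) - (z - w) * 1) / (z - w₀) ^ 2) z :=
      ((hasDerivAt_id z).sub_const w).div ((hasDerivAt_id z).sub_const w₀) h2
    convert! hd.clog hslit using 1
    field_simp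

/-- The index vanishes around points far away. -/
lemma contourIndex_eq_zero_of_norm {C : Contour} {R : ℝ} (h : ∀ z ∈ trace C, ‖z‖ < R) {w : ℂ}
    (hw : R ≤ ‖w‖) : contourIndex C w = 0 := by
  rw [contourIndex, contourIntegral_eq_zero_of_hasDerivAt (G := fun z => log (1 - z / w)), mul_zero]
  · refine ContinuousOn.inv₀ (by fun_prop) fun z hz h0 => ?_
    rw [sub_eq_zero] at h0
    have := h z hz
    rw [h0] at this; linarith
  · intro z hz
    have hz' := h z hz
    have hw0 : w ≠ 0 := by
      rintro rfl
      rw [norm_zero] at hw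
      linarith [norm_nonneg z]
    have hlt : ‖z / w‖ < 1 := by
      rw [norm_div, div_lt_one (norm_pos_iff.2 hw0)]; linarith
    have hslit : 1 - z / w ∈ slitPlane := by
      left
      rw [sub_re, one_re]
      have := (abs_re_le_norm (z / w)).trans_lt hlt
      linarith [(abs_lt.1 this).2]
    have hd : HasDerivAt (fun z => 1 - z / w) (-(1 / w)) z :=
      ((hasDerivAt_id z).div_const w).const_sub 1
    convert! hd.clog hslit using 1
    have h1 : z - w ≠ 0 := by
      intro h0
      rw [sub_eq_zero] at h0
      rw [h0] at hz'; linarith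
    have h2 : w - z ≠ 0 := by rw [← neg_sub]; exact neg_ne_zero.2 h1
    field_simp
    ring

/-! ### Cauchy's theorem in the punctured plane -/

/-- The open annulus `r < |z| < R`. -/
def annulus (r R : ℝ) : Set ℂ := {z | r < ‖z‖ ∧ ‖z‖ < R}

lemma isOpen_annulus (r R : ℝ) : IsOpen (annulus r R) :=
  (isOpen_lt continuous_const continuous_norm).inter (isOpen_lt continuous_norm continuous_const)

lemma exists_primitive_annulus {r R : ℝ} (hr : 0 < r) {g : ℂ → ℂ}
    (hg : DifferentiableOn ℂ g (annulus r R)) :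
    ∃ (c : ℂ) (G : ℂ → ℂ), ∀ z ∈ annulus r R, HasDerivAt G (g z - c / z) z := by
  set S : Set ℂ := {s | Real.log r < s.re ∧ s.re < Real.log R} with hS
  have hSo : IsOpen S :=
    (isOpen_lt continuous_const continuous_re).inter (isOpen_lt continuous_re continuous_const)
  have hSc : Convex ℝ S :=
    (convex_halfSpace_re_gt _).inter (convex_halfSpace_re_lt _)
  by_cases hR : 0 < R
  swap
  · exact ⟨0, 0, fun z hz => absurd (hr.trans (hz.1.trans hz.2)) hR⟩
  have hexp : ∀ s, s ∈ S ↔ exp s ∈ annulus r R := by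
    intro s
    simp only [hS, annulus, Set.mem_ofPred_eq, Complex.norm_exp]
    rw [Real.log_lt_iff_lt_exp hr, Real.lt_log_iff_exp_lt hR]
  have hper : ∀ s ∈ S, ∀ n : ℤ, s + n * (2 * Real.pi * I) ∈ S := by
    intro s hs n
    rw [hexp] at hs ⊢
    rwa [Complex.exp_add, Complex.exp_int_mul_two_pi_mul_I, mul_one]
  obtain ⟨H, hH⟩ := hSc.exists_forall_hasDerivWithinAt (𝕜 := ℂ) (f := fun s => g (exp s) * exp s)
    ((hg.comp differentiable_exp.differentiableOn fun s hs => (hexp s).1 hs).mul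
      differentiable_exp.differentiableOn)
  have hH' : ∀ s ∈ S, HasDerivAt H (g (exp s) * exp s) s := fun s hs =>
    (hH s hs).hasDerivAt (hSo.mem_nhds hs)
  have hshift : ∀ n : ℤ, ∀ s ∈ S, HasDerivAt (fun s => H (s + n * (2 * Real.pi * I)) - H s) 0 s := by
    intro n s hs
    have h1 := (hH' _ (hper s hs n)).comp_add_const s (n * (2 * Real.pi * I))
    have h2 := h1.sub (hH' s hs)
    convert! h2 using 1
    rw [Complex.exp_add, Complex.exp_int_mul_two_pi_mul_I, mul_one, sub_self]
  have hconst : ∃ k : ℂ, ∀ s ∈ S, H (s + 2 * Real.pi * I) = H s + k := by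
    rcases S.eq_empty_or_nonempty with h | ⟨s₀, hs₀⟩
    · exact ⟨0, fun s hs => by simp [h] at hs⟩
    · refine ⟨H (s₀ + 2 * Real.pi * I) - H s₀, fun s hs => ?_⟩
      have h1 := hSo.is_const_of_deriv_eq_zero hSc.isPreconnected (𝕜 := ℂ)
        (f := fun s => H (s + 2 * Real.pi * I) - H s)
        (fun s hs => by
          have := (hshift 1 s hs).differentiableAt.differentiableWithinAt (s := S)
          simpa using this)
        (fun s hs => by simpa using (hshift 1 s hs).deriv) hs hs₀
      rw [← h1]; ring
  obtain ⟨k, hk⟩ := hconst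
  have hpi := Complex.two_pi_I_ne_zero
  set c := k / (2 * Real.pi * I) with hc
  set Φ : ℂ → ℂ := fun s => H s - c * s with hΦ
  have hΦ1 : ∀ s ∈ S, Φ (s + 2 * Real.pi * I) = Φ s := by
    intro s hs
    simp only [hΦ, hk s hs, hc]
    field_simp
    ring
  have hΦn : ∀ n : ℤ, ∀ s ∈ S, Φ (s + n * (2 * Real.pi * I)) = Φ s := by
    intro n s hs
    induction n using Int.induction_on with
    | zero => simp
    | succ n ih =>
      have := hΦ1 _ (hper s hs n)
      rw [← ih, ← this]; push_cast; ring_nf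
    | pred n ih =>
      have := hΦ1 _ (hper s hs (-n - 1))
      rw [← ih, ← this]; push_cast; ring_nf
  have hΦd : ∀ s ∈ S, HasDerivAt Φ (g (exp s) * exp s - c) s := by
    intro s hs
    have := (hH' s hs).sub ((hasDerivAt_id s).const_mul c)
    simpa using! this
  refine ⟨c, fun z => Φ (log z), fun z hz => ?_⟩
  have hz0 : z ≠ 0 := by
    rintro rfl; simp only [annulus, Set.mem_ofPred_eq, norm_zero] at hz; linarith [hz.1]
  have hlogS : ∀ w ∈ annulus r R, log w ∈ S := by
    intro w hw
    have hw0 : w ≠ 0 := by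
      rintro rfl; simp only [annulus, Set.mem_ofPred_eq, norm_zero] at hw; linarith [hw.1]
    rw [hexp, exp_log hw0]; exact hw
  by_cases hslit : z ∈ slitPlane
  · have h1 := (hΦd _ (hlogS z hz)).comp z (hasDerivAt_log hslit)
    convert! h1 using 1
    rw [exp_log hz0]; field_simp
  · have hslit' : -z ∈ slitPlane := by
      rw [mem_slitPlane_iff, not_or] at hslit
      push Not at hslit
      left
      rw [neg_re]
      rcases lt_or_eq_of_le hslit.1 with h | h
      · linarith
      · exact absurd (Complex.ext h hslit.2) hz0
    have hmem : log (-z) + Real.pi * I ∈ S := by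
      rw [hexp, Complex.exp_add, exp_log (neg_ne_zero.2 hz0), Complex.exp_pi_mul_I]
      simpa using hz
    have hd : HasDerivAt (fun w => log (-w) + Real.pi * I) z⁻¹ z := by
      have := ((hasDerivAt_log hslit').comp z (hasDerivAt_neg z)).add_const (Real.pi * I)
      convert! this using 1
      field_simp
    have h1 := (hΦd _ hmem).comp z hd
    have heq : (fun w => Φ (log w)) =ᶠ[𝓝 z] fun w => Φ (log (-w) + Real.pi * I) := by
      filter_upwards [(isOpen_annulus r R).mem_nhds hz, isOpen_ne.mem_nhds hz0] with w hw hw0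
      have he : exp (log w) = exp (log (-w) + Real.pi * I) := by
        rw [exp_log hw0, Complex.exp_add, exp_log (neg_ne_zero.2 hw0), Complex.exp_pi_mul_I]; ring
      obtain ⟨n, hn⟩ := Complex.exp_eq_exp_iff_exists_int.1 he
      have hm : log (-w) + Real.pi * I ∈ S := by
        rw [hexp, ← he, exp_log hw0]; exact hw
      rw [hn, hΦn n _ hm]
    convert! h1.congr_of_eventuallyEq heq using 1
    rw [Complex.exp_add, exp_log (neg_ne_zero.2 hz0), Complex.exp_pi_mul_I]
    field_simp

lemma contourIntegral_eq_zero_of_annulus {r R : ℝ} (hr : 0 < r) {C : Contour}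
    (hC : trace C ⊆ annulus r R) (h0 : contourIndex C 0 = 0) {g : ℂ → ℂ}
    (hg : DifferentiableOn ℂ g (annulus r R)) : contourIntegral C g = 0 := by
  obtain ⟨c, G, hG⟩ := exists_primitive_annulus hr hg
  have hcont : ContinuousOn g (trace C) := hg.continuousOn.mono hC
  have hinv : ContinuousOn (fun z => c * (z - 0)⁻¹) (trace C) := by
    refine continuousOn_const.mul (ContinuousOn.inv₀ (by fun_prop) fun z hz h => ?_)
    have := (hC hz).1
    rw [sub_zero] at h
    rw [h, norm_zero] at this; linarith
  have h1 := contourIntegral_eq_zero_of_hasDerivAt (C := C) (f := fun z => g z - c * (z - 0)⁻¹)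
    (hcont.sub hinv) fun z hz => by
      simpa [div_eq_mul_inv] using hG z (hC hz)
  rw [contourIntegral_sub hcont hinv, contourIntegral_const_mul, contourIntegral_inv_eq, h0] at h1
  simpa using h1

lemma contourIntegral_zpow_eq_zero {C : Contour} {w : ℂ} (hw : w ∉ trace C) (n : ℕ) :
    contourIntegral C (fun z => ((z - w) ^ (n + 2))⁻¹) = 0 := by
  have hne : ∀ z ∈ trace C, z - w ≠ 0 := fun z hz h => hw (sub_eq_zero.1 h ▸ hz)
  refine contourIntegral_eq_zero_of_hasDerivAt
    (G := fun z => -((n : ℂ) + 1)⁻¹ * ((z - w) ^ (n + 1))⁻¹) ?_ fun z hz => ?_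
  · exact ContinuousOn.inv₀ (by fun_prop) fun z hz => pow_ne_zero _ (hne z hz)
  · have h1 := ((((hasDerivAt_id z).sub_const w).fun_pow (n + 1)).fun_inv
      (pow_ne_zero _ (hne z hz))).const_mul (-((n : ℂ) + 1)⁻¹)
    have hn : (n : ℂ) + 1 ≠ 0 := by exact_mod_cast n.succ_ne_zero
    have := hne z hz
    convert! h1 using 1
    simp only [id_eq, Nat.add_sub_cancel]
    push_cast
    field_simp
    ring

/-- Cauchy's theorem on an annulus for functions with finitely many poles around which the contour
does not wind. -/
lemma contourIntegral_eq_zero_of_finite_poles {r R : ℝ} (hr : 0 < r) {C : Contour}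
    (hC : trace C ⊆ annulus r R) (h0 : contourIndex C 0 = 0) (Z : Finset ℂ) :
    ∀ f : ℂ → ℂ, (∀ z ∈ annulus r R, z ∉ Z → DifferentiableAt ℂ f z) →
      (∀ w ∈ Z, MeromorphicAt f w ∧ w ∉ trace C ∧ contourIndex C w = 0) →
      contourIntegral C f = 0 := by
  classical
  induction Z using Finset.induction_on with
  | empty =>
    intro f hf _
    exact contourIntegral_eq_zero_of_annulus hr hC h0
      fun z hz => (hf z hz (by simp)).differentiableWithinAt
  | insert w Z hwZ ih =>
    intro f hf hZ
    obtain ⟨hmer, hwC, hw0⟩ := hZ w (by simp)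
    have key : ∀ (n : ℕ) (f : ℂ → ℂ), (∃ g, AnalyticAt ℂ g w ∧
        ∀ᶠ z in 𝓝[≠] w, (z - w) ^ n * f z = g z) →
        (∀ z ∈ annulus r R, z ∉ insert w Z → DifferentiableAt ℂ f z) →
        (∀ v ∈ Z, MeromorphicAt f v) → contourIntegral C f = 0 := by
      intro n
      induction n with
      | zero =>
        rintro f ⟨g, hg, hfg⟩ hf hm
        set f₁ := Function.update f w (g w) with hf₁
        have e1 : f₁ =ᶠ[𝓝 w] g := by
          rw [eventually_nhdsWithin_iff] at hfg
          filter_upwards [hfg] with z hz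
          by_cases h : z = w
          · subst h; simp [hf₁]
          · rw [hf₁, Function.update_of_ne h]
            simpa using hz h
        have e2 : ∀ v ≠ w, f₁ =ᶠ[𝓝 v] f := fun v hv => by
          filter_upwards [isOpen_ne.mem_nhds hv] with z hz
          rw [hf₁, Function.update_of_ne hz]
        have := ih f₁ (fun z hz hzZ => by
            by_cases h : z = w
            · subst h; exact hg.differentiableAt.congr_of_eventuallyEq e1
            · exact (hf z hz (by simp [h, hzZ])).congr_of_eventuallyEq (e2 z h))
          (fun v hv => by
            have hvw : v ≠ w := fun h => hwZ (h ▸ hv)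
            obtain ⟨-, h2, h3⟩ := hZ v (by simp [hv])
            exact ⟨(hm v hv).congr ((e2 v hvw).symm.filter_mono nhdsWithin_le_nhds), h2, h3⟩)
        rw [← this]
        refine contourIntegral_congr fun z hz => ?_
        rw [hf₁, Function.update_of_ne]
        rintro rfl; exact hwC hz
      | succ n ihn =>
        rintro f ⟨g, hg, hfg⟩ hf hm
        have hpw : ∀ z ≠ w, DifferentiableAt ℂ (fun z => g w * ((z - w) ^ (n + 1))⁻¹) z := by
          intro z hz
          have : (z - w) ^ (n + 1) ≠ 0 := pow_ne_zero _ (sub_ne_zero.2 hz)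
          fun_prop (disch := assumption)
        have hv0 : ∀ v ∈ Z, v ≠ w := fun v hv h => hwZ (h ▸ hv)
        have h1 := ihn (fun z => f z - g w * ((z - w) ^ (n + 1))⁻¹)
          ⟨dslope g w, by
            obtain ⟨q, hq⟩ := hg
            exact ⟨_, hq.has_fpower_series_dslope_fslope⟩, by
            filter_upwards [hfg, self_mem_nhdsWithin] with z hz hzw
            have hzw' : z - w ≠ 0 := sub_ne_zero.2 hzw
            rw [dslope_of_ne _ hzw, slope_def_field, ← hz]
            field_simp
            ring⟩
          (fun z hz hzZ => (hf z hz hzZ).sub (hpw z fun h => hzZ (by simp [h])))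
          (fun v hv => (hm v hv).sub (by
            have h1 : MeromorphicAt (fun z => g w) v := .const _ _
            have h2 : MeromorphicAt (fun z => z - w) v := by fun_prop
            exact h1.mul ((h2.pow _).inv)))
        have hcf : ContinuousOn f (trace C) := by
          intro z hz
          by_cases hzZ : z ∈ insert w Z
          · exact absurd hz (hZ z hzZ).2.1
          · exact (hf z (hC hz) hzZ).continuousAt.continuousWithinAt
        have hcp : ContinuousOn (fun z => g w * ((z - w) ^ (n + 1))⁻¹) (trace C) := fun z hz =>
          (hpw z fun h => hwC (h ▸ hz)).continuousAt.continuousWithinAt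
        rw [contourIntegral_sub hcf hcp, contourIntegral_const_mul] at h1
        have h2 : contourIntegral C (fun z => ((z - w) ^ (n + 1))⁻¹) = 0 := by
          cases n with
          | zero => simp only [zero_add, pow_one]; rw [contourIntegral_inv_eq, hw0, mul_zero]
          | succ n => exact contourIntegral_zpow_eq_zero hwC n
        rw [h2, mul_zero, sub_zero] at h1
        exact h1
    obtain ⟨n, hn⟩ := hmer
    exact key n f ⟨_, hn, Eventually.of_forall fun z => rfl⟩ hf
      fun v hv => (hZ v (by simp [hv])).1

/-- Cauchy's theorem for quotients of holomorphic functions on the punctured plane. -/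
theorem contourIntegral_div_eq_zero {C : Contour} {N D : ℂ → ℂ}
    (hN : ∀ z ≠ 0, DifferentiableAt ℂ N z) (hD : ∀ z ≠ 0, DifferentiableAt ℂ D z)
    (hD0 : ∃ z ≠ 0, D z ≠ 0) (h0C : 0 ∉ trace C) (hDC : ∀ z ∈ trace C, D z ≠ 0)
    (h0 : contourIndex C 0 = 0) (hw : ∀ w ≠ 0, D w = 0 → contourIndex C w = 0) :
    contourIntegral C (fun z => N z / D z) = 0 := by
  have hA : ∀ {f : ℂ → ℂ}, (∀ z ≠ 0, DifferentiableAt ℂ f z) → AnalyticOnNhd ℂ f {0}ᶜ :=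
    fun hf => DifferentiableOn.analyticOnNhd
      (fun z hz => (hf z hz).differentiableWithinAt) isOpen_compl_singleton
  have hcomp := isCompact_trace C
  obtain ⟨r, hr, hrC⟩ := Metric.isOpen_iff.1 hcomp.isClosed.isOpen_compl 0 h0C
  obtain ⟨R, hR⟩ := (isBounded_iff_forall_norm_le.1 hcomp.isBounded)
  have htr : trace C ⊆ annulus (r / 2) (R + 1) := by
    intro z hz
    refine ⟨?_, (hR z hz).trans_lt (by linarith)⟩
    by_contra! h
    exact hrC (show z ∈ Metric.ball 0 r by simp; linarith) hz
  set K : Set ℂ := {z | r / 2 ≤ ‖z‖ ∧ ‖z‖ ≤ R + 1} with hK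
  have hKc : IsCompact K := by
    refine Metric.isCompact_of_isClosed_isBounded ?_ ?_
    · exact (isClosed_le continuous_const continuous_norm).inter
        (isClosed_le continuous_norm continuous_const)
    · exact isBounded_iff_forall_norm_le.2 ⟨R + 1, fun z hz => hz.2⟩
  have hK0 : ∀ z ∈ K, z ≠ 0 := by
    rintro z hz rfl
    have := hz.1
    rw [norm_zero] at this; linarith
  have hfin : {z ∈ K | D z = 0}.Finite := by
    by_contra hinf
    obtain ⟨x, hxK, hx⟩ := Set.Infinite.exists_accPt_of_subset_isCompact hinf hKc
      (fun z hz => hz.1)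
    have hfreq : ∃ᶠ z in 𝓝[≠] x, D z = 0 :=
      (accPt_iff_frequently_nhdsNE.1 hx).mono fun z hz => hz.2
    obtain ⟨z, hz, hDz⟩ := hD0
    refine hDz ((hA hD).eqOn_zero_of_preconnected_of_frequently_eq_zero ?_ (hK0 x hxK) hfreq hz)
    exact (isConnected_compl_singleton_of_one_lt_rank (by simp) 0).isPreconnected
  have hAK : annulus (r / 2) (R + 1) ⊆ K := fun z hz => ⟨hz.1.le, hz.2.le⟩
  refine contourIntegral_eq_zero_of_finite_poles (half_pos hr) htr h0 hfin.toFinset _ ?_ ?_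
  · intro z hz hzZ
    have hz0 := hK0 z (hAK hz)
    refine (hN z hz0).div (hD z hz0) fun h => hzZ ?_
    simpa using ⟨hAK hz, h⟩
  · intro w hwZ
    simp only [Set.Finite.mem_toFinset] at hwZ
    have hw0 := hK0 w hwZ.1
    exact ⟨(hA hN w hw0).meromorphicAt.div (hA hD w hw0).meromorphicAt,
      fun h => hDC w h hwZ.2, hw w hw0 hwZ.2⟩

/-- Two contours with the same winding numbers around `0` and around the poles give the same
integral. -/
theorem contourIntegral_div_eq {C C' : Contour} {N D : ℂ → ℂ}
    (hN : ∀ z ≠ 0, DifferentiableAt ℂ N z) (hD : ∀ z ≠ 0, DifferentiableAt ℂ D z)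
    (hD0 : ∃ z ≠ 0, D z ≠ 0) (h0C : 0 ∉ trace C) (h0C' : 0 ∉ trace C')
    (hDC : ∀ z ∈ trace C, D z ≠ 0) (hDC' : ∀ z ∈ trace C', D z ≠ 0)
    (h0 : contourIndex C 0 = contourIndex C' 0)
    (hw : ∀ w ≠ 0, D w = 0 → contourIndex C w = contourIndex C' w) :
    contourIntegral C (fun z => N z / D z) = contourIntegral C' (fun z => N z / D z) := by
  have := contourIntegral_div_eq_zero (C := C ++ reverseContour C') hN hD hD0
    (by rw [trace_append, trace_reverse]; exact fun h => h.elim h0C h0C')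
    (by rw [trace_append, trace_reverse]; exact fun z h => h.elim (hDC z) (hDC' z))
    (by rw [contourIndex_append, contourIndex_reverse, h0, add_neg_cancel])
    (fun w hw0 hDw => by
      rw [contourIndex_append, contourIndex_reverse, hw w hw0 hDw, add_neg_cancel])
  rw [contourIntegral_append, contourIntegral_reverse] at this
  linear_combination this

end contours

/-! ### Circles and the existence of contours -/

section circles

/-- The circle with centre `c` and radius `R`, run through once in the positive direction. -/
noncomputable def circleCurve (c : ℂ) (R : ℝ) : ClosedCurve where
  toFun s := circleMap c R (2 * Real.pi * s)
  contDiff := (contDiff_circleMap c R).comp (contDiff_const.mul contDiff_id)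
  periodic s := by
    change circleMap c R (2 * Real.pi * (s + 1)) = circleMap c R (2 * Real.pi * s)
    rw [mul_add, mul_one, periodic_circleMap]

lemma circleCurve_integral (c : ℂ) (R : ℝ) (f : ℂ → ℂ) :
    (circleCurve c R).integral f = ∮ z in C(c, R), f z := by
  have hd : ∀ s : ℝ, deriv (circleCurve c R).toFun s =
      2 * Real.pi * deriv (circleMap c R) (2 * Real.pi * s) := fun s => by
    have h1 : HasDerivAt (fun s : ℝ => 2 * Real.pi * s) (2 * Real.pi) s := by
      simpa using (hasDerivAt_id s).const_mul (2 * Real.pi)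
    have := (hasDerivAt_circleMap c R (2 * Real.pi * s)).scomp s h1
    have h2 : HasDerivAt (circleCurve c R).toFun _ s := this
    rw [h2.deriv, deriv_circleMap]
    simp
  rw [ClosedCurve.integral, circleIntegral]
  simp only [hd]
  have := intervalIntegral.smul_integral_comp_mul_left (a := 0) (b := 1)
    (fun θ => deriv (circleMap c R) θ • f (circleMap c R θ)) (2 * Real.pi)
  rw [mul_zero, mul_one] at this
  rw [← this, ← intervalIntegral.integral_smul]
  refine intervalIntegral.integral_congr fun s _ => ?_
  simp [circleCurve]
  ring

lemma trace_circleCurve (c : ℂ) {R : ℝ} (hR : 0 ≤ R) :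
    trace [circleCurve c R] = Metric.sphere c R := by
  rw [trace_cons, trace_nil, Set.union_empty]
  have h := range_circleMap c R
  rw [abs_of_nonneg hR] at h
  rw [← h]
  ext z
  constructor
  · rintro ⟨s, rfl⟩; exact ⟨_, rfl⟩
  · rintro ⟨s, rfl⟩
    refine ⟨(2 * Real.pi)⁻¹ * s, ?_⟩
    change circleMap c R (2 * Real.pi * ((2 * Real.pi)⁻¹ * s)) = _
    rw [mul_inv_cancel_left₀ (by positivity)]

lemma contourIntegral_circleCurve (c : ℂ) (R : ℝ) (f : ℂ → ℂ) :
    contourIntegral [circleCurve c R] f = ∮ z in C(c, R), f z := by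
  rw [contourIntegral_cons, contourIntegral_nil, add_zero, circleCurve_integral]

lemma contourIndex_circleCurve_inside {c w : ℂ} {R : ℝ} (h : ‖w - c‖ < R) :
    contourIndex [circleCurve c R] w = 1 := by
  rw [contourIndex, contourIntegral_circleCurve,
    circleIntegral.integral_sub_inv_of_mem_ball (by simpa [dist_eq_norm] using h),
    inv_mul_cancel₀ Complex.two_pi_I_ne_zero]

lemma contourIndex_circleCurve_outside {c w : ℂ} {R : ℝ} (hR : 0 ≤ R) (h : R < ‖w - c‖) :
    contourIndex [circleCurve c R] w = 0 := by
  have hd : ∀ z ∈ Metric.closedBall c R, DifferentiableAt ℂ (fun z => (z - w)⁻¹) z := by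
    intro z hz
    have : z - w ≠ 0 := by
      intro h0
      rw [sub_eq_zero.1 h0, mem_closedBall_iff_norm] at hz
      linarith
    fun_prop (disch := assumption)
  rw [contourIndex, contourIntegral_circleCurve,
    Complex.circleIntegral_eq_zero_of_differentiable_on_off_countable hR Set.countable_empty
      (fun z hz => (hd z hz).continuousAt.continuousWithinAt)
      (fun z hz => hd z (Metric.ball_subset_closedBall hz.1)), mul_zero]

/-- Small circles around finitely many isolated points of a set. -/
lemma exists_contour_of_isolated (S : Set ℂ) (F : Finset ℂ) :
    (∀ w ∈ F, ∃ r > 0, ∀ v ∈ S, v ≠ w → r < ‖v - w‖) →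
    ∃ C : Contour, Disjoint (trace C) S ∧
      ∀ v ∈ S, contourIndex C v = if v ∈ F then 1 else 0 := by
  classical
  induction F using Finset.induction_on with
  | empty =>
    intro _
    refine ⟨[], by simp [trace_nil], fun v _ => ?_⟩
    simp [contourIndex, contourIntegral_nil]
  | insert w F hw ih =>
    intro h
    obtain ⟨C, hC, hi⟩ := ih fun v hv => h v (by simp [hv])
    obtain ⟨r, hr, hrS⟩ := h w (by simp)
    refine ⟨circleCurve w r :: C, ?_, fun v hv => ?_⟩
    · have := trace_append [circleCurve w r] C
      rw [List.singleton_append, trace_circleCurve w hr.le] at this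
      rw [this, Set.disjoint_union_left]
      refine ⟨Set.disjoint_left.2 fun v hv hvS => ?_, hC⟩
      rw [mem_sphere_iff_norm] at hv
      by_cases hvw : v = w
      · rw [hvw, sub_self, norm_zero] at hv; exact hr.ne hv
      · exact (hrS v hvS hvw).ne' hv
    · have := contourIndex_append [circleCurve w r] C v
      rw [List.singleton_append] at this
      rw [this, hi v hv]
      by_cases hvw : v = w
      · subst hvw
        rw [contourIndex_circleCurve_inside (by simpa using hr)]
        simp [hw]
      · rw [contourIndex_circleCurve_outside hr.le (hrS v hv hvw)]
        simp [hvw]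

/-- A contour winding once around `0` and around the points of `P`, and not around those of `Q`. -/
structure Separates (P Q : Set ℂ) (C : Contour) : Prop where
  disjoint : Disjoint (trace C) ({0} ∪ P ∪ Q)
  index_zero : contourIndex C 0 = 1
  index_inner : ∀ w ∈ P, contourIndex C w = 1
  index_outer : ∀ w ∈ Q, contourIndex C w = 0

lemma Separates.mono {P Q P' Q' : Set ℂ} {C : Contour} (h : Separates P Q C) (hP : P' ⊆ P)
    (hQ : Q' ⊆ Q) : Separates P' Q' C where
  disjoint := h.disjoint.mono_right
    (Set.union_subset_union (Set.union_subset_union le_rfl hP) hQ)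
  index_zero := h.index_zero
  index_inner w hw := h.index_inner w (hP hw)
  index_outer w hw := h.index_outer w (hQ hw)

lemma exists_separates {P Q : Set ℂ} (hPQ : Disjoint P Q) (hQ0 : 0 ∉ Q)
    (hP : ∀ ε > 0, {w ∈ P | ε ≤ ‖w‖}.Finite) (hQ : ∀ R : ℝ, {w ∈ Q | ‖w‖ ≤ R}.Finite) :
    ∃ C : Contour, Separates P Q C := by
  classical
  set S := {0} ∪ P ∪ Q with hS
  obtain ⟨ρ, hρ, hρS⟩ : ∃ ρ : ℝ, 0 < ρ ∧ ∀ w ∈ S, ‖w‖ ≠ ρ := by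
    have hf : ((fun w : ℂ => ‖w‖) '' ({w ∈ P | 1 ≤ ‖w‖} ∪ {w ∈ Q | ‖w‖ ≤ 2})).Finite :=
      ((hP 1 one_pos).union (hQ 2)).image _
    obtain ⟨ρ, hρ, hρn⟩ := (Set.Icc_infinite (one_lt_two (α := ℝ))).exists_notMem_finite hf
    refine ⟨ρ, by linarith [hρ.1], ?_⟩
    rintro w ((hw | hw) | hw) rfl
    · have h1 := hρ.1
      rw [Set.mem_singleton_iff.1 hw, norm_zero] at h1
      linarith
    · exact hρn ⟨w, Or.inl ⟨hw, hρ.1⟩, rfl⟩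
    · exact hρn ⟨w, Or.inr ⟨hw, hρ.2⟩, rfl⟩
  have hiso : ∀ w : ℂ, w ≠ 0 → ∃ r > 0, ∀ v ∈ S, v ≠ w → r < ‖v - w‖ := by
    intro w hw
    have hw' : 0 < ‖w‖ := norm_pos_iff.2 hw
    have hfin : ({v ∈ P | ‖w‖ / 2 ≤ ‖v‖} ∪ {v ∈ Q | ‖v‖ ≤ 2 * ‖w‖}).Finite :=
      (hP _ (by positivity)).union (hQ _)
    have hn : (({v ∈ P | ‖w‖ / 2 ≤ ‖v‖} ∪ {v ∈ Q | ‖v‖ ≤ 2 * ‖w‖}) \ {w})ᶜ ∈ 𝓝 w :=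
      (hfin.subset Set.sdiff_subset).isClosed.isOpen_compl.mem_nhds (by simp)
    obtain ⟨r, hr, hrsub⟩ := Metric.mem_nhds_iff.1 hn
    refine ⟨min r (‖w‖ / 2) / 2, by positivity, fun v hv hvw => ?_⟩
    by_contra! hle
    have hm : 0 < min r (‖w‖ / 2) := by positivity
    have h1 : ‖v - w‖ < r := by linarith [min_le_left r (‖w‖ / 2)]
    have h2 : ‖v - w‖ < ‖w‖ / 2 := by linarith [min_le_right r (‖w‖ / 2)]
    have h3 : ‖w‖ ≤ ‖v‖ + ‖v - w‖ := by
      have := norm_sub_le v (v - w); rwa [sub_sub_cancel] at this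
    have h4 : ‖v‖ ≤ ‖v - w‖ + ‖w‖ := by
      have := norm_add_le (v - w) w; rwa [sub_add_cancel] at this
    refine hrsub (mem_ball_iff_norm.2 h1) ⟨?_, hvw⟩
    rcases hv with (hv | hv) | hv
    · rw [Set.mem_singleton_iff.1 hv, norm_zero] at h3 h4
      rw [Set.mem_singleton_iff.1 hv, zero_sub, norm_neg] at h2
      linarith
    · exact Or.inl ⟨hv, by linarith⟩
    · exact Or.inr ⟨hv, by linarith⟩
  set F₁ := (hP ρ hρ).toFinset with hF₁
  set F₂ := (hQ ρ).toFinset with hF₂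
  obtain ⟨C₁, hC₁, hi₁⟩ := exists_contour_of_isolated S F₁ fun w hw => hiso w <| by
    rintro rfl
    simp [hF₁] at hw; linarith [hw.2]
  obtain ⟨C₂, hC₂, hi₂⟩ := exists_contour_of_isolated S F₂ fun w hw => hiso w <| by
    rintro rfl
    simp [hF₂] at hw; exact hQ0 hw.1
  have hidx : ∀ v ∈ S, contourIndex ([circleCurve 0 ρ] ++ (C₁ ++ reverseContour C₂)) v =
      (if ‖v‖ < ρ then 1 else 0) + ((if v ∈ F₁ then 1 else 0) - if v ∈ F₂ then 1 else 0) := by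
    intro v hv
    rw [contourIndex_append, contourIndex_append, contourIndex_reverse, hi₁ v hv, hi₂ v hv,
      sub_eq_add_neg]
    congr 1
    split_ifs with h
    · exact contourIndex_circleCurve_inside (by simpa using h)
    · exact contourIndex_circleCurve_outside hρ.le
        (by simpa using lt_of_le_of_ne (not_lt.1 h) (hρS v hv).symm)
  refine ⟨[circleCurve 0 ρ] ++ (C₁ ++ reverseContour C₂), ?_, ?_, ?_, ?_⟩
  · rw [trace_append, trace_append, trace_reverse, trace_circleCurve 0 hρ.le,
      Set.disjoint_union_left, Set.disjoint_union_left]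
    refine ⟨Set.disjoint_left.2 fun v hv hvS => hρS v hvS (by simpa using hv), hC₁, hC₂⟩
  · rw [hidx 0 (by simp [hS])]
    simp [hρ, hF₁, hF₂, hρ.not_ge, hQ0]
  · intro w hw
    have hwQ : w ∉ Q := fun h => Set.disjoint_left.1 hPQ hw h
    rw [hidx w (by simp [hS, hw])]
    by_cases h : ‖w‖ < ρ
    · simp [h, hF₁, hF₂, hwQ, h.not_ge]
    · simp [h, hF₁, hF₂, hwQ, not_lt.1 h, hw]
  · intro w hw
    have hwP : w ∉ P := fun h => Set.disjoint_left.1 hPQ h hw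
    have hne := hρS w (by simp [hS, hw])
    rw [hidx w (by simp [hS, hw])]
    by_cases h : ‖w‖ < ρ
    · simp [h, hF₁, hF₂, hwP, h.le, hw]
    · have : ¬ ‖w‖ ≤ ρ := fun h' => h (lt_of_le_of_ne h' hne)
      simp [h, hF₁, hF₂, hwP, this]

end circles

/-! ### Integrals depending on a parameter -/

section parametric

lemma eventually_norm_le_of_continuousAt {X : Type*} [TopologicalSpace X] {F : X → ℝ → ℂ} {x₀ : X}
    (h : ∀ s ∈ Set.Icc (0 : ℝ) 1, ContinuousAt (Function.uncurry F) (x₀, s)) :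
    ∃ M, ∀ᶠ x in 𝓝 x₀, ∀ s ∈ Set.Icc (0 : ℝ) 1, ‖F x s‖ ≤ M := by
  have hc : ContinuousOn (F x₀) (Set.Icc (0 : ℝ) 1) := fun s hs =>
    ((h s hs).comp (f := fun s => (x₀, s)) (by fun_prop)).continuousWithinAt
  obtain ⟨M, hM⟩ := isCompact_Icc.exists_bound_of_continuousOn hc
  refine ⟨M + 1, isCompact_Icc.eventually_forall_of_forall_eventually fun s hs => ?_⟩
  have h1 := (h s hs).norm.eventually (gt_mem_nhds (show ‖F x₀ s‖ < M + 1 by linarith [hM s hs]))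
  filter_upwards [h1] with p hp using hp.le

lemma continuousAt_intervalIntegral {X : Type*} [TopologicalSpace X] [FirstCountableTopology X]
    {F : X → ℝ → ℂ} {x₀ : X}
    (h : ∀ s ∈ Set.Icc (0 : ℝ) 1, ∀ᶠ p in 𝓝 (x₀, s), ContinuousAt (Function.uncurry F) p) :
    ContinuousAt (fun x => ∫ s in (0 : ℝ)..1, F x s) x₀ := by
  obtain ⟨M, hM⟩ := eventually_norm_le_of_continuousAt fun s hs => (h s hs).self_of_nhds
  have h2 := isCompact_Icc.eventually_forall_of_forall_eventually
    (P := fun x s => ContinuousAt (Function.uncurry F) (x, s)) h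
  have hcont : ∀ᶠ x in 𝓝 x₀, ContinuousOn (F x) (Set.Icc (0 : ℝ) 1) := by
    filter_upwards [h2] with x hx s hs
    exact ((hx s hs).comp (f := fun s => (x, s)) (by fun_prop)).continuousWithinAt
  refine intervalIntegral.continuousAt_of_dominated_interval (bound := fun _ => M) ?_ ?_ ?_ ?_
  · filter_upwards [hcont] with x hx
    rw [Set.uIoc_of_le zero_le_one]
    exact (hx.mono Set.Ioc_subset_Icc_self).aestronglyMeasurable measurableSet_Ioc
  · filter_upwards [hM] with x hx
    refine .of_forall fun s hs => hx s ?_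
    rw [Set.uIoc_of_le zero_le_one] at hs
    exact Set.Ioc_subset_Icc_self hs
  · exact intervalIntegrable_const
  · refine .of_forall fun s hs => ?_
    rw [Set.uIoc_of_le zero_le_one] at hs
    exact ((h s (Set.Ioc_subset_Icc_self hs)).self_of_nhds).comp (f := fun x => (x, s))
      (by fun_prop)

lemma differentiableAt_intervalIntegral {F : ℂ → ℝ → ℂ} {u₀ : ℂ}
    (h : ∀ s ∈ Set.Icc (0 : ℝ) 1, ∀ᶠ p in 𝓝 (u₀, s), ContinuousAt (Function.uncurry F) p)
    (hd : ∀ s ∈ Set.Icc (0 : ℝ) 1, ∀ᶠ p in 𝓝 (u₀, s), DifferentiableAt ℂ (fun u => F u p.2) p.1) :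
    DifferentiableAt ℂ (fun u => ∫ s in (0 : ℝ)..1, F u s) u₀ := by
  obtain ⟨M, hM⟩ := eventually_norm_le_of_continuousAt fun s hs => (h s hs).self_of_nhds
  have h2 := isCompact_Icc.eventually_forall_of_forall_eventually
    (P := fun x s => ContinuousAt (Function.uncurry F) (x, s)) h
  have h3 := isCompact_Icc.eventually_forall_of_forall_eventually
    (P := fun x s => DifferentiableAt ℂ (fun u => F u s) x) hd
  obtain ⟨r, hr, hball⟩ := Metric.eventually_nhds_iff_ball.1 (hM.and (h2.and h3))
  have hmeas : ∀ u ∈ Metric.ball u₀ r, MeasureTheory.AEStronglyMeasurable (F u)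
      (MeasureTheory.volume.restrict (Set.uIoc 0 1)) := by
    intro u hu
    rw [Set.uIoc_of_le zero_le_one]
    refine ContinuousOn.aestronglyMeasurable (fun s hs => ?_) measurableSet_Ioc
    exact (((hball u hu).2.1 s (Set.Ioc_subset_Icc_self hs)).comp (f := fun s => (u, s))
      (by fun_prop)).continuousWithinAt
  have hmem : ∀ {s : ℝ}, s ∈ Set.uIoc (0 : ℝ) 1 → s ∈ Set.Icc (0 : ℝ) 1 := fun {s} hs => by
    rw [Set.uIoc_of_le zero_le_one] at hs; exact Set.Ioc_subset_Icc_self hs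
  have hu₀ : u₀ ∈ Metric.ball u₀ r := Metric.mem_ball_self hr
  refine (intervalIntegral.hasDerivAt_integral_of_dominated_loc_of_deriv_le
    (F := F) (F' := fun u s => deriv (fun u => F u s) u) (bound := fun _ => M / (r / 2))
    (s := Metric.ball u₀ (r / 2)) (Metric.ball_mem_nhds _ (by positivity)) ?_ ?_ ?_ ?_ ?_ ?_).2.differentiableAt
  · filter_upwards [Metric.ball_mem_nhds u₀ hr] with u hu using hmeas u hu
  · refine ContinuousOn.intervalIntegrable fun s hs => ?_
    rw [Set.uIcc_of_le zero_le_one] at hs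
    exact (((hball u₀ hu₀).2.1 s hs).comp (f := fun s => (u₀, s)) (by fun_prop)).continuousWithinAt
  · obtain ⟨v, hv0, hv⟩ : ∃ v : ℕ → ℂ, (∀ n, v n ≠ 0 ∧ u₀ + v n ∈ Metric.ball u₀ r) ∧
        Tendsto v atTop (𝓝 0) := by
      refine ⟨fun n => ((r / 2 * ((n : ℝ) + 1)⁻¹ : ℝ) : ℂ), fun n => ⟨?_, ?_⟩, ?_⟩
      · exact Complex.ofReal_ne_zero.2 (by positivity)
      · rw [Metric.mem_ball, dist_self_add_left, Complex.norm_real, Real.norm_of_nonneg (by positivity)]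
        have : ((n : ℝ) + 1)⁻¹ ≤ 1 := inv_le_one_of_one_le₀ (by linarith [Nat.cast_nonneg (α := ℝ) n])
        nlinarith
      · have := (tendsto_one_div_add_atTop_nhds_zero_nat (𝕜 := ℝ)).const_mul (r / 2)
        rw [mul_zero] at this
        have := (Complex.continuous_ofReal.tendsto 0).comp this
        simpa [Function.comp_def] using this
    refine aestronglyMeasurable_of_tendsto_ae atTop
      (f := fun n s => (v n)⁻¹ • (F (u₀ + v n) s - F u₀ s)) (fun n => ?_) ?_
    · exact ((hmeas _ (hv0 n).2).sub (hmeas _ hu₀)).const_smul (v n)⁻¹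
    · refine (MeasureTheory.ae_restrict_iff' measurableSet_uIoc).2 (.of_forall fun s hs => ?_)
      have hda := ((hball u₀ hu₀).2.2 s (hmem hs)).hasDerivAt
      have := hda.tendsto_slope_zero
      exact this.comp (tendsto_nhdsWithin_iff.2 ⟨hv, .of_forall fun n => (hv0 n).1⟩)
  · refine .of_forall fun s hs u hu => ?_
    refine Complex.norm_deriv_le_of_forall_mem_sphere_norm_le (by positivity) ?_ ?_
    · refine DifferentiableOn.diffContOnCl fun w hw => ?_
      rw [closure_ball _ (by positivity)] at hw
      refine ((hball w ?_).2.2 s (hmem hs)).differentiableWithinAt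
      rw [Metric.mem_ball] at hu ⊢
      rw [Metric.mem_closedBall] at hw
      linarith [dist_triangle w u u₀]
    · intro w hw
      refine (hball w ?_).1 s (hmem hs)
      rw [Metric.mem_ball] at hu ⊢
      rw [Metric.mem_sphere] at hw
      linarith [dist_triangle w u u₀]
  · exact intervalIntegrable_const
  · refine .of_forall fun s hs u hu => ?_
    refine ((hball u ?_).2.2 s (hmem hs)).hasDerivAt
    exact Metric.ball_subset_ball (by linarith) hu

end parametric

/-! ### Separating contours -/

/-- The points `x p^a q^b` with `x ∈ T`. -/
def innerPts (p q : ℂ) (T : Set ℂ) : Set ℂ := {w | ∃ x ∈ T, ∃ a b : ℕ, w = x * p ^ a * q ^ b}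

/-- The reciprocals of the points `x p^a q^b` with `x ∈ T`. -/
def outerPts (p q : ℂ) (T : Set ℂ) : Set ℂ := {w | ∃ x ∈ T, ∃ a b : ℕ, w = (x * p ^ a * q ^ b)⁻¹}

section separation

variable {p q : ℂ}

lemma isSeparating_iff {t : Fin 8 → ℂ} {C : Contour} :
    IsSeparating p q t C ↔
      Separates (innerPts p q (Set.range t)) (outerPts p q (Set.range t)) C := by
  constructor
  · intro h
    refine ⟨Set.disjoint_left.2 ?_, h.index_zero, ?_, ?_⟩
    · rintro _ ⟨γ, hγ, s, rfl⟩ ((h0 | ⟨_, ⟨j, rfl⟩, a, b, he⟩) | ⟨_, ⟨j, rfl⟩, a, b, he⟩)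
      · exact h.avoids_zero γ hγ s h0
      · exact h.avoids_inner γ hγ s j a b he
      · exact h.avoids_outer γ hγ s j a b he
    · rintro _ ⟨_, ⟨j, rfl⟩, a, b, rfl⟩; exact h.index_inner j a b
    · rintro _ ⟨_, ⟨j, rfl⟩, a, b, rfl⟩; exact h.index_outer j a b
  · intro h
    have hd := Set.disjoint_left.1 h.disjoint
    exact
      { avoids_zero := fun γ hγ s h0 => hd ⟨γ, hγ, s, rfl⟩ (Or.inl (Or.inl h0))
        avoids_inner := fun γ hγ s j a b he =>
          hd ⟨γ, hγ, s, rfl⟩ (Or.inl (Or.inr ⟨_, ⟨j, rfl⟩, a, b, he⟩))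
        avoids_outer := fun γ hγ s j a b he =>
          hd ⟨γ, hγ, s, rfl⟩ (Or.inr ⟨_, ⟨j, rfl⟩, a, b, he⟩)
        index_zero := h.index_zero
        index_inner := fun j a b => h.index_inner _ ⟨_, ⟨j, rfl⟩, a, b, rfl⟩
        index_outer := fun j a b => h.index_outer _ ⟨_, ⟨j, rfl⟩, a, b, rfl⟩ }

lemma finite_le_norm_pow (hp : ‖p‖ < 1) (hq : ‖q‖ < 1) {ε : ℝ} (hε : 0 < ε) :
    {n : ℕ × ℕ | ε ≤ ‖p ^ n.1 * q ^ n.2‖}.Finite := by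
  have h := (summable_norm_pow_mul_pow hp hq).tendsto_cofinite_zero
  have := h.eventually (gt_mem_nhds hε)
  rw [Filter.eventually_cofinite] at this
  simpa using this

lemma finite_innerPts_norm (hp : ‖p‖ < 1) (hq : ‖q‖ < 1) {T : Set ℂ} (hT : T.Finite) {ε : ℝ}
    (hε : 0 < ε) : {w ∈ innerPts p q T | ε ≤ ‖w‖}.Finite := by
  have : {w ∈ innerPts p q T | ε ≤ ‖w‖} ⊆ ⋃ x ∈ T,
      (fun n : ℕ × ℕ => x * p ^ n.1 * q ^ n.2) '' {n | ε / (‖x‖ + 1) ≤ ‖p ^ n.1 * q ^ n.2‖} := by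
    rintro _ ⟨⟨x, hx, a, b, rfl⟩, h⟩
    refine Set.mem_biUnion hx ⟨(a, b), ?_, rfl⟩
    rw [mul_assoc, norm_mul] at h
    rw [Set.mem_ofPred_eq, div_le_iff₀ (by positivity)]
    nlinarith [norm_nonneg (p ^ a * q ^ b)]
  exact (hT.biUnion fun x _ => (finite_le_norm_pow hp hq (by positivity)).image _).subset this

lemma outerPts_eq (p q : ℂ) (T : Set ℂ) : outerPts p q T = (fun w => w⁻¹) '' innerPts p q T := by
  ext w
  constructor
  · rintro ⟨x, hx, a, b, rfl⟩; exact ⟨_, ⟨x, hx, a, b, rfl⟩, rfl⟩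
  · rintro ⟨_, ⟨x, hx, a, b, rfl⟩, rfl⟩; exact ⟨x, hx, a, b, rfl⟩

lemma innerPts_ne_zero (hp0 : p ≠ 0) (hq0 : q ≠ 0) {T : Set ℂ} (hT : ∀ x ∈ T, x ≠ 0) {w : ℂ}
    (hw : w ∈ innerPts p q T) : w ≠ 0 := by
  obtain ⟨x, hx, a, b, rfl⟩ := hw
  exact mul_ne_zero (mul_ne_zero (hT x hx) (pow_ne_zero _ hp0)) (pow_ne_zero _ hq0)

/-- A contour with the required winding numbers exists for every finite set of parameters. -/
lemma exists_separates_pts (hp : ‖p‖ < 1) (hq : ‖q‖ < 1) (hp0 : p ≠ 0) (hq0 : q ≠ 0) {T : Set ℂ}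
    (hT : T.Finite) (hT0 : ∀ x ∈ T, x ≠ 0)
    (h : ∀ x ∈ T, ∀ y ∈ T, ∀ a b : ℕ, x * y * p ^ a * q ^ b ≠ 1) :
    ∃ C, Separates (innerPts p q T) (outerPts p q T) C := by
  refine exists_separates ?_ ?_ (fun ε hε => finite_innerPts_norm hp hq hT hε) fun R => ?_
  · refine Set.disjoint_left.2 ?_
    rintro _ hw ⟨y, hy, c, d, he⟩
    have hne := innerPts_ne_zero hp0 hq0 hT0 ⟨y, hy, c, d, rfl⟩
    obtain ⟨x, hx, a, b, rfl⟩ := hw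
    refine h x hx y hy (a + c) (b + d) ?_
    have h1 : x * p ^ a * q ^ b * (y * p ^ c * q ^ d) = 1 := by rw [he, inv_mul_cancel₀ hne]
    rw [← h1]; ring
  · rw [outerPts_eq]
    rintro ⟨w, hw, h0⟩
    exact innerPts_ne_zero hp0 hq0 hT0 hw (inv_eq_zero.1 h0)
  · rw [outerPts_eq]
    refine ((finite_innerPts_norm hp hq hT (ε := (|R| + 1)⁻¹) (by positivity)).image
      fun w => w⁻¹).subset ?_
    rintro _ ⟨⟨w, hw, rfl⟩, hR⟩
    refine ⟨w, ⟨hw, ?_⟩, rfl⟩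
    have hw0 := norm_pos_iff.2 (innerPts_ne_zero hp0 hq0 hT0 hw)
    rw [norm_inv] at hR
    rw [inv_le_comm₀ (by positivity) hw0]
    linarith [le_abs_self R]

lemma countable_innerPts {T : Set ℂ} (hT : T.Countable) : (innerPts p q T).Countable := by
  have : innerPts p q T = ⋃ x ∈ T, Set.range fun n : ℕ × ℕ => x * p ^ n.1 * q ^ n.2 := by
    ext w; simp [innerPts, eq_comm]
  rw [this]
  exact hT.biUnion fun x _ => Set.countable_range _

lemma countable_outerPts {T : Set ℂ} (hT : T.Countable) : (outerPts p q T).Countable := by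
  rw [outerPts_eq]; exact (countable_innerPts hT).image _

/-- Two contours with the same separation property give the same integral. -/
lemma contourIntegral_div_eq_of_separates {P Q : Set ℂ} (hP : P.Countable) (hQ : Q.Countable)
    {C C' : Contour} (hC : Separates P Q C) (hC' : Separates P Q C') {N D : ℂ → ℂ}
    (hN : ∀ z ≠ 0, DifferentiableAt ℂ N z) (hD : ∀ z ≠ 0, DifferentiableAt ℂ D z)
    (hD0 : ∀ z ≠ 0, D z = 0 → z ∈ P ∪ Q) :
    contourIntegral C (fun z => N z / D z) = contourIntegral C' (fun z => N z / D z) := by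
  have hdis : ∀ {C}, Separates P Q C → 0 ∉ trace C ∧ ∀ z ∈ trace C, D z ≠ 0 := by
    intro C hC
    have h := Set.disjoint_left.1 hC.disjoint
    have h0 : 0 ∉ trace C := fun h' => h h' (Or.inl (Or.inl rfl))
    refine ⟨h0, fun z hz hDz => ?_⟩
    rcases hD0 z (fun h' => h0 (h' ▸ hz)) hDz with h' | h'
    · exact h hz (Or.inl (Or.inr h'))
    · exact h hz (Or.inr h')
  refine contourIntegral_div_eq hN hD ?_ (hdis hC).1 (hdis hC').1 (hdis hC).2 (hdis hC').2
    (by rw [hC.index_zero, hC'.index_zero]) fun w hw hDw => ?_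
  · obtain ⟨z, hz⟩ := (((Set.countable_singleton (0 : ℂ)).union (hP.union hQ)).dense_compl ℝ).nonempty
    exact ⟨z, fun h => hz (Or.inl h), fun h => hz (Or.inr (hD0 z (fun h => hz (Or.inl h)) h))⟩
  · rcases hD0 w hw hDw with h | h
    · rw [hC.index_inner w h, hC'.index_inner w h]
    · rw [hC.index_outer w h, hC'.index_outer w h]

/-! ### The integrand -/

/-- The numerator of the integrand. -/
noncomputable def kernelNum (p q : ℂ) (t : Fin 8 → ℂ) (z : ℂ) : ℂ :=
  (∏ j, dblPoch p q ((t j * z)⁻¹ * p * q) * dblPoch p q ((t j * z⁻¹)⁻¹ * p * q)) *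
    (qPoch (z ^ 2) p * qPoch (q * z ^ 2) q * (qPoch (z⁻¹ ^ 2) p * qPoch (q * z⁻¹ ^ 2) q))

/-- The denominator of the integrand. -/
noncomputable def kernelDen (p q : ℂ) (t : Fin 8 → ℂ) (z : ℂ) : ℂ :=
  (∏ j, dblPoch p q (t j * z) * dblPoch p q (t j * z⁻¹)) * z

lemma countable_dblPoch_zeros (hp : ‖p‖ < 1) (hq : ‖q‖ < 1) :
    {z : ℂ | dblPoch p q z = 0}.Countable := by
  have : {z : ℂ | dblPoch p q z = 0} ⊆ Set.range fun n : ℕ × ℕ => (p ^ n.1 * q ^ n.2)⁻¹ := by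
    intro z hz
    obtain ⟨a, b, h⟩ := (dblPoch_eq_zero_iff hp hq).1 hz
    rw [mul_assoc] at h
    exact ⟨(a, b), (eq_inv_of_mul_eq_one_left h).symm⟩
  exact (Set.countable_range _).mono this

lemma inv_ellGamma_eq (hp : ‖p‖ < 1) (hq : ‖q‖ < 1) {z : ℂ}
    (h1 : dblPoch p q (p * q * z) ≠ 0) (h2 : dblPoch p q (p * q * z⁻¹) ≠ 0) :
    (ellGamma p q z * ellGamma p q z⁻¹)⁻¹ =
      qPoch z p * qPoch (q * z) q * (qPoch z⁻¹ p * qPoch (q * z⁻¹) q) := by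
  have e1 : ∀ w, dblPoch p q w = qPoch w p * qPoch (q * w) q * dblPoch p q (p * q * w) := by
    intro w
    rw [dblPoch_eq_right hp hq, dblPoch_eq_left hp hq (q * w)]; ring_nf
  rw [ellGamma_eq, ellGamma_eq, e1 z, e1 z⁻¹, inv_inv, mul_inv, inv_div, inv_div]
  have e2 : z * p * q = p * q * z := by ring
  have e3 : z⁻¹ * p * q = p * q * z⁻¹ := by ring
  rw [e2, e3]
  generalize dblPoch p q (p * q * z) = X at h1 ⊢
  generalize dblPoch p q (p * q * z⁻¹) = Y at h2 ⊢
  field_simp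

/-- Off a countable set, the integrand is the quotient of two holomorphic functions. -/
lemma kernel_div_eq (hp : ‖p‖ < 1) (hq : ‖q‖ < 1) (hp0 : p ≠ 0) (hq0 : q ≠ 0) :
    ∃ B : Set ℂ, B.Countable ∧ ∀ t : Fin 8 → ℂ, ∀ z ∉ B,
      kernel p q t z / z = kernelNum p q t z / kernelDen p q t z := by
  have hc := (countable_mul_preimage (countable_dblPoch_zeros hp hq) (mul_ne_zero hp0 hq0))
  refine ⟨{z | p * q * z ^ 2 ∈ {z | dblPoch p q z = 0}} ∪
    {z | p * q * (z ^ 2)⁻¹ ∈ {z | dblPoch p q z = 0}}, ?_, fun t z hz => ?_⟩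
  · refine (countable_pow_preimage hc two_ne_zero).union
      (countable_pow_preimage (B := {z | p * q * z⁻¹ ∈ {z | dblPoch p q z = 0}}) ?_ two_ne_zero)
    exact hc.preimage inv_injective
  · simp only [Set.mem_union, Set.mem_ofPred_eq, not_or] at hz
    rw [kernel, inv_pow, div_eq_mul_inv _ (ellGamma p q (z ^ 2) * _), inv_ellGamma_eq hp hq hz.1 hz.2]
    simp only [ellGamma_eq, kernelNum, kernelDen, Finset.prod_mul_distrib, Finset.prod_div_distrib,
      inv_pow]
    simp only [div_eq_mul_inv, mul_inv]
    ring

lemma kernelDen_eq_zero (hp : ‖p‖ < 1) (hq : ‖q‖ < 1) {t : Fin 8 → ℂ} {z : ℂ} (hz : z ≠ 0)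
    (h : kernelDen p q t z = 0) :
    z ∈ innerPts p q (Set.range t) ∪ outerPts p q (Set.range t) := by
  rw [kernelDen, mul_eq_zero, or_iff_left hz, Finset.prod_eq_zero_iff] at h
  obtain ⟨j, -, h⟩ := h
  rw [mul_eq_zero, dblPoch_eq_zero_iff hp hq, dblPoch_eq_zero_iff hp hq] at h
  rcases h with ⟨a, b, h⟩ | ⟨a, b, h⟩
  · refine Or.inr ⟨_, ⟨j, rfl⟩, a, b, eq_inv_of_mul_eq_one_right ?_⟩
    rw [← h]; ring
  · refine Or.inl ⟨_, ⟨j, rfl⟩, a, b, ?_⟩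
    field_simp at h
    exact h.symm

lemma differentiableAt_kernelNum (hp : ‖p‖ < 1) (hq : ‖q‖ < 1) {T : ℂ → Fin 8 → ℂ} {Z : ℂ → ℂ}
    {u : ℂ} (hT : ∀ j, DifferentiableAt ℂ (fun u => T u j) u) (hT0 : ∀ j, T u j ≠ 0)
    (hZ : DifferentiableAt ℂ Z u) (hZ0 : Z u ≠ 0) :
    DifferentiableAt ℂ (fun u => kernelNum p q (T u) (Z u)) u := by
  have hA := differentiable_dblPoch hp hq
  have hB := differentiable_qPoch hp
  have hB' := differentiable_qPoch hq
  unfold kernelNum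
  have h2 : ∀ {f : ℂ → ℂ}, DifferentiableAt ℂ f u → DifferentiableAt ℂ (fun u => dblPoch p q (f u)) u :=
    fun {f} hf => (hA (f u)).comp u hf
  have h3 : ∀ {f : ℂ → ℂ}, DifferentiableAt ℂ f u → DifferentiableAt ℂ (fun u => qPoch (f u) p) u :=
    fun {f} hf => (hB (f u)).comp u hf
  have h4 : ∀ {f : ℂ → ℂ}, DifferentiableAt ℂ f u → DifferentiableAt ℂ (fun u => qPoch (f u) q) u :=
    fun {f} hf => (hB' (f u)).comp u hf
  have hZi := hZ.fun_inv hZ0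
  refine .mul (.fun_finsetProd fun j _ => .mul (h2 ?_) (h2 ?_))
    (.mul (.mul (h3 (hZ.fun_pow 2)) (h4 ((hZ.fun_pow 2).const_mul q)))
      (.mul (h3 (hZi.fun_pow 2)) (h4 ((hZi.fun_pow 2).const_mul q))))
  · exact ((((hT j).mul hZ).fun_inv (mul_ne_zero (hT0 j) hZ0)).mul_const p).mul_const q
  · exact ((((hT j).mul hZi).fun_inv (mul_ne_zero (hT0 j) (inv_ne_zero hZ0))).mul_const p).mul_const q

lemma differentiableAt_kernelDen (hp : ‖p‖ < 1) (hq : ‖q‖ < 1) {T : ℂ → Fin 8 → ℂ} {Z : ℂ → ℂ}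
    {u : ℂ} (hT : ∀ j, DifferentiableAt ℂ (fun u => T u j) u)
    (hZ : DifferentiableAt ℂ Z u) (hZ0 : Z u ≠ 0) :
    DifferentiableAt ℂ (fun u => kernelDen p q (T u) (Z u)) u := by
  have hA := differentiable_dblPoch hp hq
  unfold kernelDen
  have h2 : ∀ {f : ℂ → ℂ}, DifferentiableAt ℂ f u → DifferentiableAt ℂ (fun u => dblPoch p q (f u)) u :=
    fun {f} hf => (hA (f u)).comp u hf
  exact .mul (.fun_finsetProd fun j _ => .mul (h2 ((hT j).mul hZ)) (h2 ((hT j).mul (hZ.fun_inv hZ0)))) hZ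

lemma continuousAt_kernelNum {X : Type*} [TopologicalSpace X] (hp : ‖p‖ < 1) (hq : ‖q‖ < 1)
    {T : X → Fin 8 → ℂ} {Z : X → ℂ} {u : X} (hT : ContinuousAt T u) (hT0 : ∀ j, T u j ≠ 0)
    (hZ : ContinuousAt Z u) (hZ0 : Z u ≠ 0) :
    ContinuousAt (fun u => kernelNum p q (T u) (Z u)) u := by
  have hA := continuous_dblPoch hp hq
  have hB := continuous_qPoch hp
  have hB' := continuous_qPoch hq
  unfold kernelNum
  have h2 : ∀ {f : X → ℂ}, ContinuousAt f u → ContinuousAt (fun u => dblPoch p q (f u)) u :=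
    fun {f} hf => hA.continuousAt.comp hf
  have h3 : ∀ {f : X → ℂ}, ContinuousAt f u → ContinuousAt (fun u => qPoch (f u) p) u :=
    fun {f} hf => ContinuousAt.comp (g := fun z => qPoch z p) hB.continuousAt hf
  have h4 : ∀ {f : X → ℂ}, ContinuousAt f u → ContinuousAt (fun u => qPoch (f u) q) u :=
    fun {f} hf => ContinuousAt.comp (g := fun z => qPoch z q) hB'.continuousAt hf
  have hZi := hZ.inv₀ hZ0
  have hTj := fun j => continuousAt_pi.1 hT j
  refine .mul (tendsto_finsetProd _ fun j _ => ContinuousAt.mul (h2 ?_) (h2 ?_))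
    (.mul (.mul (h3 (hZ.pow 2)) (h4 ((hZ.pow 2).const_mul q)))
      (.mul (h3 (hZi.pow 2)) (h4 ((hZi.pow 2).const_mul q))))
  · exact ((((hTj j).mul hZ).inv₀ (mul_ne_zero (hT0 j) hZ0)).mul_const p).mul_const q
  · exact ((((hTj j).mul hZi).inv₀ (mul_ne_zero (hT0 j) (inv_ne_zero hZ0))).mul_const p).mul_const q

lemma continuousAt_kernelDen {X : Type*} [TopologicalSpace X] (hp : ‖p‖ < 1) (hq : ‖q‖ < 1)
    {T : X → Fin 8 → ℂ} {Z : X → ℂ} {u : X} (hT : ContinuousAt T u)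
    (hZ : ContinuousAt Z u) (hZ0 : Z u ≠ 0) :
    ContinuousAt (fun u => kernelDen p q (T u) (Z u)) u := by
  have hA := continuous_dblPoch hp hq
  unfold kernelDen
  have h2 : ∀ {f : X → ℂ}, ContinuousAt f u → ContinuousAt (fun u => dblPoch p q (f u)) u :=
    fun {f} hf => hA.continuousAt.comp hf
  have hTj := fun j => continuousAt_pi.1 hT j
  exact .mul (tendsto_finsetProd _ fun j _ =>
    ContinuousAt.mul (h2 ((hTj j).mul hZ)) (h2 ((hTj j).mul (hZ.inv₀ hZ0)))) hZ

/-! ### The function `V` -/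

lemma Balanced.ne_zero (hp0 : p ≠ 0) (hq0 : q ≠ 0) {t : Fin 8 → ℂ} (h : Balanced p q t)
    (j : Fin 8) : t j ≠ 0 := by
  have : ∏ j, t j ≠ 0 := by
    rw [h]; exact mul_ne_zero (pow_ne_zero _ hp0) (pow_ne_zero _ hq0)
  exact Finset.prod_ne_zero_iff.1 this j (Finset.mem_univ j)

lemma exists_isSeparating (hp : ‖p‖ < 1) (hq : ‖q‖ < 1) (hp0 : p ≠ 0) (hq0 : q ≠ 0)
    {t : Fin 8 → ℂ} (ht : ∀ j, t j ≠ 0) (h : Admissible p q t) : ∃ C, IsSeparating p q t C := by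
  obtain ⟨C, hC⟩ := exists_separates_pts hp hq hp0 hq0 (Set.finite_range t)
    (by rintro _ ⟨j, rfl⟩; exact ht j) (by rintro _ ⟨j, rfl⟩ _ ⟨k, rfl⟩ a b; exact h j k a b)
  exact ⟨C, isSeparating_iff.2 hC⟩

lemma IsSeparating.admissible {t : Fin 8 → ℂ} {C : Contour} (h : IsSeparating p q t C) : Admissible p q t := by
  intro j k a b he
  have h1 := h.index_inner j a b
  have h2 := h.index_outer k 0 0
  have : t j * p ^ a * q ^ b = (t k * p ^ 0 * q ^ 0)⁻¹ := by
    rw [pow_zero, pow_zero, mul_one, mul_one]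
    refine eq_inv_of_mul_eq_one_left ?_
    rw [← he]; ring
  rw [this, h2] at h1
  exact zero_ne_one h1

lemma contourIntegral_kernel (hp : ‖p‖ < 1) (hq : ‖q‖ < 1) (hp0 : p ≠ 0) (hq0 : q ≠ 0)
    (t : Fin 8 → ℂ) (C : Contour) :
    contourIntegral C (fun z => kernel p q t z / z) =
      contourIntegral C fun z => kernelNum p q t z / kernelDen p q t z := by
  obtain ⟨B, hB, h⟩ := kernel_div_eq hp hq hp0 hq0
  exact contourIntegral_congr_countable hB fun z _ hz => h t z hz

/-- `V` may be computed with any separating contour. -/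
lemma V_eq (hp : ‖p‖ < 1) (hq : ‖q‖ < 1) (hp0 : p ≠ 0) (hq0 : q ≠ 0) {t : Fin 8 → ℂ}
    (ht : ∀ j, t j ≠ 0) {C : Contour} (hC : IsSeparating p q t C) :
    V p q t = kappa p q * contourIntegral C fun z => kernel p q t z / z := by
  have hex : ∃ C : Contour, IsSeparating p q t C := ⟨C, hC⟩
  rw [V, dif_pos hex, contourIntegral_kernel hp hq hp0 hq0, contourIntegral_kernel hp hq hp0 hq0]
  congr 1
  exact contourIntegral_div_eq_of_separates
    (countable_innerPts (Set.finite_range t).countable)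
    (countable_outerPts (Set.finite_range t).countable)
    (isSeparating_iff.1 hex.choose_spec) (isSeparating_iff.1 hC)
    (fun z hz => differentiableAt_kernelNum hp hq (T := fun _ => t) (fun j => by fun_prop) ht
      differentiableAt_id hz)
    (fun z hz => differentiableAt_kernelDen hp hq (T := fun _ => t) (fun j => by fun_prop)
      differentiableAt_id hz)
    fun z hz h => kernelDen_eq_zero hp hq hz h

lemma kernel_comm (p q : ℂ) (t : Fin 8 → ℂ) (z : ℂ) : kernel p q t z = kernel q p t z := by
  simp only [kernel, ellGamma_comm p q]

lemma IsSeparating.comm {t : Fin 8 → ℂ} {C : Contour} (h : IsSeparating p q t C) :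
    IsSeparating q p t C where
  avoids_zero := h.avoids_zero
  avoids_inner γ hγ s j a b := by rw [mul_right_comm]; exact h.avoids_inner γ hγ s j b a
  avoids_outer γ hγ s j a b := by rw [mul_right_comm]; exact h.avoids_outer γ hγ s j b a
  index_zero := h.index_zero
  index_inner j a b := by rw [mul_right_comm]; exact h.index_inner j b a
  index_outer j a b := by rw [mul_right_comm]; exact h.index_outer j b a

lemma V_comm (p q : ℂ) (t : Fin 8 → ℂ) : V p q t = V q p t := by
  have h : IsSeparating p q t = IsSeparating q p t := by
    ext C; exact ⟨fun h => h.comm, fun h => h.comm⟩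
  have hk : kernel p q t = kernel q p t := by ext z; exact kernel_comm p q t z
  have hkap : kappa p q = kappa q p := by rw [kappa, kappa, mul_comm (qPoch q q)]
  have key : ∀ (A B : Contour → Prop) (f : ℂ → ℂ), A = B →
      (open Classical in if h : ∃ C, A C then kappa q p * contourIntegral h.choose f else 0) =
      (open Classical in if h : ∃ C, B C then kappa q p * contourIntegral h.choose f else 0) := by
    rintro A _ f rfl; rfl
  rw [V, V, hk, hkap]
  exact key _ _ _ h

lemma U_comm (p q : ℂ) (t : Fin 8 → ℂ) : U p q t = U q p t := by
  simp only [U, V_comm p q, ellGamma_comm p q]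

lemma eventually_contourIndex_eq {C : Contour} {w₀ : ℂ} (h : w₀ ∉ trace C) :
    ∀ᶠ w in 𝓝 w₀, w ∉ trace C ∧ contourIndex C w = contourIndex C w₀ := by
  obtain ⟨r, hr, hsub⟩ := Metric.isOpen_iff.1 (isCompact_trace C).isClosed.isOpen_compl w₀ h
  filter_upwards [Metric.ball_mem_nhds w₀ hr] with w hw
  exact ⟨hsub hw, contourIndex_eq_of_ball (Set.disjoint_right.2 fun z hz => hsub hz) hw⟩

/-- Separation is an open condition on the parameters. -/
lemma IsSeparating.eventually (hp : ‖p‖ < 1) (hq : ‖q‖ < 1) (hp0 : p ≠ 0) (hq0 : q ≠ 0)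
    {t : Fin 8 → ℂ} (ht : ∀ j, t j ≠ 0) {C : Contour} (hC : IsSeparating p q t C) :
    ∀ᶠ t' in 𝓝 t, IsSeparating p q t' C := by
  have hsep := isSeparating_iff.1 hC
  have hdis := Set.disjoint_left.1 hsep.disjoint
  have h0C : (0 : ℂ) ∉ trace C := fun h' => hdis h' (Or.inl (Or.inl rfl))
  obtain ⟨ε, hε, hεC⟩ := Metric.isOpen_iff.1 (isCompact_trace C).isClosed.isOpen_compl 0 h0C
  obtain ⟨R, hR⟩ := isBounded_iff_forall_norm_le.1 (isCompact_trace C).isBounded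
  set R' := |R| + 1 with hR'
  have hR'0 : 0 < R' := by positivity
  have hRC : ∀ z ∈ trace C, ‖z‖ < R' := fun z hz => by
    linarith [hR z hz, le_abs_self R]
  set M := ‖t‖ + 1 with hM
  have hM0 : 0 < M := by positivity
  set δ := min ε R'⁻¹ / M with hδ
  have hδ0 : 0 < δ := by positivity
  have hfin := finite_le_norm_pow hp hq hδ0
  have hcont : ∀ (j : Fin 8) (n : ℕ × ℕ),
      ContinuousAt (fun t' : Fin 8 → ℂ => t' j * p ^ n.1 * q ^ n.2) t := fun j n =>
    ((continuous_apply j).continuousAt.mul_const _).mul_const _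
  have hne : ∀ (j : Fin 8) (n : ℕ × ℕ), t j * p ^ n.1 * q ^ n.2 ≠ 0 := fun j n =>
    mul_ne_zero (mul_ne_zero (ht j) (pow_ne_zero _ hp0)) (pow_ne_zero _ hq0)
  have hin : ∀ᶠ t' in 𝓝 t, ∀ n ∈ {n : ℕ × ℕ | δ ≤ ‖p ^ n.1 * q ^ n.2‖}, ∀ j,
      (t' j * p ^ n.1 * q ^ n.2 ∉ trace C ∧ contourIndex C (t' j * p ^ n.1 * q ^ n.2) = 1) ∧
      ((t' j * p ^ n.1 * q ^ n.2)⁻¹ ∉ trace C ∧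
        contourIndex C (t' j * p ^ n.1 * q ^ n.2)⁻¹ = 0) := by
    refine (Filter.eventually_all_finite hfin).2 fun n _ => Filter.eventually_all.2 fun j => ?_
    have h1 := (hcont j n).eventually (eventually_contourIndex_eq (C := C)
      fun h => hdis h (Or.inl (Or.inr ⟨_, ⟨j, rfl⟩, n.1, n.2, rfl⟩)))
    have h2 := ((hcont j n).inv₀ (hne j n)).eventually (eventually_contourIndex_eq (C := C)
      fun h => hdis h (Or.inr ⟨_, ⟨j, rfl⟩, n.1, n.2, rfl⟩))
    filter_upwards [h1, h2] with t' h1 h2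
    exact ⟨⟨h1.1, h1.2.trans (hC.index_inner _ _ _)⟩, ⟨h2.1, h2.2.trans (hC.index_outer _ _ _)⟩⟩
  have hnorm : ∀ᶠ t' in 𝓝 t, ‖t'‖ < M :=
    continuous_norm.continuousAt.eventually (gt_mem_nhds (by rw [hM]; linarith))
  have hnz : ∀ᶠ t' in 𝓝 t, ∀ j, t' j ≠ 0 := Filter.eventually_all.2 fun j =>
    (continuous_apply j).continuousAt.eventually_ne (ht j)
  filter_upwards [hin, hnorm, hnz] with t' hin hnorm hnz
  have key : ∀ (j : Fin 8) (n : ℕ × ℕ),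
      (t' j * p ^ n.1 * q ^ n.2 ∉ trace C ∧ contourIndex C (t' j * p ^ n.1 * q ^ n.2) = 1) ∧
      ((t' j * p ^ n.1 * q ^ n.2)⁻¹ ∉ trace C ∧
        contourIndex C (t' j * p ^ n.1 * q ^ n.2)⁻¹ = 0) := by
    intro j n
    by_cases hn : δ ≤ ‖p ^ n.1 * q ^ n.2‖
    · exact hin n hn j
    · push Not at hn
      have hlt : ‖t' j * p ^ n.1 * q ^ n.2‖ < min ε R'⁻¹ := by
        rw [mul_assoc, norm_mul]
        have h1 : ‖t' j‖ ≤ M := (norm_le_pi_norm t' j).trans hnorm.le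
        calc ‖t' j‖ * ‖p ^ n.1 * q ^ n.2‖ ≤ M * ‖p ^ n.1 * q ^ n.2‖ := by gcongr
          _ < M * δ := by gcongr
          _ = min ε R'⁻¹ := by rw [hδ]; field_simp
      have hw0 : t' j * p ^ n.1 * q ^ n.2 ≠ 0 :=
        mul_ne_zero (mul_ne_zero (hnz j) (pow_ne_zero _ hp0)) (pow_ne_zero _ hq0)
      have hb : t' j * p ^ n.1 * q ^ n.2 ∈ Metric.ball 0 ε :=
        mem_ball_zero_iff.2 (hlt.trans_le (min_le_left _ _))
      have hle : R' ≤ ‖(t' j * p ^ n.1 * q ^ n.2)⁻¹‖ := by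
        rw [norm_inv, le_inv_comm₀ hR'0 (norm_pos_iff.2 hw0)]
        exact (hlt.trans_le (min_le_right _ _)).le
      refine ⟨⟨hεC hb, ?_⟩, fun h => (hRC _ h).not_ge hle, contourIndex_eq_zero_of_norm hRC hle⟩
      rw [contourIndex_eq_of_ball (Set.disjoint_right.2 fun z hz => hεC hz) hb, hC.index_zero]
  exact
    { avoids_zero := hC.avoids_zero
      avoids_inner := fun γ hγ s j a b he => (key j (a, b)).1.1 ⟨γ, hγ, s, he⟩
      avoids_outer := fun γ hγ s j a b he => (key j (a, b)).2.1 ⟨γ, hγ, s, he⟩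
      index_zero := hC.index_zero
      index_inner := fun j a b => (key j (a, b)).1.2
      index_outer := fun j a b => (key j (a, b)).2.2 }

lemma continuousAt_contourIntegral {X : Type*} [TopologicalSpace X] [FirstCountableTopology X]
    {F : X → ℂ → ℂ} {x₀ : X} {C : Contour}
    (h : ∀ z ∈ trace C, ∀ᶠ p in 𝓝 (x₀, z), ContinuousAt (Function.uncurry F) p) :
    ContinuousAt (fun x => contourIntegral C (F x)) x₀ := by
  induction C with
  | nil => exact continuousAt_const
  | cons γ C ih =>
    rw [trace_cons] at h
    simp only [contourIntegral_cons]
    refine ContinuousAt.add ?_ (ih fun z hz => h z (Or.inr hz))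
    refine continuousAt_intervalIntegral (F := fun x s => F x (γ.toFun s) * deriv γ.toFun s)
      fun s _ => ?_
    have hγ : Continuous fun p : X × ℝ => (p.1, γ.toFun p.2) :=
      continuous_fst.prodMk (γ.continuous.comp continuous_snd)
    have h1 := (hγ.continuousAt (x := (x₀, s))).eventually (h _ (Or.inl ⟨s, rfl⟩))
    filter_upwards [h1] with p hp
    exact (hp.comp (f := fun p : X × ℝ => (p.1, γ.toFun p.2)) hγ.continuousAt).mul
      (γ.continuous_deriv.comp continuous_snd).continuousAt

lemma differentiableAt_contourIntegral {F : ℂ → ℂ → ℂ} {u₀ : ℂ} {C : Contour}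
    (h : ∀ z ∈ trace C, ∀ᶠ p in 𝓝 (u₀, z), ContinuousAt (Function.uncurry F) p)
    (hd : ∀ z ∈ trace C, ∀ᶠ p in 𝓝 (u₀, z), DifferentiableAt ℂ (fun u => F u p.2) p.1) :
    DifferentiableAt ℂ (fun u => contourIntegral C (F u)) u₀ := by
  induction C with
  | nil => exact differentiableAt_const _
  | cons γ C ih =>
    rw [trace_cons] at h hd
    simp only [contourIntegral_cons]
    refine DifferentiableAt.add ?_ (ih (fun z hz => h z (Or.inr hz)) fun z hz => hd z (Or.inr hz))
    have hγ : Continuous fun p : ℂ × ℝ => (p.1, γ.toFun p.2) :=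
      continuous_fst.prodMk (γ.continuous.comp continuous_snd)
    refine differentiableAt_intervalIntegral (F := fun x s => F x (γ.toFun s) * deriv γ.toFun s)
      (fun s _ => ?_) fun s _ => ?_
    · have h1 := (hγ.continuousAt (x := (u₀, s))).eventually (h _ (Or.inl ⟨s, rfl⟩))
      filter_upwards [h1] with p hp
      exact (hp.comp (f := fun p : ℂ × ℝ => (p.1, γ.toFun p.2)) hγ.continuousAt).mul
        (γ.continuous_deriv.comp continuous_snd).continuousAt
    · have h1 := (hγ.continuousAt (x := (u₀, s))).eventually (hd _ (Or.inl ⟨s, rfl⟩))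
      filter_upwards [h1] with p hp
      exact hp.mul_const _

/-- Where the integrand has a joint limit, uniformly on a contour. -/
lemma eventually_kernel_regular {X : Type*} [TopologicalSpace X] (hp : ‖p‖ < 1) (hq : ‖q‖ < 1)
    {T : X → Fin 8 → ℂ} {x₀ : X} (hT : ContinuousAt T x₀) (hT0 : ∀ j, T x₀ j ≠ 0)
    {C : Contour} (hC : Disjoint (trace C)
      ({0} ∪ innerPts p q (Set.range (T x₀)) ∪ outerPts p q (Set.range (T x₀))))
    {z : ℂ} (hz : z ∈ trace C) :
    ∀ᶠ y in 𝓝 (x₀, z), (∀ j, T y.1 j ≠ 0) ∧ y.2 ≠ 0 ∧ kernelDen p q (T y.1) y.2 ≠ 0 := by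
  have hdis := Set.disjoint_left.1 hC
  have hz0 : z ≠ 0 := fun h' => hdis hz (Or.inl (Or.inl h'))
  have hTc : ContinuousAt (fun y : X × ℂ => T y.1) (x₀, z) :=
    ContinuousAt.comp (g := T) (f := Prod.fst) hT continuousAt_fst
  have h1 : ∀ᶠ y in 𝓝 (x₀, z), ∀ j, T y.1 j ≠ 0 := Filter.eventually_all.2 fun j =>
    (continuousAt_pi.1 hTc j).eventually_ne (hT0 j)
  have h2 : ∀ᶠ y : X × ℂ in 𝓝 (x₀, z), y.2 ≠ 0 := continuousAt_snd.eventually_ne hz0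
  have h3 := (continuousAt_kernelDen hp hq hTc continuousAt_snd hz0).eventually_ne
    (fun h0 => (kernelDen_eq_zero hp hq hz0 h0).elim (fun h' => hdis hz (Or.inl (Or.inr h')))
      fun h' => hdis hz (Or.inr h'))
  filter_upwards [h1, h2, h3] with y h1 h2 h3 using ⟨h1, h2, h3⟩

lemma continuousAt_contourIntegral_kernel (hp : ‖p‖ < 1) (hq : ‖q‖ < 1) {t : Fin 8 → ℂ}
    (ht : ∀ j, t j ≠ 0) {C : Contour} (hC : Disjoint (trace C)
      ({0} ∪ innerPts p q (Set.range t) ∪ outerPts p q (Set.range t))) :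
    ContinuousAt (fun t' => contourIntegral C fun z => kernelNum p q t' z / kernelDen p q t' z) t := by
  refine continuousAt_contourIntegral
    (F := fun t' z => kernelNum p q t' z / kernelDen p q t' z) fun z hz => ?_
  have h1 := eventually_kernel_regular hp hq (T := id) continuousAt_id ht hC hz
  filter_upwards [h1] with y hy
  exact (continuousAt_kernelNum hp hq (T := Prod.fst) continuousAt_fst hy.1 continuousAt_snd hy.2.1).div
    (continuousAt_kernelDen hp hq (T := Prod.fst) continuousAt_fst continuousAt_snd hy.2.1) hy.2.2

/-- `V` is a continuous function of the parameters. -/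
lemma continuousAt_V (hp : ‖p‖ < 1) (hq : ‖q‖ < 1) (hp0 : p ≠ 0) (hq0 : q ≠ 0)
    {t : Fin 8 → ℂ} (ht : ∀ j, t j ≠ 0) (h : Admissible p q t) : ContinuousAt (V p q) t := by
  obtain ⟨C, hC⟩ := exists_isSeparating hp hq hp0 hq0 ht h
  have hev := hC.eventually hp hq hp0 hq0 ht
  have hnz : ∀ᶠ t' in 𝓝 t, ∀ j, t' j ≠ 0 := Filter.eventually_all.2 fun j =>
    (continuous_apply j).continuousAt.eventually_ne (ht j)
  have hc := continuousAt_contourIntegral_kernel hp hq ht (isSeparating_iff.1 hC).disjoint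
  refine (hc.const_mul (kappa p q)).congr ?_
  filter_upwards [hev, hnz] with t' h1 h2
  rw [V_eq hp hq hp0 hq0 h2 h1, contourIntegral_kernel hp hq hp0 hq0]

/-- `V` is holomorphic along holomorphic curves in the space of parameters. -/
lemma differentiableAt_V (hp : ‖p‖ < 1) (hq : ‖q‖ < 1) (hp0 : p ≠ 0) (hq0 : q ≠ 0)
    {T : ℂ → Fin 8 → ℂ} {u₀ : ℂ} (hT : ∀ᶠ u in 𝓝 u₀, DifferentiableAt ℂ T u)
    (hT0 : ∀ j, T u₀ j ≠ 0) (h : Admissible p q (T u₀)) :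
    DifferentiableAt ℂ (fun u => V p q (T u)) u₀ := by
  obtain ⟨C, hC⟩ := exists_isSeparating hp hq hp0 hq0 hT0 h
  have hTc := hT.self_of_nhds.continuousAt
  have hev := hTc.eventually (hC.eventually hp hq hp0 hq0 hT0)
  have hnz : ∀ᶠ u in 𝓝 u₀, ∀ j, T u j ≠ 0 := Filter.eventually_all.2 fun j =>
    (continuousAt_pi.1 hTc j).eventually_ne (hT0 j)
  have hreg : ∀ z ∈ trace C, ∀ᶠ y in 𝓝 (u₀, z), DifferentiableAt ℂ T y.1 ∧
      (∀ j, T y.1 j ≠ 0) ∧ y.2 ≠ 0 ∧ kernelDen p q (T y.1) y.2 ≠ 0 := fun z hz =>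
    (continuousAt_fst.eventually hT).and (eventually_kernel_regular hp hq hTc hT0 (isSeparating_iff.1 hC).disjoint hz)
  have hd : DifferentiableAt ℂ
      (fun u => contourIntegral C fun z => kernelNum p q (T u) z / kernelDen p q (T u) z) u₀ := by
    refine differentiableAt_contourIntegral
      (F := fun u z => kernelNum p q (T u) z / kernelDen p q (T u) z) (fun z hz => ?_) fun z hz => ?_
    · filter_upwards [hreg z hz] with y ⟨hd, hy⟩
      have hTy : ContinuousAt (fun y : ℂ × ℂ => T y.1) y :=
        ContinuousAt.comp (g := T) (f := Prod.fst) hd.continuousAt continuousAt_fst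
      exact (continuousAt_kernelNum hp hq hTy hy.1 continuousAt_snd hy.2.1).div
        (continuousAt_kernelDen hp hq hTy continuousAt_snd hy.2.1) hy.2.2
    · filter_upwards [hreg z hz] with y ⟨hd, hy⟩
      have hdj := differentiableAt_pi.1 hd
      exact (differentiableAt_kernelNum hp hq hdj hy.1 (differentiableAt_const _) hy.2.1).div
        (differentiableAt_kernelDen hp hq hdj (differentiableAt_const _) hy.2.1) hy.2.2
  refine (hd.const_mul (kappa p q)).congr_of_eventuallyEq ?_
  filter_upwards [hev, hnz] with u h1 h2
  rw [V_eq hp hq hp0 hq0 h2 h1, contourIntegral_kernel hp hq hp0 hq0]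

/-- Admissibility is an open condition. -/
lemma Admissible.eventually (hp : ‖p‖ < 1) (hq : ‖q‖ < 1) (hp0 : p ≠ 0) (hq0 : q ≠ 0)
    {t : Fin 8 → ℂ} (ht : ∀ j, t j ≠ 0) (h : Admissible p q t) :
    ∀ᶠ t' in 𝓝 t, Admissible p q t' := by
  obtain ⟨C, hC⟩ := exists_isSeparating hp hq hp0 hq0 ht h
  filter_upwards [hC.eventually hp hq hp0 hq0 ht] with t' h1
  exact h1.admissible

end separation

section partialFractions

variable {p : ℂ}

lemma theta_zero_of_eq_zpow (hp : ‖p‖ < 1) (hp0 : p ≠ 0) {x y z : ℂ} (hx : x ≠ 0) (hy : y ≠ 0)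
    (hxy : x / y = z) (h1 : theta p x = 0) (h2 : theta p y = 0) : theta p z = 0 := by
  obtain ⟨m, rfl⟩ := (theta_eq_zero_iff hp hp0 hx).1 h1
  obtain ⟨n, rfl⟩ := (theta_eq_zero_iff hp hp0 hy).1 h2
  rw [← hxy, theta_eq_zero_iff hp hp0 (div_ne_zero hx hy)]
  exact ⟨m - n, (zpow_sub₀ hp0 m n).symm⟩

/-- The functions `θ(ax)θ(aM/x)` of `x` span a two-dimensional space, on which evaluation at two
generic points is injective. -/
lemma theta_interpolation (hp : ‖p‖ < 1) (hp0 : p ≠ 0) {a M r s x : ℂ} (ha : a ≠ 0) (hM : M ≠ 0)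
    (hr : r ≠ 0) (hs : s ≠ 0) (hx : x ≠ 0) :
    theta p (a * x) * theta p (a * M / x) * (theta p (r * s / M) * theta p (r / s)) =
      theta p (a * s) * theta p (a * M / s) * (theta p (r * x / M) * theta p (r / x)) +
      r / x * (theta p (a * r) * theta p (a * M / r) * (theta p (x * s / M) * theta p (x / s))) := by
  obtain ⟨m, hm⟩ := IsSquare.exists_sq M (IsAlgClosed.exists_pow_nat_eq M two_pos |>.imp
    fun z hz => by rw [← hz, sq])
  have hm0 : m ≠ 0 := by rintro rfl; apply hM; simp [hm]
  subst hm
  have h := theta_addition hp hp0 (x := a * m) (w := x / m) (y := r / m) (z := s / m)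
    (div_ne_zero hx hm0) (mul_ne_zero ha hm0) (div_ne_zero hr hm0) (div_ne_zero hs hm0)
  have e1 : ∀ y, a * m * (y / m) = a * y := fun y => by field_simp
  have e2 : ∀ y, a * m / (y / m) = a * m ^ 2 / y := fun y => by
    rw [div_div_eq_mul_div]; ring
  have e3 : ∀ y z, y / m * (z / m) = y * z / m ^ 2 := fun y z => by rw [div_mul_div_comm, sq]
  have e4 : ∀ y z, y / m / (z / m) = y / z := fun y z => div_div_div_cancel_right₀ hm0 y z
  simp only [e1, e2, e3, e4] at h
  linear_combination h

/-- The partial fraction expansion of products of theta functions. -/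
theorem theta_partial_fractions {ι : Type*} [DecidableEq ι] (hp : ‖p‖ < 1) (hp0 : p ≠ 0)
    (a : ι → ℂ) (n : ℕ) : ∀ (b : List ℂ) (S : Finset ι), S.card = n + 2 → b.length = n + 2 →
    (∀ β ∈ b, β ≠ 0) → (∀ i ∈ S, a i ≠ 0) → (∏ i ∈ S, a i) * b.prod = 1 →
    (∀ i ∈ S, ∀ k ∈ S, i ≠ k → theta p (a i / a k) ≠ 0) →
    ∑ i ∈ S, (b.map fun β => theta p (a i * β)).prod / ∏ k ∈ S.erase i, theta p (a i / a k) = 0 := by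
  induction n with
  | zero =>
    intro b S hS hb hb0 ha hprod hθ
    obtain ⟨i, k, hik, rfl⟩ := Finset.card_eq_two.1 hS
    obtain ⟨β, γ, rfl⟩ := List.length_eq_two.1 hb
    simp only [List.mem_cons, List.not_mem_nil, or_false, forall_eq_or_imp, forall_eq] at hb0
    have hi := ha i (by simp)
    have hk := ha k (by simp)
    rw [Finset.sum_pair hik, Finset.erase_insert (by simpa using hik), Finset.prod_singleton,
      Finset.pair_comm, Finset.erase_insert (by simpa using hik.symm), Finset.prod_singleton]
    rw [Finset.prod_pair hik] at hprod
    simp only [List.prod_cons, List.prod_nil, mul_one] at hprod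
    simp only [List.map_cons, List.map_nil, List.prod_cons, List.prod_nil, mul_one]
    have h1 : a k * γ = (a i * β)⁻¹ := by
      refine eq_inv_of_mul_eq_one_left ?_; rw [← hprod]; ring
    have h2 : a k * β = (a i * γ)⁻¹ := by
      refine eq_inv_of_mul_eq_one_left ?_; rw [← hprod]; ring
    rw [h1, h2, theta_inv hp (mul_ne_zero hi hb0.1), theta_inv hp (mul_ne_zero hi hb0.2),
      theta_div_swap hp hi hk]
    have h3 := hθ i (by simp) k (by simp) hik
    have hb1 := hb0.1
    have hb2 := hb0.2
    field_simp
    linear_combination (theta p (a i * β) * theta p (a i * γ)) * hprod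
  | succ n ih =>
    intro b S hS hb hb0 ha hprod hθ
    obtain ⟨β, b', rfl⟩ : ∃ β b', b = β :: b' := List.exists_cons_of_length_eq_add_one hb
    obtain ⟨γ, bs, rfl⟩ : ∃ γ bs, b' = γ :: bs :=
      List.exists_cons_of_length_eq_add_one (n := n + 1) (by simpa using hb)
    simp only [List.length_cons] at hb
    simp only [List.mem_cons, forall_eq_or_imp] at hb0
    obtain ⟨hβ, hγ, hbs⟩ := hb0
    simp only [List.prod_cons] at hprod
    set M := β * γ with hMdef
    have hM : M ≠ 0 := mul_ne_zero hβ hγ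
    set C : ι → ℂ := fun i =>
      (bs.map fun β => theta p (a i * β)).prod / ∏ k ∈ S.erase i, theta p (a i / a k) with hC
    set f : ℂ → ℂ := fun x => ∑ i ∈ S, C i * (theta p (a i * x) * theta p (a i * M / x)) with hf
    have hzero : ∀ l ∈ S, f (a l)⁻¹ = 0 := by
      intro l hl
      have hal := ha l hl
      have := ih (M * a l :: bs) (S.erase l) (by rw [Finset.card_erase_of_mem hl, hS]; rfl)
        (by simp; omega) (by
          simp only [List.mem_cons, forall_eq_or_imp]; exact ⟨mul_ne_zero hM hal, hbs⟩)
        (fun i hi => ha i (Finset.mem_of_mem_erase hi))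
        (by
          rw [← Finset.mul_prod_erase S a hl] at hprod
          rw [List.prod_cons, ← hprod, hMdef]; ring)
        (fun i hi k hk => hθ i (Finset.mem_of_mem_erase hi) k (Finset.mem_of_mem_erase hk))
      rw [hf, ← this]
      simp only
      rw [← Finset.add_sum_erase S _ hl, mul_inv_cancel₀ hal, theta_one hp, zero_mul, mul_zero,
        zero_add]
      refine Finset.sum_congr rfl fun i hi => ?_
      have hil := Finset.ne_of_mem_erase hi
      have hiS := Finset.mem_of_mem_erase hi
      have hli : l ∈ S.erase i := Finset.mem_erase.2 ⟨hil.symm, hl⟩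
      rw [hC]
      simp only [List.map_cons, List.prod_cons]
      rw [← Finset.mul_prod_erase (S.erase i) _ hli, Finset.erase_right_comm]
      have h1 : a i * (a l)⁻¹ = a i / a l := rfl
      have h2 : a i * M / (a l)⁻¹ = a i * (M * a l) := by rw [div_inv_eq_mul]; ring
      rw [h1, h2]
      have := hθ i hiS l hl hil
      rw [div_mul_eq_mul_div, mul_div_assoc]
      field_simp
    obtain ⟨r, hr, s, hs, h1, h2⟩ : ∃ r ∈ S, ∃ s ∈ S,
        theta p ((a r)⁻¹ * (a s)⁻¹ / M) ≠ 0 ∧ theta p ((a r)⁻¹ / (a s)⁻¹) ≠ 0 := by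
      obtain ⟨x, y, z, hx, hy, hz, hxy, hxz, hyz⟩ := Finset.two_lt_card_iff.1 (by omega : 2 < S.card)
      have hx0 := ha x hx
      have hy0 := ha y hy
      have hz0 := ha z hz
      have e : ∀ i k, (a i)⁻¹ / (a k)⁻¹ = a k / a i := fun i k => by
        rw [div_inv_eq_mul, mul_comm]; rfl
      by_cases h : theta p ((a x)⁻¹ * (a y)⁻¹ / M) = 0
      · refine ⟨x, hx, z, hz, fun h' => hθ z hz y hy hyz.symm ?_, ?_⟩
        · exact theta_zero_of_eq_zpow hp hp0 (by positivity) (by positivity)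
            (by field_simp) h h'
        · rw [e]; exact hθ z hz x hx hxz.symm
      · exact ⟨x, hx, y, hy, h, by rw [e]; exact hθ y hy x hx hxy.symm⟩
    have hr0 := inv_ne_zero (ha r hr)
    have hs0 := inv_ne_zero (ha s hs)
    have hfin : f β * (theta p ((a r)⁻¹ * (a s)⁻¹ / M) * theta p ((a r)⁻¹ / (a s)⁻¹)) =
        f (a s)⁻¹ * (theta p ((a r)⁻¹ * β / M) * theta p ((a r)⁻¹ / β)) +
        (a r)⁻¹ / β * (f (a r)⁻¹ * (theta p (β * (a s)⁻¹ / M) * theta p (β / (a s)⁻¹))) := by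
      simp only [hf, Finset.sum_mul, Finset.mul_sum, ← Finset.sum_add_distrib]
      refine Finset.sum_congr rfl fun i hi => ?_
      have := theta_interpolation hp hp0 (ha i hi) hM hr0 hs0 hβ
      linear_combination C i * this
    rw [hzero r hr, hzero s hs, zero_mul, zero_mul, mul_zero, add_zero] at hfin
    have hf0 : f β = 0 := (mul_eq_zero.1 hfin).resolve_right (mul_ne_zero h1 h2)
    rw [← hf0, hf]
    refine Finset.sum_congr rfl fun i hi => ?_
    have : a i * M / β = a i * γ := by rw [hMdef]; field_simp
    simp only [List.map_cons, List.prod_cons, hC, this]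
    ring

attribute [local irreducible] theta in
lemma theta_partial_fractions_five (hp : ‖p‖ < 1) (hp0 : p ≠ 0) {x₀ x₁ x₂ x₃ x₄ : ℂ}
    (b₀ b₁ b₂ b₃ b₄ : ℂ) (h : x₀ * x₁ * x₂ * x₃ * x₄ * (b₀ * b₁ * b₂ * b₃ * b₄) = 1)
    (h01 : theta p (x₀ / x₁) ≠ 0) (h02 : theta p (x₀ / x₂) ≠ 0) (h03 : theta p (x₀ / x₃) ≠ 0)
    (h04 : theta p (x₀ / x₄) ≠ 0) (h12 : theta p (x₁ / x₂) ≠ 0) (h13 : theta p (x₁ / x₃) ≠ 0)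
    (h14 : theta p (x₁ / x₄) ≠ 0) (h23 : theta p (x₂ / x₃) ≠ 0) (h24 : theta p (x₂ / x₄) ≠ 0)
    (h34 : theta p (x₃ / x₄) ≠ 0) (F : ℂ → ℂ)
    (hF : ∀ x, F x = theta p (x * b₀) * theta p (x * b₁) * theta p (x * b₂) * theta p (x * b₃) *
      theta p (x * b₄)) :
    F x₀ / (theta p (x₀ / x₁) * theta p (x₀ / x₂) * theta p (x₀ / x₃) * theta p (x₀ / x₄)) +
    F x₁ / (theta p (x₁ / x₀) * theta p (x₁ / x₂) * theta p (x₁ / x₃) * theta p (x₁ / x₄)) +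
    F x₂ / (theta p (x₂ / x₀) * theta p (x₂ / x₁) * theta p (x₂ / x₃) * theta p (x₂ / x₄)) +
    F x₃ / (theta p (x₃ / x₀) * theta p (x₃ / x₁) * theta p (x₃ / x₂) * theta p (x₃ / x₄)) +
    F x₄ / (theta p (x₄ / x₀) * theta p (x₄ / x₁) * theta p (x₄ / x₂) * theta p (x₄ / x₃)) = 0 := by
  have h0 : x₀ * x₁ * x₂ * x₃ * x₄ * (b₀ * b₁ * b₂ * b₃ * b₄) ≠ 0 := by rw [h]; exact one_ne_zero
  simp only [mul_ne_zero_iff] at h0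
  obtain ⟨⟨⟨⟨⟨k0, k1⟩, k2⟩, k3⟩, k4⟩, ⟨⟨⟨c0, c1⟩, c2⟩, c3⟩, c4⟩ := h0
  have swap : ∀ {x y : ℂ}, x ≠ 0 → y ≠ 0 → theta p (x / y) ≠ 0 → theta p (y / x) ≠ 0 := by
    intro x y hx hy h
    rw [theta_div_swap hp hx hy]
    exact mul_ne_zero (neg_ne_zero.2 (div_ne_zero hy hx)) h
  set a : Fin 5 → ℂ := ![x₀, x₁, x₂, x₃, x₄] with ha
  have ha0 : ∀ i, a i ≠ 0 := by intro i; fin_cases i <;> assumption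
  have hlt : ∀ i k : Fin 5, i < k → theta p (a i / a k) ≠ 0 := by
    intro i k hik
    fin_cases i <;> fin_cases k <;> first
      | exact absurd hik (by decide)
      | assumption
  have key := theta_partial_fractions hp hp0 a 3 [b₀, b₁, b₂, b₃, b₄] Finset.univ (by simp) (by simp)
    (by simp [c0, c1, c2, c3, c4]) (fun i _ => ha0 i)
    (by
      rw [Fin.prod_univ_five]
      simp only [List.prod_cons, List.prod_nil, mul_one]
      change x₀ * x₁ * x₂ * x₃ * x₄ * _ = 1
      rw [← h]; ring)
    (fun i _ k _ hik => (lt_or_gt_of_ne hik).elim (hlt i k)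
      fun h' => swap (ha0 k) (ha0 i) (hlt k i h'))
  have er : ∀ (i : Fin 5) (T : Finset (Fin 5)), Finset.univ.erase i = T →
      ∀ f : Fin 5 → ℂ, ∏ k ∈ Finset.univ.erase i, f k = ∏ k ∈ T, f k := by
    rintro i _ rfl f; rfl
  have hF' : ∀ x, ([b₀, b₁, b₂, b₃, b₄].map fun β => theta p (x * β)).prod = F x := fun x => by
    rw [hF]; simp only [List.map_cons, List.map_nil, List.prod_cons, List.prod_nil]; ring
  simp only [hF'] at key
  have four : ∀ (i j k l : Fin 5) (f : Fin 5 → ℂ), i ∉ ({j, k, l} : Finset (Fin 5)) →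
      j ∉ ({k, l} : Finset (Fin 5)) → k ≠ l →
      ∏ k ∈ {i, j, k, l}, f k = f i * f j * f k * f l := by
    intro i j k l f h1 h2 h3
    rw [Finset.prod_insert h1, Finset.prod_insert h2, Finset.prod_pair h3]; ring
  rw [Fin.sum_univ_five, er 0 {1, 2, 3, 4} (by decide), er 1 {0, 2, 3, 4} (by decide),
    er 2 {0, 1, 3, 4} (by decide), er 3 {0, 1, 2, 4} (by decide), er 4 {0, 1, 2, 3} (by decide),
    four _ _ _ _ _ (by decide) (by decide) (by decide),
    four _ _ _ _ _ (by decide) (by decide) (by decide),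
    four _ _ _ _ _ (by decide) (by decide) (by decide),
    four _ _ _ _ _ (by decide) (by decide) (by decide),
    four _ _ _ _ _ (by decide) (by decide) (by decide)] at key
  exact key

/-- The theta function identity behind the second contiguous relation. -/
lemma theta_eight_identity (hp : ‖p‖ < 1) (hp0 : p ≠ 0) {w : Fin 8 → ℂ} (hw : ∏ j, w j = p ^ 2)
    {z : ℂ} (hz : z ≠ 0) (hz2 : theta p (z ^ 2) ≠ 0)
    (h56 : theta p (w 5 / w 6) ≠ 0) (h57 : theta p (w 5 / w 7) ≠ 0) (h67 : theta p (w 6 / w 7) ≠ 0)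
    (hX : ∀ j, theta p (w j * z) ≠ 0 ∧ theta p (w j * z⁻¹) ≠ 0) :
    w 5 * theta p (w 6 / w 7) * (∏ k ∈ Finset.Iio (5 : Fin 8), theta p (w 5 * w k)) *
        (theta p (w 6 * z) * theta p (w 6 * z⁻¹) * (theta p (w 7 * z) * theta p (w 7 * z⁻¹))) -
      w 6 * theta p (w 5 / w 7) * (∏ k ∈ Finset.Iio (5 : Fin 8), theta p (w 6 * w k)) *
        (theta p (w 5 * z) * theta p (w 5 * z⁻¹) * (theta p (w 7 * z) * theta p (w 7 * z⁻¹))) -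
      w 5 * theta p (w 6 / w 5) * (∏ k ∈ Finset.Iio (5 : Fin 8), theta p (w 7 * w k)) *
        (theta p (w 5 * z) * theta p (w 5 * z⁻¹) * (theta p (w 6 * z) * theta p (w 6 * z⁻¹))) =
    w 6 * w 7 * (theta p (w 5 / w 6) * theta p (w 5 / w 7) * theta p (w 6 / w 7)) * z *
      ((z ^ 2)⁻¹ * ∏ j, theta p (w j * z) - z ^ 2 * ∏ j, theta p (w j * z⁻¹)) / theta p (z ^ 2) := by
  have hw0 : ∀ j, w j ≠ 0 := by
    have : ∏ j, w j ≠ 0 := by rw [hw]; exact pow_ne_zero _ hp0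
    exact fun j => Finset.prod_ne_zero_iff.1 this j (Finset.mem_univ j)
  have hIio : (Finset.Iio (5 : Fin 8)) = {0, 1, 2, 3, 4} := by decide
  have hF : ∀ x : ℂ, ∏ k ∈ Finset.Iio (5 : Fin 8), theta p (x * w k) =
      theta p (x * w 0) * theta p (x * w 1) * theta p (x * w 2) * theta p (x * w 3) *
        theta p (x * w 4) := fun x => by
    rw [hIio]; simp [mul_assoc]
  have hp2 : ∀ x, x ≠ 0 → theta p (x * (w 0 / p ^ 2)) = x ^ 2 * w 0 ^ 2 / p ^ 3 * theta p (x * w 0) := by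
    intro x hx
    have h0 := hw0 0
    have h1 := theta_p_mul hp hp0 (x := x * (w 0 / p ^ 2)) (by positivity)
    have h2 := theta_p_mul hp hp0 (x := p * (x * (w 0 / p ^ 2))) (by positivity)
    have e : p * (p * (x * (w 0 / p ^ 2))) = x * w 0 := by field_simp
    rw [e, h1] at h2
    rw [h2]; field_simp
  have swap : ∀ {x y : ℂ}, x ≠ 0 → y ≠ 0 → theta p (x / y) ≠ 0 → theta p (y / x) ≠ 0 := by
    intro x y hx hy h
    rw [theta_div_swap hp hx hy]
    exact mul_ne_zero (neg_ne_zero.2 (div_ne_zero hy hx)) h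
  have hzi : z⁻¹ ≠ 0 := inv_ne_zero hz
  have a1 : theta p (z / z⁻¹) ≠ 0 := by rwa [div_inv_eq_mul, ← sq]
  have a2 : ∀ j, theta p (z / w j) ≠ 0 := fun j => swap (hw0 j) hz (hX j).2
  have a3 : ∀ j, theta p (z⁻¹ / w j) ≠ 0 := fun j =>
    swap (hw0 j) hzi (by rw [div_inv_eq_mul]; exact (hX j).1)
  set F : ℂ → ℂ := fun x => theta p (x * (w 0 / p ^ 2)) * theta p (x * w 1) * theta p (x * w 2) *
    theta p (x * w 3) * theta p (x * w 4) with hFdef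
  have hw' := hw
  rw [Fin.prod_univ_eight] at hw'
  have key := theta_partial_fractions_five hp hp0 (x₀ := z) (x₁ := z⁻¹) (x₂ := w 5) (x₃ := w 6)
    (x₄ := w 7) (w 0 / p ^ 2) (w 1) (w 2) (w 3) (w 4)
    (by field_simp; linear_combination hw') a1 (a2 5) (a2 6) (a2 7) (a3 5) (a3 6) (a3 7)
    h56 h57 h67 F (fun x => rfl)
  have hFx : ∀ x, x ≠ 0 → F x = x ^ 2 * w 0 ^ 2 / p ^ 3 *
      ∏ k ∈ Finset.Iio (5 : Fin 8), theta p (x * w k) := by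
    intro x hx
    rw [hF, hFdef]
    simp only
    rw [hp2 x hx]; ring
  rw [hFx z hz, hFx _ hzi, hFx _ (hw0 5), hFx _ (hw0 6), hFx _ (hw0 7)] at key
  have b1 : ∀ j, theta p (z / w j) = -(z / w j) * theta p (w j * z⁻¹) := fun j => by
    rw [theta_div_swap hp (hw0 j) hz]; rfl
  have b2 : ∀ j, theta p (z⁻¹ / w j) = -(z⁻¹ / w j) * theta p (w j * z) := fun j => by
    rw [theta_div_swap hp (hw0 j) hzi, div_inv_eq_mul]
  have b3 : ∀ j, theta p (w j / z) = theta p (w j * z⁻¹) := fun j => rfl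
  have b4 : ∀ j, theta p (w j / z⁻¹) = theta p (w j * z) := fun j => by rw [div_inv_eq_mul]
  have b5 : theta p (z / z⁻¹) = theta p (z ^ 2) := by rw [div_inv_eq_mul, ← sq]
  have b6 : theta p (z⁻¹ / z) = -(z ^ 2)⁻¹ * theta p (z ^ 2) := by
    rw [← theta_inv hp (pow_ne_zero 2 hz), div_eq_mul_inv, sq, mul_inv]
  rw [b1, b1, b1, b2, b2, b2, b3, b3, b3, b4, b4, b4, b5, b6, theta_div_swap hp (hw0 5) (hw0 6),
    theta_div_swap hp (hw0 5) (hw0 7), theta_div_swap hp (hw0 6) (hw0 7)] at key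
  have e8 : ∀ x : ℂ, ∏ j, theta p (w j * x) = (∏ k ∈ Finset.Iio (5 : Fin 8), theta p (x * w k)) *
      (theta p (w 5 * x) * theta p (w 6 * x) * theta p (w 7 * x)) := fun x => by
    rw [hF, Fin.prod_univ_eight]; simp only [mul_comm x]; ring
  rw [e8 z, e8 z⁻¹, theta_div_swap hp (hw0 5) (hw0 6)]
  obtain ⟨x5, y5⟩ := hX 5
  obtain ⟨x6, y6⟩ := hX 6
  obtain ⟨x7, y7⟩ := hX 7
  have k5 := hw0 5
  have k6 := hw0 6
  have k7 := hw0 7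
  have k0 := hw0 0
  generalize (∏ k ∈ Finset.Iio (5 : Fin 8), theta p (z * w k)) = G1 at key ⊢
  generalize (∏ k ∈ Finset.Iio (5 : Fin 8), theta p (z⁻¹ * w k)) = G2 at key ⊢
  generalize (∏ k ∈ Finset.Iio (5 : Fin 8), theta p (w 5 * w k)) = G5 at key ⊢
  generalize (∏ k ∈ Finset.Iio (5 : Fin 8), theta p (w 6 * w k)) = G6 at key ⊢
  generalize (∏ k ∈ Finset.Iio (5 : Fin 8), theta p (w 7 * w k)) = G7 at key ⊢
  generalize theta p (w 5 * z) = X5 at *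
  generalize theta p (w 5 * z⁻¹) = Y5 at *
  generalize theta p (w 6 * z) = X6 at *
  generalize theta p (w 6 * z⁻¹) = Y6 at *
  generalize theta p (w 7 * z) = X7 at *
  generalize theta p (w 7 * z⁻¹) = Y7 at *
  generalize theta p (z ^ 2) = Z at *
  generalize theta p (w 5 / w 6) = T56 at *
  generalize theta p (w 5 / w 7) = T57 at *
  generalize theta p (w 6 / w 7) = T67 at *
  clear a1 a2 a3 b1 b2 b3 b4 b5 b6 e8 hFx hF hFdef hp2
  generalize w 5 = W5 at *
  generalize w 6 = W6 at *
  generalize w 7 = W7 at *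
  generalize w 0 = W0 at *
  field_simp at key ⊢
  refine mul_left_cancel₀ (mul_ne_zero (pow_ne_zero 2 k0) k5) ?_
  linear_combination key

end partialFractions

section contiguous

variable {p q : ℂ}

/-! ### Difference equations for the integrand -/

lemma kernel_update (hp : ‖p‖ < 1) (hq : ‖q‖ < 1) (hq0 : q ≠ 0) (s : Fin 8 → ℂ) (i : Fin 8) {z : ℂ}
    (h1 : dblPoch p q (s i * z) ≠ 0) (h2 : dblPoch p q (s i * z⁻¹) ≠ 0) :
    kernel p q (Function.update s i (q * s i)) z =
      theta p (s i * z) * theta p (s i * z⁻¹) * kernel p q s z := by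
  rw [kernel, kernel, ← Finset.mul_prod_erase _ _ (Finset.mem_univ i),
    ← Finset.mul_prod_erase Finset.univ (fun j => ellGamma p q (s j * z) * _) (Finset.mem_univ i)]
  have : ∀ j ∈ Finset.univ.erase i, ellGamma p q (Function.update s i (q * s i) j * z) *
      ellGamma p q (Function.update s i (q * s i) j * z⁻¹) =
      ellGamma p q (s j * z) * ellGamma p q (s j * z⁻¹) := fun j hj => by
    rw [Function.update_of_ne (Finset.ne_of_mem_erase hj)]
  rw [Finset.prod_congr rfl this, Function.update_self, mul_assoc q, mul_assoc q,
    ellGamma_q_mul hp hq hq0 h1, ellGamma_q_mul hp hq hq0 h2]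
  ring

lemma qShift_eq_update (q : ℂ) (t : Fin 8 → ℂ) {i j : Fin 8} (hij : i ≠ j) :
    qShift q t i j = Function.update (Function.update t j (q⁻¹ * t j)) i
      (q * Function.update t j (q⁻¹ * t j) i) := by
  rw [Function.update_of_ne hij, qShift, Function.update_comm hij]

lemma update_update_mul (hq0 : q ≠ 0) (t : Fin 8 → ℂ) (j : Fin 8) :
    Function.update (Function.update t j (q⁻¹ * t j)) j
      (q * Function.update t j (q⁻¹ * t j) j) = t := by
  rw [Function.update_self, mul_inv_cancel_left₀ hq0, Function.update_idem, Function.update_eq_self]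

/-- The difference equation for the integrand, cleared of denominators. -/
lemma kernel_first_relation (hp : ‖p‖ < 1) (hq : ‖q‖ < 1) (hp0 : p ≠ 0) (hq0 : q ≠ 0)
    {t : Fin 8 → ℂ} {z : ℂ} (ht : ∀ j, t j ≠ 0) (hz : z ≠ 0)
    (h5 : dblPoch p q (t 5 * z) ≠ 0 ∧ dblPoch p q (t 5 * z⁻¹) ≠ 0)
    (h6 : dblPoch p q (t 6 * z) ≠ 0 ∧ dblPoch p q (t 6 * z⁻¹) ≠ 0)
    (h7 : dblPoch p q (q⁻¹ * t 7 * z) ≠ 0 ∧ dblPoch p q (q⁻¹ * t 7 * z⁻¹) ≠ 0) :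
    theta p (q⁻¹ * t 7 * t 6) * theta p (q⁻¹ * t 7 / t 6) * kernel p q (qShift q t 5 7) z -
      theta p (t 5 * t 6) * theta p (t 5 / t 6) * kernel p q t z =
    t 5 / t 6 * (theta p (q⁻¹ * t 7 * t 5) * theta p (q⁻¹ * t 7 / t 5) *
      kernel p q (qShift q t 6 7) z) := by
  set s := Function.update t 7 (q⁻¹ * t 7) with hs
  have s5 : s 5 = t 5 := Function.update_of_ne (by decide) _ _
  have s6 : s 6 = t 6 := Function.update_of_ne (by decide) _ _
  have s7 : s 7 = q⁻¹ * t 7 := Function.update_self _ _ _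
  rw [qShift_eq_update q t (by decide : (5 : Fin 8) ≠ 7),
    qShift_eq_update q t (by decide : (6 : Fin 8) ≠ 7), ← hs]
  have hk : kernel p q t z = theta p (s 7 * z) * theta p (s 7 * z⁻¹) * kernel p q s z := by
    rw [← kernel_update hp hq hq0 s 7 (by rw [s7]; exact h7.1) (by rw [s7]; exact h7.2), hs,
      update_update_mul hq0]
  rw [hk, kernel_update hp hq hq0 s 5 (by rw [s5]; exact h5.1) (by rw [s5]; exact h5.2),
    kernel_update hp hq hq0 s 6 (by rw [s6]; exact h6.1) (by rw [s6]; exact h6.2), s5, s6, s7]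
  have h := theta_addition hp hp0 (x := q⁻¹ * t 7) (w := t 6) (y := t 5) (z := z) (ht 6)
    (mul_ne_zero (inv_ne_zero hq0) (ht 7)) (ht 5) hz
  simp only [div_eq_mul_inv _ z] at h
  linear_combination kernel p q s z * h

/-! ### Linear relations between values of `V` -/

lemma Separates.trace_ne_zero {P Q : Set ℂ} {C : Contour} (h : Separates P Q C) {z : ℂ}
    (hz : z ∈ trace C) : z ≠ 0 := fun h0 =>
  Set.disjoint_left.1 h.disjoint hz (Or.inl (Or.inl h0))

lemma Separates.dblPoch_ne_zero (hp : ‖p‖ < 1) (hq : ‖q‖ < 1) {T : Set ℂ} {C : Contour}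
    (h : Separates (innerPts p q T) (outerPts p q T) C) {z x : ℂ} (hz : z ∈ trace C) (hx : x ∈ T) :
    dblPoch p q (x * z) ≠ 0 ∧ dblPoch p q (x * z⁻¹) ≠ 0 := by
  have hz0 := h.trace_ne_zero hz
  have hd := Set.disjoint_left.1 h.disjoint hz
  rw [Ne, dblPoch_eq_zero_iff hp hq, Ne, dblPoch_eq_zero_iff hp hq]
  constructor
  · rintro ⟨a, b, he⟩
    refine hd (Or.inr ⟨x, hx, a, b, eq_inv_of_mul_eq_one_right ?_⟩)
    rw [← he]; ring
  · rintro ⟨a, b, he⟩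
    refine hd (Or.inl (Or.inr ⟨x, hx, a, b, ?_⟩))
    field_simp at he
    exact he.symm

lemma Separates.isSeparating {T : Set ℂ} {C : Contour} {t : Fin 8 → ℂ}
    (h : Separates (innerPts p q T) (outerPts p q T) C)
    (ht : ∀ j, ∃ x ∈ T, ∃ n : ℕ, t j = x * q ^ n) : IsSeparating p q t C := by
  refine isSeparating_iff.2 (h.mono ?_ ?_)
  · rintro _ ⟨_, ⟨j, rfl⟩, a, b, rfl⟩
    obtain ⟨x, hx, n, hn⟩ := ht j
    exact ⟨x, hx, a, n + b, by rw [hn]; ring⟩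
  · rintro _ ⟨_, ⟨j, rfl⟩, a, b, rfl⟩
    obtain ⟨x, hx, n, hn⟩ := ht j
    exact ⟨x, hx, a, n + b, by rw [hn]; ring⟩

lemma Admissible.of_mul_pow {w t : Fin 8 → ℂ} (h : Admissible p q w)
    (ht : ∀ j, ∃ n : ℕ, t j = w j * q ^ n) : Admissible p q t := by
  intro j k a b he
  obtain ⟨n, hn⟩ := ht j
  obtain ⟨m, hm⟩ := ht k
  refine h j k a (n + m + b) ?_
  rw [← he, hn, hm]; ring

lemma continuousOn_kernel (hp : ‖p‖ < 1) (hq : ‖q‖ < 1) {t : Fin 8 → ℂ} (ht : ∀ j, t j ≠ 0)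
    {C : Contour} (hC : IsSeparating p q t C) :
    ContinuousOn (fun z => kernelNum p q t z / kernelDen p q t z) (trace C) := by
  intro z hz
  have hsep := isSeparating_iff.1 hC
  have hz0 := hsep.trace_ne_zero hz
  have hd := Set.disjoint_left.1 hsep.disjoint hz
  refine ((continuousAt_kernelNum hp hq (T := fun _ => t) continuousAt_const ht continuousAt_id hz0).div
    (continuousAt_kernelDen hp hq (T := fun _ => t) continuousAt_const continuousAt_id hz0)
    fun h0 => ?_).continuousWithinAt
  exact (kernelDen_eq_zero hp hq hz0 h0).elim (fun h' => hd (Or.inl (Or.inr h')))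
    fun h' => hd (Or.inr h')

lemma V_linear_combination (hp : ‖p‖ < 1) (hq : ‖q‖ < 1) (hp0 : p ≠ 0) (hq0 : q ≠ 0)
    {t₁ t₂ t₃ : Fin 8 → ℂ} (h₁ : ∀ j, t₁ j ≠ 0) (h₂ : ∀ j, t₂ j ≠ 0) (h₃ : ∀ j, t₃ j ≠ 0)
    {C : Contour} (s₁ : IsSeparating p q t₁ C) (s₂ : IsSeparating p q t₂ C)
    (s₃ : IsSeparating p q t₃ C) (c₁ c₂ c₃ : ℂ) {B : Set ℂ} (hB : B.Countable) {G : ℂ → ℂ}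
    (h : ∀ z ∈ trace C, z ∉ B →
      c₁ * kernel p q t₁ z + c₂ * kernel p q t₂ z + c₃ * kernel p q t₃ z = z * G z) :
    c₁ * V p q t₁ + c₂ * V p q t₂ + c₃ * V p q t₃ = kappa p q * contourIntegral C G := by
  obtain ⟨B', hB', hk⟩ := kernel_div_eq hp hq hp0 hq0
  have k₁ := continuousOn_kernel hp hq h₁ s₁
  have k₂ := continuousOn_kernel hp hq h₂ s₂
  have k₃ := continuousOn_kernel hp hq h₃ s₃
  rw [V_eq hp hq hp0 hq0 h₁ s₁, V_eq hp hq hp0 hq0 h₂ s₂, V_eq hp hq hp0 hq0 h₃ s₃,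
    contourIntegral_kernel hp hq hp0 hq0, contourIntegral_kernel hp hq hp0 hq0,
    contourIntegral_kernel hp hq hp0 hq0]
  rw [mul_left_comm c₁, mul_left_comm c₂, mul_left_comm c₃, ← mul_add, ← mul_add,
    ← contourIntegral_const_mul, ← contourIntegral_const_mul, ← contourIntegral_const_mul,
    ← contourIntegral_add (k₁.const_mul c₁) (k₂.const_mul c₂),
    ← contourIntegral_add (f := fun z => c₁ * (kernelNum p q t₁ z / kernelDen p q t₁ z) +
      c₂ * (kernelNum p q t₂ z / kernelDen p q t₂ z))
      ((k₁.const_mul c₁).add (k₂.const_mul c₂)) (k₃.const_mul c₃)]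
  congr 1
  refine contourIntegral_congr_countable (hB.union hB') fun z hz hzB => ?_
  simp only [Set.mem_union, not_or] at hzB
  have hz0 := (isSeparating_iff.1 s₁).trace_ne_zero hz
  rw [← hk t₁ z hzB.2, ← hk t₂ z hzB.2, ← hk t₃ z hzB.2]
  have := h z hz hzB.1
  field_simp
  rw [this]

lemma qShift_ne_zero (hq0 : q ≠ 0) {t : Fin 8 → ℂ} (ht : ∀ j, t j ≠ 0) (i k j : Fin 8) :
    qShift q t i k j ≠ 0 := by
  rw [qShift, Function.update_apply, Function.update_apply]
  split_ifs
  · exact mul_ne_zero (inv_ne_zero hq0) (ht _)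
  · exact mul_ne_zero hq0 (ht _)
  · exact ht _

/-- The first contiguous relation. -/
theorem V_first_contiguous (hp : ‖p‖ < 1) (hq : ‖q‖ < 1) (hp0 : p ≠ 0) (hq0 : q ≠ 0)
    {t : Fin 8 → ℂ} (ht : ∀ j, t j ≠ 0) (h : Admissible p q t)
    (h₁ : Admissible p q (qShift q t 5 7)) (h₂ : Admissible p q (qShift q t 6 7)) :
    t 6 * (theta p (t 7 * t 6 / q) * theta p (t 7 / (q * t 6))) * V p q (qShift q t 5 7) -
      t 5 * (theta p (t 7 * t 5 / q) * theta p (t 7 / (q * t 5))) * V p q (qShift q t 6 7) =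
    t 6 * (theta p (t 5 * t 6) * theta p (t 5 / t 6)) * V p q t := by
  set x := q⁻¹ * t 7 with hx
  have hx0 : x ≠ 0 := mul_ne_zero (inv_ne_zero hq0) (ht 7)
  have hx7 : ∀ i, i ≠ 7 → qShift q t i 7 7 = x := fun i _ => Function.update_self _ _ _
  have hxj : ∀ i j, j ≠ i → j ≠ 7 → qShift q t i 7 j = t j := fun i j h1 h2 => by
    rw [qShift, Function.update_of_ne h2, Function.update_of_ne h1]
  have hxx : ∀ a b : ℕ, x * x * p ^ a * q ^ b ≠ 1 := fun a b => by
    have := h₁ 7 7 a b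
    rwa [hx7 5 (by decide)] at this
  have hxt : ∀ (j : Fin 8) (a b : ℕ), x * t j * p ^ a * q ^ b ≠ 1 := by
    intro j a b
    by_cases h7 : j = 7
    · subst h7
      have := hxx a (b + 1)
      have e : t 7 = q * x := by rw [hx, mul_inv_cancel_left₀ hq0]
      rw [e]
      convert this using 1; ring
    · by_cases h5 : j = 5
      · have := h₂ 7 j a b
        rwa [hx7 6 (by decide), hxj 6 j (by rw [h5]; decide) h7] at this
      · have := h₁ 7 j a b
        rwa [hx7 5 (by decide), hxj 5 j h5 h7] at this
  obtain ⟨C, hC⟩ := exists_separates_pts hp hq hp0 hq0 (T := insert x (Set.range t))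
    ((Set.finite_range t).insert x)
    (by rintro y (rfl | ⟨j, rfl⟩); exacts [hx0, ht j])
    (by
      rintro y (rfl | ⟨j, rfl⟩) z (rfl | ⟨k, rfl⟩) a b
      · exact hxx a b
      · exact hxt k a b
      · rw [mul_comm (t j)]; exact hxt j a b
      · exact h j k a b)
  have hmem : ∀ j, t j ∈ insert x (Set.range t) := fun j => Or.inr ⟨j, rfl⟩
  have sep : ∀ i, i ≠ 7 → IsSeparating p q (qShift q t i 7) C := by
    refine fun i hi => hC.isSeparating fun j => ?_
    by_cases h7 : j = 7
    · subst h7; exact ⟨x, Or.inl rfl, 0, by rw [hx7 i hi]; simp⟩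
    · by_cases hij : j = i
      · subst hij
        refine ⟨t j, hmem j, 1, ?_⟩
        rw [qShift, Function.update_of_ne h7, Function.update_self]; ring
      · exact ⟨t j, hmem j, 0, by rw [hxj i j hij h7]; simp⟩
  have := V_linear_combination hp hq hp0 hq0 (qShift_ne_zero hq0 ht 5 7) (qShift_ne_zero hq0 ht 6 7) ht
    (sep 5 (by decide)) (sep 6 (by decide)) (hC.isSeparating fun j => ⟨t j, hmem j, 0, by simp⟩)
    (t 6 * (theta p (t 7 * t 6 / q) * theta p (t 7 / (q * t 6))))
    (-(t 5 * (theta p (t 7 * t 5 / q) * theta p (t 7 / (q * t 5)))))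
    (-(t 6 * (theta p (t 5 * t 6) * theta p (t 5 / t 6)))) Set.countable_empty (G := fun _ => 0)
    (fun z hz _ => by
      have := kernel_first_relation hp hq hp0 hq0 ht (hC.trace_ne_zero hz)
        (hC.dblPoch_ne_zero hp hq hz (hmem 5)) (hC.dblPoch_ne_zero hp hq hz (hmem 6))
        (hC.dblPoch_ne_zero hp hq hz (Or.inl rfl))
      have e1 : ∀ y, t 7 * y / q = q⁻¹ * t 7 * y := fun y => by field_simp
      have e2 : ∀ y, t 7 / (q * y) = q⁻¹ * t 7 / y := fun y => by field_simp
      have h6 : t 5 / t 6 * t 6 = t 5 := div_mul_cancel₀ _ (ht 6)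
      rw [e1, e1, e2, e2]
      linear_combination t 6 * this + theta p (q⁻¹ * t 7 * t 5) * theta p (q⁻¹ * t 7 / t 5) *
        kernel p q (qShift q t 6 7) z * h6)
  have h0 : contourIntegral C (fun _ => (0 : ℂ)) = 0 := by
    simpa using contourIntegral_const_mul C 0 fun _ => 0
  rw [h0, mul_zero] at this
  linear_combination this

/-! ### The second contiguous relation -/

/-- A contour multiplied by a constant. -/
def ClosedCurve.scale (c : ℂ) (γ : ClosedCurve) : ClosedCurve where
  toFun s := c * γ.toFun s
  contDiff := contDiff_const.mul γ.contDiff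
  periodic s := by
    change c * γ.toFun (s + 1) = c * γ.toFun s
    rw [γ.periodic]

def scaleContour (c : ℂ) (C : Contour) : Contour := C.map (ClosedCurve.scale c)

lemma contourIntegral_scale (c : ℂ) (C : Contour) (f : ℂ → ℂ) :
    contourIntegral (scaleContour c C) f = contourIntegral C fun z => c * f (c * z) := by
  induction C with
  | nil => rfl
  | cons γ C ih =>
    have : scaleContour c (γ :: C) = γ.scale c :: scaleContour c C := rfl
    rw [this, contourIntegral_cons, contourIntegral_cons, ih]
    congr 1
    have hd : ∀ s, deriv (γ.scale c).toFun s = c * deriv γ.toFun s := fun s =>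
      ((γ.hasDerivAt s).const_mul c).deriv
    rw [ClosedCurve.integral, ClosedCurve.integral]
    simp only [hd]
    refine intervalIntegral.integral_congr fun s _ => ?_
    simp only [ClosedCurve.scale]; ring

lemma trace_scale {c : ℂ} (hc : c ≠ 0) {C : Contour} {z : ℂ} (hz : z ∈ trace (scaleContour c C)) :
    c⁻¹ * z ∈ trace C := by
  obtain ⟨_, hγ', s, rfl⟩ := hz
  obtain ⟨γ, hγ, rfl⟩ := List.mem_map.1 hγ'
  exact ⟨γ, hγ, s, by simp [ClosedCurve.scale, hc]⟩

lemma contourIndex_scale {c : ℂ} (hc : c ≠ 0) (C : Contour) (w : ℂ) :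
    contourIndex (scaleContour c C) w = contourIndex C (c⁻¹ * w) := by
  rw [contourIndex, contourIndex, contourIntegral_scale]
  congr 2; ext z
  have : c * z - w = c * (z - c⁻¹ * w) := by field_simp
  rw [this, mul_inv, mul_inv_cancel_left₀ hc]

/-- The coboundary is the quotient of `coboundaryNum` and `coboundaryDen`. -/
noncomputable def coboundaryNum (p q : ℂ) (w : Fin 8 → ℂ) (z : ℂ) : ℂ :=
  theta q (z⁻¹ ^ 2) *
    ∏ j, dblPoch p q ((q * w j * z)⁻¹ * p * q) * dblPoch p q ((w j * z⁻¹)⁻¹ * p * q)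

noncomputable def coboundaryDen (p q : ℂ) (w : Fin 8 → ℂ) (z : ℂ) : ℂ :=
  z ^ 2 * ∏ j, dblPoch p q (q * w j * z) * dblPoch p q (w j * z⁻¹)

lemma differentiableAt_coboundaryNum (hp : ‖p‖ < 1) (hq : ‖q‖ < 1) (hq0 : q ≠ 0) {w : Fin 8 → ℂ}
    (hw : ∀ j, w j ≠ 0) {z : ℂ} (hz : z ≠ 0) : DifferentiableAt ℂ (coboundaryNum p q w) z := by
  have hA := differentiable_dblPoch hp hq
  have h2 : ∀ {f : ℂ → ℂ}, DifferentiableAt ℂ f z → DifferentiableAt ℂ (fun u => dblPoch p q (f u)) z :=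
    fun {f} hf => (hA (f z)).comp z hf
  have hZi := (differentiableAt_fun_id (𝕜 := ℂ) (x := z)).fun_inv hz
  have hT : DifferentiableAt ℂ (fun z => theta q (z⁻¹ ^ 2)) z :=
    DifferentiableAt.comp z (g := theta q) (f := fun z => z⁻¹ ^ 2)
      (differentiableAt_theta hq (pow_ne_zero _ (inv_ne_zero hz))) (hZi.fun_pow 2)
  refine hT.mul (.fun_finsetProd fun j _ => .mul (h2 ?_) (h2 ?_))
  · exact (((differentiableAt_fun_id.const_mul _).fun_inv
      (mul_ne_zero (mul_ne_zero hq0 (hw j)) hz)).mul_const p).mul_const q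
  · exact (((hZi.const_mul _).fun_inv (mul_ne_zero (hw j) (inv_ne_zero hz))).mul_const p).mul_const q

lemma differentiableAt_coboundaryDen (hp : ‖p‖ < 1) (hq : ‖q‖ < 1) (w : Fin 8 → ℂ) {z : ℂ}
    (hz : z ≠ 0) : DifferentiableAt ℂ (coboundaryDen p q w) z := by
  have hA := differentiable_dblPoch hp hq
  have h2 : ∀ {f : ℂ → ℂ}, DifferentiableAt ℂ f z → DifferentiableAt ℂ (fun u => dblPoch p q (f u)) z :=
    fun {f} hf => (hA (f z)).comp z hf
  have hZi := (differentiableAt_fun_id (𝕜 := ℂ) (x := z)).fun_inv hz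
  exact (differentiableAt_fun_id.fun_pow 2).mul (.fun_finsetProd fun j _ =>
    .mul (h2 (differentiableAt_fun_id.const_mul _)) (h2 (hZi.const_mul _)))

lemma coboundaryDen_eq_zero (hp : ‖p‖ < 1) (hq : ‖q‖ < 1) {w : Fin 8 → ℂ} {z : ℂ} (hz : z ≠ 0)
    (h : coboundaryDen p q w z = 0) :
    z ∈ innerPts p q (Set.range w) ∪ outerPts p q (Set.range fun j => q * w j) := by
  rw [coboundaryDen, mul_eq_zero, or_iff_right (pow_ne_zero _ hz), Finset.prod_eq_zero_iff] at h
  obtain ⟨j, -, h⟩ := h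
  rw [mul_eq_zero, dblPoch_eq_zero_iff hp hq, dblPoch_eq_zero_iff hp hq] at h
  rcases h with ⟨a, b, h⟩ | ⟨a, b, h⟩
  · refine Or.inr ⟨_, ⟨j, rfl⟩, a, b, eq_inv_of_mul_eq_one_right ?_⟩
    rw [← h]; ring
  · refine Or.inl ⟨_, ⟨j, rfl⟩, a, b, ?_⟩
    field_simp at h
    exact h.symm

/-- The integral of a coboundary vanishes. -/
lemma contourIntegral_coboundary (hp : ‖p‖ < 1) (hq : ‖q‖ < 1) (hq0 : q ≠ 0)
    {w : Fin 8 → ℂ} (hw : ∀ j, w j ≠ 0) {C : Contour} (hC : IsSeparating p q w C) :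
    contourIntegral C (fun z => coboundaryNum p q w z / coboundaryDen p q w z -
      q⁻¹ * (coboundaryNum p q w (q⁻¹ * z) / coboundaryDen p q w (q⁻¹ * z))) = 0 := by
  have hsep := isSeparating_iff.1 hC
  set P := innerPts p q (Set.range w) with hP
  set Q := outerPts p q (Set.range fun j => q * w j) with hQ
  have hqi := inv_ne_zero hq0
  have hs1 : Separates P Q C := hsep.mono le_rfl (by
    rintro _ ⟨_, ⟨j, rfl⟩, a, b, rfl⟩
    exact ⟨w j, ⟨j, rfl⟩, a, b + 1, by ring⟩)
  have hPq : ∀ y ∈ P, q * y ∈ innerPts p q (Set.range w) := by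
    rintro _ ⟨x, hx, a, b, rfl⟩
    exact ⟨x, hx, a, b + 1, by ring⟩
  have hQq : ∀ y ∈ Q, q * y ∈ outerPts p q (Set.range w) := by
    rintro _ ⟨_, ⟨j, rfl⟩, a, b, rfl⟩
    refine ⟨w j, ⟨j, rfl⟩, a, b, ?_⟩
    simp only [mul_inv]
    field_simp
  have hs2 : Separates P Q (scaleContour q⁻¹ C) := by
    refine ⟨Set.disjoint_left.2 fun y hy hyS => ?_, ?_, fun y hy => ?_, fun y hy => ?_⟩
    · have hy' := trace_scale hqi hy
      rw [inv_inv] at hy'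
      refine Set.disjoint_left.1 hsep.disjoint hy' ?_
      rcases hyS with (rfl | h) | h
      · exact Or.inl (Or.inl (mul_zero q))
      · exact Or.inl (Or.inr (hPq y h))
      · exact Or.inr (hQq y h)
    · rw [contourIndex_scale hqi, mul_zero, hsep.index_zero]
    · rw [contourIndex_scale hqi, inv_inv]; exact hsep.index_inner _ (hPq y hy)
    · rw [contourIndex_scale hqi, inv_inv]; exact hsep.index_outer _ (hQq y hy)
  have hcont : ∀ {C : Contour}, Separates P Q C →
      ∀ z ∈ trace C, ContinuousAt (fun z => coboundaryNum p q w z / coboundaryDen p q w z) z := by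
    intro C hC z hz
    have hz0 := hC.trace_ne_zero hz
    refine (differentiableAt_coboundaryNum hp hq hq0 hw hz0).continuousAt.div
      (differentiableAt_coboundaryDen hp hq w hz0).continuousAt fun h0 => ?_
    have hd := Set.disjoint_left.1 hC.disjoint hz
    exact (coboundaryDen_eq_zero hp hq hz0 h0).elim (fun h => hd (Or.inl (Or.inr h)))
      fun h => hd (Or.inr h)
  have hcount := Set.finite_range w
  rw [contourIntegral_sub (fun z hz => (hcont hs1 z hz).continuousWithinAt), sub_eq_zero,
    ← contourIntegral_scale q⁻¹ C (fun z => coboundaryNum p q w z / coboundaryDen p q w z)]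
  · exact contourIntegral_div_eq_of_separates (countable_innerPts (Set.countable_range _))
      (countable_outerPts (Set.countable_range _)) hs1 hs2
      (fun z hz => differentiableAt_coboundaryNum hp hq hq0 hw hz)
      (fun z hz => differentiableAt_coboundaryDen hp hq w hz)
      fun z hz h => coboundaryDen_eq_zero hp hq hz h
  · intro z hz
    have hz' : q⁻¹ * z ∈ trace (scaleContour q⁻¹ C) := by
      obtain ⟨γ, hγ, s, rfl⟩ := hz
      exact ⟨γ.scale q⁻¹, List.mem_map.2 ⟨γ, hγ, rfl⟩, s, rfl⟩
    exact (((hcont hs2 _ hz').comp (f := fun z => q⁻¹ * z) (by fun_prop)).const_mul q⁻¹).continuousWithinAt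

lemma inv_ellGamma_eq_theta (hp : ‖p‖ < 1) (hq : ‖q‖ < 1) {z : ℂ}
    (h1 : dblPoch p q (p * q * z) ≠ 0) (h2 : dblPoch p q (p * q * z⁻¹) ≠ 0) :
    (ellGamma p q z * ellGamma p q z⁻¹)⁻¹ = theta p z * theta q z⁻¹ := by
  rw [inv_ellGamma_eq hp hq h1 h2, theta, theta, div_inv_eq_mul, qPoch_eq hp z⁻¹,
    qPoch_eq hq z⁻¹, div_eq_mul_inv]
  ring

lemma coboundary_eq (hp : ‖p‖ < 1) (hq : ‖q‖ < 1) (hq0 : q ≠ 0) {w : Fin 8 → ℂ} {z : ℂ}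
    (h1 : dblPoch p q (p * q * z ^ 2) ≠ 0) (h2 : dblPoch p q (p * q * (z ^ 2)⁻¹) ≠ 0)
    (h3 : theta p (z ^ 2) ≠ 0) (h4 : ∀ j, dblPoch p q (w j * z) ≠ 0) :
    coboundaryNum p q w z / coboundaryDen p q w z =
      kernel p q w z * ((z ^ 2)⁻¹ * ∏ j, theta p (w j * z)) / theta p (z ^ 2) := by
  have e : coboundaryNum p q w z / coboundaryDen p q w z = theta q (z⁻¹ ^ 2) / z ^ 2 *
      ∏ j, ellGamma p q (q * (w j * z)) * ellGamma p q (w j * z⁻¹) := by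
    simp only [coboundaryNum, coboundaryDen, ellGamma_eq, Finset.prod_mul_distrib,
      Finset.prod_div_distrib, ← mul_assoc q]
    rw [div_mul_div_comm, div_mul_div_comm]
  rw [e, kernel, inv_pow, div_eq_mul_inv _ (ellGamma p q (z ^ 2) * _),
    inv_ellGamma_eq_theta hp hq h1 h2]
  have : ∀ j, ellGamma p q (q * (w j * z)) = theta p (w j * z) * ellGamma p q (w j * z) := fun j =>
    ellGamma_q_mul hp hq hq0 (h4 j)
  simp only [this, Finset.prod_mul_distrib]
  field_simp

lemma coboundary_shift_eq (hp : ‖p‖ < 1) (hq : ‖q‖ < 1) (hq0 : q ≠ 0) {w : Fin 8 → ℂ} {z : ℂ}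
    (hz : z ≠ 0)
    (h1 : dblPoch p q (p * q * z ^ 2) ≠ 0) (h2 : dblPoch p q (p * q * (z ^ 2)⁻¹) ≠ 0)
    (h3 : theta p (z ^ 2) ≠ 0) (h4 : ∀ j, dblPoch p q (w j * z⁻¹) ≠ 0) :
    q⁻¹ * (coboundaryNum p q w (q⁻¹ * z) / coboundaryDen p q w (q⁻¹ * z)) =
      kernel p q w z * (z ^ 2 * ∏ j, theta p (w j * z⁻¹)) / theta p (z ^ 2) := by
  have a1 : ∀ j, q * w j * (q⁻¹ * z) = w j * z := fun j => by field_simp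
  have a2 : ∀ j, w j * (q⁻¹ * z)⁻¹ = q * (w j * z⁻¹) := fun j => by
    rw [mul_inv, inv_inv]; ring
  have a3 : (q⁻¹ * z)⁻¹ ^ 2 = q * (q * (z ^ 2)⁻¹) := by rw [mul_inv, inv_inv]; ring
  have hz2 : (z ^ 2)⁻¹ ≠ 0 := inv_ne_zero (pow_ne_zero _ hz)
  have e : coboundaryNum p q w (q⁻¹ * z) / coboundaryDen p q w (q⁻¹ * z) =
      theta q (q * (q * (z ^ 2)⁻¹)) / (q⁻¹ * z) ^ 2 *
      ∏ j, ellGamma p q (w j * z) * ellGamma p q (q * (w j * z⁻¹)) := by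
    simp only [coboundaryNum, coboundaryDen, ellGamma_eq, Finset.prod_mul_distrib,
      Finset.prod_div_distrib, a1, a2, a3]
    rw [div_mul_div_comm, div_mul_div_comm]
  rw [e, kernel, inv_pow, div_eq_mul_inv _ (ellGamma p q (z ^ 2) * _),
    inv_ellGamma_eq_theta hp hq h1 h2, theta_p_mul hq hq0 (mul_ne_zero hq0 hz2),
    theta_p_mul hq hq0 hz2]
  have : ∀ j, ellGamma p q (q * (w j * z⁻¹)) = theta p (w j * z⁻¹) * ellGamma p q (w j * z⁻¹) :=
    fun j => ellGamma_q_mul hp hq hq0 (h4 j)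
  simp only [this, Finset.prod_mul_distrib]
  field_simp

end contiguous

section secondContiguous

variable {p q : ℂ}

lemma countable_theta_zeros (hp : ‖p‖ < 1) (hp0 : p ≠ 0) : {x : ℂ | theta p x = 0}.Countable := by
  refine ((Set.countable_singleton (0 : ℂ)).union (countable_zpow p)).mono fun x hx => ?_
  by_cases h0 : x = 0
  · exact Or.inl h0
  · exact Or.inr ((theta_eq_zero_iff hp hp0 h0).1 hx)

/-- The parameters `w` with `w_i`, `w_k` multiplied by `q`. -/
def mulPair (q : ℂ) (w : Fin 8 → ℂ) (i k : Fin 8) : Fin 8 → ℂ :=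
  Function.update (Function.update w i (q * w i)) k (q * w k)

lemma mulPair_eq_mul_pow (q : ℂ) (w : Fin 8 → ℂ) (i k j : Fin 8) :
    ∃ n : ℕ, mulPair q w i k j = w j * q ^ n := by
  rw [mulPair, Function.update_apply, Function.update_apply]
  split_ifs with h1 h2
  · exact ⟨1, by rw [h1]; ring⟩
  · exact ⟨1, by rw [h2]; ring⟩
  · exact ⟨0, by simp⟩

/-- The second contiguous relation for generic parameters. -/
lemma V_second_contiguous_generic (hp : ‖p‖ < 1) (hq : ‖q‖ < 1) (hp0 : p ≠ 0) (hq0 : q ≠ 0)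
    {w : Fin 8 → ℂ} (hw : ∏ j, w j = p ^ 2) (h : Admissible p q w)
    (h56 : theta p (w 5 / w 6) ≠ 0) (h57 : theta p (w 5 / w 7) ≠ 0)
    (h67 : theta p (w 6 / w 7) ≠ 0) :
    w 5 * theta p (w 6 / w 7) * (∏ k ∈ Finset.Iio (5 : Fin 8), theta p (w 5 * w k)) *
        V p q (mulPair q w 6 7) -
      w 6 * theta p (w 5 / w 7) * (∏ k ∈ Finset.Iio (5 : Fin 8), theta p (w 6 * w k)) *
        V p q (mulPair q w 5 7) =
      w 5 * theta p (w 6 / w 5) * (∏ k ∈ Finset.Iio (5 : Fin 8), theta p (w 7 * w k)) *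
        V p q (mulPair q w 5 6) := by
  have hw0 : ∀ j, w j ≠ 0 := by
    have : ∏ j, w j ≠ 0 := by rw [hw]; exact pow_ne_zero _ hp0
    exact fun j => Finset.prod_ne_zero_iff.1 this j (Finset.mem_univ j)
  obtain ⟨C, hC⟩ := exists_isSeparating hp hq hp0 hq0 hw0 h
  have hsep := isSeparating_iff.1 hC
  have hK : ∀ i k, IsSeparating p q (mulPair q w i k) C := fun i k => hsep.isSeparating fun j =>
    ⟨w j, ⟨j, rfl⟩, mulPair_eq_mul_pow q w i k j⟩
  have hK0 : ∀ i k j, mulPair q w i k j ≠ 0 := fun i k j => by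
    obtain ⟨n, hn⟩ := mulPair_eq_mul_pow q w i k j
    rw [hn]; exact mul_ne_zero (hw0 j) (pow_ne_zero _ hq0)
  have hker : ∀ i k, i ≠ k → ∀ z ∈ trace C, kernel p q (mulPair q w i k) z =
      theta p (w i * z) * theta p (w i * z⁻¹) * (theta p (w k * z) * theta p (w k * z⁻¹)) *
        kernel p q w z := by
    intro i k hik z hz
    have hk : Function.update w i (q * w i) k = w k := Function.update_of_ne hik.symm _ _
    have d := fun j => hsep.dblPoch_ne_zero hp hq hz ⟨j, rfl⟩
    have := kernel_update hp hq hq0 (Function.update w i (q * w i)) k (z := z)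
      (by rw [hk]; exact (d k).1) (by rw [hk]; exact (d k).2)
    rw [hk, kernel_update hp hq hq0 w i (d i).1 (d i).2] at this
    rw [mulPair, this]; ring
  have ct := countable_theta_zeros hp hp0
  have cd := countable_mul_preimage (countable_dblPoch_zeros hp hq) (mul_ne_zero hp0 hq0)
  have cinv : ∀ {B : Set ℂ}, B.Countable → {z : ℂ | z⁻¹ ∈ B}.Countable := fun hB =>
    hB.preimage inv_injective
  set B : Set ℂ := {z | z ^ 2 ∈ {x | theta p x = 0}} ∪
    {z | z ^ 2 ∈ {z | p * q * z ∈ {z | dblPoch p q z = 0}}} ∪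
    {z | z ^ 2 ∈ {z | z⁻¹ ∈ {z | p * q * z ∈ {z | dblPoch p q z = 0}}}} ∪
    (⋃ j, ({z | w j * z ∈ {x | theta p x = 0}} ∪
      {z | z⁻¹ ∈ {z | w j * z ∈ {x | theta p x = 0}}})) with hB
  have hBc : B.Countable :=
    (((countable_pow_preimage ct two_ne_zero).union (countable_pow_preimage cd two_ne_zero)).union
      (countable_pow_preimage (cinv cd) two_ne_zero)).union
      (Set.countable_iUnion fun j => (countable_mul_preimage ct (hw0 j)).union
        (cinv (countable_mul_preimage ct (hw0 j))))
  set c := w 6 * w 7 * (theta p (w 5 / w 6) * theta p (w 5 / w 7) * theta p (w 6 / w 7)) with hc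
  have key := V_linear_combination hp hq hp0 hq0 (hK0 6 7) (hK0 5 7) (hK0 5 6) (hK 6 7) (hK 5 7)
    (hK 5 6)
    (w 5 * theta p (w 6 / w 7) * (∏ k ∈ Finset.Iio (5 : Fin 8), theta p (w 5 * w k)))
    (-(w 6 * theta p (w 5 / w 7) * (∏ k ∈ Finset.Iio (5 : Fin 8), theta p (w 6 * w k))))
    (-(w 5 * theta p (w 6 / w 5) * (∏ k ∈ Finset.Iio (5 : Fin 8), theta p (w 7 * w k))))
    hBc (G := fun z => c * (coboundaryNum p q w z / coboundaryDen p q w z -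
      q⁻¹ * (coboundaryNum p q w (q⁻¹ * z) / coboundaryDen p q w (q⁻¹ * z))))
    (fun z hz hzB => by
      simp only [hB, Set.mem_union, Set.mem_iUnion, Set.mem_ofPred_eq, not_or, not_exists] at hzB
      obtain ⟨⟨⟨b1, b2⟩, b3⟩, b4⟩ := hzB
      have hz0 := hsep.trace_ne_zero hz
      have d := fun j => hsep.dblPoch_ne_zero hp hq hz ⟨j, rfl⟩
      have e1 := coboundary_eq hp hq hq0 b2 b3 b1 fun j => (d j).1
      have e2 := coboundary_shift_eq hp hq hq0 hz0 b2 b3 b1 fun j => (d j).2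
      have e3 := theta_eight_identity hp hp0 hw hz0 b1 h56 h57 h67 b4
      rw [hker 6 7 (by decide) z hz, hker 5 7 (by decide) z hz, hker 5 6 (by decide) z hz, e1, e2]
      rw [← hc] at e3
      linear_combination kernel p q w z * e3)
  rw [contourIntegral_const_mul, contourIntegral_coboundary hp hq hq0 hw0 hC, mul_zero, mul_zero] at key
  linear_combination key

/-! ### Generic parameters -/

/-- The parameters with `t_6`, `t_7` divided by `q`. -/
noncomputable def lowerParams (q : ℂ) (t : Fin 8 → ℂ) : Fin 8 → ℂ :=
  Function.update (Function.update t 5 (q⁻¹ * t 5)) 6 (q⁻¹ * t 6)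

/-- Parameters for which the second contiguous relation follows by integration over one contour. -/
def Generic (p q : ℂ) (t : Fin 8 → ℂ) : Prop :=
  Admissible p q (lowerParams q t) ∧ theta p (lowerParams q t 5 / lowerParams q t 6) ≠ 0 ∧
    theta p (lowerParams q t 5 / lowerParams q t 7) ≠ 0 ∧
    theta p (lowerParams q t 6 / lowerParams q t 7) ≠ 0

def scaleExponent : Fin 8 → ℤ := ![-3, 0, 0, 0, 0, 1, 2, 0]

/-- A curve of balanced parameters through `t`. -/
noncomputable def scaleParams (t : Fin 8 → ℂ) (s : ℂ) : Fin 8 → ℂ := fun j => t j * s ^ scaleExponent j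

lemma scaleParams_one (t : Fin 8 → ℂ) : scaleParams t 1 = t := by
  funext; simp [scaleParams]

lemma continuousAt_scaleParams (t : Fin 8 → ℂ) {s : ℂ} (hs : s ≠ 0) :
    ContinuousAt (scaleParams t) s :=
  continuousAt_pi.2 fun _ => continuousAt_const.mul (continuousAt_zpow₀ s _ (Or.inl hs))

lemma Balanced.scaleParams {t : Fin 8 → ℂ} (ht : Balanced p q t) {s : ℂ} (hs : s ≠ 0) :
    Balanced p q (scaleParams t s) := by
  have h : ∏ j, s ^ scaleExponent j = 1 := by
    simp [Fin.prod_univ_eight, scaleExponent]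
    field_simp
  simp only [Balanced, EllHyp.scaleParams, Finset.prod_mul_distrib, h, mul_one]
  exact ht

lemma lowerParams_scaleParams (q : ℂ) (t : Fin 8 → ℂ) (s : ℂ) :
    lowerParams q (scaleParams t s) = scaleParams (lowerParams q t) s := by
  ext j
  simp only [lowerParams, scaleParams, Function.update_apply]
  split_ifs with h1 h2
  · rw [h1]; ring
  · rw [h2]; ring
  · rfl

lemma countable_zpow_preimage {B : Set ℂ} (hB : B.Countable) {n : ℤ} (hn : n ≠ 0) :
    {z : ℂ | z ^ n ∈ B}.Countable := by
  obtain ⟨m, rfl | rfl⟩ := n.eq_nat_or_neg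
  · simp only [zpow_natCast]
    exact countable_pow_preimage hB (by exact_mod_cast hn)
  · simp only [zpow_neg, zpow_natCast]
    exact countable_pow_preimage (B := {z | z⁻¹ ∈ B}) (hB.preimage inv_injective)
      (by simpa using hn)

lemma exists_countable_generic (hp : ‖p‖ < 1) (hp0 : p ≠ 0) (hq0 : q ≠ 0)
    {t : Fin 8 → ℂ} (ht : ∀ j, t j ≠ 0) (h : Admissible p q t) :
    ∃ B : Set ℂ, B.Countable ∧ ∀ s, s ≠ 0 → s ∉ B → Generic p q (scaleParams t s) := by
  set w := lowerParams q t with hw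
  have hw0 : ∀ j, w j ≠ 0 := by
    intro j
    rw [hw, lowerParams, Function.update_apply, Function.update_apply]
    split_ifs
    · exact mul_ne_zero (inv_ne_zero hq0) (ht _)
    · exact mul_ne_zero (inv_ne_zero hq0) (ht _)
    · exact ht j
  have hsum : ∀ j k, scaleExponent j + scaleExponent k = 0 →
      (j ≠ 5 ∧ j ≠ 6) ∧ (k ≠ 5 ∧ k ≠ 6) ∧ scaleExponent j = 0 ∧ scaleExponent k = 0 := by decide
  have hwt : ∀ j, j ≠ 5 ∧ j ≠ 6 → w j = t j := fun j hj => by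
    rw [hw, lowerParams, Function.update_of_ne hj.2, Function.update_of_ne hj.1]
  have hpre : ∀ {c : ℂ} {n : ℤ} {S : Set ℂ}, c ≠ 0 → n ≠ 0 → S.Countable →
      {s : ℂ | c * s ^ n ∈ S}.Countable := fun hc hn hS =>
    countable_zpow_preimage (countable_mul_preimage hS hc) hn
  have ct := countable_theta_zeros hp hp0
  refine ⟨(⋃ j, ⋃ k, ⋃ n : ℕ × ℕ, {s | scaleExponent j + scaleExponent k ≠ 0 ∧
      w j * w k * p ^ n.1 * q ^ n.2 * s ^ (scaleExponent j + scaleExponent k) ∈ ({1} : Set ℂ)}) ∪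
    ({s | w 5 / w 6 * s ^ (-1 : ℤ) ∈ {x | theta p x = 0}} ∪
    {s | w 5 / w 7 * s ^ (1 : ℤ) ∈ {x | theta p x = 0}} ∪
    {s | w 6 / w 7 * s ^ (2 : ℤ) ∈ {x | theta p x = 0}}), ?_, ?_⟩
  · refine Set.Countable.union ?_ (((hpre ?_ ?_ ct).union (hpre ?_ ?_ ct)).union (hpre ?_ ?_ ct))
    · refine Set.countable_iUnion fun j => Set.countable_iUnion fun k =>
        Set.countable_iUnion fun n => ?_
      by_cases hn : scaleExponent j + scaleExponent k = 0
      · simp [hn]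
      · refine (hpre ?_ hn (Set.countable_singleton 1)).mono fun s hs => hs.2
        exact mul_ne_zero (mul_ne_zero (mul_ne_zero (hw0 j) (hw0 k)) (pow_ne_zero _ hp0))
          (pow_ne_zero _ hq0)
    all_goals first
      | exact div_ne_zero (hw0 _) (hw0 _)
      | norm_num
  · intro s hs hsB
    simp only [Set.mem_union, Set.mem_iUnion, not_or, not_exists, Set.mem_ofPred_eq] at hsB
    obtain ⟨hadm, ⟨h1, h2⟩, h3⟩ := hsB
    refine ⟨?_, ?_, ?_, ?_⟩ <;> rw [lowerParams_scaleParams, ← hw]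
    · intro j k a b he
      by_cases hn : scaleExponent j + scaleExponent k = 0
      · obtain ⟨hj, hk, hj0, hk0⟩ := hsum j k hn
        simp only [scaleParams, hj0, hk0, zpow_zero, mul_one, hwt j hj, hwt k hk] at he
        exact h j k a b he
      · refine hadm j k (a, b) ⟨hn, ?_⟩
        rw [Set.mem_singleton_iff, ← he, zpow_add₀ hs, scaleParams, scaleParams]
        ring
    · intro h0; refine h1 ?_
      rw [← h0]; congr 1
      simp [scaleParams, scaleExponent]
      field_simp
    · intro h0; refine h2 ?_
      rw [← h0]; congr 1
      simp [scaleParams, scaleExponent]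
      field_simp
    · intro h0; refine h3 ?_
      rw [← h0]; congr 1
      simp [scaleParams, scaleExponent]
      field_simp

/-- A relation that is continuous in the parameters holds if it holds for generic parameters. -/
lemma eq_zero_of_generic (hp : ‖p‖ < 1) (hp0 : p ≠ 0) (hq0 : q ≠ 0)
    {R : (Fin 8 → ℂ) → ℂ} {t : Fin 8 → ℂ} (hR : ContinuousAt R t) (ht : Balanced p q t)
    (h : Admissible p q t) (hgen : ∀ t', Balanced p q t' → Generic p q t' → R t' = 0) : R t = 0 := by
  obtain ⟨B, hB, hs⟩ := exists_countable_generic hp hp0 hq0 (ht.ne_zero hp0 hq0) h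
  have := eq_zero_of_countable (f := fun s => R (scaleParams t s)) (x := 1)
    (ContinuousAt.comp (by rw [scaleParams_one]; exact hR)
      (continuousAt_scaleParams t one_ne_zero)) hB
    (by
      filter_upwards [isOpen_ne.mem_nhds one_ne_zero] with s hs0 hsB
      exact hgen _ (ht.scaleParams hs0) (hs s hs0 hsB))
  simpa only [scaleParams_one] using this

lemma mulPair_lowerParams (hq0 : q ≠ 0) (t : Fin 8 → ℂ) :
    mulPair q (lowerParams q t) 5 6 = t ∧ mulPair q (lowerParams q t) 6 7 = qShift q t 7 5 ∧
      mulPair q (lowerParams q t) 5 7 = qShift q t 7 6 := by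
  refine ⟨?_, ?_, ?_⟩ <;> ext j <;> fin_cases j <;>
    simp [mulPair, lowerParams, qShift, hq0]

lemma prod_lowerParams (hq0 : q ≠ 0) {t : Fin 8 → ℂ} (ht : Balanced p q t) :
    ∏ j, lowerParams q t j = p ^ 2 := by
  have h5 : q ^ 2 * ∏ j, lowerParams q t j = ∏ j, t j := by
    simp [Fin.prod_univ_eight, lowerParams, Function.update_apply]
    field_simp
  rw [ht] at h5
  have : q ^ 2 ≠ 0 := pow_ne_zero _ hq0
  exact mul_left_cancel₀ this (by rw [h5]; ring)

lemma continuousAt_theta_comp (hp : ‖p‖ < 1) {X : Type*} [TopologicalSpace X] {f : X → ℂ} {x : X}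
    (hf : ContinuousAt f x) (h0 : f x ≠ 0) : ContinuousAt (fun x => theta p (f x)) x :=
  ContinuousAt.comp (g := theta p) (continuousAt_theta hp h0) hf

lemma continuous_qShift (q : ℂ) (i j : Fin 8) : Continuous fun t => qShift q t i j := by
  unfold qShift
  exact (continuous_id.update i (continuous_const.mul (continuous_apply i))).update j
    (continuous_const.mul (continuous_apply j))

lemma continuousAt_V_qShift (hp : ‖p‖ < 1) (hq : ‖q‖ < 1) (hp0 : p ≠ 0) (hq0 : q ≠ 0)
    {t : Fin 8 → ℂ} (ht : ∀ j, t j ≠ 0) {i j : Fin 8} (h : Admissible p q (qShift q t i j)) :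
    ContinuousAt (fun t => V p q (qShift q t i j)) t :=
  ContinuousAt.comp (f := fun t => qShift q t i j) (g := V p q)
    (continuousAt_V hp hq hp0 hq0 (qShift_ne_zero hq0 ht i j) h) (continuous_qShift q i j).continuousAt

lemma V_second_contiguous_of_generic (hp : ‖p‖ < 1) (hq : ‖q‖ < 1) (hp0 : p ≠ 0) (hq0 : q ≠ 0)
    {t : Fin 8 → ℂ} (ht : Balanced p q t) (h : Generic p q t) :
    t 5 * theta p (t 6 / (q * t 7)) * (∏ k ∈ Finset.Iio (5 : Fin 8), theta p (t 5 * t k / q)) *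
        V p q (qShift q t 7 5) -
      t 6 * theta p (t 5 / (q * t 7)) * (∏ k ∈ Finset.Iio (5 : Fin 8), theta p (t 6 * t k / q)) *
        V p q (qShift q t 7 6) =
      t 5 * theta p (t 6 / t 5) * (∏ k ∈ Finset.Iio (5 : Fin 8), theta p (t 7 * t k)) * V p q t := by
  obtain ⟨ha, h56, h57, h67⟩ := h
  have key := V_second_contiguous_generic hp hq hp0 hq0 (prod_lowerParams hq0 ht) ha h56 h57 h67
  obtain ⟨m1, m2, m3⟩ := mulPair_lowerParams hq0 t
  rw [m1, m2, m3] at key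
  have w5 : lowerParams q t 5 = q⁻¹ * t 5 := by simp [lowerParams]
  have w6 : lowerParams q t 6 = q⁻¹ * t 6 := by simp [lowerParams]
  have w7 : lowerParams q t 7 = t 7 := by simp [lowerParams]
  have wk : ∀ k ∈ Finset.Iio (5 : Fin 8), lowerParams q t k = t k := fun k hk => by
    have hk' := Finset.mem_Iio.1 hk
    rw [lowerParams, Function.update_of_ne (hk'.trans (by decide)).ne, Function.update_of_ne hk'.ne]
  have p5 : ∀ x y : ℂ, x = q⁻¹ * y → ∏ k ∈ Finset.Iio (5 : Fin 8), theta p (x * lowerParams q t k) =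
      ∏ k ∈ Finset.Iio (5 : Fin 8), theta p (y * t k / q) := fun x y hxy =>
    Finset.prod_congr rfl fun k hk => by rw [wk k hk, hxy]; congr 1; field_simp
  have p7 : ∏ k ∈ Finset.Iio (5 : Fin 8), theta p (lowerParams q t 7 * lowerParams q t k) =
      ∏ k ∈ Finset.Iio (5 : Fin 8), theta p (t 7 * t k) :=
    Finset.prod_congr rfl fun k hk => by rw [wk k hk, w7]
  have e1 : ∀ x, q⁻¹ * x / t 7 = x / (q * t 7) := fun x => by field_simp
  have e2 : q⁻¹ * t 6 / (q⁻¹ * t 5) = t 6 / t 5 := by field_simp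
  rw [p7, p5 _ _ w5, p5 _ _ w6, w5, w6, w7, e1, e1, e2] at key
  have hqq : q * q⁻¹ = 1 := mul_inv_cancel₀ hq0
  linear_combination q * key - (t 5 * theta p (t 6 / (q * t 7)) *
    (∏ k ∈ Finset.Iio (5 : Fin 8), theta p (t 5 * t k / q)) * V p q (qShift q t 7 5) -
      t 6 * theta p (t 5 / (q * t 7)) * (∏ k ∈ Finset.Iio (5 : Fin 8), theta p (t 6 * t k / q)) *
        V p q (qShift q t 7 6) -
      t 5 * theta p (t 6 / t 5) * (∏ k ∈ Finset.Iio (5 : Fin 8), theta p (t 7 * t k)) * V p q t) * hqq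

/-- The second contiguous relation. -/
theorem V_second_contiguous (hp : ‖p‖ < 1) (hq : ‖q‖ < 1) (hp0 : p ≠ 0) (hq0 : q ≠ 0)
    {t : Fin 8 → ℂ} (ht : Balanced p q t) (h : Admissible p q t)
    (h₁ : Admissible p q (qShift q t 7 5)) (h₂ : Admissible p q (qShift q t 7 6)) :
    t 5 * theta p (t 6 / (q * t 7)) * (∏ k ∈ Finset.Iio (5 : Fin 8), theta p (t 5 * t k / q)) *
        V p q (qShift q t 7 5) -
      t 6 * theta p (t 5 / (q * t 7)) * (∏ k ∈ Finset.Iio (5 : Fin 8), theta p (t 6 * t k / q)) *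
        V p q (qShift q t 7 6) =
      t 5 * theta p (t 6 / t 5) * (∏ k ∈ Finset.Iio (5 : Fin 8), theta p (t 7 * t k)) * V p q t := by
  have ht0 := ht.ne_zero hp0 hq0
  have ca : ∀ j, ContinuousAt (fun t : Fin 8 → ℂ => t j) t := fun j => (continuous_apply j).continuousAt
  rw [← sub_eq_zero]
  refine eq_zero_of_generic hp hp0 hq0 (R := fun t => t 5 * theta p (t 6 / (q * t 7)) *
      (∏ k ∈ Finset.Iio (5 : Fin 8), theta p (t 5 * t k / q)) * V p q (qShift q t 7 5) -
      t 6 * theta p (t 5 / (q * t 7)) * (∏ k ∈ Finset.Iio (5 : Fin 8), theta p (t 6 * t k / q)) *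
        V p q (qShift q t 7 6) -
      t 5 * theta p (t 6 / t 5) * (∏ k ∈ Finset.Iio (5 : Fin 8), theta p (t 7 * t k)) * V p q t)
    ?_ ht h fun t' ht' hg => by
      rw [sub_eq_zero]; exact V_second_contiguous_of_generic hp hq hp0 hq0 ht' hg
  have d1 : ∀ i j, ContinuousAt (fun t => theta p (t i / (q * t j))) t := fun i j =>
    continuousAt_theta_comp hp ((ca i).div (continuousAt_const.mul (ca j)) (mul_ne_zero hq0 (ht0 j)))
      (div_ne_zero (ht0 i) (mul_ne_zero hq0 (ht0 j)))
  have d2 : ∀ i j, ContinuousAt (fun t => theta p (t i * t j / q)) t := fun i j =>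
    continuousAt_theta_comp hp (((ca i).mul (ca j)).div_const q)
      (div_ne_zero (mul_ne_zero (ht0 i) (ht0 j)) hq0)
  have d3 : ∀ i j, ContinuousAt (fun t => theta p (t i * t j)) t := fun i j =>
    continuousAt_theta_comp hp ((ca i).mul (ca j)) (mul_ne_zero (ht0 i) (ht0 j))
  have d4 : ContinuousAt (fun t => theta p (t 6 / t 5)) t :=
    continuousAt_theta_comp hp ((ca 6).div (ca 5) (ht0 5)) (div_ne_zero (ht0 6) (ht0 5))
  refine (ContinuousAt.sub ?_ ?_).sub ?_
  · exact (((ca 5).mul (d1 6 7)).mul (tendsto_finsetProd _ fun k _ => d2 5 k)).mul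
      (continuousAt_V_qShift hp hq hp0 hq0 ht0 h₁)
  · exact (((ca 6).mul (d1 5 7)).mul (tendsto_finsetProd _ fun k _ => d2 6 k)).mul
      (continuousAt_V_qShift hp hq hp0 hq0 ht0 h₂)
  · exact (((ca 5).mul d4).mul (tendsto_finsetProd _ fun k _ => d3 7 k)).mul
      (continuousAt_V hp hq hp0 hq0 ht0 h)

end secondContiguous

section differenceEquation

variable {p q : ℂ}

/-- The difference equation for the integrand. -/
theorem kernel_difference (hp : ‖p‖ < 1) (hq : ‖q‖ < 1) (hp0 : p ≠ 0) (hq0 : q ≠ 0)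
    {t : Fin 8 → ℂ} {z : ℂ} (ht : ∀ j, t j ≠ 0) (hz : z ≠ 0)
    (h1 : ∀ (j : Fin 8) (a b : ℕ), t j * z * p ^ a * q ^ b ≠ 1 ∧ t j * z⁻¹ * p ^ a * q ^ b ≠ 1)
    (h2 : ∀ a b : ℕ,
      q⁻¹ * t 7 * z * p ^ a * q ^ b ≠ 1 ∧ q⁻¹ * t 7 * z⁻¹ * p ^ a * q ^ b ≠ 1)
    (h3 : theta p (q⁻¹ * t 7 * t 6) ≠ 0) (h4 : theta p (q⁻¹ * t 7 * (t 6)⁻¹) ≠ 0) :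
    kernel p q (qShift q t 5 7) z -
      theta p (t 5 * t 6) * theta p (t 5 * (t 6)⁻¹) /
        (theta p (q⁻¹ * t 7 * t 6) * theta p (q⁻¹ * t 7 * (t 6)⁻¹)) * kernel p q t z =
    t 5 / t 6 * (theta p (q⁻¹ * t 7 * t 5) * theta p (q⁻¹ * t 7 * (t 5)⁻¹) /
      (theta p (q⁻¹ * t 7 * t 6) * theta p (q⁻¹ * t 7 * (t 6)⁻¹))) *
      kernel p q (qShift q t 6 7) z := by
  have d : ∀ x, (∀ a b : ℕ, x * p ^ a * q ^ b ≠ 1) → dblPoch p q x ≠ 0 := fun x hx => by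
    rw [Ne, dblPoch_eq_zero_iff hp hq]
    rintro ⟨a, b, he⟩
    exact hx a b he
  have key := kernel_first_relation hp hq hp0 hq0 ht hz
    ⟨d _ fun a b => (h1 5 a b).1, d _ fun a b => (h1 5 a b).2⟩
    ⟨d _ fun a b => (h1 6 a b).1, d _ fun a b => (h1 6 a b).2⟩
    ⟨d _ fun a b => (h2 a b).1, d _ fun a b => (h2 a b).2⟩
  simp only [← div_eq_mul_inv] at h4 ⊢
  generalize theta p (q⁻¹ * t 7 * t 6) = A at *
  generalize theta p (q⁻¹ * t 7 / t 6) = B at *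
  have h5 := ht 6
  field_simp at key ⊢
  linear_combination key

lemma Generic.admissible (hq0 : q ≠ 0) {t : Fin 8 → ℂ} (h : Generic p q t) : Admissible p q t := by
  have := mulPair_eq_mul_pow q (lowerParams q t) 5 6
  rw [(mulPair_lowerParams hq0 t).1] at this
  exact h.1.of_mul_pow this

lemma Generic.admissible_75 (hq0 : q ≠ 0) {t : Fin 8 → ℂ} (h : Generic p q t) :
    Admissible p q (qShift q t 7 5) := by
  have := mulPair_eq_mul_pow q (lowerParams q t) 6 7
  rw [(mulPair_lowerParams hq0 t).2.1] at this
  exact h.1.of_mul_pow this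

lemma Generic.admissible_76 (hq0 : q ≠ 0) {t : Fin 8 → ℂ} (h : Generic p q t) :
    Admissible p q (qShift q t 7 6) := by
  have := mulPair_eq_mul_pow q (lowerParams q t) 5 7
  rw [(mulPair_lowerParams hq0 t).2.2] at this
  exact h.1.of_mul_pow this

lemma Generic.admissible_56 (hq0 : q ≠ 0) {t : Fin 8 → ℂ} (h : Generic p q t) :
    Admissible p q (qShift q t 5 6) := by
  refine h.1.of_mul_pow fun j => ?_
  by_cases h5 : j = 5
  · subst h5; exact ⟨2, by simp [qShift, lowerParams]; field_simp⟩
  · refine ⟨0, ?_⟩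
    simp [qShift, lowerParams, Function.update_apply, h5]

lemma Generic.admissible_65 (hq0 : q ≠ 0) {t : Fin 8 → ℂ} (h : Generic p q t) :
    Admissible p q (qShift q t 6 5) := by
  refine h.1.of_mul_pow fun j => ?_
  by_cases h5 : j = 6
  · subst h5; exact ⟨2, by simp [qShift, lowerParams]; field_simp⟩
  · refine ⟨0, ?_⟩
    simp [qShift, lowerParams, Function.update_apply, h5]

lemma qShift_qShift (hq0 : q ≠ 0) (t : Fin 8 → ℂ) :
    qShift q (qShift q t 7 5) 5 7 = t ∧ qShift q (qShift q t 7 5) 6 7 = qShift q t 6 5 ∧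
    qShift q (qShift q t 7 6) 6 7 = t ∧ qShift q (qShift q t 7 6) 5 7 = qShift q t 5 6 := by
  refine ⟨?_, ?_, ?_, ?_⟩ <;> ext j <;> fin_cases j <;>
    simp [qShift, hq0]

lemma V_difference_of_generic (hp : ‖p‖ < 1) (hq : ‖q‖ < 1) (hp0 : p ≠ 0) (hq0 : q ≠ 0)
    {t : Fin 8 → ℂ} (ht : Balanced p q t) (h : Generic p q t) :
    t 5 ^ 2 * theta p (t 6 / (q * t 7)) * (∏ k ∈ Finset.Iio (5 : Fin 8), theta p (t 5 * t k / q)) *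
        theta p (t 6 / (q * t 5)) *
        (t 6 * theta p (t 7 * t 6) * theta p (t 7 / t 6) * V p q t -
          t 5 / q * theta p (t 7 * t 5 / q) * theta p (q * t 7 / t 5) * V p q (qShift q t 6 5)) -
      t 6 ^ 2 * theta p (t 5 / (q * t 7)) * (∏ k ∈ Finset.Iio (5 : Fin 8), theta p (t 6 * t k / q)) *
        theta p (t 5 / (q * t 6)) *
        (t 5 * theta p (t 7 * t 5) * theta p (t 7 / t 5) * V p q t -
          t 6 / q * theta p (t 7 * t 6 / q) * theta p (q * t 7 / t 6) * V p q (qShift q t 5 6)) =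
      t 5 ^ 2 * t 6 * theta p (t 6 / t 5) * (∏ k ∈ Finset.Iio (5 : Fin 8), theta p (t 7 * t k)) *
        theta p (t 5 * t 6 / q) * theta p (t 5 / (q * t 6)) * theta p (t 6 / (q * t 5)) *
        V p q t := by
  have ht0 := ht.ne_zero hp0 hq0
  obtain ⟨e1, e2, e3, e4⟩ := qShift_qShift hq0 t
  have c := V_second_contiguous_of_generic hp hq hp0 hq0 ht h
  have b1 := V_first_contiguous hp hq hp0 hq0 (qShift_ne_zero hq0 ht0 7 5) (h.admissible_75 hq0)
    (by rw [e1]; exact h.admissible hq0) (by rw [e2]; exact h.admissible_65 hq0)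
  have b2 := V_first_contiguous hp hq hp0 hq0 (qShift_ne_zero hq0 ht0 7 6) (h.admissible_76 hq0)
    (by rw [e4]; exact h.admissible_56 hq0) (by rw [e3]; exact h.admissible hq0)
  rw [e1, e2] at b1
  rw [e3, e4] at b2
  have v1 : qShift q t 7 5 5 = t 5 / q := by simp [qShift]; ring
  have v2 : qShift q t 7 5 6 = t 6 := by simp [qShift]
  have v3 : qShift q t 7 5 7 = q * t 7 := by simp [qShift]
  have v4 : qShift q t 7 6 5 = t 5 := by simp [qShift]
  have v5 : qShift q t 7 6 6 = t 6 / q := by simp [qShift]; ring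
  have v6 : qShift q t 7 6 7 = q * t 7 := by simp [qShift]
  rw [v1, v2, v3] at b1
  rw [v4, v5, v6] at b2
  have f1 : ∀ x : ℂ, q * t 7 * x / q = t 7 * x := fun x => by field_simp
  have f2 : ∀ x : ℂ, q * t 7 / (q * x) = t 7 / x := fun x => mul_div_mul_left _ _ hq0
  have f3 : ∀ x : ℂ, t 7 * (x / q) = t 7 * x / q := fun x => mul_div_assoc' _ _ _
  have f4 : ∀ x : ℂ, t 7 / (x / q) = q * t 7 / x := fun x => by
    rw [div_div_eq_mul_div]; ring
  have f5 : t 5 / q * t 6 = t 5 * t 6 / q := by ring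
  have f6 : t 5 / q / t 6 = t 5 / (q * t 6) := div_div _ _ _
  have f7 : t 5 * (t 6 / q) = t 5 * t 6 / q := by ring
  have f8 : theta p (t 5 / (t 6 / q)) = -(q * t 5 / t 6) * theta p (t 6 / (q * t 5)) := by
    rw [div_div_eq_mul_div, mul_comm (t 5) q]
    exact theta_div_swap hp (ht0 6) (mul_ne_zero hq0 (ht0 5))
  simp only [f1, f2, f3, f4, f5, f6, f7, f8] at b1 b2
  have hg : t 6 / q * (q * t 5 / t 6) = t 5 := by
    have := ht0 6
    field_simp
  linear_combination (t 5 ^ 2 * theta p (t 6 / (q * t 7)) *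
      (∏ k ∈ Finset.Iio (5 : Fin 8), theta p (t 5 * t k / q)) * theta p (t 6 / (q * t 5))) * b1 +
    (t 6 ^ 2 * theta p (t 5 / (q * t 7)) *
      (∏ k ∈ Finset.Iio (5 : Fin 8), theta p (t 6 * t k / q)) * theta p (t 5 / (q * t 6))) *
      (b2 - theta p (t 5 * t 6 / q) * theta p (t 6 / (q * t 5)) * V p q (qShift q t 7 6) * hg) +
    t 5 * t 6 * theta p (t 5 * t 6 / q) * theta p (t 5 / (q * t 6)) * theta p (t 6 / (q * t 5)) * c

/-- The difference equation for `V`, cleared of denominators. -/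
lemma V_difference (hp : ‖p‖ < 1) (hq : ‖q‖ < 1) (hp0 : p ≠ 0) (hq0 : q ≠ 0)
    {t : Fin 8 → ℂ} (ht : Balanced p q t) (h : Admissible p q t)
    (h₁ : Admissible p q (qShift q t 5 6)) (h₂ : Admissible p q (qShift q t 6 5)) :
    t 5 ^ 2 * theta p (t 6 / (q * t 7)) * (∏ k ∈ Finset.Iio (5 : Fin 8), theta p (t 5 * t k / q)) *
        theta p (t 6 / (q * t 5)) *
        (t 6 * theta p (t 7 * t 6) * theta p (t 7 / t 6) * V p q t -
          t 5 / q * theta p (t 7 * t 5 / q) * theta p (q * t 7 / t 5) * V p q (qShift q t 6 5)) -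
      t 6 ^ 2 * theta p (t 5 / (q * t 7)) * (∏ k ∈ Finset.Iio (5 : Fin 8), theta p (t 6 * t k / q)) *
        theta p (t 5 / (q * t 6)) *
        (t 5 * theta p (t 7 * t 5) * theta p (t 7 / t 5) * V p q t -
          t 6 / q * theta p (t 7 * t 6 / q) * theta p (q * t 7 / t 6) * V p q (qShift q t 5 6)) =
      t 5 ^ 2 * t 6 * theta p (t 6 / t 5) * (∏ k ∈ Finset.Iio (5 : Fin 8), theta p (t 7 * t k)) *
        theta p (t 5 * t 6 / q) * theta p (t 5 / (q * t 6)) * theta p (t 6 / (q * t 5)) *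
        V p q t := by
  have ht0 := ht.ne_zero hp0 hq0
  have ca : ∀ j, ContinuousAt (fun t : Fin 8 → ℂ => t j) t := fun j => (continuous_apply j).continuousAt
  rw [← sub_eq_zero]
  refine eq_zero_of_generic hp hp0 hq0 (R := fun t =>
    t 5 ^ 2 * theta p (t 6 / (q * t 7)) * (∏ k ∈ Finset.Iio (5 : Fin 8), theta p (t 5 * t k / q)) *
        theta p (t 6 / (q * t 5)) *
        (t 6 * theta p (t 7 * t 6) * theta p (t 7 / t 6) * V p q t -
          t 5 / q * theta p (t 7 * t 5 / q) * theta p (q * t 7 / t 5) * V p q (qShift q t 6 5)) -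
      t 6 ^ 2 * theta p (t 5 / (q * t 7)) * (∏ k ∈ Finset.Iio (5 : Fin 8), theta p (t 6 * t k / q)) *
        theta p (t 5 / (q * t 6)) *
        (t 5 * theta p (t 7 * t 5) * theta p (t 7 / t 5) * V p q t -
          t 6 / q * theta p (t 7 * t 6 / q) * theta p (q * t 7 / t 6) * V p q (qShift q t 5 6)) -
      t 5 ^ 2 * t 6 * theta p (t 6 / t 5) * (∏ k ∈ Finset.Iio (5 : Fin 8), theta p (t 7 * t k)) *
        theta p (t 5 * t 6 / q) * theta p (t 5 / (q * t 6)) * theta p (t 6 / (q * t 5)) *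
        V p q t)
    ?_ ht h fun t' ht' hg => by
      rw [sub_eq_zero]; exact V_difference_of_generic hp hq hp0 hq0 ht' hg
  have d1 : ∀ i j, ContinuousAt (fun t => theta p (t i / (q * t j))) t := fun i j =>
    continuousAt_theta_comp hp ((ca i).div (continuousAt_const.mul (ca j)) (mul_ne_zero hq0 (ht0 j)))
      (div_ne_zero (ht0 i) (mul_ne_zero hq0 (ht0 j)))
  have d2 : ∀ i j, ContinuousAt (fun t => theta p (t i * t j / q)) t := fun i j =>
    continuousAt_theta_comp hp (((ca i).mul (ca j)).div_const q)
      (div_ne_zero (mul_ne_zero (ht0 i) (ht0 j)) hq0)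
  have d3 : ∀ i j, ContinuousAt (fun t => theta p (t i * t j)) t := fun i j =>
    continuousAt_theta_comp hp ((ca i).mul (ca j)) (mul_ne_zero (ht0 i) (ht0 j))
  have d4 : ∀ i j, ContinuousAt (fun t => theta p (t i / t j)) t := fun i j =>
    continuousAt_theta_comp hp ((ca i).div (ca j) (ht0 j)) (div_ne_zero (ht0 i) (ht0 j))
  have d5 : ∀ i j, ContinuousAt (fun t => theta p (q * t i / t j)) t := fun i j =>
    continuousAt_theta_comp hp ((continuousAt_const.mul (ca i)).div (ca j) (ht0 j))
      (div_ne_zero (mul_ne_zero hq0 (ht0 i)) (ht0 j))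
  have hV := continuousAt_V hp hq hp0 hq0 ht0 h
  refine (ContinuousAt.sub ?_ ?_).sub ?_
  · exact (((((ca 5).pow 2).mul (d1 6 7)).mul (tendsto_finsetProd _ fun k _ => d2 5 k)).mul
      (d1 6 5)).mul (((((ca 6).mul (d3 7 6)).mul (d4 7 6)).mul hV).sub
        (((((ca 5).div_const q).mul (d2 7 5)).mul (d5 7 5)).mul
          (continuousAt_V_qShift hp hq hp0 hq0 ht0 h₂)))
  · exact (((((ca 6).pow 2).mul (d1 5 7)).mul (tendsto_finsetProd _ fun k _ => d2 6 k)).mul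
      (d1 5 6)).mul (((((ca 5).mul (d3 7 5)).mul (d4 7 5)).mul hV).sub
        (((((ca 6).div_const q).mul (d2 7 6)).mul (d5 7 6)).mul
          (continuousAt_V_qShift hp hq hp0 hq0 ht0 h₁)))
  · exact (((((((((ca 5).pow 2).mul (ca 6)).mul (d4 6 5)).mul
      (tendsto_finsetProd _ fun k _ => d3 7 k)).mul (d2 5 6)).mul (d1 5 6)).mul (d1 6 5)).mul hV)

/-! ### The elliptic hypergeometric equation -/

/-- `∏_k Γ(t_k x) Γ(t_k / x)`. -/
noncomputable def pairGamma (p q : ℂ) (s : Finset (Fin 8)) (t : Fin 8 → ℂ) (x : ℂ) : ℂ :=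
  ∏ k ∈ s, ellGamma p q (t k * x) * ellGamma p q (t k / x)

/-- The normalizing product in the definition of `U`. -/
noncomputable def normalizer (p q : ℂ) (t : Fin 8 → ℂ) : ℂ :=
  pairGamma p q (Finset.Iio 7) t (t 7)

lemma UDefined.normalizer_ne_zero {t : Fin 8 → ℂ} (h : UDefined p q t) : normalizer p q t ≠ 0 :=
  Finset.prod_ne_zero_iff.2 fun k hk => mul_ne_zero (h.2 k hk).1 (h.2 k hk).2

lemma V_eq_U_mul {t : Fin 8 → ℂ} (h : UDefined p q t) : V p q t = U p q t * normalizer p q t :=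
  (div_mul_cancel₀ _ h.normalizer_ne_zero).symm

lemma pairGamma_qShift (hp : ‖p‖ < 1) (hq : ‖q‖ < 1) (hq0 : q ≠ 0) {t : Fin 8 → ℂ}
    {s : Finset (Fin 8)} {i j : Fin 8} (hmi : i ∈ s) (hj : j ∈ s) (hij : i ≠ j) {x : ℂ}
    (h1 : ellGamma p q (t i * x) ≠ 0) (h2 : ellGamma p q (t i / x) ≠ 0)
    (h3 : ellGamma p q (q⁻¹ * t j * x) ≠ 0) (h4 : ellGamma p q (q⁻¹ * t j / x) ≠ 0) :
    pairGamma p q s (qShift q t i j) x * (theta p (x * t j / q) * theta p (t j / (q * x))) =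
      theta p (t i * x) * theta p (t i / x) * pairGamma p q s t x := by
  have si : qShift q t i j i = q * t i := by
    rw [qShift, Function.update_of_ne hij, Function.update_self]
  have sj : qShift q t i j j = q⁻¹ * t j := Function.update_self _ _ _
  have hmj : j ∈ s.erase i := Finset.mem_erase.2 ⟨hij.symm, hj⟩
  have hrest : ∀ k ∈ (s.erase i).erase j,
      ellGamma p q (qShift q t i j k * x) * ellGamma p q (qShift q t i j k / x)
        = ellGamma p q (t k * x) * ellGamma p q (t k / x) := by
    intro k hk
    have sk : qShift q t i j k = t k := by
      rw [qShift, Function.update_of_ne (Finset.ne_of_mem_erase hk),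
        Function.update_of_ne (Finset.ne_of_mem_erase (Finset.mem_of_mem_erase hk))]
    rw [sk]
  have e1 := ellGamma_q_mul' hp hq hq0 h1
  have e2 := ellGamma_q_mul' hp hq hq0 h2
  have e3 := ellGamma_q_mul' hp hq hq0 h3
  have e4 := ellGamma_q_mul' hp hq hq0 h4
  have f1 : q * (q⁻¹ * t j * x) = t j * x := by field_simp
  have f2 : q * (q⁻¹ * t j / x) = t j / x := by field_simp
  have f3 : q⁻¹ * t j * x = x * t j / q := by field_simp
  have f4 : q⁻¹ * t j / x = t j / (q * x) := by field_simp
  rw [f1] at e3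
  rw [f2] at e4
  rw [pairGamma, pairGamma, ← Finset.mul_prod_erase _ _ hmi, ← Finset.mul_prod_erase _ _ hmj,
    Finset.prod_congr rfl hrest,
    ← Finset.mul_prod_erase s (fun k => ellGamma p q (t k * x) * _) hmi,
    ← Finset.mul_prod_erase (s.erase i)
      (fun k => ellGamma p q (t k * x) * _) hmj, si, sj, mul_assoc q, mul_div_assoc q, e1, e2, e3,
    e4, ← f3, ← f4]
  ring

lemma normalizer_qShift (hp : ‖p‖ < 1) (hq : ‖q‖ < 1) (hq0 : q ≠ 0) {t : Fin 8 → ℂ}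
    (h : UDefined p q t) {i j : Fin 8} (hi : i < 7) (hj : j < 7) (hij : i ≠ j)
    (h' : UDefined p q (qShift q t i j)) :
    normalizer p q (qShift q t i j) * (theta p (t 7 * t j / q) * theta p (t j / (q * t 7))) =
      theta p (t i * t 7) * theta p (t i / t 7) * normalizer p q t := by
  have s7 : qShift q t i j 7 = t 7 := by
    rw [qShift, Function.update_of_ne hj.ne', Function.update_of_ne hi.ne']
  have hi' := h.2 i (Finset.mem_Iio.2 hi)
  have hj' := h'.2 j (Finset.mem_Iio.2 hj)
  rw [show qShift q t i j j = q⁻¹ * t j from Function.update_self _ _ _, s7] at hj'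
  rw [normalizer, normalizer, s7]
  exact pairGamma_qShift hp hq hq0 (Finset.mem_Iio.2 hi) (Finset.mem_Iio.2 hj) hij hi'.1 hi'.2
    hj'.1 hj'.2

/-- The difference equation for `U` in a form that presupposes only that the theta functions in
the elliptic hypergeometric equation do not vanish. -/
lemma U_difference (hp : ‖p‖ < 1) (hq : ‖q‖ < 1) (hp0 : p ≠ 0) (hq0 : q ≠ 0)
    {t : Fin 8 → ℂ} (ht : Balanced p q t) (h : UDefined p q t)
    (h₁ : UDefined p q (qShift q t 5 6)) (h₂ : UDefined p q (qShift q t 6 5))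
    (k2 : theta p (t 6 / (q * t 5)) ≠ 0)
    (k3 : theta p (t 6 / t 5) ≠ 0) (k4 : theta p (t 5 / (q * t 6)) ≠ 0) :
    theta p (t 5 / (q * t 7)) * theta p (t 5 * t 7) * theta p (t 7 / t 5) /
        (theta p (t 5 / t 6) * theta p (t 6 / (q * t 5))) *
        (∏ k ∈ Finset.Iio (5 : Fin 8), theta p (t 6 * t k / q)) *
        (U p q (qShift q t 5 6) - U p q t) +
      theta p (t 6 / (q * t 7)) * theta p (t 6 * t 7) * theta p (t 7 / t 6) /
        (theta p (t 6 / t 5) * theta p (t 5 / (q * t 6))) *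
        (∏ k ∈ Finset.Iio (5 : Fin 8), theta p (t 5 * t k / q)) *
        (U p q (qShift q t 6 5) - U p q t) +
      theta p (t 5 * t 6 / q) * (∏ k ∈ Finset.Iio (5 : Fin 8), theta p (t 7 * t k)) * U p q t = 0 := by
  have ht0 := ht.ne_zero hp0 hq0
  have key := V_difference hp hq hp0 hq0 ht h.1 h₁.1 h₂.1
  have n1 := normalizer_qShift hp hq hq0 h (i := 5) (j := 6) (by decide) (by decide) (by decide) h₁
  have n2 := normalizer_qShift hp hq hq0 h (i := 6) (j := 5) (by decide) (by decide) (by decide) h₂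
  rw [V_eq_U_mul h, V_eq_U_mul h₁, V_eq_U_mul h₂] at key
  have hD := h.normalizer_ne_zero
  have a5 := ht0 5
  have a6 := ht0 6
  have a7 := ht0 7
  have s1 : ∀ i, theta p (q * t 7 / t i) = -(q * t 7 / t i) * theta p (t i / (q * t 7)) := fun i =>
    theta_div_swap hp (ht0 i) (mul_ne_zero hq0 a7)
  have s2 : ∀ i, theta p (t i / t 7) = -(t i / t 7) * theta p (t 7 / t i) := fun i =>
    theta_div_swap hp a7 (ht0 i)
  have s3 : theta p (t 5 / t 6) = -(t 5 / t 6) * theta p (t 6 / t 5) := theta_div_swap hp a6 a5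
  rw [s1, s1] at key
  rw [s2] at n1 n2
  rw [s3]
  rw [mul_comm (t 7) (t 6), mul_comm (t 7) (t 5)] at key
  rw [mul_comm (t 7) (t 6)] at n1
  rw [mul_comm (t 7) (t 5)] at n2
  generalize hN1 : normalizer p q (qShift q t 5 6) = N1 at *
  generalize hN2 : normalizer p q (qShift q t 6 5) = N2 at *
  generalize normalizer p q t = N at *
  generalize U p q (qShift q t 5 6) = U1 at *
  generalize U p q (qShift q t 6 5) = U2 at *
  generalize U p q t = U0 at *
  generalize (∏ k ∈ Finset.Iio (5 : Fin 8), theta p (t 5 * t k / q)) = F5 at *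
  generalize (∏ k ∈ Finset.Iio (5 : Fin 8), theta p (t 6 * t k / q)) = F6 at *
  generalize (∏ k ∈ Finset.Iio (5 : Fin 8), theta p (t 7 * t k)) = F7 at *
  generalize theta p (t 6 * t 7 / q) = A1 at *
  generalize theta p (t 5 * t 7 / q) = A2 at *
  generalize theta p (t 6 / (q * t 7)) = A3 at *
  generalize theta p (t 5 / (q * t 7)) = A4 at *
  generalize theta p (t 5 * t 7) = A5 at *
  generalize theta p (t 6 * t 7) = A6 at *
  generalize theta p (t 7 / t 5) = A7 at *
  generalize theta p (t 7 / t 6) = A8 at *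
  generalize theta p (t 6 / t 5) = A9 at *
  generalize theta p (t 6 / (q * t 5)) = A10 at *
  generalize theta p (t 5 / (q * t 6)) = A11 at *
  generalize theta p (t 5 * t 6 / q) = A12 at *
  clear h h₁ h₂ ht s1 s2 s3
  have m1 : t 6 / q * A1 * (-(q * t 7 / t 6) * A3) * (U1 * N1) = t 5 * A5 * A7 * (U1 * N) := by
    have : t 7 * (N1 * (A1 * A3)) = -(t 5 * A5 * A7 * N) := by
      rw [n1]; field_simp
    field_simp
    linear_combination (-U1) * this
  have m2 : t 5 / q * A2 * (-(q * t 7 / t 5) * A4) * (U2 * N2) = t 6 * A6 * A8 * (U2 * N) := by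
    have : t 7 * (N2 * (A2 * A4)) = -(t 6 * A6 * A8 * N) := by
      rw [n2]; field_simp
    field_simp
    linear_combination (-U2) * this
  rw [m1, m2] at key
  have hfin : t 5 * t 6 * N * (A3 * F5 * A10 * A6 * A8 * t 5 * (U0 - U2) - t 6 * A4 * F6 * A11 * A5 * A7 * (U0 - U1) -
    t 5 * A9 * F7 * A12 * A11 * A10 * U0) = 0 := by
    linear_combination key
  have hfin' := (mul_eq_zero.1 hfin).resolve_left (mul_ne_zero (mul_ne_zero a5 a6) hD)
  field_simp
  linear_combination (-1 : ℂ) * hfin'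

/-- The difference equation for `U` in terms of the potential. -/
theorem U_potential_equation (hp : ‖p‖ < 1) (hq : ‖q‖ < 1) (hp0 : p ≠ 0) (hq0 : q ≠ 0)
    {t : Fin 8 → ℂ} (ht : Balanced p q t) (h : UDefined p q t)
    (h₁ : UDefined p q (qShift q t 5 6)) (h₂ : UDefined p q (qShift q t 6 5))
    (d₁ : PotentialDefined p q t) (d₂ : PotentialDefined p q (swap67 t)) :
    potential p q t * (U p q (qShift q t 5 6) - U p q t) +
      potential p q (swap67 t) * (U p q (qShift q t 6 5) - U p q t) + U p q t = 0 := by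
  have w5 : swap67 t 5 = t 6 := by simp [swap67]
  have w6 : swap67 t 6 = t 5 := by simp [swap67]
  have w7 : swap67 t 7 = t 7 := by rw [swap67, Equiv.swap_apply_of_ne_of_ne (by decide) (by decide)]
  have wk : ∀ k ∈ Finset.Iio (5 : Fin 8), swap67 t k = t k := fun k hk => by
    have hk' := Finset.mem_Iio.1 hk
    rw [swap67, Equiv.swap_apply_of_ne_of_ne hk'.ne (hk'.trans (by decide)).ne]
  obtain ⟨k1, k2, k3, k4⟩ := d₁
  obtain ⟨l1, l2, -, -⟩ := d₂
  rw [w5, w6] at l1 l2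
  have key := U_difference hp hq hp0 hq0 ht h h₁ h₂ k2 l1 l2
  have hF : ∏ k ∈ Finset.Iio (5 : Fin 8), theta p (t 7 * t k) ≠ 0 := Finset.prod_ne_zero_iff.2 k4
  rw [potential, potential, w5, w6, w7]
  have hprod : ∏ k ∈ Finset.Iio (5 : Fin 8), theta p (t 5 * swap67 t k / q) / theta p (t 7 * swap67 t k) =
      (∏ k ∈ Finset.Iio (5 : Fin 8), theta p (t 5 * t k / q)) /
        ∏ k ∈ Finset.Iio (5 : Fin 8), theta p (t 7 * t k) := by
    rw [← Finset.prod_div_distrib]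
    exact Finset.prod_congr rfl fun k hk => by rw [wk k hk]
  rw [hprod, Finset.prod_div_distrib, mul_comm (t 6) (t 5)]
  generalize (∏ k ∈ Finset.Iio (5 : Fin 8), theta p (t 7 * t k)) = F7 at *
  field_simp at key ⊢
  linear_combination key

lemma eheParams_qShift (q a t₈ z : ℂ) (τ : Fin 5 → ℂ) :
    qShift q (eheParams a τ t₈ z) 5 6 = eheParams a τ t₈ (q * z) ∧
    qShift q (eheParams a τ t₈ z) 6 5 = eheParams a τ t₈ (q⁻¹ * z) := by
  constructor <;> ext j <;> fin_cases j <;> simp [qShift, eheParams, div_eq_mul_inv] <;> ring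

/-- `U` solves the elliptic hypergeometric equation. -/
theorem U_ellHypEquation (hp : ‖p‖ < 1) (hq : ‖q‖ < 1) (hp0 : p ≠ 0) (hq0 : q ≠ 0)
    {a z t₈ : ℂ} {τ : Fin 5 → ℂ} (ht : Balanced p q (eheParams a τ t₈ z))
    (h : UDefined p q (eheParams a τ t₈ z))
    (h₁ : UDefined p q (eheParams a τ t₈ (q * z)))
    (h₂ : UDefined p q (eheParams a τ t₈ (q⁻¹ * z))) (hd : EheDefined p q z) :
    EllHypEquation p q a τ t₈ z (U p q (eheParams a τ t₈ (q * z)))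
      (U p q (eheParams a τ t₈ z)) (U p q (eheParams a τ t₈ (q⁻¹ * z))) := by
  obtain ⟨s1, s2⟩ := eheParams_qShift q a t₈ z τ
  set t := eheParams a τ t₈ z with ht'
  have ht0 := ht.ne_zero hp0 hq0
  have t5 : t 5 = a * z := rfl
  have t6 : t 6 = a / z := rfl
  have t7 : t 7 = t₈ := rfl
  have ha : a ≠ 0 := by have := ht0 5; rw [t5] at this; exact left_ne_zero_of_mul this
  have hz : z ≠ 0 := by have := ht0 5; rw [t5] at this; exact right_ne_zero_of_mul this
  have h8 : t₈ ≠ 0 := ht0 7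
  obtain ⟨k1, k2, k3, k4⟩ := hd
  have e1 : t 5 / t 6 = z ^ 2 := by rw [t5, t6]; field_simp
  have e2 : t 6 / (q * t 5) = 1 / (q * z ^ 2) := by rw [t5, t6]; field_simp
  have e3 : t 6 / t 5 = 1 / z ^ 2 := by rw [t5, t6]; field_simp
  have e4 : t 5 / (q * t 6) = z ^ 2 / q := by rw [t5, t6]; field_simp
  rw [← s1] at h₁
  rw [← s2] at h₂
  have key := U_difference hp hq hp0 hq0 ht h h₁ h₂ (by rwa [e2]) (by rwa [e3])
    (by rwa [e4])
  rw [e1, e2, e3, e4, s1, s2] at key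
  have hprod : ∀ f : Fin 8 → ℂ, ∏ k ∈ Finset.Iio (5 : Fin 8), f k = f 0 * f 1 * f 2 * f 3 * f 4 := by
    intro f
    have : (Finset.Iio (5 : Fin 8)) = {0, 1, 2, 3, 4} := by decide
    rw [this]; simp [mul_assoc]
  have F : ∀ g : ℂ → ℂ, ∏ k ∈ Finset.Iio (5 : Fin 8), g (t k) = ∏ k : Fin 5, g (τ k) := fun g => by
    rw [hprod, Fin.prod_univ_five]; rfl
  rw [F fun x => theta p (t 6 * x / q), F fun x => theta p (t 5 * x / q),
    F fun x => theta p (t 7 * x), t5, t6, t7] at key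
  rw [EllHypEquation, eheCoeff, eheCoeff]
  have g1 : ∀ k, a * τ k / (q * z) = a / z * τ k / q := fun k => by field_simp
  have g2 : ∀ k, a * τ k / (q * z⁻¹) = a * z * τ k / q := fun k => by field_simp
  have g3 : a * t₈ * z = a * z * t₈ := by ring
  have g4 : a * t₈ * z⁻¹ = a / z * t₈ := by ring
  have g5 : a * z⁻¹ = a / z := rfl
  have g6 : z⁻¹ ^ 2 = 1 / z ^ 2 := by field_simp
  have g7 : 1 / (q * z⁻¹ ^ 2) = z ^ 2 / q := by field_simp
  have g8 : a ^ 2 / q = a * z * (a / z) / q := by field_simp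
  have g9 : ∀ k, τ k * t₈ = t₈ * τ k := fun k => mul_comm _ _
  simp only [g1, g2, g3, g4, g7, g8, g9]
  rw [g6, g5]
  exact key

/-- The two expressions for the potential agree. -/
theorem potential_eq_potential' (hp : ‖p‖ < 1) (hp0 : p ≠ 0) (hq0 : q ≠ 0) {t : Fin 8 → ℂ}
    (ht : Balanced p q t) {t₀ : ℂ} (h : t 7 = p ^ 2 * t₀) :
    potential p q t = potential' p q t t₀ := by
  have ht0 := ht.ne_zero hp0 hq0
  have h0 : t₀ ≠ 0 := by
    rintro rfl
    exact ht0 7 (by rw [h, mul_zero])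
  have a5 := ht0 5
  have a6 := ht0 6
  have shift : ∀ x, x ≠ 0 → theta p (p ^ 2 * x) = (p * x ^ 2)⁻¹ * theta p x := fun x hx => by
    rw [sq, mul_assoc, theta_p_mul hp hp0 (mul_ne_zero hp0 hx), theta_p_mul hp hp0 hx]
    field_simp
  have r1 : theta p (t 5 / (q * t 7)) = -(t 5 / (q * t 7)) * ((p * (q * t₀ / t 5) ^ 2)⁻¹ *
      theta p (q * t₀ / t 5)) := by
    rw [theta_div_swap hp (mul_ne_zero hq0 (ht0 7)) a5, h, ← shift _ (by positivity)]
    congr 2; ring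
  have r2 : theta p (t 5 * t 7) = (p * (t₀ * t 5) ^ 2)⁻¹ * theta p (t₀ * t 5) := by
    rw [← shift _ (by positivity), h]; congr 1; ring
  have r3 : theta p (t 7 / t 5) = (p * (t₀ / t 5) ^ 2)⁻¹ * theta p (t₀ / t 5) := by
    rw [← shift _ (by positivity), h]; congr 1; ring
  have r4 : theta p (t 6 / (q * t 5)) = -(t 6 / (q * t 5)) * theta p (q * t 5 / t 6) :=
    theta_div_swap hp (mul_ne_zero hq0 a5) a6
  have r5 : theta p (t 5 * t 6 / q) = -(t 5 * t 6 / q) * theta p (q / (t 5 * t 6)) :=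
    theta_div_swap hp hq0 (mul_ne_zero a5 a6)
  have r6 : ∀ k, theta p (t 6 * t k / q) / theta p (t 7 * t k) =
      (-(t 6 * t k / q) * (p * (t₀ * t k) ^ 2)) * (theta p (q / (t 6 * t k)) / theta p (t₀ * t k)) := by
    intro k
    have ak := ht0 k
    have : theta p (t 7 * t k) = (p * (t₀ * t k) ^ 2)⁻¹ * theta p (t₀ * t k) := by
      rw [← shift _ (by positivity), h]; congr 1; ring
    rw [this, theta_div_swap hp hq0 (mul_ne_zero a6 ak)]
    rw [div_eq_mul_inv, mul_inv, inv_inv]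
    ring
  rw [potential, potential', r1, r2, r3, r4, r5, Finset.prod_congr rfl fun k _ => r6 k,
    Finset.prod_mul_distrib]
  have hIio : (Finset.Iio (5 : Fin 8)) = {0, 1, 2, 3, 4} := by decide
  have hc : ∏ k ∈ Finset.Iio (5 : Fin 8), (-(t 6 * t k / q) * (p * (t₀ * t k) ^ 2)) =
      -((t 6 * p * t₀ ^ 2 / q) ^ 5 * (t 0 * t 1 * t 2 * t 3 * t 4) ^ 3) := by
    rw [hIio]; simp; ring
  have hb : t 0 * t 1 * t 2 * t 3 * t 4 * t 5 * t 6 * t₀ = q ^ 2 := by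
    have := ht
    rw [Balanced, Fin.prod_univ_eight, h] at this
    have hp2 : p ^ 2 ≠ 0 := pow_ne_zero _ hp0
    exact mul_left_cancel₀ hp2 (by linear_combination this)
  have hb' : t 0 * t 1 * t 2 * t 3 * t 4 = q ^ 2 / (t 5 * t 6 * t₀) := by
    field_simp; linear_combination hb
  rw [hc, hb', h]
  generalize (∏ k ∈ Finset.Iio (5 : Fin 8), theta p (q / (t 6 * t k)) / theta p (t₀ * t k)) = G
  field_simp

end differenceEquation

section ellipticPotential

/-- The potential in additive notation, with an arbitrary function in place of the theta
function. -/
noncomputable def potentialForm (θ : ℂ → ℂ) (ω₁ : ℂ) (h : Fin 8 → ℂ) : ℂ :=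
  θ (h 5 - (ω₁ + h 7)) * θ (h 5 + h 7) * θ (h 7 - h 5) /
      (θ (h 5 - h 6) * θ (h 6 - (ω₁ + h 5)) * θ (h 5 + h 6 - ω₁)) *
    ∏ k ∈ Finset.Iio (5 : Fin 8), θ (h 6 + h k - ω₁) / θ (h 7 + h k)

lemma potential_expParams (p ω₁ ω₂ : ℂ) (h : Fin 8 → ℂ) :
    potential p (e (ω₁ / ω₂)) (expParams ω₂ h) =
      potentialForm (fun u => theta p (e (u / ω₂))) ω₁ h := by
  simp only [potential, potentialForm, expParams, ← e_add, ← e_sub, ← add_div, ← sub_div]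

lemma potentialForm_mul (E θ : ℂ → ℂ) (ω₁ : ℂ) (h : Fin 8 → ℂ) :
    potentialForm (fun u => E u * θ u) ω₁ h = potentialForm E ω₁ h * potentialForm θ ω₁ h := by
  simp only [potentialForm, mul_div_mul_comm, Finset.prod_mul_distrib]
  ring

lemma potentialForm_add_period {θ : ℂ → ℂ} {ω : ℂ} (hθ : Function.Periodic θ ω) (ω₁ : ℂ)
    (h : Fin 8 → ℂ) (n : Fin 8 → ℤ) :
    potentialForm θ ω₁ (fun j => h j + n j * ω) = potentialForm θ ω₁ h := by
  have key : ∀ (m : ℤ) (u w : ℂ), w = u + m * ω → θ w = θ u := fun m u w hw => by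
    rw [hw]; exact hθ.int_mul m u
  simp only [potentialForm]
  congr 1
  · congr 1
    · congr 1
      · congr 1
        · exact key (n 5 - n 7) _ _ (by push_cast; ring)
        · exact key (n 5 + n 7) _ _ (by push_cast; ring)
      · exact key (n 7 - n 5) _ _ (by push_cast; ring)
    · congr 1
      · congr 1
        · exact key (n 5 - n 6) _ _ (by push_cast; ring)
        · exact key (n 6 - n 5) _ _ (by push_cast; ring)
      · exact key (n 5 + n 6) _ _ (by push_cast; ring)
  · refine Finset.prod_congr rfl fun k _ => ?_
    congr 1
    · exact key (n 6 + n k) _ _ (by push_cast; ring)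
    · exact key (n 7 + n k) _ _ (by push_cast; ring)

lemma potentialForm_gaussian {ω₁ ω₂ ω₃ : ℂ} (h2 : ω₂ ≠ 0) (h3 : ω₃ ≠ 0) (c : ℂ) {h : Fin 8 → ℂ}
    (hb : AddBalanced ω₁ ω₂ ω₃ h) :
    potentialForm (fun u => exp (Real.pi * I * (u * (u - ω₂ - ω₃) / (ω₂ * ω₃) + c))) ω₁ h = 1 := by
  have hIio : (Finset.Iio (5 : Fin 8)) = {0, 1, 2, 3, 4} := by decide
  rw [AddBalanced, Fin.sum_univ_eight] at hb
  simp only [potentialForm, hIio, ← exp_add, ← exp_sub]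
  rw [← Complex.exp_sum, ← exp_add, ← Complex.exp_zero]
  congr 1
  have h7 : h 7 = 2 * (ω₁ + ω₂ + ω₃) - (h 0 + h 1 + h 2 + h 3 + h 4 + h 5 + h 6) := by
    linear_combination hb
  simp
  rw [h7]
  field_simp
  ring

lemma meromorphicAt_potentialForm {θ : ℂ → ℂ} (hθ : Differentiable ℂ θ) (ω₁ : ℂ)
    {H : ℂ → Fin 8 → ℂ} (hH : ∀ i, Differentiable ℂ fun u => H u i) (x : ℂ) :
    MeromorphicAt (fun u => potentialForm θ ω₁ (H u)) x := by
  have key : ∀ f : ℂ → ℂ, Differentiable ℂ f → MeromorphicAt (fun u => θ (f u)) x := fun f hf =>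
    ((hθ.comp hf).analyticAt x).meromorphicAt
  have c := differentiable_const (𝕜 := ℂ) (E := ℂ) ω₁
  have hp : MeromorphicAt (fun u => ∏ k ∈ Finset.Iio (5 : Fin 8),
      θ (H u 6 + H u k - ω₁) / θ (H u 7 + H u k)) x :=
    MeromorphicAt.fun_prod fun k _ =>
      (key _ (((hH 6).add (hH k)).sub c)).fun_div (key _ ((hH 7).add (hH k)))
  exact ((((key _ ((hH 5).sub (c.add (hH 7)))).fun_mul (key _ ((hH 5).add (hH 7)))).fun_mul
    (key _ ((hH 7).sub (hH 5)))).fun_div (((key _ ((hH 5).sub (hH 6))).fun_mul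
      (key _ ((hH 6).sub (c.add (hH 5))))).fun_mul (key _ (((hH 5).add (hH 6)).sub c)))).fun_mul hp

/-- The parameters `(g_1,…,g_8)` with `g_8` given by the balancing condition. -/
noncomputable def balancedSnoc (ω₁ ω₂ ω₃ : ℂ) (g : Fin 7 → ℂ) : Fin 8 → ℂ :=
  Fin.snoc (α := fun _ => ℂ) g (2 * (ω₁ + ω₂ + ω₃) - ∑ j, g j)

lemma potentialAdd_eq (ω₁ ω₂ ω₃ : ℂ) (g : Fin 7 → ℂ) : potentialAdd ω₁ ω₂ ω₃ g =
    potentialForm (fun u => theta (e (ω₃ / ω₂)) (e (u / ω₂))) ω₁ (balancedSnoc ω₁ ω₂ ω₃ g) :=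
  potential_expParams _ _ _ _

lemma addBalanced_balancedSnoc (ω₁ ω₂ ω₃ : ℂ) (g : Fin 7 → ℂ) :
    AddBalanced ω₁ ω₂ ω₃ (balancedSnoc ω₁ ω₂ ω₃ g) := by
  rw [AddBalanced, Fin.sum_univ_castSucc]
  simp only [balancedSnoc, Fin.snoc_castSucc, Fin.snoc_last]
  ring

lemma periodic_theta_e {ω₂ : ℂ} (h2 : ω₂ ≠ 0) (p : ℂ) :
    Function.Periodic (fun u => theta p (e (u / ω₂))) ω₂ := fun u => by
  simp only [add_div, div_self h2, e_add_one]

lemma potentialForm_balancedSnoc {θ : ℂ → ℂ} {ω : ℂ} (hθ : Function.Periodic θ ω)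
    {ω₁ ω₂ ω₃ ω₂' ω₃' : ℂ} (m : ℤ) (hm : 2 * (ω₂' + ω₃') = 2 * (ω₂ + ω₃) + m * ω) (g : Fin 7 → ℂ)
    (n : Fin 7 → ℤ) :
    potentialForm θ ω₁ (balancedSnoc ω₁ ω₂' ω₃' fun j => g j + n j * ω) =
      potentialForm θ ω₁ (balancedSnoc ω₁ ω₂ ω₃ g) := by
  rw [← potentialForm_add_period hθ ω₁ (balancedSnoc ω₁ ω₂ ω₃ g)
    (Fin.snoc (α := fun _ => ℤ) n (m - ∑ j, n j))]
  congr 1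
  ext j
  refine Fin.lastCases ?_ (fun j => ?_) j
  · simp only [balancedSnoc, Fin.snoc_last, Finset.sum_add_distrib, ← Finset.sum_mul]
    push_cast
    linear_combination hm
  · simp only [balancedSnoc, Fin.snoc_castSucc]

variable {ω₂ ω₃ : ℂ}

lemma potentialForm_modular (h : 0 < (ω₃ / ω₂).im) (ω₁ : ℂ) {g : Fin 8 → ℂ}
    (hb : AddBalanced ω₁ ω₂ ω₃ g) :
    potentialForm (fun u => theta (e (-ω₂ / ω₃)) (e (-u / ω₃))) ω₁ g =
      potentialForm (fun u => theta (e (ω₃ / ω₂)) (e (u / ω₂))) ω₁ g := by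
  have h2 : ω₂ ≠ 0 := by rintro rfl; simp at h
  have h3 : ω₃ ≠ 0 := by rintro rfl; simp at h
  have : (fun u => theta (e (-ω₂ / ω₃)) (e (-u / ω₃))) = fun u =>
      exp (Real.pi * I * (u * (u - ω₂ - ω₃) / (ω₂ * ω₃) +
        ((ω₃ / ω₂ + 1 / (ω₃ / ω₂)) / 6 + 1 / 2))) * theta (e (ω₃ / ω₂)) (e (u / ω₂)) := by
    ext u
    rw [theta_modular h]
    congr 3
    rw [thetaExponent]
    field_simp
    ring
  rw [this, potentialForm_mul, potentialForm_gaussian h2 h3 _ hb, one_mul]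

lemma potentialAdd_eq_modular (h : 0 < (ω₃ / ω₂).im) (ω₁ : ℂ) (g : Fin 7 → ℂ) :
    potentialAdd ω₁ ω₂ ω₃ g =
      potentialForm (fun u => theta (e (-ω₂ / ω₃)) (e (-u / ω₃))) ω₁ (balancedSnoc ω₁ ω₂ ω₃ g) := by
  rw [potentialAdd_eq, potentialForm_modular h ω₁ (addBalanced_balancedSnoc _ _ _ _)]

lemma periodic_theta_e_neg (h3 : ω₃ ≠ 0) (p : ℂ) :
    Function.Periodic (fun u => theta p (e (-u / ω₃))) ω₃ := fun u => by
  have : -(u + ω₃) / ω₃ = -u / ω₃ + (-1 : ℤ) := by field_simp; push_cast; ring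
  simp only [this, e_add, e_int, mul_one]

lemma update_eq_add (g : Fin 7 → ℂ) (j : Fin 7) (ω : ℂ) :
    Function.update g j (g j + ω) = fun k => g k + (Pi.single j 1 : Fin 7 → ℤ) k * ω := by
  ext k
  rcases eq_or_ne k j with rfl | hk
  · simp
  · simp [hk]

theorem potentialAdd_meromorphicAt (h : 0 < (ω₃ / ω₂).im) (ω₁ : ℂ) (g : Fin 7 → ℂ) (j : Fin 7)
    (x : ℂ) : MeromorphicAt (fun u => potentialAdd ω₁ ω₂ ω₃ (Function.update g j u)) x := by
  have hp : ‖e (ω₃ / ω₂)‖ < 1 := norm_e_lt_one.2 h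
  simp only [potentialAdd_eq]
  have hu : ∀ k, Differentiable ℂ fun u => Function.update g j u k := fun k => by
    rcases eq_or_ne k j with rfl | hk
    · simp
    · simp [Function.update_of_ne hk]
  refine meromorphicAt_potentialForm (fun u => ?_) ω₁ (fun i => ?_) x
  · have he : Differentiable ℂ (fun u : ℂ => e (u / ω₂)) :=
      differentiable_e.comp (differentiable_id.div_const ω₂)
    exact DifferentiableAt.comp (g := theta (e (ω₃ / ω₂))) (f := fun u => e (u / ω₂)) u
      (differentiableAt_theta hp (e_ne_zero _)) (he u)
  · refine Fin.lastCases ?_ (fun i => ?_) i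
    · simp only [balancedSnoc, Fin.snoc_last]
      exact (differentiable_const _).sub (Differentiable.fun_sum fun k _ => hu k)
    · simpa only [balancedSnoc, Fin.snoc_castSucc] using hu i

theorem potentialAdd_periodic (h : 0 < (ω₃ / ω₂).im) (ω₁ : ℂ) (g : Fin 7 → ℂ) (j : Fin 7) :
    potentialAdd ω₁ ω₂ ω₃ (Function.update g j (g j + ω₂)) = potentialAdd ω₁ ω₂ ω₃ g ∧
    potentialAdd ω₁ ω₂ ω₃ (Function.update g j (g j + ω₃)) = potentialAdd ω₁ ω₂ ω₃ g := by
  have h2 : ω₂ ≠ 0 := by rintro rfl; simp at h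
  have h3 : ω₃ ≠ 0 := by rintro rfl; simp at h
  constructor
  · rw [potentialAdd_eq, potentialAdd_eq, update_eq_add]
    exact potentialForm_balancedSnoc (periodic_theta_e h2 _) 0 (by simp) g _
  · rw [potentialAdd_eq_modular h, potentialAdd_eq_modular h, update_eq_add]
    exact potentialForm_balancedSnoc (periodic_theta_e_neg h3 _) 0 (by simp) g _

theorem potentialAdd_add (h : 0 < (ω₃ / ω₂).im) (ω₁ : ℂ) (g : Fin 7 → ℂ) :
    potentialAdd ω₁ ω₂ (ω₃ + ω₂) g = potentialAdd ω₁ ω₂ ω₃ g := by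
  have h2 : ω₂ ≠ 0 := by rintro rfl; simp at h
  rw [potentialAdd_eq, potentialAdd_eq, add_div, div_self h2, e_add_one]
  simpa using potentialForm_balancedSnoc (ω₁ := ω₁) (periodic_theta_e h2 (e (ω₃ / ω₂))) (ω₂ := ω₂)
    (ω₃ := ω₃) (ω₂' := ω₂) (ω₃' := ω₃ + ω₂) 2 (by push_cast; ring) g 0

theorem potentialAdd_inversion (h : 0 < (ω₃ / ω₂).im) (ω₁ : ℂ) (g : Fin 7 → ℂ) :
    potentialAdd ω₁ (-ω₃) ω₂ g = potentialAdd ω₁ ω₂ ω₃ g := by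
  have h3 : ω₃ ≠ 0 := by rintro rfl; simp at h
  rw [potentialAdd_eq_modular h, potentialAdd_eq]
  simp only [div_neg, ← neg_div]
  simpa using potentialForm_balancedSnoc (ω₁ := ω₁) (periodic_theta_e_neg h3 (e (-ω₂ / ω₃)))
    (ω₂ := ω₂) (ω₃ := ω₃) (ω₂' := -ω₃) (ω₃' := ω₂) (-4) (by push_cast; ring) g 0

end ellipticPotential

section gammaModular

lemma neg_div_im_pos {a b : ℂ} (h : 0 < (a / b).im) : 0 < (-b / a).im := by
  have h0 : a / b ≠ 0 := by intro h0; simp [h0] at h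
  have : -b / a = -(a / b)⁻¹ := by rw [inv_div, neg_div]
  rw [this, neg_im, inv_im, neg_div, neg_neg]
  exact div_pos h (normSq_pos.2 h0)

lemma dblPoch_theta {p q : ℂ} (hp : ‖p‖ < 1) (hq : ‖q‖ < 1) (hq0 : q ≠ 0) {x : ℂ} (hx : x ≠ 0) :
    dblPoch p q ((q * x)⁻¹ * p * q) * dblPoch p q x =
      theta p x * (dblPoch p q (x⁻¹ * p * q) * dblPoch p q (q * x)) := by
  have h1 := dblPoch_eq_right hp hq x
  have h2 := dblPoch_eq_right hp hq (p * x⁻¹)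
  have e1 : (q * x)⁻¹ * p * q = p * x⁻¹ := by field_simp
  have e2 : x⁻¹ * p * q = q * (p * x⁻¹) := by ring
  rw [e1, e2, h1, h2, theta, div_eq_mul_inv]
  ring

lemma dblPoch_comp_hasDerivAt {p q : ℂ} (hp : ‖p‖ < 1) (hq : ‖q‖ < 1) {f : ℂ → ℂ} {f' x : ℂ}
    (hf : HasDerivAt f f' x) (hf' : f' ≠ 0) (hx : f x = 1) :
    ∃ d, d ≠ 0 ∧ HasDerivAt (fun u => dblPoch p q (f u)) d x := by
  have h : ∀ z, dblPoch p q z = (1 - z) * (qPoch (p * z) p * dblPoch p q (q * z)) := fun z => by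
    rw [dblPoch_eq_right hp hq, qPoch_eq hp, mul_assoc]
  have hR : DifferentiableAt ℂ (fun u => qPoch (p * f u) p * dblPoch p q (q * f u)) x := by
    refine DifferentiableAt.mul ?_ ?_
    · exact DifferentiableAt.comp (g := fun a => qPoch a p) (f := fun u => p * f u) x
        (differentiable_qPoch hp _) (hf.differentiableAt.const_mul p)
    · exact DifferentiableAt.comp (g := dblPoch p q) (f := fun u => q * f u) x
        (differentiable_dblPoch hp hq _) (hf.differentiableAt.const_mul q)
  refine ⟨-f' * (qPoch (p * f x) p * dblPoch p q (q * f x)), ?_, ?_⟩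
  · rw [hx, mul_one, mul_one]
    refine mul_ne_zero (neg_ne_zero.2 hf') (mul_ne_zero (qPoch_self_ne_zero hp) ?_)
    rw [Ne, dblPoch_eq_zero_iff hp hq]
    rintro ⟨a, b, hab⟩
    have := congrArg norm hab
    rw [norm_mul, norm_mul, norm_pow, norm_pow, norm_one] at this
    have h1 : ‖p‖ ^ a ≤ 1 := pow_le_one₀ (norm_nonneg _) hp.le
    have h2 : ‖q‖ ^ b ≤ 1 := pow_le_one₀ (norm_nonneg _) hq.le
    have h3 : ‖q‖ * ‖p‖ ^ a * ‖q‖ ^ b ≤ ‖q‖ * 1 * 1 := by gcongr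
    linarith
  · have := (hf.const_sub 1).mul hR.hasDerivAt
    rw [hx, sub_self, zero_mul, add_zero] at this
    rw [hx]
    refine this.congr_of_eventuallyEq (Eventually.of_forall fun u => ?_)
    exact h _

/-- The numerator of `Γ(e(u/ω₂); e(ω₃/ω₂), e(ω₁/ω₂))`. -/
noncomputable def gammaNum (ω₁ ω₂ ω₃ u : ℂ) : ℂ :=
  dblPoch (e (ω₃ / ω₂)) (e (ω₁ / ω₂)) (e ((ω₁ + ω₃ - u) / ω₂))

/-- The denominator of `Γ(e(u/ω₂); e(ω₃/ω₂), e(ω₁/ω₂))`. -/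
noncomputable def gammaDen (ω₁ ω₂ ω₃ u : ℂ) : ℂ :=
  dblPoch (e (ω₃ / ω₂)) (e (ω₁ / ω₂)) (e (u / ω₂))

lemma ellGamma_e (ω₁ ω₂ ω₃ u : ℂ) : ellGamma (e (ω₃ / ω₂)) (e (ω₁ / ω₂)) (e (u / ω₂)) =
    gammaNum ω₁ ω₂ ω₃ u / gammaDen ω₁ ω₂ ω₃ u := by
  rw [ellGamma_eq, gammaNum, gammaDen, ← e_neg, ← e_add, ← e_add]
  congr 3
  ring

lemma gammaNum_comm (ω₁ ω₂ ω₃ u : ℂ) : gammaNum ω₁ ω₂ ω₃ u = gammaNum ω₃ ω₂ ω₁ u := by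
  rw [gammaNum, gammaNum, dblPoch_comm, add_comm ω₁]

lemma gammaDen_comm (ω₁ ω₂ ω₃ u : ℂ) : gammaDen ω₁ ω₂ ω₃ u = gammaDen ω₃ ω₂ ω₁ u :=
  dblPoch_comm _ _ _

variable {ω₁ ω₂ ω₃ : ℂ}

lemma gamma_shift (h1 : 0 < (ω₁ / ω₂).im) (h3 : 0 < (ω₃ / ω₂).im) (u : ℂ) :
    gammaNum ω₁ ω₂ ω₃ (u + ω₁) * gammaDen ω₁ ω₂ ω₃ u = theta (e (ω₃ / ω₂)) (e (u / ω₂)) *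
      (gammaNum ω₁ ω₂ ω₃ u * gammaDen ω₁ ω₂ ω₃ (u + ω₁)) := by
  have := dblPoch_theta (norm_e_lt_one.2 h3) (norm_e_lt_one.2 h1) (e_ne_zero _) (e_ne_zero (u / ω₂))
  simp only [← e_neg, ← e_add] at this
  simp only [gammaNum, gammaDen]
  convert! this using 4
  all_goals congr 1; ring

lemma gammaNum_add (h2 : ω₂ ≠ 0) (u : ℂ) : gammaNum ω₁ ω₂ ω₃ (u + ω₂) = gammaNum ω₁ ω₂ ω₃ u := by
  rw [gammaNum, gammaNum, ← e_add_one ((ω₁ + ω₃ - (u + ω₂)) / ω₂)]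
  congr 2; field_simp; ring

lemma gammaDen_add (h2 : ω₂ ≠ 0) (u : ℂ) : gammaDen ω₁ ω₂ ω₃ (u + ω₂) = gammaDen ω₁ ω₂ ω₃ u := by
  rw [gammaDen, gammaDen, add_div, div_self h2, e_add_one]

lemma differentiable_gammaDen (h1 : 0 < (ω₁ / ω₂).im) (h3 : 0 < (ω₃ / ω₂).im) :
    Differentiable ℂ (gammaDen ω₁ ω₂ ω₃) := by
  have he : Differentiable ℂ (fun u : ℂ => e (u / ω₂)) :=
    differentiable_e.comp (differentiable_id.div_const ω₂)
  exact (differentiable_dblPoch (norm_e_lt_one.2 h3) (norm_e_lt_one.2 h1)).comp he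

lemma gammaNum_eq_gammaDen (ω₁ ω₂ ω₃ u : ℂ) :
    gammaNum ω₁ ω₂ ω₃ u = gammaDen ω₁ ω₂ ω₃ (ω₁ + ω₃ - u) := rfl

lemma differentiable_gammaNum (h1 : 0 < (ω₁ / ω₂).im) (h3 : 0 < (ω₃ / ω₂).im) :
    Differentiable ℂ (gammaNum ω₁ ω₂ ω₃) :=
  (differentiable_gammaDen h1 h3).comp (differentiable_id.const_sub _)

lemma gammaDen_eq_zero_iff (h1 : 0 < (ω₁ / ω₂).im) (h3 : 0 < (ω₃ / ω₂).im) {u : ℂ} :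
    gammaDen ω₁ ω₂ ω₃ u = 0 ↔ ∃ (a b : ℕ) (n : ℤ), u + a * ω₃ + b * ω₁ = n * ω₂ := by
  have h2 : ω₂ ≠ 0 := by rintro rfl; simp at h1
  rw [gammaDen, dblPoch_eq_zero_iff (norm_e_lt_one.2 h3) (norm_e_lt_one.2 h1)]
  refine exists_congr fun a => exists_congr fun b => ?_
  rw [← e_nat_mul, ← e_nat_mul, ← e_add, ← e_add, e_eq_one_iff]
  refine exists_congr fun n => ?_
  rw [← div_left_inj' h2 (a := u + _ + _), mul_div_cancel_right₀ _ h2]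
  exact Eq.congr (by ring) rfl

lemma gammaDen_hasDerivAt (h1 : 0 < (ω₁ / ω₂).im) (h3 : 0 < (ω₃ / ω₂).im) (n : ℤ) :
    ∃ d, d ≠ 0 ∧ HasDerivAt (gammaDen ω₁ ω₂ ω₃) d (n * ω₂) := by
  have h2 : ω₂ ≠ 0 := by rintro rfl; simp at h1
  have hx : e (n * ω₂ / ω₂) = 1 := by rw [mul_div_cancel_right₀ _ h2, e_int]
  have := (hasDerivAt_e (n * ω₂ / ω₂)).comp (n * ω₂ : ℂ) ((hasDerivAt_id' (n * ω₂ : ℂ)).div_const ω₂)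
  refine dblPoch_comp_hasDerivAt (norm_e_lt_one.2 h3) (norm_e_lt_one.2 h1) this ?_ hx
  rw [hx]
  exact mul_ne_zero (mul_ne_zero Complex.two_pi_I_ne_zero one_ne_zero) (one_div_ne_zero h2)

lemma cubicP_add (h1 : ω₁ ≠ 0) (h2 : ω₂ ≠ 0) (h3 : ω₃ ≠ 0) (u : ℂ) :
    cubicP ω₁ ω₂ ω₃ (u + ω₁) = cubicP ω₁ ω₂ ω₃ u + thetaExponent (ω₃ / ω₂) (u / ω₂) := by
  rw [cubicP, cubicP, thetaExponent]
  field_simp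
  ring

lemma cubicP_comm (ω₁ ω₂ ω₃ u : ℂ) : cubicP ω₁ ω₂ ω₃ u = cubicP ω₂ ω₁ ω₃ u := by
  rw [cubicP, cubicP]; ring

/-- The modular transformation of the elliptic gamma function in terms of entire functions. -/
lemma gamma_modular (h12 : 0 < (ω₁ / ω₂).im) (h31 : 0 < (ω₃ / ω₁).im) (h32 : 0 < (ω₃ / ω₂).im)
    (u : ℂ) :
    gammaNum ω₁ ω₂ ω₃ u * gammaNum (-ω₂) ω₁ ω₃ (ω₃ - u) * gammaDen (-ω₂) ω₃ (-ω₁) (-u) *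
        exp (Real.pi * I * cubicP ω₁ ω₂ ω₃ u) =
      gammaDen ω₁ ω₂ ω₃ u * gammaDen (-ω₂) ω₁ ω₃ (ω₃ - u) * gammaNum (-ω₂) ω₃ (-ω₁) (-u) := by
  have n1 : ω₁ ≠ 0 := by rintro rfl; simp at h12
  have n2 : ω₂ ≠ 0 := by rintro rfl; simp at h12
  have n3 : ω₃ ≠ 0 := by rintro rfl; simp at h31
  have h21 := neg_div_im_pos h12
  have h13 := neg_div_im_pos h31
  have h23 := neg_div_im_pos h32
  obtain ⟨α, β', h3⟩ := exists_real_coords h12.ne' ω₃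
  have hα : 0 < α := by
    have : (ω₃ / ω₂).im = α * (ω₁ / ω₂).im := by
      rw [h3, add_div, mul_div_assoc, mul_div_cancel_right₀ _ n2, add_im, im_ofReal_mul, ofReal_im,
        add_zero]
    rw [this] at h32
    exact pos_of_mul_pos_left h32 h12.le
  obtain ⟨β, rfl⟩ : ∃ β, β' = -β := ⟨-β', (neg_neg _).symm⟩
  have hβ : 0 < β := by
    have : (ω₃ / ω₁).im = β * (-ω₂ / ω₁).im := by
      rw [h3, add_div, mul_div_cancel_right₀ _ n1, mul_div_assoc, add_im, im_ofReal_mul, ofReal_im,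
        zero_add, neg_div, neg_im]
      ring
    rw [this] at h31
    exact pos_of_mul_pos_left h31 h21.le
  have indep : ∀ x y : ℝ, x * ω₁ + y * ω₂ = 0 → x = 0 ∧ y = 0 := fun x y h => by
    have hx : x = 0 := by
      have : (x : ℂ) * (ω₁ / ω₂) + y = 0 := by field_simp; linear_combination h
      have := congrArg Complex.im this
      simp only [add_im, im_ofReal_mul, ofReal_im, add_zero, zero_im] at this
      exact (mul_eq_zero.1 this).resolve_right h12.ne'
    subst hx
    simpa [n2] using h
  set d1 := gammaDen ω₁ ω₂ ω₃ with hd1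
  set N1 := gammaNum ω₁ ω₂ ω₃ with hN1
  set d2 : ℂ → ℂ := fun u => gammaDen (-ω₂) ω₁ ω₃ (ω₃ - u) with hd2
  set N2 : ℂ → ℂ := fun u => gammaNum (-ω₂) ω₁ ω₃ (ω₃ - u) with hN2
  set d3 : ℂ → ℂ := fun u => gammaDen (-ω₂) ω₃ (-ω₁) (-u) with hd3
  set N3 : ℂ → ℂ := fun u => gammaNum (-ω₂) ω₃ (-ω₁) (-u) with hN3
  set E : ℂ → ℂ := fun u => exp (Real.pi * I * cubicP ω₁ ω₂ ω₃ u) with hE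
  have D1 : Differentiable ℂ d1 := differentiable_gammaDen h12 h32
  have DN1 : Differentiable ℂ N1 := differentiable_gammaNum h12 h32
  have D2 : Differentiable ℂ d2 := (differentiable_gammaDen h21 h31).comp (differentiable_id.const_sub _)
  have DN2 : Differentiable ℂ N2 := (differentiable_gammaNum h21 h31).comp (differentiable_id.const_sub _)
  have D3 : Differentiable ℂ d3 := (differentiable_gammaDen h23 h13).comp differentiable_id.neg
  have DN3 : Differentiable ℂ N3 := (differentiable_gammaNum h23 h13).comp differentiable_id.neg
  have DE : Differentiable ℂ E := by
    simp only [hE, cubicP]; fun_prop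
  have z1 : ∀ s t : ℝ, d1 (s * ω₁ + t * ω₂) = 0 →
      ∃ (a b : ℕ) (n : ℤ), s = -(a * α) - b ∧ t = n + a * β := by
    intro s t h
    obtain ⟨a, b, n, h⟩ := (gammaDen_eq_zero_iff h12 h32).1 h
    have := indep (s + a * α + b) (t - a * β - n) (by
      push_cast; rw [h3] at h; push_cast at h; linear_combination h)
    exact ⟨a, b, n, by linarith [this.1], by linarith [this.2]⟩
  have z2 : ∀ s t : ℝ, d2 (s * ω₁ + t * ω₂) = 0 → ∃ a b : ℕ, t = -(a + 1) * β - b := by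
    intro s t h
    obtain ⟨a, b, n, h⟩ := (gammaDen_eq_zero_iff h21 h31).1 h
    have := indep (s - (a + 1) * α + n) (t + (a + 1) * β + b) (by
      push_cast; rw [h3] at h; push_cast at h; linear_combination -h)
    exact ⟨a, b, by linarith [this.2]⟩
  have z3 : ∀ s t : ℝ, N3 (s * ω₁ + t * ω₂) = 0 → ∃ (a b : ℕ) (n : ℤ),
      s = a + 1 + n * α ∧ t = b + 1 - n * β := by
    intro s t h
    obtain ⟨a, b, n, h⟩ := (gammaDen_eq_zero_iff h23 h13).1 h
    have := indep (s - (a + 1) - n * α) (t - (b + 1) + n * β) (by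
      push_cast; rw [h3] at h; push_cast at h; linear_combination h)
    exact ⟨a, b, n, by linarith [this.1], by linarith [this.2]⟩
  have hd0 : ∀ u : ℂ, (∃ s t : ℝ, u = s * ω₁ + t * ω₂ ∧ 0 ≤ t) → d2 u ≠ 0 := by
    rintro _ ⟨s, t, rfl, ht⟩ h
    obtain ⟨a, b, h⟩ := z2 s t h
    have : (0 : ℝ) ≤ a * β := by positivity
    have : (0 : ℝ) ≤ b := by positivity
    nlinarith
  have c1 : d1 0 = 0 := (gammaDen_eq_zero_iff h12 h32).2 ⟨0, 0, 0, by simp⟩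
  have dU : d1 (1 * ω₁) ≠ 0 := fun h => by
    obtain ⟨a, b, n, h, -⟩ := z1 1 0 (by simpa using h)
    have : (0 : ℝ) ≤ a * α := by positivity
    have : (0 : ℝ) ≤ b := by positivity
    linarith
  have N3U : ∀ s t : ℝ, s ≤ 1 → t ≤ 1 → N3 (s * ω₁ + t * ω₂) = 0 → s = 1 ∧ t = 1 := by
    intro s t hs ht h
    obtain ⟨a, b, n, e1, e2⟩ := z3 s t h
    have ha : (0 : ℝ) ≤ a := by positivity
    have hb : (0 : ℝ) ≤ b := by positivity
    have hn1 : (n : ℝ) ≤ 0 := by by_contra! hc; nlinarith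
    have hn2 : 0 ≤ (n : ℝ) := by by_contra! hc; nlinarith
    have hn : (n : ℝ) = 0 := le_antisymm hn1 hn2
    rw [hn, zero_mul] at e1 e2
    constructor <;> linarith
  have d1U : ∀ s t : ℝ, 0 ≤ s → d1 (s * ω₁ + t * ω₂) = 0 → s = 0 ∧ ∃ n : ℤ, t = n := by
    intro s t hs h
    obtain ⟨a, b, n, e1, e2⟩ := z1 s t h
    have ha : (0 : ℝ) ≤ a * α := by positivity
    have hb : (0 : ℝ) ≤ b := by positivity
    have ha0 : (a : ℝ) * α = 0 := by linarith
    have ha1 : (a : ℝ) = 0 := (mul_eq_zero.1 ha0).resolve_right hα.ne'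
    exact ⟨by linarith, n, by rw [e2, ha1]; ring⟩
  have hexp : ∀ x y : ℂ, exp (Real.pi * I * (x + y)) =
      exp (Real.pi * I * y) * exp (Real.pi * I * x) := fun x y => by
    rw [mul_add, exp_add, mul_comm]
  obtain ⟨c, hc⟩ := eq_const_mul_of_periodic (F := fun u => N1 u * N2 u * d3 u * E u)
    (D := fun u => d1 u * d2 u * N3 u) (((DN1.mul DN2).mul D3).mul DE) ((D1.mul D2).mul DN3)
    ⟨1 * ω₁, mul_ne_zero (mul_ne_zero dU (hd0 _ ⟨1, 0, by simp, le_rfl⟩)) fun h => by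
      have := (N3U 1 0 le_rfl zero_le_one (by simpa using h)).2
      norm_num at this⟩ (ω₁ := ω₁) (ω₂ := ω₂)
    (fun u => by
      have s1 := gamma_shift h12 h32 u
      have s2 : d2 (u + ω₁) = d2 u := by
        simp only [hd2]; rw [← gammaDen_add n1]; congr 1; ring
      have s2' : N2 (u + ω₁) = N2 u := by
        simp only [hN2]; rw [← gammaNum_add n1]; congr 1; ring
      have s4 := gamma_shift h13 h23 (-u)
      rw [theta_modular h32 u] at s4
      simp only [gammaNum_comm (-ω₁) ω₃ (-ω₂), gammaDen_comm (-ω₁) ω₃ (-ω₂)] at s4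
      have s5 : -u + -ω₁ = -(u + ω₁) := by ring
      rw [s5] at s4
      simp only [s2, s2', hE, cubicP_add n1 n2 n3, hexp]
      simp only [hd3, hN3]
      linear_combination (N2 u * gammaDen (-ω₂) ω₃ (-ω₁) (-(u + ω₁)) *
          (exp (Real.pi * I * thetaExponent (ω₃ / ω₂) (u / ω₂)) *
            exp (Real.pi * I * cubicP ω₁ ω₂ ω₃ u)) * d2 u * gammaNum (-ω₂) ω₃ (-ω₁) (-u)) * s1 -
        (N1 u * d1 (u + ω₁) * N2 u * d2 u * exp (Real.pi * I * cubicP ω₁ ω₂ ω₃ u)) * s4)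
    (fun u => by
      have s1 := gamma_shift h21 h31 (ω₃ - u)
      have s2 : d1 (u + ω₂) = d1 u := gammaDen_add n2 u
      have s2' : N1 (u + ω₂) = N1 u := gammaNum_add n2 u
      have s4 := gamma_shift h23 h13 (-u)
      rw [theta_modular h31 u] at s4
      have s5 : -u + -ω₂ = -(u + ω₂) := by ring
      have s6 : ω₃ - u + -ω₂ = ω₃ - (u + ω₂) := by ring
      rw [s6, sub_div, e_sub, theta_p_div (norm_e_lt_one.2 h31) (e_ne_zero _) (e_ne_zero _)] at s1
      rw [s5] at s4
      simp only [s2, s2', hE, cubicP_comm ω₁ ω₂, cubicP_add n2 n1 n3, hexp]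
      simp only [hd3, hN3, hd2, hN2]
      linear_combination (N1 u * gammaDen (-ω₂) ω₃ (-ω₁) (-(u + ω₂)) *
          (exp (Real.pi * I * thetaExponent (ω₃ / ω₁) (u / ω₁)) *
            exp (Real.pi * I * cubicP ω₂ ω₁ ω₃ u)) * d1 u * gammaNum (-ω₂) ω₃ (-ω₁) (-u)) * s1 -
        (N1 u * d1 u * gammaNum (-ω₂) ω₁ ω₃ (ω₃ - u) * gammaDen (-ω₂) ω₁ ω₃ (ω₃ - (u + ω₂)) *
          exp (Real.pi * I * cubicP ω₂ ω₁ ω₃ u)) * s4)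
    (isCompact_parallelogram ω₁ ω₂ 0) (parallelogram_covers h12.ne' 0)
    (by
      rintro _ ⟨⟨s, t⟩, ⟨⟨hs0, hs1⟩, ht0, ht1⟩, rfl⟩
      simp only [zero_add] at hs0 hs1 ht0 ht1
      simp only
      have hd2' := hd0 (s * ω₁ + t * ω₂) ⟨s, t, rfl, ht0⟩
      by_cases hz1 : d1 (s * ω₁ + t * ω₂) = 0
      · obtain ⟨rfl, n, rfl⟩ := d1U s t hs0 hz1
        have hx : ((0 : ℝ) : ℂ) * ω₁ + ((n : ℝ) : ℂ) * ω₂ = n * ω₂ := by simp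
        have hN3 : N3 (((0 : ℝ) : ℂ) * ω₁ + ((n : ℝ) : ℂ) * ω₂) ≠ 0 := fun h => by
          have := (N3U 0 n zero_le_one ht1 h).1
          norm_num at this
        rw [hx] at hz1 hd2' hN3 ⊢
        obtain ⟨d, hd, hder⟩ := gammaDen_hasDerivAt h12 h32 n
        refine eventually_norm_le_of_deriv_ne_zero ((((DN1.mul DN2).mul D3).mul DE) _)
          ((hder.mul (D2 _).hasDerivAt).mul (DN3 _).hasDerivAt) ?_ ?_
        · rw [← hd1]
          simp only [Pi.mul_apply, hz1, zero_mul, add_zero]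
          exact mul_ne_zero (mul_ne_zero hd hd2') hN3
        · have hn : n = 0 ∨ n = 1 := by
            have a1 : (0 : ℤ) ≤ n := by exact_mod_cast ht0
            have a2 : n ≤ 1 := by exact_mod_cast ht1
            omega
          rcases hn with rfl | rfl
          · have : d3 ((0 : ℤ) * ω₂) = 0 := (gammaDen_eq_zero_iff h23 h13).2 ⟨0, 0, 0, by simp⟩
            simp only [this, mul_zero, zero_mul]
          · have : N2 ((1 : ℤ) * ω₂) = 0 := by
              simp only [hN2, gammaNum_eq_gammaDen]
              exact (gammaDen_eq_zero_iff h21 h31).2 ⟨0, 0, 0, by push_cast; ring⟩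
            simp only [this, mul_zero, zero_mul]
      · by_cases hz3 : N3 (s * ω₁ + t * ω₂) = 0
        · obtain ⟨rfl, rfl⟩ := N3U s t hs1 ht1 hz3
          have hx : ((1 : ℝ) : ℂ) * ω₁ + ((1 : ℝ) : ℂ) * ω₂ = ω₁ + ω₂ := by simp
          rw [hx] at hz1 hz3 hd2' ⊢
          obtain ⟨d, hd, hder⟩ := gammaDen_hasDerivAt h23 h13 0
          have hder' : HasDerivAt N3 d (ω₁ + ω₂) := by
            have h1 : HasDerivAt (fun u : ℂ => -ω₂ + -ω₁ - -u) 1 (ω₁ + ω₂) := by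
              simpa using ((hasDerivAt_id (ω₁ + ω₂)).neg).const_sub (-ω₂ + -ω₁)
            have h2 : HasDerivAt (gammaDen (-ω₂) ω₃ (-ω₁)) d (-ω₂ + -ω₁ - -(ω₁ + ω₂)) := by
              convert! hder using 1
              simp
            have h4 := h2.comp (ω₁ + ω₂) h1
            rw [mul_one] at h4
            exact h4
          refine eventually_norm_le_of_deriv_ne_zero ((((DN1.mul DN2).mul D3).mul DE) _)
            (((D1 _).mul (D2 _)).hasDerivAt.mul hder') ?_ ?_
          · rw [hz3, mul_zero, zero_add]
            exact mul_ne_zero (mul_ne_zero hz1 hd2') hd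
          · have : N2 (ω₁ + ω₂) = 0 := by
              simp only [hN2, gammaNum_eq_gammaDen]
              exact (gammaDen_eq_zero_iff h21 h31).2 ⟨0, 0, 1, by push_cast; ring⟩
            simp only [this, mul_zero, zero_mul]
        · exact eventually_norm_le_of_ne_zero (((DN1.mul DN2).mul D3).mul DE).continuous.continuousAt
            ((D1.mul D2).mul DN3).continuous.continuousAt (mul_ne_zero (mul_ne_zero hz1 hd2') hz3))
  have hmid := hc ((ω₁ + ω₂ + ω₃) / 2)
  have m0 : (ω₁ + ω₂ + ω₃) / 2 = ((1 + α) / 2 : ℝ) * ω₁ + ((1 - β) / 2 : ℝ) * ω₂ := by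
    rw [h3]; push_cast; ring
  have e1 : ∀ x y : ℂ, x = y + 1 → e x = e y := fun x y h => by rw [h, e_add_one]
  have m1 : N1 ((ω₁ + ω₂ + ω₃) / 2) = d1 ((ω₁ + ω₂ + ω₃) / 2) := by
    simp only [hN1, hd1, gammaNum, gammaDen]
    congr 1; exact (e1 _ _ (by field_simp; ring)).symm
  have m2 : N2 ((ω₁ + ω₂ + ω₃) / 2) = d2 ((ω₁ + ω₂ + ω₃) / 2) := by
    simp only [hN2, hd2, gammaNum, gammaDen]
    congr 1; exact e1 _ _ (by field_simp; ring)
  have m3 : N3 ((ω₁ + ω₂ + ω₃) / 2) = d3 ((ω₁ + ω₂ + ω₃) / 2) := by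
    simp only [hN3, hd3, gammaNum, gammaDen]
    congr 1; exact e1 _ _ (by field_simp; ring)
  have mE : E ((ω₁ + ω₂ + ω₃) / 2) = 1 := by simp [hE, cubicP]
  have k1 : d1 ((ω₁ + ω₂ + ω₃) / 2) ≠ 0 := fun h => by
    rw [m0] at h
    have := (d1U _ _ (by positivity) h).1
    linarith
  have k2 : d2 ((ω₁ + ω₂ + ω₃) / 2) ≠ 0 := fun h => by
    rw [m0] at h
    obtain ⟨a, b, h⟩ := z2 _ _ h
    have : (0 : ℝ) ≤ a * β := by positivity
    have : (0 : ℝ) ≤ b := by positivity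
    nlinarith
  have k3 : N3 ((ω₁ + ω₂ + ω₃) / 2) ≠ 0 := fun h => by
    rw [m0] at h
    obtain ⟨a, b, n, e1, e2⟩ := z3 _ _ h
    have ha : (0 : ℝ) ≤ a := by positivity
    have hb : (0 : ℝ) ≤ b := by positivity
    rcases le_or_gt n 0 with hn | hn
    · have : (n : ℝ) ≤ 0 := by exact_mod_cast hn
      nlinarith
    · have : (1 : ℝ) ≤ n := by exact_mod_cast hn
      nlinarith
  simp only [m1, m2, mE, mul_one, ← m3] at hmid
  have : c = 1 := by
    have hD := mul_ne_zero (mul_ne_zero k1 k2) k3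
    exact (mul_right_cancel₀ hD (by rw [one_mul]; exact hmid)).symm
  have := hc u
  rw [‹c = 1›, one_mul] at this
  exact this

end gammaModular

section modifiedFunctions

variable {ω₁ ω₂ ω₃ : ℂ}

/-- The third elliptic gamma function in the modular triple. -/
noncomputable def dualGamma (ω₁ ω₂ ω₃ u : ℂ) : ℂ :=
  ellGamma (e (-ω₁ / ω₃)) (e (-ω₂ / ω₃)) (e (-u / ω₃))

lemma dualGamma_eq (ω₁ ω₂ ω₃ u : ℂ) : dualGamma ω₁ ω₂ ω₃ u =
    gammaNum (-ω₂) ω₃ (-ω₁) (-u) / gammaDen (-ω₂) ω₃ (-ω₁) (-u) :=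
  ellGamma_e _ _ _ _

lemma modGamma_of_pos (h12 : 0 < (ω₁ / ω₂).im) (u : ℂ) : modGamma ω₁ ω₂ ω₃ u =
    gammaNum ω₁ ω₂ ω₃ u / gammaDen ω₁ ω₂ ω₃ u *
      (gammaNum (-ω₂) ω₁ ω₃ (ω₃ - u) / gammaDen (-ω₂) ω₁ ω₃ (ω₃ - u)) := by
  rw [modGamma, if_pos h12, ← e_add, ← add_div, ellGamma_e, ← sub_eq_add_neg, ellGamma_e]

lemma dual_gammaDen_ne_zero (h12 : 0 < (ω₁ / ω₂).im) (h31 : 0 < (ω₃ / ω₁).im)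
    (h32 : 0 < (ω₃ / ω₂).im) {u : ℂ} (h1 : gammaDen ω₁ ω₂ ω₃ u ≠ 0)
    (h2 : gammaDen (-ω₂) ω₁ ω₃ (ω₃ - u) ≠ 0) : gammaDen (-ω₂) ω₃ (-ω₁) (-u) ≠ 0 := by
  intro h3
  obtain ⟨a, b, n, h⟩ := (gammaDen_eq_zero_iff (neg_div_im_pos h32) (neg_div_im_pos h31)).1 h3
  rcases le_or_gt 0 n with hn | hn
  · lift n to ℕ using hn
    refine h1 ((gammaDen_eq_zero_iff h12 h32).2 ⟨n, a, -b, ?_⟩)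
    push_cast at h ⊢
    linear_combination -h
  · obtain ⟨m, rfl⟩ : ∃ m : ℕ, n = -(m + 1) := ⟨(-n - 1).toNat, by omega⟩
    refine h2 ((gammaDen_eq_zero_iff (neg_div_im_pos h12) h31).2 ⟨m, b, a, ?_⟩)
    push_cast at h ⊢
    linear_combination h

lemma modGamma_eq_of_gammaDen (h12 : 0 < (ω₁ / ω₂).im) (h31 : 0 < (ω₃ / ω₁).im)
    (h32 : 0 < (ω₃ / ω₂).im) {u : ℂ} (h1 : gammaDen ω₁ ω₂ ω₃ u ≠ 0)
    (h2 : gammaDen (-ω₂) ω₁ ω₃ (ω₃ - u) ≠ 0) :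
    modGamma ω₁ ω₂ ω₃ u = exp (-Real.pi * I * cubicP ω₁ ω₂ ω₃ u) * dualGamma ω₁ ω₂ ω₃ u := by
  have h3 := dual_gammaDen_ne_zero h12 h31 h32 h1 h2
  have key := gamma_modular h12 h31 h32 u
  have hE : exp (-Real.pi * I * cubicP ω₁ ω₂ ω₃ u) = (exp (Real.pi * I * cubicP ω₁ ω₂ ω₃ u))⁻¹ := by
    rw [← exp_neg]; congr 1; ring
  rw [modGamma_of_pos h12, dualGamma_eq, hE]
  have h4 := Complex.exp_ne_zero (Real.pi * I * cubicP ω₁ ω₂ ω₃ u)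
  field_simp
  linear_combination key

lemma modGamma_eq_of_ne_zero (h12 : 0 ≤ (ω₁ / ω₂).im) (h31 : 0 < (ω₃ / ω₁).im)
    (h32 : 0 < (ω₃ / ω₂).im) {u : ℂ} (h : modGamma ω₁ ω₂ ω₃ u ≠ 0) :
    modGamma ω₁ ω₂ ω₃ u = exp (-Real.pi * I * cubicP ω₁ ω₂ ω₃ u) * dualGamma ω₁ ω₂ ω₃ u := by
  rcases h12.lt_or_eq with h12 | h12
  · rw [modGamma_of_pos h12, mul_ne_zero_iff, div_ne_zero_iff, div_ne_zero_iff] at h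
    exact modGamma_eq_of_gammaDen h12 h31 h32 h.1.2 h.2.2
  · rw [modGamma, if_neg h12.ge.not_gt, dualGamma]

lemma countable_gammaDen_zeros (h1 : 0 < (ω₁ / ω₂).im) (h3 : 0 < (ω₃ / ω₂).im) :
    {u | gammaDen ω₁ ω₂ ω₃ u = 0}.Countable := by
  refine (Set.countable_range fun m : ℕ × ℕ × ℤ => m.2.2 * ω₂ - m.1 * ω₃ - m.2.1 * ω₁).mono ?_
  intro u hu
  obtain ⟨a, b, n, h⟩ := (gammaDen_eq_zero_iff h1 h3).1 hu
  exact ⟨(a, b, n), by simp only; rw [← h]; ring⟩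

lemma exists_countable_modGamma_eq (h12 : 0 ≤ (ω₁ / ω₂).im) (h31 : 0 < (ω₃ / ω₁).im)
    (h32 : 0 < (ω₃ / ω₂).im) : ∃ B : Set ℂ, B.Countable ∧ ∀ u ∉ B,
      modGamma ω₁ ω₂ ω₃ u =
        exp (-Real.pi * I * cubicP ω₁ ω₂ ω₃ u) * dualGamma ω₁ ω₂ ω₃ u := by
  rcases h12.lt_or_eq with h12 | h12
  · refine ⟨{u | gammaDen ω₁ ω₂ ω₃ u = 0} ∪ {u | gammaDen (-ω₂) ω₁ ω₃ (ω₃ - u) = 0},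
      (countable_gammaDen_zeros h12 h32).union
        ((countable_gammaDen_zeros (neg_div_im_pos h12) h31).preimage sub_right_injective), ?_⟩
    intro u hu
    simp only [Set.mem_union, Set.mem_ofPred_eq, not_or] at hu
    exact modGamma_eq_of_gammaDen h12 h31 h32 hu.1 hu.2
  · exact ⟨∅, Set.countable_empty, fun u _ => by rw [modGamma, if_neg h12.ge.not_gt, dualGamma]⟩

lemma cubicP_add_sub (a x : ℂ) : cubicP ω₁ ω₂ ω₃ (a + x) + cubicP ω₁ ω₂ ω₃ (a - x) =
    2 * cubicP ω₁ ω₂ ω₃ a + 6 * (a - (ω₁ + ω₂ + ω₃) / 2) * x ^ 2 / (3 * ω₁ * ω₂ * ω₃) := by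
  rw [cubicP, cubicP, cubicP]; ring

/-- `e^{-2πi g_j/ω₃}`. -/
lemma expParams_neg (ω₃ : ℂ) (g : Fin 8 → ℂ) (j : Fin 8) : expParams (-ω₃) g j = e (-g j / ω₃) := by
  rw [expParams, div_neg, neg_div]

lemma LinedUp.norm_lt_one {g : Fin 8 → ℂ} (h : LinedUp ω₃ g) (j : Fin 8) :
    ‖expParams (-ω₃) g j‖ < 1 := by
  rw [expParams_neg, norm_e_lt_one, neg_div, neg_im]
  linarith [h j]

lemma expParams_ne_zero (ω : ℂ) (g : Fin 8 → ℂ) (j : Fin 8) : expParams ω g j ≠ 0 := e_ne_zero _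

lemma norm_mul_pow_lt_one {p q t : ℂ} (hp : ‖p‖ < 1) (hq : ‖q‖ < 1) (ht : ‖t‖ < 1) (a b : ℕ) :
    ‖t * p ^ a * q ^ b‖ < 1 := by
  rw [norm_mul, norm_mul, norm_pow, norm_pow]
  have h1 : ‖p‖ ^ a ≤ 1 := pow_le_one₀ (norm_nonneg _) hp.le
  have h2 : ‖q‖ ^ b ≤ 1 := pow_le_one₀ (norm_nonneg _) hq.le
  calc ‖t‖ * ‖p‖ ^ a * ‖q‖ ^ b ≤ ‖t‖ * 1 * 1 := by gcongr
    _ < 1 := by simpa using ht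

lemma admissible_of_norm_lt_one {p q : ℂ} (hp : ‖p‖ < 1) (hq : ‖q‖ < 1) {t : Fin 8 → ℂ}
    (ht : ∀ j, ‖t j‖ < 1) : Admissible p q t := fun j k a b h => by
  have h1 : ‖t j * t k‖ < 1 := by
    rw [norm_mul]
    exact mul_lt_one_of_nonneg_of_lt_one_left (norm_nonneg _) (ht j) (ht k).le
  have := norm_mul_pow_lt_one hp hq h1 a b
  rw [h, norm_one] at this
  exact lt_irrefl _ this

/-- For parameters inside the unit circle `V` is an integral over the unit circle. -/
lemma V_eq_integral {p q : ℂ} (hp : ‖p‖ < 1) (hq : ‖q‖ < 1) (hp0 : p ≠ 0) (hq0 : q ≠ 0)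
    {t : Fin 8 → ℂ} (ht0 : ∀ j, t j ≠ 0) (ht : ∀ j, ‖t j‖ < 1) :
    V p q t = qPoch q q * qPoch p p / 2 * ∫ s in (0 : ℝ)..1, kernel p q t (e s) := by
  have hi := fun j a b => norm_mul_pow_lt_one hp hq (ht j) a b
  have hn0 : ∀ j a b, t j * p ^ a * q ^ b ≠ 0 := fun j a b =>
    mul_ne_zero (mul_ne_zero (ht0 j) (pow_ne_zero _ hp0)) (pow_ne_zero _ hq0)
  have ho : ∀ j a b, 1 < ‖(t j * p ^ a * q ^ b)⁻¹‖ := fun j a b => by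
    rw [norm_inv]; exact one_lt_inv_iff₀.2 ⟨norm_pos_iff.2 (hn0 j a b), hi j a b⟩
  have hv : ∀ s, (circleCurve 0 1).toFun s = e s := fun s => by
    simp only [circleCurve, circleMap, e]
    push_cast
    rw [zero_add, one_mul]
    congr 1; ring
  have hC : IsSeparating p q t [circleCurve 0 1] := by
    have hu : ∀ s, ‖(circleCurve 0 1).toFun s‖ = 1 := fun s => by
      rw [hv, norm_e]; simp
    refine ⟨?_, ?_, ?_, ?_, ?_, ?_⟩
    · intro γ hγ s h
      rw [List.mem_singleton.1 hγ] at h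
      have := hu s
      rw [h, norm_zero] at this
      exact zero_ne_one this
    · intro γ hγ s j a b h
      rw [List.mem_singleton.1 hγ] at h
      have := hu s
      rw [h] at this
      exact (hi j a b).ne this
    · intro γ hγ s j a b h
      rw [List.mem_singleton.1 hγ] at h
      have := hu s
      rw [h] at this
      exact (ho j a b).ne' this
    · exact contourIndex_circleCurve_inside (by simp)
    · exact fun j a b => contourIndex_circleCurve_inside (by rw [sub_zero]; exact hi j a b)
    · exact fun j a b => contourIndex_circleCurve_outside zero_le_one (by rw [sub_zero]; exact ho j a b)
  have hd : ∀ s : ℝ, deriv (circleCurve 0 1).toFun s = 2 * Real.pi * I * e s := fun s => by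
    have h1 : HasDerivAt (fun s : ℝ => e s) (2 * Real.pi * I * e s) s :=
      (hasDerivAt_e s).comp_ofReal
    rw [show (circleCurve 0 1).toFun = fun s : ℝ => e s from funext hv, h1.deriv]
  rw [V_eq hp hq hp0 hq0 ht0 hC, contourIntegral_cons, contourIntegral_nil, add_zero,
    ClosedCurve.integral]
  simp only [hv, hd]
  have : ∀ s : ℝ, kernel p q t (e s) / e s * (2 * Real.pi * I * e s) =
      2 * Real.pi * I * kernel p q t (e s) := fun s => by
    have := e_ne_zero s
    field_simp
  simp only [this, intervalIntegral.integral_const_mul]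
  rw [kappa]
  have h2 := Complex.two_pi_I_ne_zero
  have h3 : (Real.pi : ℂ) ≠ 0 := by exact_mod_cast Real.pi_ne_zero
  field_simp [I_ne_zero]
  ring

/-- `v^{mod}` is proportional to the modular transform of `v`. -/
theorem vMod_eq (h12 : 0 ≤ (ω₁ / ω₂).im) (h31 : 0 < (ω₃ / ω₁).im) (h32 : 0 < (ω₃ / ω₂).im)
    {g : Fin 8 → ℂ} (hb : AddBalanced ω₁ ω₂ ω₃ g) (hl : LinedUp ω₃ g) :
    vMod g ω₁ ω₂ ω₃ =
      2 * ω₃ * exp (2 * Real.pi * I * (cubicP ω₁ ω₂ ω₃ 0 - ∑ j, cubicP ω₁ ω₂ ω₃ (g j))) /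
        (ω₂ * qPoch (e (-ω₂ / ω₃)) (e (-ω₂ / ω₃)) * qPoch (e (-ω₁ / ω₃)) (e (-ω₁ / ω₃))) *
        v g ω₁ (-ω₃) ω₂ := by
  have n1 : ω₁ ≠ 0 := by rintro rfl; simp at h31
  have n2 : ω₂ ≠ 0 := by rintro rfl; simp at h32
  have n3 : ω₃ ≠ 0 := by rintro rfl; simp at h31
  have hp := norm_e_lt_one.2 (neg_div_im_pos h31)
  have hq := norm_e_lt_one.2 (neg_div_im_pos h32)
  obtain ⟨B, hB, hmod⟩ := exists_countable_modGamma_eq h12 h31 h32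
  set T := expParams (-ω₃) g with hT
  set K := exp (2 * Real.pi * I * (cubicP ω₁ ω₂ ω₃ 0 - ∑ j, cubicP ω₁ ω₂ ω₃ (g j))) with hK
  have hinj : ∀ a b : ℂ, b ≠ 0 → Function.Injective fun s : ℝ => a + b * s := fun a b hb s t h => by
    simpa [hb] using h
  have hpt : ∀ᵐ s : ℝ, (∏ j : Fin 8, modGamma ω₁ ω₂ ω₃ (g j + s * ω₃) *
        modGamma ω₁ ω₂ ω₃ (g j - s * ω₃)) /
      (modGamma ω₁ ω₂ ω₃ (2 * (s * ω₃)) * modGamma ω₁ ω₂ ω₃ (-(2 * (s * ω₃)))) * (ω₃ / ω₂) =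
      K * (ω₃ / ω₂) * kernel (e (-ω₁ / ω₃)) (e (-ω₂ / ω₃)) T (e s) := by
    have hc : ((⋃ j : Fin 8, (fun s : ℝ => g j + ω₃ * s) ⁻¹' B ∪ (fun s : ℝ => g j + -ω₃ * s) ⁻¹' B) ∪
        ((fun s : ℝ => 0 + 2 * ω₃ * s) ⁻¹' B ∪ (fun s : ℝ => 0 + -(2 * ω₃) * s) ⁻¹' B)).Countable := by
      refine (Set.countable_iUnion fun j => (hB.preimage (hinj _ _ n3)).union
        (hB.preimage (hinj _ _ (neg_ne_zero.2 n3)))).union ((hB.preimage (hinj _ _ ?_)).union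
        (hB.preimage (hinj _ _ ?_))) <;> simp [n3]
    filter_upwards [hc.ae_notMem MeasureTheory.volume] with s hs
    simp only [Set.mem_union, Set.mem_iUnion, Set.mem_preimage, not_or, not_exists] at hs
    obtain ⟨hs1, hs2, hs3⟩ := hs
    have hj1 : ∀ j, modGamma ω₁ ω₂ ω₃ (g j + s * ω₃) = _ := fun j =>
      hmod _ (by rw [mul_comm]; exact (hs1 j).1)
    have hj2 : ∀ j, modGamma ω₁ ω₂ ω₃ (g j - s * ω₃) = _ := fun j =>
      hmod _ (by rw [show g j - s * ω₃ = g j + -ω₃ * s by ring]; exact (hs1 j).2)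
    have hj3 : modGamma ω₁ ω₂ ω₃ (2 * (s * ω₃)) = _ :=
      hmod _ (by rw [show 2 * (s * ω₃) = 0 + 2 * ω₃ * s by ring]; exact hs2)
    have hj4 : modGamma ω₁ ω₂ ω₃ (-(2 * (s * ω₃))) = _ :=
      hmod _ (by rw [show -(2 * (s * ω₃)) = 0 + -(2 * ω₃) * s by ring]; exact hs3)
    have d1 : ∀ j, dualGamma ω₁ ω₂ ω₃ (g j + s * ω₃) =
        ellGamma (e (-ω₁ / ω₃)) (e (-ω₂ / ω₃)) (T j * (e s)⁻¹) := fun j => by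
      rw [dualGamma, hT, expParams_neg, ← e_neg, ← e_add]; congr 2; field_simp; ring
    have d2 : ∀ j, dualGamma ω₁ ω₂ ω₃ (g j - s * ω₃) =
        ellGamma (e (-ω₁ / ω₃)) (e (-ω₂ / ω₃)) (T j * e s) := fun j => by
      rw [dualGamma, hT, expParams_neg, ← e_add]; congr 2; field_simp; ring
    have d3 : dualGamma ω₁ ω₂ ω₃ (2 * (s * ω₃)) =
        ellGamma (e (-ω₁ / ω₃)) (e (-ω₂ / ω₃)) ((e s)⁻¹ ^ 2) := by
      rw [dualGamma, ← e_neg, ← e_two_mul]; congr 2; field_simp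
    have d4 : dualGamma ω₁ ω₂ ω₃ (-(2 * (s * ω₃))) =
        ellGamma (e (-ω₁ / ω₃)) (e (-ω₂ / ω₃)) (e s ^ 2) := by
      rw [dualGamma, ← e_two_mul]; congr 2; field_simp
    have hprod : ∏ j : Fin 8, modGamma ω₁ ω₂ ω₃ (g j + s * ω₃) * modGamma ω₁ ω₂ ω₃ (g j - s * ω₃) =
        exp (∑ j : Fin 8, -Real.pi * I * (cubicP ω₁ ω₂ ω₃ (g j + s * ω₃) +
          cubicP ω₁ ω₂ ω₃ (g j - s * ω₃))) *
        ∏ j : Fin 8, ellGamma (e (-ω₁ / ω₃)) (e (-ω₂ / ω₃)) (T j * e s) *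
          ellGamma (e (-ω₁ / ω₃)) (e (-ω₂ / ω₃)) (T j * (e s)⁻¹) := by
      rw [Complex.exp_sum, ← Finset.prod_mul_distrib]
      refine Finset.prod_congr rfl fun j _ => ?_
      rw [hj1, hj2, d1, d2, mul_add, exp_add]
      ring
    have hexp : exp (∑ j : Fin 8, -Real.pi * I * (cubicP ω₁ ω₂ ω₃ (g j + s * ω₃) +
          cubicP ω₁ ω₂ ω₃ (g j - s * ω₃))) =
        K * (exp (-Real.pi * I * cubicP ω₁ ω₂ ω₃ (2 * (s * ω₃))) *
          exp (-Real.pi * I * cubicP ω₁ ω₂ ω₃ (-(2 * (s * ω₃))))) := by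
      rw [hK, ← exp_add, ← exp_add]
      congr 1
      rw [← Finset.mul_sum, ← mul_add]
      have h0 := cubicP_add_sub (ω₁ := ω₁) (ω₂ := ω₂) (ω₃ := ω₃) 0 (2 * (s * ω₃))
      rw [zero_add, zero_sub] at h0
      rw [h0, Finset.sum_congr rfl fun j _ => cubicP_add_sub (g j) (s * ω₃), Finset.sum_add_distrib,
        ← Finset.mul_sum, ← Finset.sum_div, ← Finset.sum_mul, ← Finset.mul_sum,
        Finset.sum_sub_distrib, hb]
      simp
      ring
    rw [hprod, hexp, hj3, hj4, d3, d4, kernel]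
    have e1 := Complex.exp_ne_zero (-Real.pi * I * cubicP ω₁ ω₂ ω₃ (2 * (s * ω₃)))
    have e2 := Complex.exp_ne_zero (-Real.pi * I * cubicP ω₁ ω₂ ω₃ (-(2 * (s * ω₃))))
    rw [mul_mul_mul_comm (exp _), mul_assoc K, mul_left_comm K, mul_div_mul_left _ _ (mul_ne_zero e1 e2),
      mul_comm (ellGamma _ _ ((e s)⁻¹ ^ 2))]
    ring
  have hV := V_eq_integral hp hq (e_ne_zero _) (e_ne_zero _) (expParams_ne_zero _ _) hl.norm_lt_one
  have hv : v g ω₁ (-ω₃) ω₂ = V (e (-ω₁ / ω₃)) (e (-ω₂ / ω₃)) T := by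
    rw [v, div_neg, div_neg, ← neg_div, ← neg_div]
  have hper : Function.Periodic (fun s : ℝ => kernel (e (-ω₁ / ω₃)) (e (-ω₂ / ω₃)) T (e s)) 1 :=
    fun s => by simp only [ofReal_add, ofReal_one, e_add_one]
  have hint := hper.intervalIntegral_add_eq (-1 / 2) 0
  rw [show (-1 / 2 + 1 : ℝ) = 1 / 2 by norm_num, zero_add] at hint
  rw [hv, hV, vMod, intervalIntegral.integral_congr_ae (hpt.mono fun s hs _ => hs),
    intervalIntegral.integral_const_mul, hint]
  have q1 := qPoch_self_ne_zero hp
  have q2 := qPoch_self_ne_zero hq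
  generalize qPoch (e (-ω₁ / ω₃)) (e (-ω₁ / ω₃)) = Q1 at *
  generalize qPoch (e (-ω₂ / ω₃)) (e (-ω₂ / ω₃)) = Q2 at *
  generalize (∫ s in (0 : ℝ)..1, kernel (e (-ω₁ / ω₃)) (e (-ω₂ / ω₃)) T (e s)) = J
  field_simp

end modifiedFunctions

section modifiedEquation

variable {ω₁ ω₂ ω₃ : ℂ}

lemma sum_univ_eq_add_sum_Iio (f : Fin 8 → ℂ) :
    ∑ j, f j = f 7 + ∑ k ∈ Finset.Iio (7 : Fin 8), f k := by
  have : (Finset.univ : Finset (Fin 8)) = insert 7 (Finset.Iio 7) := by decide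
  rw [this, Finset.sum_insert (by decide)]

/-- The ratio of `U^{mod}` and the modular transform of `U`. -/
noncomputable def dualFactor (ω₁ ω₂ ω₃ g₈ : ℂ) : ℂ :=
  2 * ω₃ / (ω₂ * qPoch (e (-ω₂ / ω₃)) (e (-ω₂ / ω₃)) * qPoch (e (-ω₁ / ω₃)) (e (-ω₁ / ω₃))) *
    exp (2 * Real.pi * I * (cubicP ω₁ ω₂ ω₃ 0 - cubicP ω₁ ω₂ ω₃ g₈) +
      Real.pi * I * (6 * (-(3 / 2) * (ω₁ + ω₂ + ω₃) - g₈) * g₈ ^ 2 / (3 * ω₁ * ω₂ * ω₃)))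

lemma dualFactor_ne_zero (h31 : 0 < (ω₃ / ω₁).im) (h32 : 0 < (ω₃ / ω₂).im) (g₈ : ℂ) :
    dualFactor ω₁ ω₂ ω₃ g₈ ≠ 0 := by
  have n2 : ω₂ ≠ 0 := by rintro rfl; simp at h32
  have n3 : ω₃ ≠ 0 := by rintro rfl; simp at h31
  have q1 := qPoch_self_ne_zero (norm_e_lt_one.2 (neg_div_im_pos h31))
  have q2 := qPoch_self_ne_zero (norm_e_lt_one.2 (neg_div_im_pos h32))
  exact mul_ne_zero (div_ne_zero (mul_ne_zero two_ne_zero n3) (mul_ne_zero (mul_ne_zero n2 q2) q1))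
    (Complex.exp_ne_zero _)

lemma dualGamma_ne_zero (h12 : 0 ≤ (ω₁ / ω₂).im) (h31 : 0 < (ω₃ / ω₁).im)
    (h32 : 0 < (ω₃ / ω₂).im) {u : ℂ} (h : modGamma ω₁ ω₂ ω₃ u ≠ 0) : dualGamma ω₁ ω₂ ω₃ u ≠ 0 := by
  have := h
  rw [modGamma_eq_of_ne_zero h12 h31 h32 h] at this
  exact right_ne_zero_of_mul this

lemma dualGamma_add_sub (g : Fin 8 → ℂ) (k : Fin 8) :
    dualGamma ω₁ ω₂ ω₃ (g k + g 7) =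
        ellGamma (e (-ω₁ / ω₃)) (e (-ω₂ / ω₃)) (expParams (-ω₃) g k * expParams (-ω₃) g 7) ∧
      dualGamma ω₁ ω₂ ω₃ (g k - g 7) =
        ellGamma (e (-ω₁ / ω₃)) (e (-ω₂ / ω₃)) (expParams (-ω₃) g k / expParams (-ω₃) g 7) := by
  constructor
  · rw [dualGamma, expParams_neg, expParams_neg, ← e_add]; congr 2; ring
  · rw [dualGamma, expParams_neg, expParams_neg, ← e_sub]; congr 2; ring

lemma UModDefined.uDefined (h12 : 0 ≤ (ω₁ / ω₂).im) (h31 : 0 < (ω₃ / ω₁).im)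
    (h32 : 0 < (ω₃ / ω₂).im) {g : Fin 8 → ℂ} (h : UModDefined ω₁ ω₂ ω₃ g) :
    UDefined (e (-ω₂ / ω₃)) (e (-ω₁ / ω₃)) (expParams (-ω₃) g) := by
  refine ⟨admissible_of_norm_lt_one (norm_e_lt_one.2 (neg_div_im_pos h32))
    (norm_e_lt_one.2 (neg_div_im_pos h31)) h.1.norm_lt_one, fun k hk => ?_⟩
  obtain ⟨a1, a2⟩ := dualGamma_add_sub (ω₁ := ω₁) (ω₂ := ω₂) (ω₃ := ω₃) g k
  rw [ellGamma_comm, ← a1, ellGamma_comm, ← a2]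
  exact ⟨dualGamma_ne_zero h12 h31 h32 (h.2 k hk).1,
    dualGamma_ne_zero h12 h31 h32 (h.2 k hk).2⟩

/-- `U^{mod}` is proportional to the modular transform of `U`. -/
lemma UMod_eq (h12 : 0 ≤ (ω₁ / ω₂).im) (h31 : 0 < (ω₃ / ω₁).im) (h32 : 0 < (ω₃ / ω₂).im)
    {g : Fin 8 → ℂ} (hb : AddBalanced ω₁ ω₂ ω₃ g) (h : UModDefined ω₁ ω₂ ω₃ g) :
    UMod ω₁ ω₂ ω₃ g = dualFactor ω₁ ω₂ ω₃ (g 7) *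
      U (e (-ω₂ / ω₃)) (e (-ω₁ / ω₃)) (expParams (-ω₃) g) := by
  have hprod : ∏ k ∈ Finset.Iio (7 : Fin 8),
      modGamma ω₁ ω₂ ω₃ (g k + g 7) * modGamma ω₁ ω₂ ω₃ (g k - g 7) =
      exp (∑ k ∈ Finset.Iio (7 : Fin 8), -Real.pi * I *
        (cubicP ω₁ ω₂ ω₃ (g k + g 7) + cubicP ω₁ ω₂ ω₃ (g k - g 7))) *
      ∏ k ∈ Finset.Iio (7 : Fin 8),
        ellGamma (e (-ω₁ / ω₃)) (e (-ω₂ / ω₃)) (expParams (-ω₃) g k * expParams (-ω₃) g 7) *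
        ellGamma (e (-ω₁ / ω₃)) (e (-ω₂ / ω₃)) (expParams (-ω₃) g k / expParams (-ω₃) g 7) := by
    rw [Complex.exp_sum, ← Finset.prod_mul_distrib]
    refine Finset.prod_congr rfl fun k hk => ?_
    obtain ⟨a1, a2⟩ := dualGamma_add_sub (ω₁ := ω₁) (ω₂ := ω₂) (ω₃ := ω₃) g k
    rw [modGamma_eq_of_ne_zero h12 h31 h32 (h.2 k hk).1,
      modGamma_eq_of_ne_zero h12 h31 h32 (h.2 k hk).2, a1, a2, mul_add, exp_add]
    ring
  have hv : v g ω₁ (-ω₃) ω₂ = V (e (-ω₁ / ω₃)) (e (-ω₂ / ω₃)) (expParams (-ω₃) g) := by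
    rw [v, div_neg, div_neg, ← neg_div, ← neg_div]
  have hexp : exp (2 * Real.pi * I * (cubicP ω₁ ω₂ ω₃ 0 - ∑ j, cubicP ω₁ ω₂ ω₃ (g j))) =
      exp (2 * Real.pi * I * (cubicP ω₁ ω₂ ω₃ 0 - cubicP ω₁ ω₂ ω₃ (g 7)) +
        Real.pi * I * (6 * (-(3 / 2) * (ω₁ + ω₂ + ω₃) - g 7) * g 7 ^ 2 / (3 * ω₁ * ω₂ * ω₃))) *
      exp (∑ k ∈ Finset.Iio (7 : Fin 8), -Real.pi * I *
        (cubicP ω₁ ω₂ ω₃ (g k + g 7) + cubicP ω₁ ω₂ ω₃ (g k - g 7))) := by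
    rw [← exp_add]
    congr 1
    rw [AddBalanced, sum_univ_eq_add_sum_Iio] at hb
    have hb' : ∑ k ∈ Finset.Iio (7 : Fin 8), g k = 2 * (ω₁ + ω₂ + ω₃) - g 7 := by
      linear_combination hb
    rw [sum_univ_eq_add_sum_Iio, ← Finset.mul_sum,
      Finset.sum_congr rfl fun k _ => cubicP_add_sub (g k) (g 7), Finset.sum_add_distrib,
      ← Finset.mul_sum, ← Finset.sum_div, ← Finset.sum_mul, ← Finset.mul_sum,
      Finset.sum_sub_distrib, hb']
    simp
    ring
  rw [UMod, hprod, vMod_eq h12 h31 h32 hb h.1, hv, hexp, U_comm, U, dualFactor]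
  have e1 := Complex.exp_ne_zero (∑ k ∈ Finset.Iio (7 : Fin 8), -Real.pi * I *
        (cubicP ω₁ ω₂ ω₃ (g k + g 7) + cubicP ω₁ ω₂ ω₃ (g k - g 7)))
  rw [← mul_div_assoc, mul_comm (exp (∑ k ∈ _, _)) (∏ k ∈ _, _), div_mul_eq_div_div]
  rw [div_eq_iff e1]
  ring

lemma AddBalanced.balanced_expParams_neg (n3 : ω₃ ≠ 0) {g : Fin 8 → ℂ}
    (hb : AddBalanced ω₁ ω₂ ω₃ g) :
    Balanced (e (-ω₂ / ω₃)) (e (-ω₁ / ω₃)) (expParams (-ω₃) g) := by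
  have h1 : ∏ j, expParams (-ω₃) g j = e (∑ j, -g j / ω₃) := by
    simp only [expParams_neg, e, Finset.mul_sum, Complex.exp_sum]
  rw [Balanced, h1, ← Finset.sum_div, Finset.sum_neg_distrib, hb, ← e_two_mul, ← e_two_mul, ← e_add]
  have : -(2 * (ω₁ + ω₂ + ω₃)) / ω₃ = 2 * (-ω₂ / ω₃) + 2 * (-ω₁ / ω₃) + (-2 : ℤ) := by
    field_simp; push_cast; ring
  rw [this, e_add _ ((-2 : ℤ) : ℂ), e_int, mul_one]

/-- The modular multiplier of the theta function. -/
noncomputable def thetaMultiplier (ω₂ ω₃ u : ℂ) : ℂ :=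
  exp (Real.pi * I * thetaExponent (ω₃ / ω₂) (u / ω₂))

lemma theta_dual (h32 : 0 < (ω₃ / ω₂).im) {u x y : ℂ} (hx : x = e (-u / ω₃)) (hy : y = e (u / ω₂)) :
    theta (e (-ω₂ / ω₃)) x = thetaMultiplier ω₂ ω₃ u * theta (e (ω₃ / ω₂)) y := by
  rw [hx, hy, theta_modular h32, thetaMultiplier]

lemma thetaMultiplier_ne_zero (u : ℂ) : thetaMultiplier ω₂ ω₃ u ≠ 0 := Complex.exp_ne_zero _

/-- The coefficients of the elliptic hypergeometric equation under the modular transformation. -/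
lemma eheCoeff_dual (h32 : 0 < (ω₃ / ω₂).im) {α y g₈ : ℂ} {c : Fin 5 → ℂ}
    (hb : 2 * α + ∑ k, c k + g₈ = 2 * (ω₁ + ω₂ + ω₃)) :
    eheCoeff (e (-ω₂ / ω₃)) (e (-ω₁ / ω₃)) (e (-α / ω₃)) (fun k => e (-c k / ω₃)) (e (-g₈ / ω₃))
        (e (-y / ω₃)) =
      thetaMultiplier ω₂ ω₃ (2 * α - ω₁) * (∏ k, thetaMultiplier ω₂ ω₃ (c k + g₈)) *
        eheCoeff (e (ω₃ / ω₂)) (e (ω₁ / ω₂)) (e (α / ω₂)) (fun k => e (c k / ω₂)) (e (g₈ / ω₂))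
          (e (y / ω₂)) := by
  have n2 : ω₂ ≠ 0 := by rintro rfl; simp at h32
  have n3 : ω₃ ≠ 0 := by rintro rfl; simp at h32
  simp only [eheCoeff]
  simp only [← e_two_mul, ← e_add, ← e_sub, one_div, ← e_neg]
  rw [theta_dual h32 (u := α + y - (ω₁ + g₈)) (y := e (α / ω₂ + y / ω₂ - (ω₁ / ω₂ + g₈ / ω₂)))
      (by congr 1; ring) (by congr 1; ring),
    theta_dual h32 (u := α + g₈ + y) (y := e (α / ω₂ + g₈ / ω₂ + y / ω₂))
      (by congr 1; ring) (by congr 1; ring),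
    theta_dual h32 (u := g₈ - (α + y)) (y := e (g₈ / ω₂ - (α / ω₂ + y / ω₂)))
      (by congr 1; ring) (by congr 1; ring),
    theta_dual h32 (u := 2 * y) (y := e (2 * (y / ω₂))) (by congr 1; ring) (by congr 1; ring),
    theta_dual h32 (u := -(ω₁ + 2 * y)) (y := e (-(ω₁ / ω₂ + 2 * (y / ω₂))))
      (by congr 1; ring) (by congr 1; ring),
    Finset.prod_congr rfl fun k _ => theta_dual h32 (u := α + c k - (ω₁ + y))
      (y := e (α / ω₂ + c k / ω₂ - (ω₁ / ω₂ + y / ω₂))) (by congr 1; ring) (by congr 1; ring),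
    Finset.prod_mul_distrib]
  have hM : thetaMultiplier ω₂ ω₃ (α + y - (ω₁ + g₈)) * thetaMultiplier ω₂ ω₃ (α + g₈ + y) *
      thetaMultiplier ω₂ ω₃ (g₈ - (α + y)) * (∏ k, thetaMultiplier ω₂ ω₃ (α + c k - (ω₁ + y))) =
      thetaMultiplier ω₂ ω₃ (2 * α - ω₁) * (∏ k, thetaMultiplier ω₂ ω₃ (c k + g₈)) *
      (thetaMultiplier ω₂ ω₃ (2 * y) * thetaMultiplier ω₂ ω₃ (-(ω₁ + 2 * y))) := by
    simp only [thetaMultiplier, ← Complex.exp_sum, ← exp_add, ← mul_add, ← Finset.mul_sum]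
    congr 2
    simp only [thetaExponent, Fin.sum_univ_five] at hb ⊢
    have h8 : g₈ = 2 * (ω₁ + ω₂ + ω₃) - 2 * α - (c 0 + c 1 + c 2 + c 3 + c 4) := by
      linear_combination hb
    rw [h8]
    field_simp
    ring
  have m1 := thetaMultiplier_ne_zero (ω₂ := ω₂) (ω₃ := ω₃) (2 * y)
  have m2 := thetaMultiplier_ne_zero (ω₂ := ω₂) (ω₃ := ω₃) (-(ω₁ + 2 * y))
  have hM' := (div_eq_iff (mul_ne_zero m1 m2)).2 hM
  rw [← hM']
  rw [mul_mul_mul_comm (thetaMultiplier _ _ (2 * y)), mul_mul_mul_comm (thetaMultiplier _ _ (α + y - _)),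
    mul_mul_mul_comm (thetaMultiplier _ _ (α + y - _) * _), mul_div_mul_comm]
  ring

/-- `U^{mod}` solves the elliptic hypergeometric equation. -/
theorem UMod_ellHypEquation (h12 : 0 ≤ (ω₁ / ω₂).im) (h31 : 0 < (ω₃ / ω₁).im)
    (h32 : 0 < (ω₃ / ω₂).im) {α y g₈ : ℂ} {c : Fin 5 → ℂ}
    (hb : AddBalanced ω₁ ω₂ ω₃ (addParams α c g₈ y))
    (h0 : UModDefined ω₁ ω₂ ω₃ (addParams α c g₈ y))
    (h1 : UModDefined ω₁ ω₂ ω₃ (addParams α c g₈ (y + ω₁)))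
    (h2 : UModDefined ω₁ ω₂ ω₃ (addParams α c g₈ (y - ω₁)))
    (hd : EheDefined (e (ω₃ / ω₂)) (e (ω₁ / ω₂)) (e (y / ω₂))) :
    EllHypEquation (e (ω₃ / ω₂)) (e (ω₁ / ω₂)) (e (α / ω₂)) (fun k => e (c k / ω₂)) (e (g₈ / ω₂))
      (e (y / ω₂)) (UMod ω₁ ω₂ ω₃ (addParams α c g₈ (y + ω₁))) (UMod ω₁ ω₂ ω₃ (addParams α c g₈ y))
      (UMod ω₁ ω₂ ω₃ (addParams α c g₈ (y - ω₁))) := by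
  have n2 : ω₂ ≠ 0 := by rintro rfl; simp at h32
  have n3 : ω₃ ≠ 0 := by rintro rfl; simp at h32
  have hbal : ∀ y, ∑ j, addParams α c g₈ y j = 2 * α + ∑ k, c k + g₈ := fun y => by
    rw [Fin.sum_univ_eight, Fin.sum_univ_five]
    simp [addParams]
    ring
  have hb0 : 2 * α + ∑ k, c k + g₈ = 2 * (ω₁ + ω₂ + ω₃) := by rw [← hbal y]; exact hb
  have hb' : ∀ y, AddBalanced ω₁ ω₂ ω₃ (addParams α c g₈ y) := fun y => by
    rw [AddBalanced, hbal, hb0]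
  have hpar : ∀ y, expParams (-ω₃) (addParams α c g₈ y) =
      eheParams (e (-α / ω₃)) (fun k => e (-c k / ω₃)) (e (-g₈ / ω₃)) (e (-y / ω₃)) := fun y => by
    ext j
    rw [expParams_neg]
    fin_cases j <;> simp [addParams, eheParams, ← e_add, ← e_sub] <;> congr 1 <;> ring
  have z1 : e (-(y + ω₁) / ω₃) = e (-ω₁ / ω₃) * e (-y / ω₃) := by rw [← e_add]; congr 1; ring
  have z2 : e (-(y - ω₁) / ω₃) = (e (-ω₁ / ω₃))⁻¹ * e (-y / ω₃) := by
    rw [← e_neg, ← e_add]; congr 1; ring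
  have hB := (hb' y).balanced_expParams_neg n3
  have u0 := h0.uDefined h12 h31 h32
  have u1 := h1.uDefined h12 h31 h32
  have u2 := h2.uDefined h12 h31 h32
  rw [UMod_eq h12 h31 h32 (hb' _) h0, UMod_eq h12 h31 h32 (hb' _) h1, UMod_eq h12 h31 h32 (hb' _) h2]
  have p7 : ∀ y, addParams α c g₈ y 7 = g₈ := fun y => rfl
  rw [hpar] at hB u0
  rw [hpar, z1] at u1
  rw [hpar, z2] at u2
  rw [p7, p7, p7, hpar, hpar, hpar, z1, z2]
  have hne : ∀ {u x w : ℂ}, x = e (-u / ω₃) → w = e (u / ω₂) → theta (e (ω₃ / ω₂)) w ≠ 0 →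
      theta (e (-ω₂ / ω₃)) x ≠ 0 := fun hx hw h => by
    rw [theta_dual h32 hx hw]; exact mul_ne_zero (thetaMultiplier_ne_zero _) h
  have hd' : EheDefined (e (-ω₂ / ω₃)) (e (-ω₁ / ω₃)) (e (-y / ω₃)) := by
    obtain ⟨k1, k2, k3, k4⟩ := hd
    simp only [EheDefined, one_div, ← e_two_mul, ← e_add, ← e_neg, ← e_sub] at k1 k2 k3 k4 ⊢
    exact ⟨hne (u := 2 * y) (by congr 1; ring) (by congr 1; ring) k1,
      hne (u := -(ω₁ + 2 * y)) (by congr 1; ring) (by congr 1; ring) k2,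
      hne (u := -(2 * y)) (by congr 1; ring) (by congr 1; ring) k3,
      hne (u := 2 * y - ω₁) (by congr 1; ring) (by congr 1; ring) k4⟩
  have key := U_ellHypEquation (norm_e_lt_one.2 (neg_div_im_pos h32))
    (norm_e_lt_one.2 (neg_div_im_pos h31)) (e_ne_zero _) (e_ne_zero _) hB u0 u1 u2 hd'
  rw [EllHypEquation] at key ⊢
  have c2 := eheCoeff_dual h32 (y := -y) hb0
  rw [neg_neg] at c2
  have i1 : (e (-y / ω₃))⁻¹ = e (y / ω₃) := by rw [← e_neg]; congr 1; ring
  have i2 : (e (y / ω₂))⁻¹ = e (-y / ω₂) := by rw [← e_neg]; congr 1; ring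
  rw [i1, eheCoeff_dual h32 hb0, c2,
    theta_dual h32 (u := 2 * α - ω₁) (y := e (α / ω₂) ^ 2 / e (ω₁ / ω₂))
      (by rw [← e_two_mul, ← e_sub]; congr 1; ring) (by rw [← e_two_mul, ← e_sub]; congr 1; ring),
    Finset.prod_congr rfl fun k _ => theta_dual h32 (u := c k + g₈) (y := e (c k / ω₂) * e (g₈ / ω₂))
      (by rw [← e_add]; congr 1; ring) (by rw [← e_add]; congr 1; ring),
    Finset.prod_mul_distrib] at key
  rw [i2]
  have hM : thetaMultiplier ω₂ ω₃ (2 * α - ω₁) * (∏ k, thetaMultiplier ω₂ ω₃ (c k + g₈)) ≠ 0 :=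
    mul_ne_zero (thetaMultiplier_ne_zero _)
      (Finset.prod_ne_zero_iff.2 fun k _ => thetaMultiplier_ne_zero _)
  refine (mul_eq_zero.1 (?_ : (thetaMultiplier ω₂ ω₃ (2 * α - ω₁) *
    (∏ k, thetaMultiplier ω₂ ω₃ (c k + g₈))) * _ = 0)).resolve_left hM
  linear_combination (dualFactor ω₁ ω₂ ω₃ g₈) * key

end modifiedEquation

section residue

variable {p q : ℂ}

/-- `(z;p,q)_∞ / (1 - z)`. -/
noncomputable def dblPochTail (p q z : ℂ) : ℂ := qPoch (p * z) p * dblPoch p q (q * z)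

lemma dblPoch_eq_tail (hp : ‖p‖ < 1) (hq : ‖q‖ < 1) (z : ℂ) :
    dblPoch p q z = (1 - z) * dblPochTail p q z := by
  rw [dblPoch_eq_right hp hq, qPoch_eq hp, mul_assoc, dblPochTail]

lemma differentiable_dblPochTail (hp : ‖p‖ < 1) (hq : ‖q‖ < 1) :
    Differentiable ℂ (dblPochTail p q) := by
  refine Differentiable.mul ?_ ?_
  · exact (differentiable_qPoch hp).comp (differentiable_id.const_mul p)
  · exact (differentiable_dblPoch hp hq).comp (differentiable_id.const_mul q)

lemma dblPochTail_one_ne_zero (hp : ‖p‖ < 1) (hq : ‖q‖ < 1) : dblPochTail p q 1 ≠ 0 := by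
  rw [dblPochTail, mul_one, mul_one]
  refine mul_ne_zero (qPoch_self_ne_zero hp) ?_
  rw [Ne, dblPoch_eq_zero_iff hp hq]
  rintro ⟨a, b, hab⟩
  have := norm_mul_pow_lt_one hp hq hq a b
  rw [hab, norm_one] at this
  exact lt_irrefl _ this

/-- Parameters `t_i`, `t_j` multiplied by `c`. -/
noncomputable def scalePair (c : ℂ) (i j : Fin 8) (t : Fin 8 → ℂ) : Fin 8 → ℂ :=
  fun k => if k = i ∨ k = j then t k * c else t k

lemma scalePair_ne_zero {c : ℂ} (hc : c ≠ 0) (i j : Fin 8) {t : Fin 8 → ℂ} (ht : ∀ k, t k ≠ 0)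
    (k : Fin 8) : scalePair c i j t k ≠ 0 := by
  rw [scalePair]; split_ifs
  · exact mul_ne_zero (ht k) hc
  · exact ht k

lemma continuous_scalePair (c : ℂ) (i j : Fin 8) : Continuous (scalePair c i j) := by
  refine continuous_pi fun k => ?_
  simp only [scalePair]
  split_ifs <;> fun_prop

lemma innerPts_scalePair (p q : ℂ) (i j : Fin 8) (t : Fin 8 → ℂ) (k : Fin 8) (a b : ℕ) :
    t k * p ^ a * q ^ b = t i ∨ t k * p ^ a * q ^ b = t j ∨
      (∃ c d : ℕ, t k * p ^ a * q ^ b = scalePair p i j t k * p ^ c * q ^ d) ∨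
      ∃ c d : ℕ, t k * p ^ a * q ^ b = scalePair q i j t k * p ^ c * q ^ d := by
  by_cases hk : k = i ∨ k = j
  · rcases a with _ | a
    · rcases b with _ | b
      · rcases hk with rfl | rfl <;> simp
      · exact Or.inr (Or.inr (Or.inr ⟨0, b, by rw [scalePair, if_pos hk]; ring⟩))
    · exact Or.inr (Or.inr (Or.inl ⟨a, b, by rw [scalePair, if_pos hk]; ring⟩))
  · exact Or.inr (Or.inr (Or.inl ⟨a, b, by rw [scalePair, if_neg hk]⟩))

/-- `t_i t_j = 1` is the only obstruction to the separation of the parameters. -/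
def Pinched (p q : ℂ) (i j : Fin 8) (t : Fin 8 → ℂ) : Prop :=
  t i * t j = 1 ∧ ∀ (k l : Fin 8) (a b : ℕ), t k * t l * p ^ a * q ^ b = 1 →
    (a = 0 ∧ b = 0) ∧ (k = i ∧ l = j ∨ k = j ∧ l = i)

lemma Pinched.symm {i j : Fin 8} {t : Fin 8 → ℂ} (h : Pinched p q i j t) : Pinched p q j i t :=
  ⟨by rw [mul_comm]; exact h.1, fun k l a b hk => ⟨(h.2 k l a b hk).1, (h.2 k l a b hk).2.symm⟩⟩

lemma Pinched.exists_contour (hp : ‖p‖ < 1) (hq : ‖q‖ < 1) (hp0 : p ≠ 0) (hq0 : q ≠ 0)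
    {i j : Fin 8} {t : Fin 8 → ℂ} (ht0 : ∀ k, t k ≠ 0) (h : Pinched p q i j t) :
    ∃ C, IsSeparating p q (scalePair p i j t) C ∧ IsSeparating p q (scalePair q i j t) C ∧
      t i ∉ trace C ∧ t j ∉ trace C ∧ contourIndex C (t i) = 0 ∧ contourIndex C (t j) = 0 := by
  set P : Set ℂ := {w | ∃ (k : Fin 8) (a b : ℕ), w = t k * p ^ a * q ^ b ∧
    (k = i ∨ k = j → ¬(a = 0 ∧ b = 0))} with hP
  have hPsub : P ⊆ innerPts p q (Set.range t) := by
    rintro w ⟨k, a, b, rfl, -⟩; exact ⟨_, ⟨k, rfl⟩, a, b, rfl⟩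
  have hP0 : ∀ w ∈ P, w ≠ 0 := fun w hw =>
    innerPts_ne_zero hp0 hq0 (by rintro _ ⟨k, rfl⟩; exact ht0 k) (hPsub hw)
  have hfin := fun ε hε => finite_innerPts_norm (ε := ε) hp hq (Set.finite_range t) hε
  have hk2 : ∀ (k l : Fin 8) (a b a' b' : ℕ), t k * p ^ a * q ^ b * (t l * p ^ a' * q ^ b') = 1 →
      ((a + a' = 0) ∧ b + b' = 0) ∧ (k = i ∧ l = j ∨ k = j ∧ l = i) := fun k l a b a' b' he =>
    h.2 k l (a + a') (b + b') (by rw [← he]; ring)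
  obtain ⟨C, hC⟩ := exists_separates (P := P) (Q := (fun w => w⁻¹) '' P ∪ {t i, t j}) (by
      refine Set.disjoint_left.2 ?_
      rintro w ⟨k, a, b, rfl, hk⟩ (⟨_, ⟨l, a', b', rfl, hl⟩, he⟩ | he)
      · have hne := hP0 _ ⟨l, a', b', rfl, hl⟩
        obtain ⟨⟨h1, h2⟩, h3⟩ := hk2 k l a b a' b' (by
          rw [← he]; exact inv_mul_cancel₀ hne)
        exact hk (by tauto) ⟨by omega, by omega⟩
      · have : ∃ l, (l = i ∨ l = j) ∧ t k * p ^ a * q ^ b * (t l * p ^ 0 * q ^ 0) = 1 := by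
          have h1 := h.1
          rcases he with he | he
          · exact ⟨j, Or.inr rfl, by rw [he]; simpa using h1⟩
          · rw [Set.mem_singleton_iff] at he
            exact ⟨i, Or.inl rfl, by rw [he, mul_comm]; simpa using h1⟩
        obtain ⟨l, -, he⟩ := this
        obtain ⟨⟨h1, h2⟩, h3⟩ := hk2 k l a b 0 0 he
        exact hk (by tauto) ⟨by omega, by omega⟩) (by
      rintro (⟨w, hw, h0⟩ | h0)
      · exact hP0 w hw (inv_eq_zero.1 h0)
      · rcases h0 with h0 | h0
        · exact ht0 i h0.symm
        · exact ht0 j (Set.mem_singleton_iff.1 h0).symm)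
    (fun ε hε => (hfin ε hε).subset fun w hw => ⟨hPsub hw.1, hw.2⟩) (fun R => by
      have h1 : ((fun w : ℂ => w⁻¹) '' {w ∈ innerPts p q (Set.range t) | (|R| + 1)⁻¹ ≤ ‖w‖}).Finite :=
        (hfin _ (by positivity)).image _
      refine (h1.union (Set.toFinite {t i, t j})).subset ?_
      rintro _ ⟨⟨w, hw, rfl⟩ | hw, hR⟩
      · refine Or.inl ⟨w, ⟨hPsub hw, ?_⟩, rfl⟩
        rw [norm_inv] at hR
        have hw0 := norm_pos_iff.2 (hP0 w hw)
        rw [inv_le_comm₀ (by positivity) hw0]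
        linarith [le_abs_self R]
      · exact Or.inr hw)
  have hsub : ∀ c : ℂ, (c = p ∨ c = q) → innerPts p q (Set.range (scalePair c i j t)) ⊆ P := by
    rintro c hc w ⟨_, ⟨k, rfl⟩, a, b, rfl⟩
    by_cases hk : k = i ∨ k = j
    · rcases hc with rfl | rfl
      · exact ⟨k, a + 1, b, by rw [scalePair, if_pos hk]; ring, fun _ h => by omega⟩
      · exact ⟨k, a, b + 1, by rw [scalePair, if_pos hk]; ring, fun _ h => by omega⟩
    · exact ⟨k, a, b, by rw [scalePair, if_neg hk], fun h => absurd h hk⟩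
  have hsep : ∀ c : ℂ, (c = p ∨ c = q) → IsSeparating p q (scalePair c i j t) C := fun c hc =>
    isSeparating_iff.2 (hC.mono (hsub c hc) (by
      rw [outerPts_eq]; exact (Set.image_mono (hsub c hc)).trans Set.subset_union_left))
  have hd := Set.disjoint_left.1 hC.disjoint
  have hi : t i ∈ (fun w => w⁻¹) '' P ∪ {t i, t j} := by simp
  have hj : t j ∈ (fun w => w⁻¹) '' P ∪ {t i, t j} := by simp
  exact ⟨C, hsep p (Or.inl rfl), hsep q (Or.inr rfl), fun h' => hd h' (Or.inr hi),
    fun h' => hd h' (Or.inr hj), hC.index_outer _ hi, hC.index_outer _ hj⟩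

/-- The denominator of the integrand without the factor vanishing at `t_i`. -/
noncomputable def reducedDen (p q : ℂ) (i : Fin 8) (t : Fin 8 → ℂ) (z : ℂ) : ℂ :=
  dblPochTail p q (t i * z⁻¹) * dblPoch p q (t i * z) *
    ∏ k ∈ Finset.univ.erase i, dblPoch p q (t k * z) * dblPoch p q (t k * z⁻¹)

lemma kernelDen_eq_reducedDen (hp : ‖p‖ < 1) (hq : ‖q‖ < 1) (i : Fin 8) (t : Fin 8 → ℂ) {z : ℂ}
    (hz : z ≠ 0) : kernelDen p q t z = (z - t i) * reducedDen p q i t z := by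
  rw [kernelDen, reducedDen, ← Finset.mul_prod_erase _ _ (Finset.mem_univ i),
    dblPoch_eq_tail hp hq (t i * z⁻¹)]
  have : (1 - t i * z⁻¹) * z = z - t i := by field_simp
  linear_combination (dblPochTail p q (t i * z⁻¹) * dblPoch p q (t i * z) *
    ∏ k ∈ Finset.univ.erase i, dblPoch p q (t k * z) * dblPoch p q (t k * z⁻¹)) * this

/-- `reducedDen` at `z = t_i` without the factor `1 - t_i t_j`. -/
noncomputable def pinchDen (p q : ℂ) (i j : Fin 8) (t : Fin 8 → ℂ) : ℂ :=
  dblPochTail p q (t i * (t i)⁻¹) * dblPoch p q (t i * t i) *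
    (dblPochTail p q (t j * t i) * dblPoch p q (t j * (t i)⁻¹) *
    ∏ k ∈ (Finset.univ.erase i).erase j, dblPoch p q (t k * t i) * dblPoch p q (t k * (t i)⁻¹))

lemma reducedDen_self (hp : ‖p‖ < 1) (hq : ‖q‖ < 1) {i j : Fin 8} (hij : i ≠ j) (t : Fin 8 → ℂ) :
    reducedDen p q i t (t i) = (1 - t i * t j) * pinchDen p q i j t := by
  have hj : j ∈ Finset.univ.erase i := Finset.mem_erase.2 ⟨hij.symm, Finset.mem_univ j⟩
  rw [reducedDen, pinchDen, ← Finset.mul_prod_erase _ _ hj, dblPoch_eq_tail hp hq (t j * t i)]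
  ring

lemma differentiableAt_reducedDen (hp : ‖p‖ < 1) (hq : ‖q‖ < 1) (i : Fin 8) (t : Fin 8 → ℂ) {z : ℂ}
    (hz : z ≠ 0) : DifferentiableAt ℂ (reducedDen p q i t) z := by
  have hA := differentiable_dblPoch hp hq
  have hinv : DifferentiableAt ℂ (fun z : ℂ => z⁻¹) z := differentiableAt_inv hz
  have h1 : ∀ k, DifferentiableAt ℂ (fun z => dblPoch p q (t k * z)) z := fun k =>
    (hA _).comp z (differentiableAt_id.const_mul (t k))
  have h2 : ∀ k, DifferentiableAt ℂ (fun z => dblPoch p q (t k * z⁻¹)) z := fun k =>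
    DifferentiableAt.comp (g := dblPoch p q) z (hA _) (hinv.const_mul (t k))
  have h3 : DifferentiableAt ℂ (fun z => dblPochTail p q (t i * z⁻¹)) z :=
    DifferentiableAt.comp (g := dblPochTail p q) z (differentiable_dblPochTail hp hq _)
      (hinv.const_mul (t i))
  exact (h3.mul (h1 i)).mul (.fun_finsetProd fun k _ => (h1 k).mul (h2 k))

lemma continuousAt_pinchDen (hp : ‖p‖ < 1) (hq : ‖q‖ < 1) (i j : Fin 8) {t : Fin 8 → ℂ}
    (ht : ∀ k, t k ≠ 0) : ContinuousAt (pinchDen p q i j) t := by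
  have ca : ∀ j, ContinuousAt (fun t : Fin 8 → ℂ => t j) t := fun j => (continuous_apply j).continuousAt
  have hA := continuous_dblPoch hp hq
  have hR := (differentiable_dblPochTail hp hq).continuous
  have h1 : ∀ k l, ContinuousAt (fun t : Fin 8 → ℂ => dblPoch p q (t k * t l)) t := fun k l =>
    hA.continuousAt.comp ((ca k).mul (ca l))
  have h2 : ∀ k l, ContinuousAt (fun t : Fin 8 → ℂ => dblPoch p q (t k * (t l)⁻¹)) t := fun k l =>
    hA.continuousAt.comp ((ca k).mul ((ca l).inv₀ (ht l)))
  have h3 : ContinuousAt (fun t : Fin 8 → ℂ => dblPochTail p q (t i * (t i)⁻¹)) t :=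
    hR.continuousAt.comp ((ca i).mul ((ca i).inv₀ (ht i)))
  have h4 : ContinuousAt (fun t : Fin 8 → ℂ => dblPochTail p q (t j * t i)) t :=
    hR.continuousAt.comp ((ca j).mul (ca i))
  exact (h3.mul (h1 i i)).mul ((h4.mul (h2 j i)).mul (tendsto_finsetProd _ fun k _ => (h1 k i).mul (h2 k i)))

lemma Pinched.dblPoch_ne_zero (hp : ‖p‖ < 1) (hq : ‖q‖ < 1) {i j : Fin 8} {t : Fin 8 → ℂ}
    (h : Pinched p q i j t) (k l : Fin 8) (hkl : ¬(k = i ∧ l = j ∨ k = j ∧ l = i)) :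
    dblPoch p q (t k * t l) ≠ 0 := by
  rw [Ne, dblPoch_eq_zero_iff hp hq]
  rintro ⟨a, b, hab⟩
  exact hkl (h.2 k l a b hab).2

lemma Pinched.inv_eq {i j : Fin 8} {t : Fin 8 → ℂ} (h : Pinched p q i j t) : (t i)⁻¹ = t j :=
  inv_eq_of_mul_eq_one_right h.1

lemma Pinched.pinchDen_ne_zero (hp : ‖p‖ < 1) (hq : ‖q‖ < 1) {i j : Fin 8} {t : Fin 8 → ℂ}
    (hij : i ≠ j) (h : Pinched p q i j t) : pinchDen p q i j t ≠ 0 := by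
  have hA := h.dblPoch_ne_zero hp hq
  have h1 := dblPochTail_one_ne_zero hp hq
  rw [pinchDen, h.inv_eq, mul_comm (t j), h.1]
  refine mul_ne_zero (mul_ne_zero h1 (hA i i (by tauto)))
    (mul_ne_zero (mul_ne_zero h1 (hA j j (by tauto))) (Finset.prod_ne_zero_iff.2 fun k hk => ?_))
  simp only [Finset.mem_erase, Finset.mem_univ, and_true] at hk
  exact mul_ne_zero (hA k i (by tauto)) (hA k j (by tauto))

lemma exists_radius (hp : ‖p‖ < 1) (hq : ‖q‖ < 1) {i : Fin 8} {t : Fin 8 → ℂ} (ht0 : ∀ k, t k ≠ 0)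
    (h : reducedDen p q i t (t i) ≠ 0) :
    ∃ r > 0, ∀ z ∈ Metric.closedBall (t i) r, z ≠ 0 ∧ reducedDen p q i t z ≠ 0 := by
  have h1 := (differentiableAt_reducedDen hp hq i t (ht0 i)).continuousAt.eventually_ne h
  have h2 : ∀ᶠ z : ℂ in 𝓝 (t i), z ≠ 0 := continuousAt_id.eventually_ne (ht0 i)
  obtain ⟨r, hr, hrs⟩ := Metric.eventually_nhds_iff_ball.1 (h2.and h1)
  exact ⟨r / 2, by positivity, fun z hz => hrs z (Metric.closedBall_subset_ball (by linarith) hz)⟩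

lemma circleCurve_kernel (hp : ‖p‖ < 1) (hq : ‖q‖ < 1) {i : Fin 8} {t : Fin 8 → ℂ}
    (ht0 : ∀ k, t k ≠ 0) {r : ℝ} (hr : 0 < r)
    (h : ∀ z ∈ Metric.closedBall (t i) r, z ≠ 0 ∧ reducedDen p q i t z ≠ 0) :
    contourIntegral [circleCurve (t i) r] (fun z => kernelNum p q t z / kernelDen p q t z) =
      2 * Real.pi * I * (kernelNum p q t (t i) / reducedDen p q i t (t i)) := by
  rw [contourIntegral_circleCurve]
  have hd : DifferentiableOn ℂ (fun z => kernelNum p q t z / reducedDen p q i t z)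
      (Metric.closedBall (t i) r) := fun z hz =>
    ((differentiableAt_kernelNum hp hq (T := fun _ => t) (Z := fun z => z)
      (fun _ => differentiableAt_const _) ht0 differentiableAt_id (h z hz).1).div
      (differentiableAt_reducedDen hp hq i t (h z hz).1) (h z hz).2).differentiableWithinAt
  have := hd.circleIntegral_sub_inv_smul (Metric.mem_ball_self hr)
  simp only [smul_eq_mul] at this
  rw [← this]
  refine circleIntegral.integral_congr hr.le fun z hz => ?_
  have hz' := h z (Metric.sphere_subset_closedBall hz)
  rw [kernelDen_eq_reducedDen hp hq i t hz'.1]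
  rw [div_eq_mul_inv, div_eq_mul_inv, mul_inv]
  ring

lemma kernelDen_inner_eq_zero (hp : ‖p‖ < 1) (hq : ‖q‖ < 1) (hp0 : p ≠ 0) (hq0 : q ≠ 0)
    {t : Fin 8 → ℂ} (ht0 : ∀ k, t k ≠ 0) {w : ℂ}
    (hw : w ∈ {0} ∪ innerPts p q (Set.range t) ∪ outerPts p q (Set.range t)) :
    kernelDen p q t w = 0 := by
  rw [kernelDen]
  rcases hw with (rfl | ⟨_, ⟨k, rfl⟩, a, b, rfl⟩) | ⟨_, ⟨k, rfl⟩, a, b, rfl⟩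
  · rw [mul_zero]
  · have : dblPoch p q (t k * (t k * p ^ a * q ^ b)⁻¹) = 0 := by
      rw [dblPoch_eq_zero_iff hp hq]
      refine ⟨a, b, ?_⟩
      have := ht0 k
      field_simp
    rw [Finset.prod_eq_zero (Finset.mem_univ k) (by rw [this, mul_zero]), zero_mul]
  · have : dblPoch p q (t k * (t k * p ^ a * q ^ b)⁻¹) = 0 := by
      rw [dblPoch_eq_zero_iff hp hq]
      refine ⟨a, b, ?_⟩
      have := ht0 k
      field_simp
    rw [Finset.prod_eq_zero (Finset.mem_univ k) (by rw [this, zero_mul]), zero_mul]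

end residue

section residue

variable {p q : ℂ}

/-- The constant in the residue of `V` at `t_i t_j = 1`, `x = t_i`. -/
noncomputable def residueFactor (p q x : ℂ) : ℂ :=
  kappa p q * (2 * (2 * Real.pi * I)) *
    (dblPoch p q (p * q) ^ 2 * dblPoch p q (x⁻¹ * x⁻¹ * p * q) * dblPoch p q (x * x * p * q) *
      (qPoch (x * x) p * qPoch (q * (x * x)) q * (qPoch (x⁻¹ * x⁻¹) p * qPoch (q * (x⁻¹ * x⁻¹)) q)) /
      (dblPochTail p q 1 ^ 2 * dblPoch p q (x * x) * dblPoch p q (x⁻¹ * x⁻¹)))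

/-- The contour for parameters near a pinched point. -/
lemma isSeparating_of_pinched (hp : ‖p‖ < 1) (hq : ‖q‖ < 1) (hp0 : p ≠ 0) (hq0 : q ≠ 0)
    {i j : Fin 8} {t : Fin 8 → ℂ} (ht0 : ∀ k, t k ≠ 0) (hne : t i ≠ t j) {C : Contour}
    (hCp : IsSeparating p q (scalePair p i j t) C) (hCq : IsSeparating p q (scalePair q i j t) C)
    (hi : t i ∉ trace C ∧ contourIndex C (t i) = 0) (hj : t j ∉ trace C ∧ contourIndex C (t j) = 0)
    (hi' : (t i)⁻¹ ∉ trace C ∧ contourIndex C (t i)⁻¹ = 0)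
    (hj' : (t j)⁻¹ ∉ trace C ∧ contourIndex C (t j)⁻¹ = 0)
    {r s : ℝ} (hr0 : 0 < r) (hs0 : 0 < s)
    (hr : ∀ z ∈ Metric.closedBall (t i) r, z ≠ 0 ∧ reducedDen p q i t z ≠ 0)
    (hs : ∀ z ∈ Metric.closedBall (t j) s, z ≠ 0 ∧ reducedDen p q j t z ≠ 0) :
    Disjoint (trace C) ({0} ∪ innerPts p q (Set.range t) ∪ outerPts p q (Set.range t)) ∧
    IsSeparating p q t (C ++ ([circleCurve (t i) r] ++ [circleCurve (t j) s])) := by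
  set S : Set ℂ := {0} ∪ innerPts p q (Set.range t) ∪ outerPts p q (Set.range t) with hS
  have far : ∀ {x : Fin 8} {r : ℝ}, (∀ z ∈ Metric.closedBall (t x) r, z ≠ 0 ∧
      reducedDen p q x t z ≠ 0) → ∀ w ∈ S, w ≠ t x → r < ‖w - t x‖ := by
    intro x r hr w hw hwx
    by_contra! hle
    have h1 := hr w (by rwa [mem_closedBall_iff_norm])
    have h2 := kernelDen_inner_eq_zero hp hq hp0 hq0 ht0 hw
    rw [kernelDen_eq_reducedDen hp hq x t h1.1] at h2
    exact mul_ne_zero (sub_ne_zero.2 hwx) h1.2 h2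
  have houter : ∀ {x : Fin 8}, reducedDen p q x t (t x) ≠ 0 →
      ∀ w ∈ outerPts p q (Set.range t), w ≠ t x := by
    rintro x h w ⟨_, ⟨k, rfl⟩, a, b, rfl⟩ he
    have hz : dblPoch p q (t k * t x) = 0 := by
      rw [dblPoch_eq_zero_iff hp hq]
      refine ⟨a, b, ?_⟩
      rw [← he]
      have := ht0 k
      field_simp
    refine h ?_
    rw [reducedDen]
    by_cases hk : k = x
    · rw [hk] at hz; rw [hz]; ring
    · rw [Finset.prod_eq_zero (Finset.mem_erase.2 ⟨hk, Finset.mem_univ k⟩) (by rw [hz, zero_mul]),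
        mul_zero]
  have hdp := Set.disjoint_left.1 (isSeparating_iff.1 hCp).disjoint
  have hdq := Set.disjoint_left.1 (isSeparating_iff.1 hCq).disjoint
  have hinner : ∀ w ∈ innerPts p q (Set.range t), w = t i ∨ w = t j ∨
      (w ∉ trace C ∧ contourIndex C w = 1) := by
    rintro _ ⟨_, ⟨k, rfl⟩, a, b, rfl⟩
    rcases innerPts_scalePair p q i j t k a b with h | h | ⟨c, d, h⟩ | ⟨c, d, h⟩
    · exact Or.inl h
    · exact Or.inr (Or.inl h)
    · refine Or.inr (Or.inr ?_)
      rw [h]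
      exact ⟨fun h' => hdp h' (Or.inl (Or.inr ⟨_, ⟨k, rfl⟩, c, d, rfl⟩)), hCp.index_inner k c d⟩
    · refine Or.inr (Or.inr ?_)
      rw [h]
      exact ⟨fun h' => hdq h' (Or.inl (Or.inr ⟨_, ⟨k, rfl⟩, c, d, rfl⟩)), hCq.index_inner k c d⟩
  have houter' : ∀ w ∈ outerPts p q (Set.range t), w ∉ trace C ∧ contourIndex C w = 0 := by
    rintro _ ⟨_, ⟨k, rfl⟩, a, b, rfl⟩
    rcases innerPts_scalePair p q i j t k a b with h | h | ⟨c, d, h⟩ | ⟨c, d, h⟩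
    · rw [h]; exact hi'
    · rw [h]; exact hj'
    · rw [h]
      exact ⟨fun h' => hdp h' (Or.inr ⟨_, ⟨k, rfl⟩, c, d, rfl⟩), hCp.index_outer k c d⟩
    · rw [h]
      exact ⟨fun h' => hdq h' (Or.inr ⟨_, ⟨k, rfl⟩, c, d, rfl⟩), hCq.index_outer k c d⟩
  have h0C : (0 : ℂ) ∉ trace C := fun h' => hdp h' (Or.inl (Or.inl rfl))
  have hdisC : Disjoint (trace C) S := by
    refine Set.disjoint_left.2 ?_
    rintro w hw ((rfl | hwi) | hwo)
    · exact h0C hw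
    · rcases hinner w hwi with rfl | rfl | h
      · exact hi.1 hw
      · exact hj.1 hw
      · exact h.1 hw
    · exact (houter' w hwo).1 hw
  refine ⟨hdisC, isSeparating_iff.2 ⟨?_, ?_, ?_, ?_⟩⟩
  · rw [trace_append, trace_append, trace_circleCurve _ hr0.le, trace_circleCurve _ hs0.le,
      Set.disjoint_union_left, Set.disjoint_union_left]
    refine ⟨hdisC, ?_, ?_⟩
    · refine Set.disjoint_left.2 fun w hw hwS => ?_
      rw [mem_sphere_iff_norm] at hw
      by_cases hwx : w = t i
      · rw [hwx, sub_self, norm_zero] at hw; exact hr0.ne hw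
      · exact (far hr w hwS hwx).ne' hw
    · refine Set.disjoint_left.2 fun w hw hwS => ?_
      rw [mem_sphere_iff_norm] at hw
      by_cases hwx : w = t j
      · rw [hwx, sub_self, norm_zero] at hw; exact hs0.ne hw
      · exact (far hs w hwS hwx).ne' hw
  · rw [contourIndex_append, contourIndex_append, hCp.index_zero,
      contourIndex_circleCurve_outside hr0.le (far hr 0 (by simp [hS]) (ht0 i).symm),
      contourIndex_circleCurve_outside hs0.le (far hs 0 (by simp [hS]) (ht0 j).symm)]
    simp
  · intro w hw
    have hwS : w ∈ S := Or.inl (Or.inr hw)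
    rw [contourIndex_append, contourIndex_append]
    by_cases h1 : w = t i
    · rw [h1, hi.2, contourIndex_circleCurve_inside (by simpa using hr0),
        contourIndex_circleCurve_outside hs0.le (far hs (t i) (h1 ▸ hwS) hne)]
      simp
    · by_cases h2 : w = t j
      · rw [h2, hj.2, contourIndex_circleCurve_outside hr0.le (far hr (t j) (h2 ▸ hwS) hne.symm),
          contourIndex_circleCurve_inside (by simpa using hs0)]
        simp
      · rw [contourIndex_circleCurve_outside hr0.le (far hr w hwS h1),
          contourIndex_circleCurve_outside hs0.le (far hs w hwS h2),
          (((hinner w hw).resolve_left h1).resolve_left h2).2]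
        simp
  · intro w hw
    have hwS : w ∈ S := Or.inr hw
    rw [contourIndex_append, contourIndex_append, (houter' w hw).2,
      contourIndex_circleCurve_outside hr0.le
        (far hr w hwS (houter (hr _ (Metric.mem_closedBall_self hr0.le)).2 w hw)),
      contourIndex_circleCurve_outside hs0.le
        (far hs w hwS (houter (hs _ (Metric.mem_closedBall_self hs0.le)).2 w hw))]
    simp

lemma Pinched.quotient_eq {i j : Fin 8} {t : Fin 8 → ℂ}
    (hij : i ≠ j) (h : Pinched p q i j t) :
    kappa p q * (2 * (2 * Real.pi * I)) * (kernelNum p q t (t i) / pinchDen p q i j t) =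
      residueFactor p q (t i) * pairGamma p q ((Finset.univ.erase i).erase j) t (t i) := by
  have hj : j ∈ Finset.univ.erase i := Finset.mem_erase.2 ⟨hij.symm, Finset.mem_univ j⟩
  have hx : t i ≠ 0 := left_ne_zero_of_mul (h.1.trans_ne one_ne_zero)
  have hinv := h.inv_eq
  rw [residueFactor, kernelNum, pinchDen, ← Finset.mul_prod_erase _ _ (Finset.mem_univ i),
    ← Finset.mul_prod_erase _ _ hj, pairGamma]
  simp only [ellGamma_eq, div_mul_div_comm, Finset.prod_div_distrib, ← hinv, div_eq_mul_inv (t _)]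
  have e1 : t i * (t i)⁻¹ = 1 := mul_inv_cancel₀ hx
  have e2 : (t i)⁻¹ * t i = 1 := inv_mul_cancel₀ hx
  simp only [mul_inv, inv_inv, e1, e2, pow_two]
  ring_nf

lemma Pinched.residueFactor_ne_zero (hp : ‖p‖ < 1) (hq : ‖q‖ < 1) {i j : Fin 8} {t : Fin 8 → ℂ}
    (hij : i ≠ j) (h : Pinched p q i j t) : residueFactor p q (t i) ≠ 0 := by
  have hA1 : ∀ a b : ℕ, t i * t i * p ^ a * q ^ b ≠ 1 := fun a b he => by
    have := (h.2 i i a b he).2; tauto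
  have hA2 : ∀ a b : ℕ, t j * t j * p ^ a * q ^ b ≠ 1 := fun a b he => by
    have := (h.2 j j a b he).2; tauto
  have hpq : ∀ a b : ℕ, p * q * p ^ a * q ^ b ≠ 1 := fun a b he => by
    have h1 : ‖p * q‖ < 1 := by
      rw [norm_mul]; exact mul_lt_one_of_nonneg_of_lt_one_left (norm_nonneg _) hp hq.le
    have := norm_mul_pow_lt_one hp hq h1 a b
    rw [he, norm_one] at this
    exact lt_irrefl _ this
  have hQ : ∀ {x : ℂ}, (∀ a b : ℕ, x * p ^ a * q ^ b ≠ 1) → dblPoch p q x ≠ 0 ∧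
      dblPoch p q (x * p * q) ≠ 0 ∧ qPoch x p ≠ 0 ∧ qPoch (q * x) q ≠ 0 := by
    intro x hx
    refine ⟨?_, ?_, ?_, ?_⟩
    · rw [Ne, dblPoch_eq_zero_iff hp hq]; rintro ⟨a, b, he⟩; exact hx a b he
    · rw [Ne, dblPoch_eq_zero_iff hp hq]; rintro ⟨a, b, he⟩
      exact hx (a + 1) (b + 1) (by rw [← he]; ring)
    · rw [Ne, qPoch_eq_zero_iff hp]; rintro ⟨a, he⟩; exact hx a 0 (by rw [← he]; ring)
    · rw [Ne, qPoch_eq_zero_iff hq]; rintro ⟨b, he⟩; exact hx 0 (b + 1) (by rw [← he]; ring)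
  obtain ⟨a1, a2, a3, a4⟩ := hQ hA1
  obtain ⟨b1, b2, b3, b4⟩ := hQ hA2
  have c1 := (hQ hpq).1
  have hk : kappa p q ≠ 0 := by
    refine div_ne_zero (mul_ne_zero (qPoch_self_ne_zero hq) (qPoch_self_ne_zero hp)) ?_
    have h2 := Complex.two_pi_I_ne_zero
    intro h0
    exact h2 (by linear_combination h0 / 2)
  rw [residueFactor, h.inv_eq]
  exact mul_ne_zero (mul_ne_zero hk (mul_ne_zero two_ne_zero Complex.two_pi_I_ne_zero))
    (div_ne_zero (mul_ne_zero (mul_ne_zero (mul_ne_zero (pow_ne_zero _ c1) b2) a2)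
      (mul_ne_zero (mul_ne_zero a3 a4) (mul_ne_zero b3 b4)))
      (mul_ne_zero (mul_ne_zero (pow_ne_zero _ (dblPochTail_one_ne_zero hp hq)) a1) b1))

lemma Pinched.quotient_symm {i j : Fin 8} {t : Fin 8 → ℂ} (h : Pinched p q i j t) :
    kernelNum p q t (t j) / pinchDen p q j i t = kernelNum p q t (t i) / pinchDen p q i j t := by
  have h1 := h.inv_eq
  have h2 := h.symm.inv_eq
  congr 1
  · rw [← h1, kernelNum, kernelNum]
    simp only [inv_inv]
    congr 1
    · exact Finset.prod_congr rfl fun k _ => mul_comm _ _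
    · ring
  · rw [pinchDen, pinchDen, h1, h2, mul_comm (t j) (t i), Finset.erase_right_comm]
    have : ∀ k, dblPoch p q (t k * t j) * dblPoch p q (t k * t i) =
        dblPoch p q (t k * t i) * dblPoch p q (t k * t j) := fun k => mul_comm _ _
    simp only [this]
    ring

/-- The behaviour of `V` near a pinched point. -/
theorem Pinched.tendsto_V (hp : ‖p‖ < 1) (hq : ‖q‖ < 1) (hp0 : p ≠ 0) (hq0 : q ≠ 0)
    {i j : Fin 8} {t : Fin 8 → ℂ} (hij : i ≠ j) (ht0 : ∀ k, t k ≠ 0) (h : Pinched p q i j t) :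
    (∀ᶠ t' in 𝓝[{t' | t' i * t' j ≠ 1}] t, Admissible p q t') ∧
    Tendsto (fun t' => (1 - t' i * t' j) * V p q t') (𝓝[{t' | t' i * t' j ≠ 1}] t)
      (𝓝 (residueFactor p q (t i) *
        pairGamma p q ((Finset.univ.erase i).erase j) t (t i))) := by
  obtain ⟨C, hCp, hCq, hi1, hj1, hi2, hj2⟩ := h.exists_contour hp hq hp0 hq0 ht0
  have ca : ∀ j, ContinuousAt (fun t : Fin 8 → ℂ => t j) t := fun j => (continuous_apply j).continuousAt
  have hinv := h.inv_eq
  have hinv' := h.symm.inv_eq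
  have hne : t i ≠ t j := fun he => by
    have h1 := (h.2 i i 0 0 (by rw [pow_zero, pow_zero, mul_one, mul_one]; nth_rw 2 [he]; exact h.1)).2
    tauto
  have ei := eventually_contourIndex_eq hi1
  have ej := eventually_contourIndex_eq hj1
  rw [hi2] at ei
  rw [hj2] at ej
  have ev1 := (continuous_scalePair p i j).continuousAt.eventually
    (hCp.eventually hp hq hp0 hq0 (scalePair_ne_zero hp0 i j ht0))
  have ev2 := (continuous_scalePair q i j).continuousAt.eventually
    (hCq.eventually hp hq hp0 hq0 (scalePair_ne_zero hq0 i j ht0))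
  have ev3 := (ca i).eventually ei
  have ev4 := (ca j).eventually ej
  have ev5 := ((ca i).inv₀ (ht0 i)).eventually (hinv.symm ▸ ej)
  have ev6 := ((ca j).inv₀ (ht0 j)).eventually (hinv'.symm ▸ ei)
  have ev7 : ∀ᶠ t' in 𝓝 t, ∀ j, t' j ≠ 0 := Filter.eventually_all.2 fun j => (ca j).eventually_ne (ht0 j)
  have ev8 : ∀ᶠ t' in 𝓝 t, t' i ≠ t' j :=
    (((ca i).sub (ca j)).eventually_ne (sub_ne_zero.2 hne)).mono fun _ => sub_ne_zero.1
  have ev9 := (continuousAt_pinchDen hp hq i j ht0).eventually_ne (h.pinchDen_ne_zero hp hq hij)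
  have ev10 := (continuousAt_pinchDen hp hq j i ht0).eventually_ne
    (h.symm.pinchDen_ne_zero hp hq hij.symm)
  have main : ∀ᶠ t' in 𝓝[{t' | t' i * t' j ≠ 1}] t, Admissible p q t' ∧
      kappa p q * ((1 - t' i * t' j) *
        contourIntegral C (fun z => kernelNum p q t' z / kernelDen p q t' z) +
        2 * Real.pi * I * (kernelNum p q t' (t' i) / pinchDen p q i j t') +
        2 * Real.pi * I * (kernelNum p q t' (t' j) / pinchDen p q j i t')) =
      (1 - t' i * t' j) * V p q t' := by
    filter_upwards [self_mem_nhdsWithin, nhdsWithin_le_nhds ev1, nhdsWithin_le_nhds ev2,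
      nhdsWithin_le_nhds ev3, nhdsWithin_le_nhds ev4, nhdsWithin_le_nhds ev5, nhdsWithin_le_nhds ev6,
      nhdsWithin_le_nhds ev7, nhdsWithin_le_nhds ev8, nhdsWithin_le_nhds ev9,
      nhdsWithin_le_nhds ev10] with t' h0 h1 h2 h3 h4 h5 h6 h7 h8 h9 h10
    have h0' : 1 - t' i * t' j ≠ 0 := sub_ne_zero.2 (Ne.symm h0)
    have r1 := reducedDen_self hp hq hij t'
    have r2 := reducedDen_self hp hq hij.symm t'
    rw [mul_comm (t' j)] at r2
    obtain ⟨r, hr0, hr⟩ := exists_radius hp hq h7 (r1.trans_ne (mul_ne_zero h0' h9))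
    obtain ⟨s, hs0, hs⟩ := exists_radius hp hq h7 (r2.trans_ne (mul_ne_zero h0' h10))
    obtain ⟨-, hsep⟩ := isSeparating_of_pinched hp hq hp0 hq0 h7 h8 h1 h2 h3 h4 h5 h6 hr0 hs0 hr hs
    refine ⟨hsep.admissible, ?_⟩
    rw [V_eq hp hq hp0 hq0 h7 hsep, contourIntegral_kernel hp hq hp0 hq0, contourIntegral_append,
      contourIntegral_append, circleCurve_kernel hp hq h7 hr0 hr, circleCurve_kernel hp hq h7 hs0 hs,
      r1, r2]
    field_simp
    ring
  have hdis : Disjoint (trace C) ({0} ∪ innerPts p q (Set.range t) ∪ outerPts p q (Set.range t)) := by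
    have hdp := Set.disjoint_left.1 (isSeparating_iff.1 hCp).disjoint
    have hdq := Set.disjoint_left.1 (isSeparating_iff.1 hCq).disjoint
    refine Set.disjoint_left.2 ?_
    rintro w hw ((rfl | ⟨_, ⟨k, rfl⟩, a, b, rfl⟩) | ⟨_, ⟨k, rfl⟩, a, b, rfl⟩)
    · exact hdp hw (Or.inl (Or.inl rfl))
    · rcases innerPts_scalePair p q i j t k a b with h | h | ⟨c, d, h⟩ | ⟨c, d, h⟩ <;> rw [h] at hw
      · exact hi1 hw
      · exact hj1 hw
      · exact hdp hw (Or.inl (Or.inr ⟨_, ⟨k, rfl⟩, c, d, rfl⟩))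
      · exact hdq hw (Or.inl (Or.inr ⟨_, ⟨k, rfl⟩, c, d, rfl⟩))
    · rcases innerPts_scalePair p q i j t k a b with h | h | ⟨c, d, h⟩ | ⟨c, d, h⟩ <;> rw [h] at hw
      · rw [hinv] at hw; exact hj1 hw
      · rw [hinv'] at hw; exact hi1 hw
      · exact hdp hw (Or.inr ⟨_, ⟨k, rfl⟩, c, d, rfl⟩)
      · exact hdq hw (Or.inr ⟨_, ⟨k, rfl⟩, c, d, rfl⟩)
  refine ⟨main.mono fun t' h => h.1, ?_⟩
  have hcont : ContinuousAt (fun t' : Fin 8 → ℂ => kappa p q * ((1 - t' i * t' j) *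
        contourIntegral C (fun z => kernelNum p q t' z / kernelDen p q t' z) +
        2 * Real.pi * I * (kernelNum p q t' (t' i) / pinchDen p q i j t') +
        2 * Real.pi * I * (kernelNum p q t' (t' j) / pinchDen p q j i t'))) t := by
    have hN : ∀ k, ContinuousAt (fun t' : Fin 8 → ℂ => kernelNum p q t' (t' k)) t := fun k =>
      continuousAt_kernelNum hp hq (T := fun t => t) continuousAt_id ht0 (ca k) (ht0 k)
    exact continuousAt_const.mul ((((continuousAt_const.sub ((ca i).mul (ca j))).mul
      (continuousAt_contourIntegral_kernel hp hq ht0 hdis)).add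
      (continuousAt_const.mul ((hN i).div (continuousAt_pinchDen hp hq i j ht0)
        (h.pinchDen_ne_zero hp hq hij)))).add
      (continuousAt_const.mul ((hN j).div (continuousAt_pinchDen hp hq j i ht0)
        (h.symm.pinchDen_ne_zero hp hq hij.symm))))
  have hlim := hcont.tendsto.mono_left (nhdsWithin_le_nhds (s := {t' | t' i * t' j ≠ 1}))
  have hval : kappa p q * ((1 - t i * t j) *
        contourIntegral C (fun z => kernelNum p q t z / kernelDen p q t z) +
        2 * Real.pi * I * (kernelNum p q t (t i) / pinchDen p q i j t) +
        2 * Real.pi * I * (kernelNum p q t (t j) / pinchDen p q j i t)) =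
      residueFactor p q (t i) * pairGamma p q ((Finset.univ.erase i).erase j) t (t i) := by
    rw [← h.quotient_eq hij, h.quotient_symm, h.1]
    ring
  rw [hval] at hlim
  exact hlim.congr' (main.mono fun t' h => h.2)

end residue

section nonresonant

variable {ω₁ ω₂ ω₃ : ℂ}

/-- The group `ℤω₁ + ℤω₂ + ℤω₃`. -/
noncomputable def periods (ω₁ ω₂ ω₃ : ℂ) : Submodule ℤ ℂ := Submodule.span ℤ {ω₁, ω₂, ω₃}

lemma mem_periods {u : ℂ} :
    u ∈ periods ω₁ ω₂ ω₃ ↔ ∃ a b c : ℤ, a * ω₁ + b * ω₂ + c * ω₃ = u := by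
  simp [periods, Submodule.mem_span_triple]

lemma mem_periods_of_eq {u : ℂ} (a b c : ℤ) (h : u = a * ω₁ + b * ω₂ + c * ω₃) :
    u ∈ periods ω₁ ω₂ ω₃ := mem_periods.2 ⟨a, b, c, h.symm⟩

lemma omega₁_mem_periods : ω₁ ∈ periods ω₁ ω₂ ω₃ := mem_periods_of_eq 1 0 0 (by simp)

lemma countable_periods (ω₁ ω₂ ω₃ : ℂ) : (periods ω₁ ω₂ ω₃ : Set ℂ).Countable := by
  refine (Set.countable_range fun n : ℤ × ℤ × ℤ => n.1 * ω₁ + n.2.1 * ω₂ + n.2.2 * ω₃).mono ?_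
  intro u hu
  obtain ⟨a, b, c, h⟩ := mem_periods.1 hu
  exact ⟨(a, b, c), h⟩

lemma periods_dual (ω₁ ω₂ ω₃ : ℂ) : periods ω₁ (-ω₃) ω₂ = periods ω₁ ω₂ ω₃ := by
  ext u
  constructor <;> intro h <;> obtain ⟨a, b, c, rfl⟩ := mem_periods.1 h
  · exact mem_periods_of_eq a c (-b) (by push_cast; ring)
  · exact mem_periods_of_eq a (-c) b (by push_cast; ring)

lemma periods_rotate (ω₁ ω₂ ω₃ : ℂ) : periods (-ω₂) ω₁ ω₃ = periods ω₁ ω₂ ω₃ := by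
  ext u
  constructor <;> intro h <;> obtain ⟨a, b, c, rfl⟩ := mem_periods.1 h
  · exact mem_periods_of_eq b (-a) c (by push_cast; ring)
  · exact mem_periods_of_eq (-b) a c (by push_cast; ring)

lemma gammaNum_den_ne_zero (h1 : 0 < (ω₁ / ω₂).im) (h3 : 0 < (ω₃ / ω₂).im) {u : ℂ}
    (hu : u ∉ periods ω₁ ω₂ ω₃) : gammaNum ω₁ ω₂ ω₃ u ≠ 0 ∧ gammaDen ω₁ ω₂ ω₃ u ≠ 0 := by
  rw [gammaNum_eq_gammaDen, Ne, Ne, gammaDen_eq_zero_iff h1 h3, gammaDen_eq_zero_iff h1 h3]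
  constructor
  · rintro ⟨a, b, n, h⟩
    exact hu (mem_periods_of_eq (b + 1) (-n) (a + 1) (by push_cast; linear_combination -h))
  · rintro ⟨a, b, n, h⟩
    exact hu (mem_periods_of_eq (-b) n (-a) (by push_cast; linear_combination h))

lemma ellGamma_e_ne_zero (h1 : 0 < (ω₁ / ω₂).im) (h3 : 0 < (ω₃ / ω₂).im) {u z : ℂ}
    (hu : u ∉ periods ω₁ ω₂ ω₃) (hz : z = e (u / ω₂)) :
    ellGamma (e (ω₃ / ω₂)) (e (ω₁ / ω₂)) z ≠ 0 := by
  rw [hz, ellGamma_e]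
  exact div_ne_zero (gammaNum_den_ne_zero h1 h3 hu).1 (gammaNum_den_ne_zero h1 h3 hu).2

lemma theta_e_ne_zero (h3 : 0 < (ω₃ / ω₂).im) {u z : ℂ} (hu : u ∉ periods ω₁ ω₂ ω₃)
    (hz : z = e (u / ω₂)) : theta (e (ω₃ / ω₂)) z ≠ 0 := by
  have h2 : ω₂ ≠ 0 := by rintro rfl; simp at h3
  rw [hz, Ne, theta_eq_zero_iff (norm_e_lt_one.2 h3) (e_ne_zero _) (e_ne_zero _)]
  rintro ⟨n, hn⟩
  rw [← e_int_mul, ← div_eq_one_iff_eq (e_ne_zero _), ← e_sub, e_eq_one_iff] at hn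
  obtain ⟨m, hm⟩ := hn
  refine hu (mem_periods_of_eq 0 m n ?_)
  field_simp at hm
  push_cast
  linear_combination hm

lemma modGamma_ne_zero (h12 : 0 < (ω₁ / ω₂).im) (h31 : 0 < (ω₃ / ω₁).im) (h32 : 0 < (ω₃ / ω₂).im)
    {u : ℂ} (hu : u ∉ periods ω₁ ω₂ ω₃) : modGamma ω₁ ω₂ ω₃ u ≠ 0 := by
  have h : ω₃ - u ∉ periods (-ω₂) ω₁ ω₃ := fun h => by
    rw [periods_rotate] at h
    obtain ⟨a, b, c, hc⟩ := mem_periods.1 h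
    exact hu (mem_periods_of_eq (-a) (-b) (1 - c) (by push_cast; linear_combination hc))
  obtain ⟨a1, a2⟩ := gammaNum_den_ne_zero h12 h32 hu
  obtain ⟨b1, b2⟩ := gammaNum_den_ne_zero (neg_div_im_pos h12) h31 h
  rw [modGamma_of_pos h12]
  exact mul_ne_zero (div_ne_zero a1 a2) (div_ne_zero b1 b2)

/-- No resonances between the parameters and the quasiperiods. -/
def Nonresonant (ω₁ ω₂ ω₃ : ℂ) (g : Fin 8 → ℂ) : Prop :=
  (∀ j k, g j + g k ∉ periods ω₁ ω₂ ω₃) ∧ ∀ k ∈ Finset.Iio (7 : Fin 8), g k - g 7 ∉ periods ω₁ ω₂ ω₃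

lemma Nonresonant.dual {g : Fin 8 → ℂ} (h : Nonresonant ω₁ ω₂ ω₃ g) : Nonresonant ω₁ (-ω₃) ω₂ g := by
  rw [Nonresonant, periods_dual]; exact h

lemma addShift_sub_mem (g : Fin 8 → ℂ) (k : Fin 8) : addShift ω₁ g k - g k ∈ periods ω₁ ω₂ ω₃ := by
  rw [addShift]
  by_cases h6 : k = 6
  · subst h6; rw [Function.update_self, sub_sub_cancel_left]; exact neg_mem omega₁_mem_periods
  · rw [Function.update_of_ne h6]
    by_cases h5 : k = 5
    · subst h5; rw [Function.update_self, add_sub_cancel_left]; exact omega₁_mem_periods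
    · rw [Function.update_of_ne h5, sub_self]; exact zero_mem _

lemma Nonresonant.addShift {g : Fin 8 → ℂ} (h : Nonresonant ω₁ ω₂ ω₃ g) :
    Nonresonant ω₁ ω₂ ω₃ (addShift ω₁ g) := by
  have hm := addShift_sub_mem (ω₁ := ω₁) (ω₂ := ω₂) (ω₃ := ω₃) g
  refine ⟨fun j k hjk => h.1 j k ?_, fun k hk hjk => h.2 k hk ?_⟩
  · convert! sub_mem hjk (add_mem (hm j) (hm k)) using 1; ring
  · convert! sub_mem hjk (sub_mem (hm k) (hm 7)) using 1; ring

lemma Nonresonant.uAddDefined (h1 : 0 < (ω₁ / ω₂).im) (h3 : 0 < (ω₃ / ω₂).im) {g : Fin 8 → ℂ}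
    (h : Nonresonant ω₁ ω₂ ω₃ g) : UAddDefined ω₁ ω₂ ω₃ g := by
  refine ⟨fun j k a b he => ?_, fun k hk => ⟨ellGamma_e_ne_zero h1 h3 (h.1 k 7) ?_,
    ellGamma_e_ne_zero h1 h3 (h.2 k hk) ?_⟩⟩
  · refine (gammaNum_den_ne_zero h1 h3 (h.1 j k)).2 ?_
    rw [gammaDen, dblPoch_eq_zero_iff (norm_e_lt_one.2 h3) (norm_e_lt_one.2 h1)]
    exact ⟨a, b, by rw [← he, add_div, e_add]; rfl⟩
  · rw [add_div, e_add]; rfl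
  · rw [sub_div, e_sub]; rfl

lemma Nonresonant.uModDefined (h12 : 0 < (ω₁ / ω₂).im) (h31 : 0 < (ω₃ / ω₁).im)
    (h32 : 0 < (ω₃ / ω₂).im) {g : Fin 8 → ℂ} (h : Nonresonant ω₁ ω₂ ω₃ g) (hl : LinedUp ω₃ g) :
    UModDefined ω₁ ω₂ ω₃ g :=
  ⟨hl, fun k hk => ⟨modGamma_ne_zero h12 h31 h32 (h.1 k 7), modGamma_ne_zero h12 h31 h32 (h.2 k hk)⟩⟩

lemma countable_affine {A B : ℂ} (h : A ∉ periods ω₁ ω₂ ω₃ ∨ B ≠ 0) :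
    {u : ℂ | A + u * B ∈ periods ω₁ ω₂ ω₃}.Countable := by
  by_cases hB : B = 0
  · have : {u : ℂ | A + u * B ∈ periods ω₁ ω₂ ω₃} = ∅ := by
      ext u; simpa [hB] using h
    rw [this]; exact Set.countable_empty
  · refine ((countable_periods ω₁ ω₂ ω₃).preimage (f := fun u => A + u * B) ?_)
    intro u v huv
    exact mul_right_cancel₀ hB (add_left_cancel huv)

lemma countable_resonant (a b : Fin 8 → ℂ)
    (h1 : ∀ j k, a j + a k ∉ periods ω₁ ω₂ ω₃ ∨ b j + b k ≠ 0)
    (h2 : ∀ k ∈ Finset.Iio (7 : Fin 8), a k - a 7 ∉ periods ω₁ ω₂ ω₃ ∨ b k - b 7 ≠ 0) :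
    {u : ℂ | ¬Nonresonant ω₁ ω₂ ω₃ (a + u • b)}.Countable := by
  refine ((Set.countable_iUnion fun j => Set.countable_iUnion fun k => countable_affine (h1 j k)).union
    (Set.countable_iUnion fun k => Set.countable_iUnion fun hk => countable_affine (h2 k hk))).mono ?_
  intro u hu
  by_contra hn
  simp only [Set.mem_union, Set.mem_iUnion, Set.mem_ofPred_eq, not_or, not_exists] at hn
  refine hu ⟨fun j k h => hn.1 j k ?_, fun k hk h => hn.2 k hk ?_⟩
  · convert! h using 1; simp; ring
  · convert! h using 1; simp; ring

end nonresonant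

section casorati

variable {p q ω₁ ω₂ ω₃ : ℂ}

lemma differentiableAt_ellGamma (hp : ‖p‖ < 1) (hq : ‖q‖ < 1) {z : ℂ} (hz : z ≠ 0)
    (h : ellGamma p q z ≠ 0) : DifferentiableAt ℂ (ellGamma p q) z := by
  have hA := differentiable_dblPoch hp hq
  have h1 : DifferentiableAt ℂ (fun z => dblPoch p q (z⁻¹ * p * q)) z :=
    DifferentiableAt.comp (g := dblPoch p q) z (hA _)
      (((differentiableAt_inv hz).mul_const p).mul_const q)
  exact (h1.div (hA z) (ellGamma_ne_zero_iff.1 h).2).congr_of_eventuallyEq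
    (Eventually.of_forall fun z => ellGamma_eq p q z)

/-- The arguments of the gamma functions in the normalization of `U` are regular. -/
lemma eventually_ellGamma_ne_zero (hp : ‖p‖ < 1) (hq : ‖q‖ < 1) {t : Fin 8 → ℂ}
    (ht : ∀ k, t k ≠ 0) (h : ∀ k ∈ Finset.Iio (7 : Fin 8),
      ellGamma p q (t k * t 7) ≠ 0 ∧ ellGamma p q (t k / t 7) ≠ 0) :
    ∀ᶠ t' in 𝓝 t, ∀ k ∈ Finset.Iio (7 : Fin 8),
      ellGamma p q (t' k * t' 7) ≠ 0 ∧ ellGamma p q (t' k / t' 7) ≠ 0 := by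
  have ca : ∀ k, ContinuousAt (fun t : Fin 8 → ℂ => t k) t := fun k =>
    (continuous_apply k).continuousAt
  refine (Finset.eventually_all _).2 fun k hk => ?_
  have c1 := (differentiableAt_ellGamma hp hq (mul_ne_zero (ht k) (ht 7))
    (h k hk).1).continuousAt.comp (f := fun t : Fin 8 → ℂ => t k * t 7) ((ca k).mul (ca 7))
  have c2 := (differentiableAt_ellGamma hp hq (div_ne_zero (ht k) (ht 7))
    (h k hk).2).continuousAt.comp (f := fun t : Fin 8 → ℂ => t k / t 7) ((ca k).div (ca 7) (ht 7))
  exact (c1.eventually_ne (h k hk).1).and (c2.eventually_ne (h k hk).2)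

lemma UDefined.eventually (hp : ‖p‖ < 1) (hq : ‖q‖ < 1) (hp0 : p ≠ 0) (hq0 : q ≠ 0)
    {t : Fin 8 → ℂ} (ht : ∀ k, t k ≠ 0) (h : UDefined p q t) : ∀ᶠ t' in 𝓝 t, UDefined p q t' :=
  (h.1.eventually hp hq hp0 hq0 ht).and (eventually_ellGamma_ne_zero hp hq ht h.2)

lemma continuousAt_normalizer (hp : ‖p‖ < 1) (hq : ‖q‖ < 1) {t : Fin 8 → ℂ}
    (ht : ∀ k, t k ≠ 0) (h : ∀ k ∈ Finset.Iio (7 : Fin 8),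
      ellGamma p q (t k * t 7) ≠ 0 ∧ ellGamma p q (t k / t 7) ≠ 0) :
    ContinuousAt (normalizer p q) t := by
  have ca : ∀ k, ContinuousAt (fun t : Fin 8 → ℂ => t k) t := fun k =>
    (continuous_apply k).continuousAt
  exact tendsto_finsetProd _ fun k hk =>
    ((differentiableAt_ellGamma hp hq (mul_ne_zero (ht k) (ht 7))
      (h k hk).1).continuousAt.comp (f := fun t : Fin 8 → ℂ => t k * t 7) ((ca k).mul (ca 7))).mul
    ((differentiableAt_ellGamma hp hq (div_ne_zero (ht k) (ht 7))
      (h k hk).2).continuousAt.comp (f := fun t : Fin 8 → ℂ => t k / t 7) ((ca k).div (ca 7) (ht 7)))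

lemma UDefined.continuousAt (hp : ‖p‖ < 1) (hq : ‖q‖ < 1) (hp0 : p ≠ 0) (hq0 : q ≠ 0)
    {t : Fin 8 → ℂ} (ht : ∀ k, t k ≠ 0) (h : UDefined p q t) : ContinuousAt (U p q) t :=
  (continuousAt_V hp hq hp0 hq0 ht h.1).div (continuousAt_normalizer hp hq ht h.2)
    h.normalizer_ne_zero

lemma UDefined.differentiableAt (hp : ‖p‖ < 1) (hq : ‖q‖ < 1) (hp0 : p ≠ 0) (hq0 : q ≠ 0)
    {T : ℂ → Fin 8 → ℂ} {u : ℂ} (hT : Differentiable ℂ T) (hT0 : ∀ j, T u j ≠ 0)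
    (h : UDefined p q (T u)) : DifferentiableAt ℂ (fun u => U p q (T u)) u := by
  have ca : ∀ k, DifferentiableAt ℂ (fun u => T u k) u := fun k => differentiableAt_pi.1 (hT u) k
  refine (differentiableAt_V hp hq hp0 hq0 (Eventually.of_forall hT) hT0 h.1).div ?_
    h.normalizer_ne_zero
  exact DifferentiableAt.fun_finsetProd fun k hk =>
    (DifferentiableAt.comp (g := ellGamma p q) (f := fun u => T u k * T u 7) u
      (differentiableAt_ellGamma hp hq (mul_ne_zero (hT0 k) (hT0 7)) (h.2 k hk).1)
      ((ca k).mul (ca 7))).mul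
    (DifferentiableAt.comp (g := ellGamma p q) (f := fun u => T u k / T u 7) u
      (differentiableAt_ellGamma hp hq (div_ne_zero (hT0 k) (hT0 7)) (h.2 k hk).2)
      ((ca k).div (ca 7) (hT0 7)))

lemma differentiable_expParams (ω : ℂ) {g : ℂ → Fin 8 → ℂ} (hg : Differentiable ℂ g) :
    Differentiable ℂ (fun u => expParams ω (g u)) :=
  differentiable_pi.2 fun j => differentiable_e.comp ((differentiable_pi.1 hg j).div_const ω)

lemma continuous_expParams (ω : ℂ) : Continuous (expParams ω) :=
  continuous_pi fun j => continuous_e.comp (Continuous.div_const (continuous_apply (A := fun _ => ℂ) j) ω)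

lemma continuous_addShift (ω₁ : ℂ) : Continuous (addShift ω₁) := by
  unfold addShift; fun_prop

lemma UAddDefined.eventually (h1 : 0 < (ω₁ / ω₂).im) (h3 : 0 < (ω₃ / ω₂).im) {g : Fin 8 → ℂ}
    (h : UAddDefined ω₁ ω₂ ω₃ g) : ∀ᶠ g' in 𝓝 g, UAddDefined ω₁ ω₂ ω₃ g' :=
  (continuous_expParams ω₂).continuousAt.eventually (UDefined.eventually (norm_e_lt_one.2 h3)
    (norm_e_lt_one.2 h1) (e_ne_zero _) (e_ne_zero _) (expParams_ne_zero ω₂ g) h)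

lemma UAddDefined.continuousAt (h1 : 0 < (ω₁ / ω₂).im) (h3 : 0 < (ω₃ / ω₂).im) {g : Fin 8 → ℂ}
    (h : UAddDefined ω₁ ω₂ ω₃ g) : ContinuousAt (UAdd ω₁ ω₂ ω₃) g :=
  ContinuousAt.comp (f := expParams ω₂) (UDefined.continuousAt (norm_e_lt_one.2 h3)
    (norm_e_lt_one.2 h1) (e_ne_zero _) (e_ne_zero _) (expParams_ne_zero ω₂ g) h)
    (continuous_expParams ω₂).continuousAt

lemma UAddDefined.differentiableAt (h1 : 0 < (ω₁ / ω₂).im) (h3 : 0 < (ω₃ / ω₂).im)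
    {g : ℂ → Fin 8 → ℂ} (hg : Differentiable ℂ g) {u : ℂ} (h : UAddDefined ω₁ ω₂ ω₃ (g u)) :
    DifferentiableAt ℂ (fun u => UAdd ω₁ ω₂ ω₃ (g u)) u :=
  UDefined.differentiableAt (norm_e_lt_one.2 h3) (norm_e_lt_one.2 h1) (e_ne_zero _) (e_ne_zero _)
    (differentiable_expParams ω₂ hg) (expParams_ne_zero ω₂ (g u)) h

/-- The Casorati determinant of `U` and its modular transform. -/
noncomputable def dualCasorati (ω₁ ω₂ ω₃ : ℂ) (g : Fin 8 → ℂ) : ℂ :=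
  UAdd ω₁ ω₂ ω₃ g * UAdd ω₁ (-ω₃) ω₂ (addShift ω₁ g) -
    UAdd ω₁ ω₂ ω₃ (addShift ω₁ g) * UAdd ω₁ (-ω₃) ω₂ g

lemma div_neg_im_pos {a b : ℂ} (h : 0 < (a / b).im) : 0 < (b / -a).im := by
  rw [div_neg, ← neg_div]; exact neg_div_im_pos h

lemma AddBalanced.addShift {g : Fin 8 → ℂ} (h : AddBalanced ω₁ ω₂ ω₃ g) :
    AddBalanced ω₁ ω₂ ω₃ (addShift ω₁ g) := by
  rw [AddBalanced, ← h, Fin.sum_univ_eight, Fin.sum_univ_eight]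
  simp [EllHyp.addShift]
  ring

lemma UModDefined.uAddDefined (h12 : 0 < (ω₁ / ω₂).im) (h31 : 0 < (ω₃ / ω₁).im)
    (h32 : 0 < (ω₃ / ω₂).im) {g : Fin 8 → ℂ} (h : UModDefined ω₁ ω₂ ω₃ g) :
    UAddDefined ω₁ (-ω₃) ω₂ g := by
  rw [UAddDefined, div_neg, div_neg, ← neg_div, ← neg_div]
  exact h.uDefined h12.le h31 h32

lemma casorati_ne_zero_iff (h12 : 0 < (ω₁ / ω₂).im) (h31 : 0 < (ω₃ / ω₁).im)
    (h32 : 0 < (ω₃ / ω₂).im) {g : Fin 8 → ℂ} (hb : AddBalanced ω₁ ω₂ ω₃ g)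
    (h : UModDefined ω₁ ω₂ ω₃ g) (h' : UModDefined ω₁ ω₂ ω₃ (addShift ω₁ g)) :
    casorati ω₁ ω₂ ω₃ g ≠ 0 ↔ dualCasorati ω₁ ω₂ ω₃ g ≠ 0 := by
  have hd : ∀ g, U (e (-ω₂ / ω₃)) (e (-ω₁ / ω₃)) (expParams (-ω₃) g) = UAdd ω₁ (-ω₃) ω₂ g := fun g => by
    rw [UAdd, div_neg, div_neg, ← neg_div, ← neg_div]
  have h7 : addShift ω₁ g 7 = g 7 := by simp [addShift]
  have : casorati ω₁ ω₂ ω₃ g = dualFactor ω₁ ω₂ ω₃ (g 7) * dualCasorati ω₁ ω₂ ω₃ g := by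
    rw [casorati, UMod_eq h12.le h31 h32 hb h, UMod_eq h12.le h31 h32 hb.addShift h', h7, hd, hd,
      dualCasorati]
    ring
  rw [this, mul_ne_zero_iff, and_iff_right (dualFactor_ne_zero h31 h32 _)]

lemma eventually_modGamma_ne_zero (h12 : 0 < (ω₁ / ω₂).im) (h31 : 0 < (ω₃ / ω₁).im)
    (h32 : 0 < (ω₃ / ω₂).im) {u : ℂ} (hu : modGamma ω₁ ω₂ ω₃ u ≠ 0) :
    ∀ᶠ v in 𝓝 u, modGamma ω₁ ω₂ ω₃ v ≠ 0 := by
  rw [modGamma_of_pos h12, mul_ne_zero_iff, div_ne_zero_iff, div_ne_zero_iff] at hu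
  obtain ⟨⟨a1, a2⟩, a3, a4⟩ := hu
  have cs : ContinuousAt (fun u => ω₃ - u) u := by fun_prop
  filter_upwards [(differentiable_gammaNum h12 h32).continuous.continuousAt.eventually_ne a1,
    (differentiable_gammaDen h12 h32).continuous.continuousAt.eventually_ne a2,
    cs.eventually ((differentiable_gammaNum (neg_div_im_pos h12) h31).continuous.continuousAt.eventually_ne a3),
    cs.eventually ((differentiable_gammaDen (neg_div_im_pos h12) h31).continuous.continuousAt.eventually_ne a4)]
    with v b1 b2 b3 b4
  rw [modGamma_of_pos h12]
  exact mul_ne_zero (div_ne_zero b1 b2) (div_ne_zero b3 b4)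

lemma eventually_linedUp {g : Fin 8 → ℂ} (h : LinedUp ω₃ g) : ∀ᶠ g' in 𝓝 g, LinedUp ω₃ g' :=
  Filter.eventually_all.2 fun j => (Complex.continuous_im.comp
    (Continuous.div_const (continuous_apply (A := fun _ => ℂ) j) ω₃)).continuousAt.eventually_lt continuousAt_const (h j)

lemma UModDefined.eventually (h12 : 0 < (ω₁ / ω₂).im) (h31 : 0 < (ω₃ / ω₁).im)
    (h32 : 0 < (ω₃ / ω₂).im) {g : Fin 8 → ℂ} (h : UModDefined ω₁ ω₂ ω₃ g) :
    ∀ᶠ g' in 𝓝 g, UModDefined ω₁ ω₂ ω₃ g' := by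
  refine (eventually_linedUp h.1).and ((Finset.eventually_all _).2 fun k hk => ?_)
  have c1 : ContinuousAt (fun g : Fin 8 → ℂ => g k + g 7) g := by fun_prop
  have c2 : ContinuousAt (fun g : Fin 8 → ℂ => g k - g 7) g := by fun_prop
  exact (c1.eventually (eventually_modGamma_ne_zero h12 h31 h32 (h.2 k hk).1)).and
    (c2.eventually (eventually_modGamma_ne_zero h12 h31 h32 (h.2 k hk).2))

lemma isOpen_independenceSet (h12 : 0 < (ω₁ / ω₂).im) (h31 : 0 < (ω₃ / ω₁).im)
    (h32 : 0 < (ω₃ / ω₂).im) : ∃ O : Set (Fin 8 → ℂ), IsOpen O ∧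
      independenceSet ω₁ ω₂ ω₃ = O ∩ solutionDomain ω₁ ω₂ ω₃ := by
  set S := independenceSet ω₁ ω₂ ω₃
  have key : ∀ g ∈ S, ∀ᶠ g' in 𝓝 g, g' ∈ solutionDomain ω₁ ω₂ ω₃ → g' ∈ S := by
    rintro g ⟨hD, h1, h2, h3, h4, h5⟩
    rw [casorati_ne_zero_iff h12 h31 h32 hD.1 h3 h4] at h5
    have cs := (continuous_addShift ω₁).continuousAt (x := g)
    have d1 := div_neg_im_pos h31
    have d2 := div_neg_im_pos h32
    have hc : ContinuousAt (dualCasorati ω₁ ω₂ ω₃) g :=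
      ((h1.continuousAt h12 h32).mul (ContinuousAt.comp (f := addShift ω₁)
        ((h4.uAddDefined h12 h31 h32).continuousAt d1 d2) cs)).sub
      ((ContinuousAt.comp (f := addShift ω₁) (h2.continuousAt h12 h32) cs).mul
        ((h3.uAddDefined h12 h31 h32).continuousAt d1 d2))
    filter_upwards [h1.eventually h12 h32, cs.eventually (h2.eventually h12 h32),
      h3.eventually h12 h31 h32, cs.eventually (h4.eventually h12 h31 h32), hc.eventually_ne h5]
      with g' k1 k2 k3 k4 k5 hg'
    exact ⟨hg', k1, k2, k3, k4, (casorati_ne_zero_iff h12 h31 h32 hg'.1 k3 k4).2 k5⟩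
  refine ⟨interior {g | g ∈ solutionDomain ω₁ ω₂ ω₃ → g ∈ S}, isOpen_interior, ?_⟩
  ext g
  exact ⟨fun hg => ⟨mem_interior_iff_mem_nhds.2 (key g hg), hg.1⟩,
    fun hg => interior_subset hg.1 hg.2⟩

/-- A single nonvanishing value of the Casorati determinant makes the independence set dense. -/
lemma solutionDomain_subset_closure (h12 : 0 < (ω₁ / ω₂).im) (h31 : 0 < (ω₃ / ω₁).im)
    (h32 : 0 < (ω₃ / ω₂).im) {g₁ : Fin 8 → ℂ} (hb : AddBalanced ω₁ ω₂ ω₃ g₁)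
    (hn : Nonresonant ω₁ ω₂ ω₃ g₁) (hc : dualCasorati ω₁ ω₂ ω₃ g₁ ≠ 0) :
    solutionDomain ω₁ ω₂ ω₃ ⊆ closure (independenceSet ω₁ ω₂ ω₃) := by
  intro g hg
  set γ : ℂ → Fin 8 → ℂ := fun u => g + u • (g₁ - g) with hγ
  have hγd : Differentiable ℂ γ := by fun_prop
  have hγ1 : γ 1 = g₁ := by simp [hγ]
  have hγ0 : γ 0 = g := by simp [hγ]
  have hbal : ∀ u, AddBalanced ω₁ ω₂ ω₃ (γ u) := fun u => by
    have h0 := hg.1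
    rw [AddBalanced] at hb h0 ⊢
    simp only [hγ, Pi.add_apply, Pi.smul_apply, Pi.sub_apply, smul_eq_mul, Finset.sum_add_distrib,
      ← Finset.mul_sum, Finset.sum_sub_distrib, hb, h0]
    ring
  set Z := {u : ℂ | ¬Nonresonant ω₁ ω₂ ω₃ (γ u)} with hZ
  have hsum : ∀ {a b : ℂ}, a + b ∉ periods ω₁ ω₂ ω₃ → a ∉ periods ω₁ ω₂ ω₃ ∨ b ≠ 0 := by
    intro a b h
    by_contra! hn
    rw [hn.2, add_zero] at h
    exact h hn.1
  have hZc : Z.Countable := countable_resonant g (g₁ - g)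
    (fun j k => hsum (by convert! hn.1 j k using 1; simp; ring_nf))
    (fun k hk => hsum (by convert! hn.2 k hk using 1; simp; ring_nf))
  have d1 := div_neg_im_pos h31
  have d2 := div_neg_im_pos h32
  have hsd : Differentiable ℂ fun u => addShift ω₁ (γ u) := by
    refine differentiable_pi.2 fun k => ?_
    have : ∀ k, Differentiable ℂ fun u => γ u k := differentiable_pi.1 hγd
    simp only [addShift, Function.update_apply]
    split_ifs
    · exact (this 6).sub_const _
    · exact (this 5).add_const _
    · exact this k
  have han : AnalyticOnNhd ℂ (fun u => dualCasorati ω₁ ω₂ ω₃ (γ u)) Zᶜ := by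
    intro u hu
    have hu' : Nonresonant ω₁ ω₂ ω₃ (γ u) := not_not.1 hu
    rw [analyticAt_iff_eventually_differentiableAt]
    have c1 := hγd.continuous.continuousAt (x := u)
    have c2 := hsd.continuous.continuousAt (x := u)
    filter_upwards [c1.eventually ((hu'.uAddDefined h12 h32).eventually h12 h32),
      c1.eventually ((hu'.dual.uAddDefined d1 d2).eventually d1 d2),
      c2.eventually ((hu'.addShift.uAddDefined h12 h32).eventually h12 h32),
      c2.eventually ((hu'.addShift.dual.uAddDefined d1 d2).eventually d1 d2)] with v k1 k2 k3 k4
    exact ((k1.differentiableAt h12 h32 hγd).mul (k4.differentiableAt d1 d2 hsd)).sub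
      ((k3.differentiableAt h12 h32 hsd).mul (k2.differentiableAt d1 d2 hγd))
  have hconn : IsPreconnected Zᶜ :=
    (hZc.isConnected_compl_of_one_lt_rank (by simp)).isPreconnected
  have h1Z : (1 : ℂ) ∈ Zᶜ := fun h => h (hγ1 ▸ hn)
  have hlined : ∀ᶠ u in 𝓝 (0 : ℂ), LinedUp ω₃ (γ u) ∧ LinedUp ω₃ (addShift ω₁ (γ u)) :=
    (hγd.continuous.continuousAt.eventually (eventually_linedUp (by rw [hγ0]; exact hg.2.1))).and
      (hsd.continuous.continuousAt.eventually (eventually_linedUp (by simpa only [hγ0] using hg.2.2)))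
  rw [mem_closure_iff_nhds]
  by_contra! hcon
  obtain ⟨W, hW, hWS⟩ := hcon
  have hW' : ∀ᶠ u in 𝓝 (0 : ℂ), γ u ∈ W := hγd.continuous.continuousAt (by rw [hγ0]; exact hW)
  obtain ⟨N, hN, hNo, h0N⟩ := eventually_nhds_iff.1 (hlined.and hW')
  have hzero : ∀ u ∈ N, u ∈ Zᶜ → dualCasorati ω₁ ω₂ ω₃ (γ u) = 0 := by
    intro u huN huZ
    by_contra hne
    obtain ⟨⟨l1, l2⟩, hw⟩ := hN u huN
    have hu' : Nonresonant ω₁ ω₂ ω₃ (γ u) := not_not.1 huZ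
    have m1 := hu'.uModDefined h12 h31 h32 l1
    have m2 := hu'.addShift.uModDefined h12 h31 h32 l2
    have : γ u ∈ W ∩ independenceSet ω₁ ω₂ ω₃ := ⟨hw, ⟨hbal u, l1, l2⟩, hu'.uAddDefined h12 h32,
      hu'.addShift.uAddDefined h12 h32, m1, m2,
      (casorati_ne_zero_iff h12 h31 h32 (hbal u) m1 m2).2 hne⟩
    rw [hWS] at this
    exact this
  obtain ⟨z, hzN, hzZ⟩ := (hZc.dense_compl ℂ).inter_open_nonempty N hNo ⟨0, h0N⟩
  have hfreq : ∃ᶠ u in 𝓝[≠] z, dualCasorati ω₁ ω₂ ω₃ (γ u) = 0 := by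
    rw [frequently_nhdsWithin_iff]
    have hd := (hZc.union (Set.countable_singleton z)).dense_compl ℂ
    have := mem_closure_iff_frequently.1 (hd z)
    refine (this.and_eventually (hNo.mem_nhds hzN)).mono fun u hu => ?_
    exact ⟨hzero u hu.2 fun h => hu.1 (Or.inl h), fun h => hu.1 (Or.inr h)⟩
  refine hc ?_
  rw [← hγ1]
  exact han.eqOn_zero_of_preconnected_of_frequently_eq_zero hconn hzZ hfreq h1Z

end casorati

section pinchedLimit

variable {ω₁ ω₂ ω₃ s : ℂ} {g : Fin 8 → ℂ} {i j : Fin 8}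

/-- The leading coefficient of `U` at a pinched point. -/
noncomputable def leadingU (p q : ℂ) (i j : Fin 8) (t : Fin 8 → ℂ) : ℂ :=
  residueFactor p q (t i) * pairGamma p q ((Finset.univ.erase i).erase j) t (t i) / normalizer p q t

/-- Integers for which `m_j + m_k = 0` holds only for two pairs of indices. -/
def weight : Fin 8 → ℤ := ![1, -1, 2, -2, 5, 7, 11, -23]

lemma notMem_of_sub_mem (hs : ∀ n : ℤ, n * s ∈ periods ω₁ ω₂ ω₃ → n = 0) {n : ℤ} (hn : n ≠ 0)
    {u : ℂ} (hu : u - n * s ∈ periods ω₁ ω₂ ω₃) : u ∉ periods ω₁ ω₂ ω₃ := fun h =>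
  hn (hs n (by convert! sub_mem h hu using 1; ring))

lemma add_notMem_periods (hs : ∀ n : ℤ, n * s ∈ periods ω₁ ω₂ ω₃ → n = 0)
    (hg : ∀ k, g k - weight k * s ∈ periods ω₁ ω₂ ω₃) {k l : Fin 8} (h : weight k + weight l ≠ 0) :
    g k + g l ∉ periods ω₁ ω₂ ω₃ :=
  notMem_of_sub_mem hs h (by convert! add_mem (hg k) (hg l) using 1; push_cast; ring)

lemma sub_notMem_periods (hs : ∀ n : ℤ, n * s ∈ periods ω₁ ω₂ ω₃ → n = 0)
    (hg : ∀ k, g k - weight k * s ∈ periods ω₁ ω₂ ω₃) {k l : Fin 8} (h : k ≠ l) :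
    g k - g l ∉ periods ω₁ ω₂ ω₃ :=
  notMem_of_sub_mem hs (sub_ne_zero.2 (fun he => h ((by decide : Function.Injective weight) he)))
    (by convert! sub_mem (hg k) (hg l) using 1; push_cast; ring)

lemma pinched_expParams (h1 : 0 < (ω₁ / ω₂).im) (hind : ∀ k₁ k₂ k₃ : ℤ,
      k₁ * ω₁ + k₂ * ω₂ + k₃ * ω₃ = 0 → k₁ = 0 ∧ k₂ = 0 ∧ k₃ = 0)
    (hs : ∀ n : ℤ, n * s ∈ periods ω₁ ω₂ ω₃ → n = 0)
    (hg : ∀ k, g k - weight k * s ∈ periods ω₁ ω₂ ω₃) {i' j' : Fin 8} (m : ℤ)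
    (hij : g i + g j = m * ω₂) (hij' : g i' + g j' = ω₃)
    (hw : ∀ k l, weight k + weight l = 0 →
      (k = i ∧ l = j ∨ k = j ∧ l = i) ∨ (k = i' ∧ l = j' ∨ k = j' ∧ l = i')) :
    Pinched (e (ω₃ / ω₂)) (e (ω₁ / ω₂)) i j (expParams ω₂ g) := by
  have h2 : ω₂ ≠ 0 := by rintro rfl; simp at h1
  refine ⟨?_, fun k l a b h => ?_⟩
  · rw [expParams, expParams, ← e_add, ← add_div, hij, mul_div_cancel_right₀ _ h2, e_int]
  · rw [expParams, expParams, ← e_nat_mul, ← e_nat_mul, ← e_add, ← e_add, ← e_add, e_eq_one_iff] at h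
    obtain ⟨n, hn⟩ := h
    have hn' : g k + g l + a * ω₃ + b * ω₁ = n * ω₂ := by
      field_simp at hn
      linear_combination hn
    have hkl : weight k + weight l = 0 := by
      by_contra hne
      exact add_notMem_periods hs hg hne (mem_periods_of_eq (-b) n (-a)
        (by push_cast; linear_combination hn'))
    rcases hw k l hkl with h | h
    · have hsum : g k + g l = m * ω₂ := by
        rcases h with ⟨rfl, rfl⟩ | ⟨rfl, rfl⟩
        · exact hij
        · rw [add_comm]; exact hij
      obtain ⟨z1, -, z3⟩ := hind b (m - n) a (by push_cast; linear_combination hn' - hsum)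
      exact ⟨⟨by exact_mod_cast z3, by exact_mod_cast z1⟩, h⟩
    · have hsum : g k + g l = ω₃ := by
        rcases h with ⟨rfl, rfl⟩ | ⟨rfl, rfl⟩
        · exact hij'
        · rw [add_comm]; exact hij'
      obtain ⟨-, -, z3⟩ := hind b (-n) (a + 1) (by push_cast; linear_combination hn' - hsum)
      omega

lemma normalizer_regular (h1 : 0 < (ω₁ / ω₂).im) (h3 : 0 < (ω₃ / ω₂).im)
    (hs : ∀ n : ℤ, n * s ∈ periods ω₁ ω₂ ω₃ → n = 0)
    (hg : ∀ k, g k - weight k * s ∈ periods ω₁ ω₂ ω₃) : ∀ k ∈ Finset.Iio (7 : Fin 8),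
      ellGamma (e (ω₃ / ω₂)) (e (ω₁ / ω₂)) (expParams ω₂ g k * expParams ω₂ g 7) ≠ 0 ∧
      ellGamma (e (ω₃ / ω₂)) (e (ω₁ / ω₂)) (expParams ω₂ g k / expParams ω₂ g 7) ≠ 0 := by
  intro k hk
  refine ⟨ellGamma_e_ne_zero h1 h3 (add_notMem_periods hs hg
      ((by decide : ∀ k, weight k + weight 7 ≠ 0) k)) (by rw [add_div, e_add]; rfl),
    ellGamma_e_ne_zero h1 h3 (sub_notMem_periods hs hg (Finset.mem_Iio.1 hk).ne)
      (by rw [sub_div, e_sub]; rfl)⟩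

lemma normalizer_expParams_ne_zero (h1 : 0 < (ω₁ / ω₂).im) (h3 : 0 < (ω₃ / ω₂).im)
    (hs : ∀ n : ℤ, n * s ∈ periods ω₁ ω₂ ω₃ → n = 0)
    (hg : ∀ k, g k - weight k * s ∈ periods ω₁ ω₂ ω₃) :
    normalizer (e (ω₃ / ω₂)) (e (ω₁ / ω₂)) (expParams ω₂ g) ≠ 0 :=
  Finset.prod_ne_zero_iff.2 fun k hk => mul_ne_zero (normalizer_regular h1 h3 hs hg k hk).1
    (normalizer_regular h1 h3 hs hg k hk).2

lemma tendsto_UAdd_of_pinched (h1 : 0 < (ω₁ / ω₂).im) (h3 : 0 < (ω₃ / ω₂).im)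
    (hs : ∀ n : ℤ, n * s ∈ periods ω₁ ω₂ ω₃ → n = 0)
    (hg : ∀ k, g k - weight k * s ∈ periods ω₁ ω₂ ω₃) (hij : i ≠ j)
    (P : Pinched (e (ω₃ / ω₂)) (e (ω₁ / ω₂)) i j (expParams ω₂ g)) {l : Filter ℂ}
    {γ : ℂ → Fin 8 → ℂ} (hγ : Tendsto γ l (𝓝 g)) (hn : ∀ᶠ x in l, Nonresonant ω₁ ω₂ ω₃ (γ x)) :
    Tendsto (fun x => (1 - expParams ω₂ (γ x) i * expParams ω₂ (γ x) j) * UAdd ω₁ ω₂ ω₃ (γ x)) l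
      (𝓝 (leadingU (e (ω₃ / ω₂)) (e (ω₁ / ω₂)) i j (expParams ω₂ g))) := by
  have hp := norm_e_lt_one.2 h3
  have hq := norm_e_lt_one.2 h1
  have hV := (P.tendsto_V hp hq (e_ne_zero _) (e_ne_zero _) hij (expParams_ne_zero ω₂ g)).2
  have hN := (continuousAt_normalizer hp hq (expParams_ne_zero ω₂ g)
    (normalizer_regular h1 h3 hs hg)).tendsto.mono_left (nhdsWithin_le_nhds
      (s := {t' | t' i * t' j ≠ 1}))
  have hU := hV.div hN (normalizer_expParams_ne_zero h1 h3 hs hg)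
  refine (hU.comp (tendsto_nhdsWithin_iff.2
    ⟨((continuous_expParams ω₂).tendsto g).comp hγ, ?_⟩)).congr fun x => mul_div_assoc _ _ _
  filter_upwards [hn] with x hx he
  exact (hx.uAddDefined h1 h3).1 i j 0 0 (by simpa using he)

/-- `θ(e((u + x)/ω₂)) θ(e((u - x)/ω₂))`. -/
noncomputable def thetaPair (ω₂ ω₃ u x : ℂ) : ℂ :=
  theta (e (ω₃ / ω₂)) (e (u / ω₂) * e (x / ω₂)) * theta (e (ω₃ / ω₂)) (e (u / ω₂) / e (x / ω₂))

lemma thetaPair_ne_zero (h3 : 0 < (ω₃ / ω₂).im) {u x : ℂ} (h : u + x ∉ periods ω₁ ω₂ ω₃)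
    (h' : u - x ∉ periods ω₁ ω₂ ω₃) : thetaPair ω₂ ω₃ u x ≠ 0 :=
  mul_ne_zero (theta_e_ne_zero h3 h (by rw [add_div, e_add])) (theta_e_ne_zero h3 h'
    (by rw [sub_div, e_sub]))

lemma thetaPair_dual (h3 : 0 < (ω₃ / ω₂).im) (u x : ℂ) : thetaPair (-ω₃) ω₂ u x =
    thetaMultiplier ω₂ ω₃ (u + x) * thetaMultiplier ω₂ ω₃ (u - x) * thetaPair ω₂ ω₃ u x := by
  rw [thetaPair, thetaPair, ← e_add, ← e_sub, ← e_add, ← e_sub, div_neg ω₂, ← neg_div,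
    theta_dual h3 (u := u + x) (y := e (u / ω₂ + x / ω₂)) (by congr 1; ring) (by congr 1; ring),
    theta_dual h3 (u := u - x) (y := e (u / ω₂ - x / ω₂)) (by congr 1; ring) (by congr 1; ring)]
  ring

lemma thetaMultiplier_four (n2 : ω₂ ≠ 0) (n3 : ω₃ ≠ 0) (u v x y : ℂ) :
    thetaMultiplier ω₂ ω₃ (u + x) * thetaMultiplier ω₂ ω₃ (u - x) *
      (thetaMultiplier ω₂ ω₃ (v + y) * thetaMultiplier ω₂ ω₃ (v - y)) =
    thetaMultiplier ω₂ ω₃ (v + x) * thetaMultiplier ω₂ ω₃ (v - x) *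
      (thetaMultiplier ω₂ ω₃ (u + y) * thetaMultiplier ω₂ ω₃ (u - y)) := by
  simp only [thetaMultiplier, ← exp_add, ← mul_add]
  congr 2
  simp only [thetaExponent]
  field_simp
  ring

lemma sub_omega_notMem {u : ℂ} (h : u ∉ periods ω₁ ω₂ ω₃) : u - ω₁ ∉ periods ω₁ ω₂ ω₃ := fun h' =>
  h (by convert! add_mem h' omega₁_mem_periods using 1; ring)

lemma leadingU_ne_zero (h1 : 0 < (ω₁ / ω₂).im) (h3 : 0 < (ω₃ / ω₂).im)
    (hs : ∀ n : ℤ, n * s ∈ periods ω₁ ω₂ ω₃ → n = 0)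
    (hg : ∀ k, g k - weight k * s ∈ periods ω₁ ω₂ ω₃) (hij : i ≠ j)
    (hw : ∀ k, k ≠ j → weight k + weight i ≠ 0)
    (P : Pinched (e (ω₃ / ω₂)) (e (ω₁ / ω₂)) i j (expParams ω₂ g)) :
    leadingU (e (ω₃ / ω₂)) (e (ω₁ / ω₂)) i j (expParams ω₂ g) ≠ 0 := by
  refine div_ne_zero (mul_ne_zero (P.residueFactor_ne_zero (norm_e_lt_one.2 h3) (norm_e_lt_one.2 h1)
    hij) (Finset.prod_ne_zero_iff.2 fun k hk => ?_)) (normalizer_expParams_ne_zero h1 h3 hs hg)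
  simp only [Finset.mem_erase, Finset.mem_univ, and_true] at hk
  exact mul_ne_zero (ellGamma_e_ne_zero h1 h3 (add_notMem_periods hs hg (hw k hk.1))
      (by rw [add_div, e_add]; rfl))
    (ellGamma_e_ne_zero h1 h3 (sub_notMem_periods hs hg hk.2) (by rw [sub_div, e_sub]; rfl))

lemma expParams_addShift (g : Fin 8 → ℂ) :
    expParams ω₂ (addShift ω₁ g) = qShift (e (ω₁ / ω₂)) (expParams ω₂ g) 5 6 := by
  ext k
  simp only [expParams, addShift, qShift, Function.update_apply, ← e_neg, ← e_add]
  split_ifs <;> congr 1 <;> ring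

lemma pairGamma_addShift (h1 : 0 < (ω₁ / ω₂).im) (h3 : 0 < (ω₃ / ω₂).im)
    (hs : ∀ n : ℤ, n * s ∈ periods ω₁ ω₂ ω₃ → n = 0)
    (hg : ∀ k, g k - weight k * s ∈ periods ω₁ ω₂ ω₃) {S : Finset (Fin 8)} (h5 : 5 ∈ S) (h6 : 6 ∈ S)
    (hi : i ≠ 5 ∧ i ≠ 6) :
    pairGamma (e (ω₃ / ω₂)) (e (ω₁ / ω₂)) S (expParams ω₂ (addShift ω₁ g)) (expParams ω₂ g i) *
      thetaPair ω₂ ω₃ (g 6 - ω₁) (g i) = thetaPair ω₂ ω₃ (g 5) (g i) *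
        pairGamma (e (ω₃ / ω₂)) (e (ω₁ / ω₂)) S (expParams ω₂ g) (expParams ω₂ g i) := by
  have a5 := add_notMem_periods hs hg ((by decide : ∀ k, weight 5 + weight k ≠ 0) i)
  have a6 := add_notMem_periods hs hg ((by decide : ∀ k, weight 6 + weight k ≠ 0) i)
  have b5 := sub_notMem_periods hs hg hi.1.symm
  have b6 := sub_notMem_periods hs hg hi.2.symm
  have key := pairGamma_qShift (norm_e_lt_one.2 h3) (norm_e_lt_one.2 h1) (e_ne_zero _)
    (t := expParams ω₂ g) h5 h6 (by decide) (x := expParams ω₂ g i)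
    (ellGamma_e_ne_zero h1 h3 a5 (by rw [add_div, e_add]; rfl))
    (ellGamma_e_ne_zero h1 h3 b5 (by rw [sub_div, e_sub]; rfl))
    (ellGamma_e_ne_zero h1 h3 (sub_omega_notMem a6) (by
      simp only [expParams, ← e_neg, ← e_add]; congr 1; ring))
    (ellGamma_e_ne_zero h1 h3 (sub_omega_notMem b6) (by
      simp only [expParams, ← e_neg, ← e_add, ← e_sub]; congr 1; ring))
  have x1 : e ((g 6 - ω₁) / ω₂) * e (g i / ω₂) =
      expParams ω₂ g i * expParams ω₂ g 6 / e (ω₁ / ω₂) := by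
    rw [expParams, expParams, ← e_add, ← e_add, ← e_sub]; congr 1; ring
  have x2 : e ((g 6 - ω₁) / ω₂) / e (g i / ω₂) =
      expParams ω₂ g 6 / (e (ω₁ / ω₂) * expParams ω₂ g i) := by
    rw [expParams, expParams, ← e_add, ← e_sub, ← e_sub]; congr 1; ring
  rw [expParams_addShift, thetaPair, x1, x2]
  exact key

/-- The shift of the leading coefficient. -/
lemma leadingU_addShift (h1 : 0 < (ω₁ / ω₂).im) (h3 : 0 < (ω₃ / ω₂).im)
    (hs : ∀ n : ℤ, n * s ∈ periods ω₁ ω₂ ω₃ → n = 0)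
    (hg : ∀ k, g k - weight k * s ∈ periods ω₁ ω₂ ω₃) (hi : i < 4) (hj : j < 4) :
    leadingU (e (ω₃ / ω₂)) (e (ω₁ / ω₂)) i j (expParams ω₂ (addShift ω₁ g)) *
        (thetaPair ω₂ ω₃ (g 6 - ω₁) (g i) * thetaPair ω₂ ω₃ (g 5) (g 7)) =
      leadingU (e (ω₃ / ω₂)) (e (ω₁ / ω₂)) i j (expParams ω₂ g) *
        (thetaPair ω₂ ω₃ (g 5) (g i) * thetaPair ω₂ ω₃ (g 6 - ω₁) (g 7)) := by
  have hm : ∀ {k : Fin 8}, (4 : Fin 8) < k → k ∈ (Finset.univ.erase i).erase j := fun {k} hk => by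
    simp only [Finset.mem_erase, Finset.mem_univ, and_true]
    exact ⟨(hj.trans hk).ne', (hi.trans hk).ne'⟩
  have n1 := pairGamma_addShift h1 h3 hs hg (hm (by decide : (4 : Fin 8) < 5))
    (hm (by decide : (4 : Fin 8) < 6)) (i := i)
    ⟨(hi.trans (by decide)).ne, (hi.trans (by decide)).ne⟩
  have n2 := pairGamma_addShift h1 h3 hs hg (S := Finset.Iio 7) (by decide) (by decide) (i := 7)
    (by decide)
  have ei : expParams ω₂ (addShift ω₁ g) i = expParams ω₂ g i := by
    simp [expParams, addShift, (hi.trans (by decide : (4 : Fin 8) < 6)).ne,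
      (hi.trans (by decide : (4 : Fin 8) < 5)).ne]
  have e7 : expParams ω₂ (addShift ω₁ g) 7 = expParams ω₂ g 7 := by simp [expParams, addShift]
  have hN := normalizer_expParams_ne_zero h1 h3 hs hg
  have hg' : ∀ k, addShift ω₁ g k - weight k * s ∈ periods ω₁ ω₂ ω₃ := fun k => by
    convert! add_mem (hg k) (addShift_sub_mem g k) using 1; ring
  have hN' := normalizer_expParams_ne_zero h1 h3 hs hg'
  rw [normalizer] at hN hN'
  rw [e7] at hN'
  rw [leadingU, leadingU, normalizer, normalizer, ei, e7]
  rw [div_mul_eq_mul_div, div_mul_eq_mul_div, div_eq_div_iff hN' hN]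
  linear_combination (residueFactor (e (ω₃ / ω₂)) (e (ω₁ / ω₂)) (expParams ω₂ g i) *
    thetaPair ω₂ ω₃ (g 5) (g 7) * pairGamma (e (ω₃ / ω₂)) (e (ω₁ / ω₂)) (Finset.Iio 7)
      (expParams ω₂ g) (expParams ω₂ g 7)) * n1 -
    (residueFactor (e (ω₃ / ω₂)) (e (ω₁ / ω₂)) (expParams ω₂ g i) * thetaPair ω₂ ω₃ (g 5) (g i) *
      pairGamma (e (ω₃ / ω₂)) (e (ω₁ / ω₂)) ((Finset.univ.erase i).erase j) (expParams ω₂ g)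
      (expParams ω₂ g i)) * n2

lemma exists_weight_scale (ω₁ ω₂ ω₃ : ℂ) : ∃ s : ℂ, ∀ n : ℤ, n * s ∈ periods ω₁ ω₂ ω₃ → n = 0 := by
  have hc : (⋃ (n : ℤ) (_ : n ≠ 0), {s : ℂ | 0 + s * n ∈ periods ω₁ ω₂ ω₃}).Countable :=
    Set.countable_iUnion fun n => Set.countable_iUnion fun hn =>
      countable_affine (Or.inr (Int.cast_ne_zero.2 hn))
  obtain ⟨s, hs⟩ := (hc.dense_compl ℂ).nonempty
  simp only [Set.mem_compl_iff, Set.mem_iUnion, Set.mem_ofPred_eq, not_exists] at hs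
  refine ⟨s, fun n hn => ?_⟩
  by_contra h0
  exact hs n h0 (by rwa [zero_add, mul_comm])

/-- Some Casorati determinant does not vanish. -/
theorem exists_dualCasorati_ne_zero (h12 : 0 < (ω₁ / ω₂).im) (h31 : 0 < (ω₃ / ω₁).im)
    (h32 : 0 < (ω₃ / ω₂).im) (hind : ∀ k₁ k₂ k₃ : ℤ,
      k₁ * ω₁ + k₂ * ω₂ + k₃ * ω₃ = 0 → k₁ = 0 ∧ k₂ = 0 ∧ k₃ = 0) :
    ∃ g, AddBalanced ω₁ ω₂ ω₃ g ∧ Nonresonant ω₁ ω₂ ω₃ g ∧ dualCasorati ω₁ ω₂ ω₃ g ≠ 0 := by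
  have n2 : ω₂ ≠ 0 := by rintro rfl; simp at h32
  have n3 : ω₃ ≠ 0 := by rintro rfl; simp at h32
  have d1 := div_neg_im_pos h31
  have d2 := div_neg_im_pos h32
  obtain ⟨s, hs⟩ := exists_weight_scale ω₁ ω₂ ω₃
  set g : Fin 8 → ℂ := fun k => weight k * s + ![0, ω₂, 0, ω₃, 0, 0, 0, 2 * ω₁ + ω₂ + ω₃] k with hgdef
  have hg : ∀ k, g k - weight k * s ∈ periods ω₁ ω₂ ω₃ := fun k => by
    rw [hgdef]
    dsimp only
    rw [add_sub_cancel_left]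
    have z1 : (0 : ℂ) ∈ periods ω₁ ω₂ ω₃ := zero_mem _
    have z2 : ω₂ ∈ periods ω₁ ω₂ ω₃ := mem_periods_of_eq 0 1 0 (by simp)
    have z3 : ω₃ ∈ periods ω₁ ω₂ ω₃ := mem_periods_of_eq 0 0 1 (by simp)
    have z4 : 2 * ω₁ + ω₂ + ω₃ ∈ periods ω₁ ω₂ ω₃ := mem_periods_of_eq 2 1 1 (by simp)
    fin_cases k <;> assumption
  have g01 : g 0 + g 1 = ω₂ := by simp [hgdef, weight]
  have g23 : g 2 + g 3 = ω₃ := by simp [hgdef, weight]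
  set d : Fin 8 → ℤ := ![1, 0, 1, 0, -2, 0, 0, 0] with hd
  set γ : ℂ → Fin 8 → ℂ := fun x => g + x • fun k => (d k : ℂ) with hγ
  set Z := {x : ℂ | ¬Nonresonant ω₁ ω₂ ω₃ (γ x)} with hZ
  have hZc : Z.Countable := by
    refine countable_resonant g _ (fun j k => ?_) fun k hk =>
      Or.inl (sub_notMem_periods hs hg (Finset.mem_Iio.1 hk).ne)
    by_cases h : weight j + weight k = 0
    · refine Or.inr ?_
      have := (by decide : ∀ j k, weight j + weight k = 0 →
        (![1, 0, 1, 0, -2, 0, 0, 0] : Fin 8 → ℤ) j + (![1, 0, 1, 0, -2, 0, 0, 0] : Fin 8 → ℤ) k ≠ 0)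
        j k h
      exact_mod_cast this
    · exact Or.inl (add_notMem_periods hs hg h)
  have : (𝓝[Zᶜ] (0 : ℂ)).NeBot := mem_closure_iff_nhdsWithin_neBot.1 (hZc.dense_compl ℂ 0)
  have hγt : Tendsto γ (𝓝[Zᶜ] 0) (𝓝 g) := by
    have : Continuous γ := by fun_prop
    have h0 := this.tendsto 0
    rw [show γ 0 = g by simp [hγ]] at h0
    exact h0.mono_left nhdsWithin_le_nhds
  have hγt' := ((continuous_addShift ω₁).tendsto g).comp hγt
  have hn : ∀ᶠ x in 𝓝[Zᶜ] (0 : ℂ), Nonresonant ω₁ ω₂ ω₃ (γ x) :=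
    eventually_mem_nhdsWithin.mono fun x hx => not_not.1 hx
  have hg' : ∀ k, addShift ω₁ g k - weight k * s ∈ periods ω₁ ω₂ ω₃ := fun k => by
    convert! add_mem (hg k) (addShift_sub_mem g k) using 1; ring
  have hgd := hg
  have hgd' := hg'
  have hsd := hs
  rw [← periods_dual] at hgd hgd' hsd
  have hindd : ∀ k₁ k₂ k₃ : ℤ, k₁ * ω₁ + k₂ * (-ω₃) + k₃ * ω₂ = 0 → k₁ = 0 ∧ k₂ = 0 ∧ k₃ = 0 := by
    intro a b c h
    obtain ⟨z1, z2, z3⟩ := hind a c (-b) (by push_cast; linear_combination h)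
    exact ⟨z1, neg_eq_zero.1 z3, z2⟩
  have sh : ∀ (g : Fin 8 → ℂ) (k : Fin 8), k < 4 → addShift ω₁ g k = g k := fun g k hk => by
    simp [addShift, (hk.trans (by decide : (4 : Fin 8) < 6)).ne,
      (hk.trans (by decide : (4 : Fin 8) < 5)).ne]
  have P := pinched_expParams (i := 0) (j := 1) (i' := 2) (j' := 3) h12 hind hs hg 1
    (by rw [g01]; simp) g23 (by decide)
  have P' := pinched_expParams (i := 0) (j := 1) (i' := 2) (j' := 3) h12 hind hs hg' 1
    (by rw [sh g 0 (by decide), sh g 1 (by decide), g01]; simp)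
    (by rw [sh g 2 (by decide), sh g 3 (by decide), g23]) (by decide)
  have Q := pinched_expParams (i := 2) (j := 3) (i' := 0) (j' := 1) d1 hindd hsd hgd (-1)
    (by rw [g23]; simp) g01 (by decide)
  have Q' := pinched_expParams (i := 2) (j := 3) (i' := 0) (j' := 1) d1 hindd hsd hgd' (-1)
    (by rw [sh g 2 (by decide), sh g 3 (by decide), g23]; simp)
    (by rw [sh g 0 (by decide), sh g 1 (by decide), g01]) (by decide)
  have t1 := tendsto_UAdd_of_pinched h12 h32 hs hg (by decide) P hγt hn
  have t2 := tendsto_UAdd_of_pinched h12 h32 hs hg' (by decide) P' hγt' (hn.mono fun x h => h.addShift)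
  have t3 := tendsto_UAdd_of_pinched d1 d2 hsd hgd (by decide) Q hγt (hn.mono fun x h => h.dual)
  have t4 := tendsto_UAdd_of_pinched d1 d2 hsd hgd' (by decide) Q' hγt'
    (hn.mono fun x h => h.addShift.dual)
  have r1 := leadingU_addShift h12 h32 hs hg (i := 0) (j := 1) (by decide) (by decide)
  have r2 := leadingU_addShift d1 d2 hsd hgd (i := 2) (j := 3) (by decide) (by decide)
  have l1 := leadingU_ne_zero h12 h32 hs hg (by decide) (by decide) P
  have l2 := leadingU_ne_zero d1 d2 hsd hgd (by decide) (by decide) Q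
  by_contra! hcon
  have hlim := (t1.mul t4).sub (t2.mul t3)
  have hzero := hlim.congr' (f₂ := fun _ => 0) (by
    filter_upwards [hn] with x hx
    have hb : AddBalanced ω₁ ω₂ ω₃ (γ x) := by
      rw [AddBalanced, Fin.sum_univ_eight]
      simp [hγ, hgdef, hd, weight]
      ring
    have h0 := hcon _ hb hx
    rw [dualCasorati] at h0
    have s0 : ∀ (ω : ℂ) (k : Fin 8), k < 4 →
        expParams ω ((addShift ω₁ ∘ γ) x) k = expParams ω (γ x) k := fun ω k hk => by
      rw [expParams, expParams, Function.comp_apply, sh _ k hk]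
    rw [s0 _ 0 (by decide), s0 _ 1 (by decide), s0 _ 2 (by decide), s0 _ 3 (by decide)]
    simp only [Function.comp_apply]
    linear_combination ((1 - expParams ω₂ (γ x) 0 * expParams ω₂ (γ x) 1) *
      (1 - expParams (-ω₃) (γ x) 2 * expParams (-ω₃) (γ x) 3)) * h0)
  have heq := tendsto_nhds_unique hzero tendsto_const_nhds
  clear t1 t2 t3 t4 hlim hzero P P' Q Q'
  rw [thetaPair_dual h32, thetaPair_dual h32, thetaPair_dual h32, thetaPair_dual h32] at r2
  have hM := thetaMultiplier_four n2 n3 (g 5) (g 6 - ω₁) (g 2) (g 7)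
  have hM0 : thetaMultiplier ω₂ ω₃ (g 5 + g 2) * thetaMultiplier ω₂ ω₃ (g 5 - g 2) *
      (thetaMultiplier ω₂ ω₃ (g 6 - ω₁ + g 7) * thetaMultiplier ω₂ ω₃ (g 6 - ω₁ - g 7)) ≠ 0 := by
    simp [thetaMultiplier_ne_zero]
  have a6 : ∀ k, g 6 - ω₁ + g k ∉ periods ω₁ ω₂ ω₃ := fun k => by
    rw [sub_add_eq_add_sub]
    exact sub_omega_notMem (add_notMem_periods hs hg
      ((by decide : ∀ k, weight 6 + weight k ≠ 0) k))
  have b6 : ∀ k, (6 : Fin 8) ≠ k → g 6 - ω₁ - g k ∉ periods ω₁ ω₂ ω₃ := fun k hk => by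
    rw [sub_right_comm]
    exact sub_omega_notMem (sub_notMem_periods hs hg hk)
  have a5 : ∀ k, g 5 + g k ∉ periods ω₁ ω₂ ω₃ := fun k =>
    add_notMem_periods hs hg ((by decide : ∀ k, weight 5 + weight k ≠ 0) k)
  have b5 : ∀ k, (5 : Fin 8) ≠ k → g 5 - g k ∉ periods ω₁ ω₂ ω₃ := fun k hk =>
    sub_notMem_periods hs hg hk
  have A7 := thetaPair_ne_zero h32 (a5 7) (b5 7 (by decide))
  have B7 := thetaPair_ne_zero h32 (a6 7) (b6 7 (by decide))
  have B0 := thetaPair_ne_zero h32 (a6 0) (b6 0 (by decide))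
  have B2 := thetaPair_ne_zero h32 (a6 2) (b6 2 (by decide))
  have hadd := theta_addition (norm_e_lt_one.2 h32) (e_ne_zero (ω₃ / ω₂)) (e_ne_zero (g 2 / ω₂))
    (e_ne_zero (g 5 / ω₂)) (e_ne_zero ((g 6 - ω₁) / ω₂)) (e_ne_zero (g 0 / ω₂))
  have f1 : theta (e (ω₃ / ω₂)) (e (g 5 / ω₂) * e ((g 6 - ω₁) / ω₂)) ≠ 0 :=
    theta_e_ne_zero h32 (a6 5) (by rw [← e_add]; congr 1; ring)
  have f2 : theta (e (ω₃ / ω₂)) (e (g 5 / ω₂) / e ((g 6 - ω₁) / ω₂)) ≠ 0 :=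
    theta_e_ne_zero h32 (u := g 5 - (g 6 - ω₁)) (fun h => b6 5 (by decide) (by
      convert! neg_mem h using 1; ring)) (by rw [← e_sub]; congr 1; ring)
  have f3 : theta (e (ω₃ / ω₂)) (e (g 2 / ω₂) * e (g 0 / ω₂)) ≠ 0 :=
    theta_e_ne_zero h32 (add_notMem_periods hs hg (by decide : weight 2 + weight 0 ≠ 0))
      (by rw [← e_add]; congr 1; ring)
  have f4 : theta (e (ω₃ / ω₂)) (e (g 2 / ω₂) / e (g 0 / ω₂)) ≠ 0 :=
    theta_e_ne_zero h32 (sub_notMem_periods hs hg (by decide : (2 : Fin 8) ≠ 0))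
      (by rw [← e_sub]; congr 1; ring)
  have hrhs := mul_ne_zero (div_ne_zero (e_ne_zero ((g 6 - ω₁) / ω₂)) (e_ne_zero (g 2 / ω₂)))
    (mul_ne_zero (mul_ne_zero (mul_ne_zero f1 f2) f3) f4)
  rw [← hadd] at hrhs
  have hrhs' : thetaPair ω₂ ω₃ (g 5) (g 2) * thetaPair ω₂ ω₃ (g 6 - ω₁) (g 0) -
      thetaPair ω₂ ω₃ (g 5) (g 0) * thetaPair ω₂ ω₃ (g 6 - ω₁) (g 2) ≠ 0 := by
    convert! hrhs using 1
    simp only [thetaPair]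
    ring
  refine hrhs' ((mul_eq_zero.1 ?_).resolve_left
    (mul_ne_zero (mul_ne_zero (mul_ne_zero l1 l2) (mul_ne_zero A7 B7)) hM0))
  linear_combination (thetaMultiplier ω₂ ω₃ (g 5 + g 2) *
    thetaMultiplier ω₂ ω₃ (g 5 - g 2) * (thetaMultiplier ω₂ ω₃ (g 6 - ω₁ + g 7) *
    thetaMultiplier ω₂ ω₃ (g 6 - ω₁ - g 7)) * thetaPair ω₂ ω₃ (g 5) (g 7) ^ 2 *
    thetaPair ω₂ ω₃ (g 6 - ω₁) (g 0) * thetaPair ω₂ ω₃ (g 6 - ω₁) (g 2)) * heq -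
    (leadingU (e (ω₃ / ω₂)) (e (ω₁ / ω₂)) 0 1 (expParams ω₂ g) *
      leadingU (e (ω₂ / -ω₃)) (e (ω₁ / -ω₃)) 2 3 (expParams (-ω₃) (addShift ω₁ g)) *
      thetaPair ω₂ ω₃ (g 5) (g 7) ^ 2 * thetaPair ω₂ ω₃ (g 6 - ω₁) (g 0) *
      thetaPair ω₂ ω₃ (g 6 - ω₁) (g 2)) * hM -
    (leadingU (e (ω₃ / ω₂)) (e (ω₁ / ω₂)) 0 1 (expParams ω₂ g) * thetaPair ω₂ ω₃ (g 5) (g 7) *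
      thetaPair ω₂ ω₃ (g 6 - ω₁) (g 0)) * r2 +
    (leadingU (e (ω₂ / -ω₃)) (e (ω₁ / -ω₃)) 2 3 (expParams (-ω₃) g) *
      (thetaMultiplier ω₂ ω₃ (g 5 + g 2) * thetaMultiplier ω₂ ω₃ (g 5 - g 2) *
      (thetaMultiplier ω₂ ω₃ (g 6 - ω₁ + g 7) * thetaMultiplier ω₂ ω₃ (g 6 - ω₁ - g 7))) *
      thetaPair ω₂ ω₃ (g 5) (g 7) * thetaPair ω₂ ω₃ (g 6 - ω₁) (g 2)) * r1

end pinchedLimit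

end EllHyp

theorem mainTheorem5 :
    -- multiplicative part
    (∀ p q : ℂ, 0 < ‖p‖ → ‖p‖ < 1 → 0 < ‖q‖ → ‖q‖ < 1 →
      -- addition formula for theta functions
      (∀ w x y z : ℂ, w ≠ 0 → x ≠ 0 → y ≠ 0 → z ≠ 0 →
        EllHyp.theta p (x * w) * EllHyp.theta p (x / w) *
              EllHyp.theta p (y * z) * EllHyp.theta p (y / z) -
            EllHyp.theta p (x * z) * EllHyp.theta p (x / z) *
              EllHyp.theta p (y * w) * EllHyp.theta p (y / w) =
          y / w * (EllHyp.theta p (x * y) * EllHyp.theta p (x / y) *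
            EllHyp.theta p (w * z) * EllHyp.theta p (w / z))) ∧
      -- difference equation for the integrand
      (∀ (t : Fin 8 → ℂ) (z : ℂ), (∀ j, t j ≠ 0) → z ≠ 0 →
        (∀ (j : Fin 8) (a b : ℕ),
          t j * z * p ^ a * q ^ b ≠ 1 ∧ t j * z⁻¹ * p ^ a * q ^ b ≠ 1) →
        (∀ a b : ℕ,
          q⁻¹ * t 7 * z * p ^ a * q ^ b ≠ 1 ∧ q⁻¹ * t 7 * z⁻¹ * p ^ a * q ^ b ≠ 1) →
        EllHyp.theta p (q⁻¹ * t 7 * t 6) ≠ 0 → EllHyp.theta p (q⁻¹ * t 7 * (t 6)⁻¹) ≠ 0 →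
        EllHyp.kernel p q (EllHyp.qShift q t 5 7) z -
            EllHyp.theta p (t 5 * t 6) * EllHyp.theta p (t 5 * (t 6)⁻¹) /
              (EllHyp.theta p (q⁻¹ * t 7 * t 6) * EllHyp.theta p (q⁻¹ * t 7 * (t 6)⁻¹)) *
              EllHyp.kernel p q t z =
          t 5 / t 6 *
            (EllHyp.theta p (q⁻¹ * t 7 * t 5) * EllHyp.theta p (q⁻¹ * t 7 * (t 5)⁻¹) /
              (EllHyp.theta p (q⁻¹ * t 7 * t 6) * EllHyp.theta p (q⁻¹ * t 7 * (t 6)⁻¹))) *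
            EllHyp.kernel p q (EllHyp.qShift q t 6 7) z) ∧
      -- `V` is well defined: separating contours exist and all give the same value
      (∀ t : Fin 8 → ℂ, EllHyp.Balanced p q t → EllHyp.Admissible p q t →
        (∃ C : EllHyp.Contour, EllHyp.IsSeparating p q t C) ∧
        ∀ C : EllHyp.Contour, EllHyp.IsSeparating p q t C →
          EllHyp.V p q t =
            EllHyp.kappa p q * EllHyp.contourIntegral C fun z => EllHyp.kernel p q t z / z) ∧
      -- first contiguous relation
      (∀ t : Fin 8 → ℂ, EllHyp.Balanced p q t → EllHyp.Admissible p q t →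
        EllHyp.Admissible p q (EllHyp.qShift q t 5 7) →
        EllHyp.Admissible p q (EllHyp.qShift q t 6 7) →
        t 6 * (EllHyp.theta p (t 7 * t 6 / q) * EllHyp.theta p (t 7 / (q * t 6))) *
              EllHyp.V p q (EllHyp.qShift q t 5 7) -
            t 5 * (EllHyp.theta p (t 7 * t 5 / q) * EllHyp.theta p (t 7 / (q * t 5))) *
              EllHyp.V p q (EllHyp.qShift q t 6 7) =
          t 6 * (EllHyp.theta p (t 5 * t 6) * EllHyp.theta p (t 5 / t 6)) * EllHyp.V p q t) ∧
      -- second contiguous relation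
      (∀ t : Fin 8 → ℂ, EllHyp.Balanced p q t → EllHyp.Admissible p q t →
        EllHyp.Admissible p q (EllHyp.qShift q t 7 5) →
        EllHyp.Admissible p q (EllHyp.qShift q t 7 6) →
        t 5 * EllHyp.theta p (t 6 / (q * t 7)) *
              (∏ k ∈ Finset.Iio (5 : Fin 8), EllHyp.theta p (t 5 * t k / q)) *
              EllHyp.V p q (EllHyp.qShift q t 7 5) -
            t 6 * EllHyp.theta p (t 5 / (q * t 7)) *
              (∏ k ∈ Finset.Iio (5 : Fin 8), EllHyp.theta p (t 6 * t k / q)) *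
              EllHyp.V p q (EllHyp.qShift q t 7 6) =
          t 5 * EllHyp.theta p (t 6 / t 5) *
            (∏ k ∈ Finset.Iio (5 : Fin 8), EllHyp.theta p (t 7 * t k)) * EllHyp.V p q t) ∧
      -- second order difference equation for `U`
      (∀ t : Fin 8 → ℂ, EllHyp.Balanced p q t → EllHyp.UDefined p q t →
        EllHyp.UDefined p q (EllHyp.qShift q t 5 6) →
        EllHyp.UDefined p q (EllHyp.qShift q t 6 5) →
        EllHyp.PotentialDefined p q t → EllHyp.PotentialDefined p q (EllHyp.swap67 t) →
        EllHyp.potential p q t *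
              (EllHyp.U p q (EllHyp.qShift q t 5 6) - EllHyp.U p q t) +
            EllHyp.potential p q (EllHyp.swap67 t) *
              (EllHyp.U p q (EllHyp.qShift q t 6 5) - EllHyp.U p q t) +
            EllHyp.U p q t = 0) ∧
      -- the two expressions for the potential
      (∀ t : Fin 8 → ℂ, EllHyp.Balanced p q t →
        ∀ t₀ : ℂ, t 7 = p ^ 2 * t₀ → EllHyp.potential p q t = EllHyp.potential' p q t t₀) ∧
      -- `U` solves the elliptic hypergeometric equation
      (∀ (a z t₈ : ℂ) (τ : Fin 5 → ℂ), a ≠ 0 → z ≠ 0 → (∀ k, τ k ≠ 0) →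
        t₈ = p ^ 2 * q ^ 2 / (a ^ 2 * ∏ k, τ k) →
        EllHyp.UDefined p q (EllHyp.eheParams a τ t₈ z) →
        EllHyp.UDefined p q (EllHyp.eheParams a τ t₈ (q * z)) →
        EllHyp.UDefined p q (EllHyp.eheParams a τ t₈ (q⁻¹ * z)) →
        EllHyp.EheDefined p q z →
        EllHyp.EllHypEquation p q a τ t₈ z
          (EllHyp.U p q (EllHyp.eheParams a τ t₈ (q * z)))
          (EllHyp.U p q (EllHyp.eheParams a τ t₈ z))
          (EllHyp.U p q (EllHyp.eheParams a τ t₈ (q⁻¹ * z))))) ∧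
    -- the potential is a modular invariant elliptic function of `g_1, …, g_7`
    (∀ ω₁ ω₂ ω₃ : ℂ, 0 < (ω₃ / ω₂).im → ∀ g : Fin 7 → ℂ,
      (∀ (j : Fin 7) (x : ℂ),
        MeromorphicAt (fun u => EllHyp.potentialAdd ω₁ ω₂ ω₃ (Function.update g j u)) x) ∧
      (∀ j : Fin 7,
        EllHyp.potentialAdd ω₁ ω₂ ω₃ (Function.update g j (g j + ω₂)) =
          EllHyp.potentialAdd ω₁ ω₂ ω₃ g ∧
        EllHyp.potentialAdd ω₁ ω₂ ω₃ (Function.update g j (g j + ω₃)) =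
          EllHyp.potentialAdd ω₁ ω₂ ω₃ g) ∧
      EllHyp.potentialAdd ω₁ ω₂ (ω₃ + ω₂) g = EllHyp.potentialAdd ω₁ ω₂ ω₃ g ∧
      EllHyp.potentialAdd ω₁ (-ω₃) ω₂ g = EllHyp.potentialAdd ω₁ ω₂ ω₃ g) ∧
    -- additive part: the modified elliptic hypergeometric function
    (∀ ω₁ ω₂ ω₃ : ℂ, 0 ≤ (ω₁ / ω₂).im → 0 < (ω₃ / ω₁).im → 0 < (ω₃ / ω₂).im →
      -- `U^{mod}` solves the elliptic hypergeometric equation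
      (∀ (α y g₈ : ℂ) (c : Fin 5 → ℂ),
        EllHyp.AddBalanced ω₁ ω₂ ω₃ (EllHyp.addParams α c g₈ y) →
        EllHyp.UModDefined ω₁ ω₂ ω₃ (EllHyp.addParams α c g₈ y) →
        EllHyp.UModDefined ω₁ ω₂ ω₃ (EllHyp.addParams α c g₈ (y + ω₁)) →
        EllHyp.UModDefined ω₁ ω₂ ω₃ (EllHyp.addParams α c g₈ (y - ω₁)) →
        EllHyp.EheDefined (EllHyp.e (ω₃ / ω₂)) (EllHyp.e (ω₁ / ω₂)) (EllHyp.e (y / ω₂)) →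
        EllHyp.EllHypEquation (EllHyp.e (ω₃ / ω₂)) (EllHyp.e (ω₁ / ω₂)) (EllHyp.e (α / ω₂))
          (fun k => EllHyp.e (c k / ω₂)) (EllHyp.e (g₈ / ω₂)) (EllHyp.e (y / ω₂))
          (EllHyp.UMod ω₁ ω₂ ω₃ (EllHyp.addParams α c g₈ (y + ω₁)))
          (EllHyp.UMod ω₁ ω₂ ω₃ (EllHyp.addParams α c g₈ y))
          (EllHyp.UMod ω₁ ω₂ ω₃ (EllHyp.addParams α c g₈ (y - ω₁)))) ∧
      -- `v^{mod}` is proportional to the modular transform of `v`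
      (∀ g : Fin 8 → ℂ, EllHyp.AddBalanced ω₁ ω₂ ω₃ g → EllHyp.LinedUp ω₃ g →
        EllHyp.vMod g ω₁ ω₂ ω₃ =
          2 * ω₃ * Complex.exp (2 * Real.pi * Complex.I *
              (EllHyp.cubicP ω₁ ω₂ ω₃ 0 - ∑ j, EllHyp.cubicP ω₁ ω₂ ω₃ (g j))) /
            (ω₂ * EllHyp.qPoch (EllHyp.e (-ω₂ / ω₃)) (EllHyp.e (-ω₂ / ω₃)) *
              EllHyp.qPoch (EllHyp.e (-ω₁ / ω₃)) (EllHyp.e (-ω₁ / ω₃))) *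
            EllHyp.v g ω₁ (-ω₃) ω₂) ∧
      -- `U` and `U^{mod}` are linearly independent solutions for generic parameters
      (0 < (ω₁ / ω₂).im →
        (∀ k₁ k₂ k₃ : ℤ, k₁ * ω₁ + k₂ * ω₂ + k₃ * ω₃ = 0 → k₁ = 0 ∧ k₂ = 0 ∧ k₃ = 0) →
        (∃ O : Set (Fin 8 → ℂ), IsOpen O ∧
          EllHyp.independenceSet ω₁ ω₂ ω₃ = O ∩ EllHyp.solutionDomain ω₁ ω₂ ω₃) ∧
        EllHyp.solutionDomain ω₁ ω₂ ω₃ ⊆ closure (EllHyp.independenceSet ω₁ ω₂ ω₃))) := by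
  refine ⟨fun p q hp0' hp hq0' hq => ?_, fun ω₁ ω₂ ω₃ h g => ?_, fun ω₁ ω₂ ω₃ h12 h31 h32 => ?_⟩
  · have hp0 : p ≠ 0 := norm_pos_iff.1 hp0'
    have hq0 : q ≠ 0 := norm_pos_iff.1 hq0'
    refine ⟨fun w x y z hw hx hy hz => EllHyp.theta_addition hp hp0 hw hx hy hz,
      fun t z ht hz h1 h2 h3 h4 => EllHyp.kernel_difference hp hq hp0 hq0 ht hz h1 h2 h3 h4,
      fun t ht h => ⟨EllHyp.exists_isSeparating hp hq hp0 hq0 (ht.ne_zero hp0 hq0) h,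
        fun C hC => EllHyp.V_eq hp hq hp0 hq0 (ht.ne_zero hp0 hq0) hC⟩,
      fun t ht h h₁ h₂ => EllHyp.V_first_contiguous hp hq hp0 hq0 (ht.ne_zero hp0 hq0) h h₁ h₂,
      fun t ht h h₁ h₂ => EllHyp.V_second_contiguous hp hq hp0 hq0 ht h h₁ h₂,
      fun t ht h h₁ h₂ d₁ d₂ => EllHyp.U_potential_equation hp hq hp0 hq0 ht h h₁ h₂ d₁ d₂,
      fun t ht t₀ h => EllHyp.potential_eq_potential' hp hp0 hq0 ht h,
      fun a z t₈ τ ha hz hτ h8 h h₁ h₂ hd =>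
        EllHyp.U_ellHypEquation hp hq hp0 hq0 ?_ h h₁ h₂ hd⟩
    have hτ' := Finset.prod_ne_zero_iff.2 fun k (_ : k ∈ Finset.univ) => hτ k
    rw [Fin.prod_univ_five] at h8 hτ'
    rw [EllHyp.Balanced, h8, Fin.prod_univ_eight]
    simp only [EllHyp.eheParams]
    simp
    field_simp
    exact div_self hτ'
  · exact ⟨fun j x => EllHyp.potentialAdd_meromorphicAt h ω₁ g j x,
      fun j => EllHyp.potentialAdd_periodic h ω₁ g j, EllHyp.potentialAdd_add h ω₁ g,
      EllHyp.potentialAdd_inversion h ω₁ g⟩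
  · refine ⟨fun α y g₈ c hb h0 h1 h2 hd => EllHyp.UMod_ellHypEquation h12 h31 h32 hb h0 h1 h2 hd,
      fun g hb hl => EllHyp.vMod_eq h12 h31 h32 hb hl, fun h12' hind =>
      ⟨EllHyp.isOpen_independenceSet h12' h31 h32, ?_⟩⟩
    obtain ⟨g, hb, hn, hc⟩ := EllHyp.exists_dualCasorati_ne_zero h12' h31 h32 hind
    exact EllHyp.solutionDomain_subset_closure h12' h31 h32 hb hn hc
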